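/- **Setting.** Let $\mu,\mu_2>0$, let $D\subset\mathbb R^2$ be a bounded domain with $C^2$ boundary, and let $\Gamma\in C^3(\mathbb R;D)$, $|\partial_\xi\Gamma|=1$, be an arc length parametrization, periodic with period $L$ and injective on $[0,L)$, of a Jordan curve in $D$ (also denoted by $\Gamma$). Put $\tau=\partial_\xi\Gamma$, $n=\mathbb A\tau$ with $\mathbb A=\begin{pmatrix}0&-1\\1&0\end{pmatrix}$, and let $\kappa$ be given by $\partial_\xi\tau=\kappa n$. Let $D\setminus\Gamma=D_1\cup\Omega_3$ with $D_1,\Omega_3$ disjoint and open, $n$ pointing from $D_1$ into $\Omega_3$ (for a clockwise curve, $D_1$ is the enclosed part); put $\Omega_{lim}=D_1\cup\Omega_3$. Let $h\in C^2(\mathbb R)$ be $L$-periodic, $h>0$. For small $\varepsilon>0$ let $$\Gamma_\varepsilon=\Gamma-\varepsilon h n,\quad \Omega_2=\{\Gamma(\xi)-r\,n(\xi):0<r<\varepsilon h(\xi)\},\quad \Omega_1=D_1\setminus\overline{\Omega_2},$$ $\tau_\varepsilon=\partial_\xi\Gamma_\varepsilon/|\partial_\xi\Gamma_\varepsilon|$,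 $n_\varepsilon=-\mathbb A\tau_\varepsilon$, and let $\kappa_\varepsilon$ be defined by $\partial_\xi n_\varepsilon=\kappa_\varepsilon\tau_\varepsilon$ (derivative in the parameter $\xi$ of $\Gamma$; thus $\kappa_\varepsilon$ is $|\partial_\xi\Gamma_\varepsilon|$ times the curvature of $\Gamma_\varepsilon$). For an open set $O$, $X^0(O)$ is the set of functions on $O$ that extend continuously to $\overline O$, and $X^1(O)$ the set of $C^1$ functions that lie in $X^0(O)$ together with their gradient; on a disjoint union of open sets, $X^k$ is understood on each of them. A superscript $k$ denotes the restriction to $\Omega_k$ (for limit functions: $k=1$ for $D_1$, $k=3$ for $\Omega_3$), and its boundary values. **Hypotheses.** For all small $\varepsilon>0$ let $u_\varepsilon\in C(\overline D;\mathbb R^2)$ and $p_\varepsilon$ be such that, on $\Omega=\Omega_1\cup\Omega_2\cup\Omega_3$, $u_\varepsilon\in C^2\cap X^1$, $p_\varepsilon\in C^1\cap X^0$, and $$\mu(x)\Delta u_\varepsilon=\nabla p_\varepsilon,\quad \nabla\cdot u_\varepsilon=0\ \text{ in }\Omega,\qquad \mu(x)=\mu\text{ in }\Omega_1\cup\Omega_3,\quad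 \mu(x)=\mu_2\text{ in }\Omega_2,$$ $$u_\varepsilon=U\text{ on }\partial D,\qquad (\Sigma^3-\Sigma^2)n=-\kappa n\text{ on }\Gamma,\qquad(\Sigma^2-\Sigma^1)n_\varepsilon=-\kappa_\varepsilon n_\varepsilon\text{ on }\Gamma_\varepsilon,$$ where $\Sigma^k=-p_\varepsilon^kI+\mu_k(\nabla u_\varepsilon^k+(\nabla u_\varepsilon^k)^T)$, $\mu_1=\mu_3=\mu$, and $U$ does not depend on $\varepsilon$. Let $u_0\in C(\overline D;\mathbb R^2)\cap C^2(\Omega_{lim})\cap X^1(\Omega_{lim})$, $p_0\in C^1(\Omega_{lim})\cap X^0(\Omega_{lim})$ and $u_1,p_1\in X^0(\Omega_{lim})$, and assume: 1. (outer expansion) $|u_\varepsilon-u_0|/\varepsilon$ is bounded in $D$, uniformly in small $\varepsilon$; at every point of $\Omega_{lim}$, $(u_\varepsilon-u_0)/\varepsilon\to u_1$ and $(p_\varepsilon-p_0)/\varepsilon\to p_1$ as $\varepsilon\to0^+$; for small $\varepsilon$, $|p_\varepsilon-p_0|/\varepsilon$ is dominated in $\Omega_1\cup\Omega_3$ by an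 integrable function on $D$ that does not depend on $\varepsilon$, and $|p_\varepsilon|$ is bounded in $\Omega_2$, uniformly in $\varepsilon$. 2. (inner expansion) For every $x_0=\Gamma(\xi_0)$, put $B_k=\nabla u_0^k(x_0)$ for $k=1,3$ and $$B_2=B_2(x_0)=B_1+\Big(\frac{\mu}{\mu_2}-1\Big)\big(\tau\cdot(B_1+B_1^T)n\big)\,\tau\otimes n .$$ There is $w_2\in\mathbb R^2$ such that $\frac{u_\varepsilon(x_0+\varepsilon y)-u_0(x_0)}{\varepsilon}$ converges, uniformly on compact sets of $y\in\mathbb R^2$, to $v_1(y)=B_ky+w_k$, where $k=3$ for $y\cdot n>0$, $k=2$ for $-h\le y\cdot n\le0$, $k=1$ for $y\cdot n<-h$, and $w_3=w_2$, $w_1=w_2+h(B_1-B_2)n$. Moreover $p_\varepsilon(x_0+\varepsilon y)$ converges, uniformly on compact sets that do not meet the lines $y\cdot n=0$ and $y\cdot n=-h$, to the function equal to $p_0^3(x_0)$, to $\frac{p_0^3(x_0)+p_0^1(x_0)}2-2(\mu-\mu_2)\,n\cdot B_1n$, and to $p_0^1(x_0)$ in these three regions, respectively. (All quantities are taken at $\xi_0$.)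 **Conclusion.** For all $\varphi\in C_c^\infty(D;\mathbb R^2)$, $$\begin{aligned}&\int_D\big[\mu\,u_1\cdot(\Delta\varphi+\nabla(\nabla\cdot\varphi))+p_1\nabla\cdot\varphi\big]dV\\&=(\mu_2-\mu)\int_\Gamma hB_2:(\nabla\varphi+(\nabla\varphi)^T)ds+2(\mu-\mu_2)\int_\Gamma h\,(n\cdot B_2n)\,\nabla\cdot\varphi\,ds+\int_\Gamma\partial_\xi^2h\,n\cdot\varphi\,ds+\int_\Gamma h\,\partial_\xi\kappa\,\tau\cdot\varphi\,ds,\end{aligned}$$ $\nabla\cdot u_1=0$ in the sense of distributions in $D$, and $u_1=0$ on $\partial D$, that is, $u_1(x)\to0$ as $x\in\Omega_{lim}$ tends to a point of $\partial D$. -/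

import Mathlib

open MeasureTheory Filter Topology Set

namespace ThinFilm

noncomputable section

/-- The Euclidean plane. -/
abbrev Plane := EuclideanSpace ℝ (Fin 2)

/-- Linear maps of the plane (2 x 2 matrices). The matrix `∇u(x)` is `fderiv ℝ u x`,
so that `u (x + y) = u x + ∇u(x) y + o(y)`. -/
abbrev Mat := Plane →L[ℝ] Plane

/-! ### Vector calculus -/

/-- The `i`-th vector of the canonical basis. -/
def basisVec (i : Fin 2) : Plane := EuclideanSpace.single i 1

/-- The divergence of a vector field. -/
def divergence (f : Plane → Plane) (x : Plane) : ℝ :=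
  ∑ i : Fin 2, (fderiv ℝ f x (basisVec i)) i

/-- `A + Aᵀ`. -/
def plusTranspose (A : Mat) : Mat := A + ContinuousLinearMap.adjoint A

/-- The Frobenius product `A : B`. -/
def frob (A B : Mat) : ℝ := ∑ i : Fin 2, inner ℝ (A (basisVec i)) (B (basisVec i))

/-- The tensor `a ⊗ b`, that is, `y ↦ (b ⬝ y) a`. -/
def tensor (a b : Plane) : Mat := (innerSL ℝ b).smulRight a

/-- The stress tensor `-p I + m (A + Aᵀ)` for viscosity `m`, velocity gradient `A`
and pressure `p`. -/
def stress (m : ℝ) (A : Mat) (p : ℝ) : Mat :=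
  m • plusTranspose A - p • ContinuousLinearMap.id ℝ Plane

/-! ### Function spaces -/

/-- `f` is continuous on `O` and extends continuously to the closure of `O`.
Its boundary values are then given by `extendFrom O f`. -/
def IsX0 {F : Type*} [TopologicalSpace F] (O : Set Plane) (f : Plane → F) : Prop :=
  ∃ g : Plane → F, ContinuousOn g (closure O) ∧ EqOn f g O

/-- `f` is `C¹` on the open set `O`, and `f` and its gradient extend continuously to the closure
of `O`. -/
def IsX1 (O : Set Plane) (f : Plane → Plane) : Prop :=
  ContDiffOn ℝ 1 f O ∧ IsX0 O f ∧ IsX0 O (fderiv ℝ f)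

/-- `φ` is a smooth function with compact support contained in the open set `D`. -/
def IsTest {F : Type*} [NormedAddCommGroup F] [NormedSpace ℝ F]
    (D : Set Plane) (φ : Plane → F) : Prop :=
  ContDiff ℝ (⊤ : ℕ∞) φ ∧ HasCompactSupport φ ∧ tsupport φ ⊆ D

/-- The boundary of `D` is of class `C²`: locally `D` is the region `{ρ < 0}` for a `C²`
function `ρ` whose differential does not vanish. -/
def HasC2Boundary (D : Set Plane) : Prop :=
  ∀ x ∈ frontier D, ∃ (V : Set Plane) (ρ : Plane → ℝ), IsOpen V ∧ x ∈ V ∧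
    ContDiffOn ℝ 2 ρ V ∧ (∀ y ∈ V, fderiv ℝ ρ y ≠ 0) ∧ ∀ y ∈ V, y ∈ D ↔ ρ y < 0

/-! ### The two interfaces -/

/-- The rotation by the matrix with rows `(0, -1)` and `(1, 0)`. -/
def rot (v : Plane) : Plane := !₂[-v 1, v 0]

/-- The tangent vector `τ = ∂_ξ Γ` (for an arc length parametrization). -/
def tangent (Γ : ℝ → Plane) (ξ : ℝ) : Plane := deriv Γ ξ

/-- The normal vector `n`, obtained by rotating `τ`. -/
def normal (Γ : ℝ → Plane) (ξ : ℝ) : Plane := rot (tangent Γ ξ)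

/-- The curvature `κ`, determined by `∂_ξ τ = κ n`, `∂_ξ n = -κ τ`. -/
def curv (Γ : ℝ → Plane) (ξ : ℝ) : ℝ := inner ℝ (deriv (tangent Γ) ξ) (normal Γ ξ)

/-- The second interface `Γ_ε = Γ - ε h n`. -/
def gammaEps (Γ : ℝ → Plane) (h : ℝ → ℝ) (ε ξ : ℝ) : Plane := Γ ξ - (ε * h ξ) • normal Γ ξ

/-- The unit tangent vector of `Γ_ε`. -/
def tangentEps (Γ : ℝ → Plane) (h : ℝ → ℝ) (ε ξ : ℝ) : Plane :=
  ‖deriv (gammaEps Γ h ε) ξ‖⁻¹ • deriv (gammaEps Γ h ε) ξ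

/-- The unit normal vector of `Γ_ε` that points out of the layer. -/
def normalEps (Γ : ℝ → Plane) (h : ℝ → ℝ) (ε ξ : ℝ) : Plane := -rot (tangentEps Γ h ε ξ)

/-- The quantity `κ_ε`, determined by `∂_ξ n_ε = κ_ε τ_ε`, `∂_ξ τ_ε = -κ_ε n_ε`, where `ξ` is
the parameter of `Γ`. -/
def curvEps (Γ : ℝ → Plane) (h : ℝ → ℝ) (ε ξ : ℝ) : ℝ :=
  inner ℝ (deriv (normalEps Γ h ε) ξ) (tangentEps Γ h ε ξ)

/-! ### The domains -/

/-- The geometry: `D` is a bounded domain with `C²` boundary, `Γ` is an arc length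
parametrization, with period `L`, of a Jordan curve in `D` that divides `D` into two open sets
`D₁` and `Ω₃`, the normal vector `n` pointing from `D₁` to `Ω₃`. (If `Γ` runs clockwise, then `D₁`
is the part of `D` enclosed by the curve. The orientation is not prescribed.) The layer will lie
on the side of `D₁`, and it has thickness `ε h`. -/
structure Geometry (D D₁ Ω₃ : Set Plane) (Γ : ℝ → Plane) (L : ℝ) (h : ℝ → ℝ) : Prop where
  isOpen_D : IsOpen D
  bounded_D : Bornology.IsBounded D
  connected_D : IsConnected D
  boundary_D : HasC2Boundary D
  smooth_Γ : ContDiff ℝ 3 Γ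
  unit_speed : ∀ ξ, ‖deriv Γ ξ‖ = 1
  period_pos : 0 < L
  periodic_Γ : ∀ ξ, Γ (ξ + L) = Γ ξ
  injective_Γ : InjOn Γ (Ico 0 L)
  isOpen_D₁ : IsOpen D₁
  isOpen_Ω₃ : IsOpen Ω₃
  disjoint_D₁_Ω₃ : Disjoint D₁ Ω₃
  range_subset : range Γ ⊆ D
  decomposition : D \ range Γ = D₁ ∪ Ω₃
  sides : ∀ ξ, ∀ᶠ t : ℝ in 𝓝[>] 0,
    Γ ξ + t • normal Γ ξ ∈ Ω₃ ∧ Γ ξ - t • normal Γ ξ ∈ D₁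
  smooth_h : ContDiff ℝ 2 h
  periodic_h : ∀ ξ, h (ξ + L) = h ξ
  pos_h : ∀ ξ, 0 < h ξ

/-- The domain `Ω₂` of fluid 2: the thin layer between `Γ` and `Γ_ε`. -/
def layer (Γ : ℝ → Plane) (h : ℝ → ℝ) (ε : ℝ) : Set Plane :=
  {x | ∃ ξ r : ℝ, 0 < r ∧ r < ε * h ξ ∧ x = Γ ξ - r • normal Γ ξ}

/-- The domain `Ω₁` of fluid 1: what remains of `D₁` outside the layer. -/
def omega1 (D₁ : Set Plane) (Γ : ℝ → Plane) (h : ℝ → ℝ) (ε : ℝ) : Set Plane :=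
  D₁ \ closure (layer Γ h ε)

/-! ### The two-fluid Stokes problem -/

/-- The Stokes equations with viscosity `m` in an open set `O`. -/
def StokesIn (m : ℝ) (O : Set Plane) (u : Plane → Plane) (p : Plane → ℝ) : Prop :=
  ∀ x ∈ O, m • Laplacian.laplacian u x = gradient p x ∧ divergence u x = 0

/-- `(u, p)` is of class `(C²(O) ∩ X¹(O)) × (C¹(O) ∩ X⁰(O))`. -/
def RegularIn (O : Set Plane) (u : Plane → Plane) (p : Plane → ℝ) : Prop :=
  ContDiffOn ℝ 2 u O ∧ IsX1 O u ∧ ContDiffOn ℝ 1 p O ∧ IsX0 O p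

/-- The stress tensor at a boundary point `x` of `O`, computed from the side of `O`. -/
def stressFrom (m : ℝ) (O : Set Plane) (u : Plane → Plane) (p : Plane → ℝ) (x : Plane) : Mat :=
  stress m (extendFrom O (fderiv ℝ u) x) (extendFrom O p x)

/-- `(u, p)` solves the two-fluid Stokes problem with layer `layer Γ h ε`. The continuity of the
velocity across both interfaces is contained in `continuous_u`. -/
structure IsTwoFluidSolution (μ μ₂ : ℝ) (D D₁ Ω₃ : Set Plane) (Γ : ℝ → Plane) (h : ℝ → ℝ)
    (U : Plane → Plane) (ε : ℝ) (u : Plane → Plane) (p : Plane → ℝ) : Prop where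
  continuous_u : ContinuousOn u (closure D)
  regular₁ : RegularIn (omega1 D₁ Γ h ε) u p
  regular₂ : RegularIn (layer Γ h ε) u p
  regular₃ : RegularIn Ω₃ u p
  stokes₁ : StokesIn μ (omega1 D₁ Γ h ε) u p
  stokes₂ : StokesIn μ₂ (layer Γ h ε) u p
  stokes₃ : StokesIn μ Ω₃ u p
  boundary_u : ∀ x ∈ frontier D, u x = U x
  stress_plus : ∀ ξ,
    (stressFrom μ Ω₃ u p (Γ ξ) - stressFrom μ₂ (layer Γ h ε) u p (Γ ξ)) (normal Γ ξ)
      = -(curv Γ ξ) • normal Γ ξ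
  stress_minus : ∀ ξ,
    (stressFrom μ₂ (layer Γ h ε) u p (gammaEps Γ h ε ξ)
        - stressFrom μ (omega1 D₁ Γ h ε) u p (gammaEps Γ h ε ξ)) (normalEps Γ h ε ξ)
      = -(curvEps Γ h ε ξ) • normalEps Γ h ε ξ

/-! ### The inner solution -/

/-- `∇u₀(x₀)` at `x₀ = Γ ξ`, computed from the side of the open set `O`. -/
def gradFrom (O : Set Plane) (u₀ : Plane → Plane) (Γ : ℝ → Plane) (ξ : ℝ) : Mat :=
  extendFrom O (fderiv ℝ u₀) (Γ ξ)

/-- The matrix `B₂ = B₁ + (μ/μ₂ - 1) (τ ⬝ (B₁ + B₁ᵀ) n) τ ⊗ n`, where `B₁` is the gradient of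
`u₀` at `Γ ξ` from the side of `D₁`. -/
def matB2 (μ μ₂ : ℝ) (D₁ : Set Plane) (u₀ : Plane → Plane) (Γ : ℝ → Plane) (ξ : ℝ) : Mat :=
  gradFrom D₁ u₀ Γ ξ
    + ((μ / μ₂ - 1) * inner ℝ (tangent Γ ξ) (plusTranspose (gradFrom D₁ u₀ Γ ξ) (normal Γ ξ)))
      • tensor (tangent Γ ξ) (normal Γ ξ)

/-- The piecewise affine inner velocity `v₁` at `x₀ = Γ ξ`: it is `B_k y + w_k` in the three
regions `0 < y ⬝ n` (`k = 3`), `-h < y ⬝ n < 0` (`k = 2`), `y ⬝ n < -h` (`k = 1`), where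
`B₁`, `B₃` are the gradients of `u₀` from the two sides, `w₃ = w₂` and
`w₁ = w₂ + h (B₁ - B₂) n`. -/
def innerV (μ μ₂ : ℝ) (D₁ Ω₃ : Set Plane) (u₀ : Plane → Plane) (Γ : ℝ → Plane) (h : ℝ → ℝ)
    (ξ : ℝ) (w₂ y : Plane) : Plane :=
  if 0 < inner ℝ y (normal Γ ξ) then gradFrom Ω₃ u₀ Γ ξ y + w₂
  else if -h ξ ≤ inner ℝ y (normal Γ ξ) then matB2 μ μ₂ D₁ u₀ Γ ξ y + w₂
  else gradFrom D₁ u₀ Γ ξ y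
    + (w₂ + h ξ • (gradFrom D₁ u₀ Γ ξ - matB2 μ μ₂ D₁ u₀ Γ ξ) (normal Γ ξ))

/-- The piecewise constant inner pressure `P₁` at `x₀ = Γ ξ`: the boundary values of `p₀` from
the two sides in the outer regions, and
`(P³ + P¹)/2 - 2 (μ - μ₂) n ⬝ B₁ n` in the strip `-h < y ⬝ n < 0`. -/
def innerP (μ μ₂ : ℝ) (D₁ Ω₃ : Set Plane) (u₀ : Plane → Plane) (p₀ : Plane → ℝ)
    (Γ : ℝ → Plane) (h : ℝ → ℝ) (ξ : ℝ) (y : Plane) : ℝ :=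
  if 0 < inner ℝ y (normal Γ ξ) then extendFrom Ω₃ p₀ (Γ ξ)
  else if -h ξ < inner ℝ y (normal Γ ξ) then
    (extendFrom Ω₃ p₀ (Γ ξ) + extendFrom D₁ p₀ (Γ ξ)) / 2
      - 2 * (μ - μ₂) * inner ℝ (normal Γ ξ) (gradFrom D₁ u₀ Γ ξ (normal Γ ξ))
  else extendFrom D₁ p₀ (Γ ξ)

/-- Convergence of the rescaled fields at `x₀ = Γ ξ`. For the velocity,
`(v_ε(y) - u₀(x₀)) / ε` with `v_ε(y) = u_ε(x₀ + ε y)` converges to `v₁` uniformly on compact sets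
of the plane. For the pressure, `ε⁻¹ P_ε(y)` with `P_ε(y) = ε p_ε(x₀ + ε y)` converges to `P₁`
uniformly on the compact sets that avoid the two lines `y ⬝ n = 0` and `y ⬝ n = -h` on which
`P₁` may jump. -/
def InnerConvergence (μ μ₂ : ℝ) (D₁ Ω₃ : Set Plane) (Γ : ℝ → Plane) (h : ℝ → ℝ)
    (u₀ : Plane → Plane) (p₀ : Plane → ℝ) (u : ℝ → Plane → Plane) (p : ℝ → Plane → ℝ)
    (ξ : ℝ) : Prop :=
  (∃ w₂ : Plane, ∀ K : Set Plane, IsCompact K →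
    TendstoUniformlyOn (fun (ε : ℝ) (y : Plane) => ε⁻¹ • (u ε (Γ ξ + ε • y) - u₀ (Γ ξ)))
      (innerV μ μ₂ D₁ Ω₃ u₀ Γ h ξ w₂) (𝓝[>] 0) K) ∧
  ∀ K : Set Plane, IsCompact K →
    (∀ y ∈ K, inner ℝ y (normal Γ ξ) ≠ 0 ∧ inner ℝ y (normal Γ ξ) ≠ -h ξ) →
    TendstoUniformlyOn (fun (ε : ℝ) (y : Plane) => ε⁻¹ * (ε * p ε (Γ ξ + ε • y)))
      (innerP μ μ₂ D₁ Ω₃ u₀ p₀ Γ h ξ) (𝓝[>] 0) K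

/-! ### The limit operator -/

/-- `⟨S₀(u, p), φ⟩ = ∫_D [μ u ⬝ (Δφ + ∇ ⬝ ∇φᵀ) + p ∇ ⬝ φ] dV`, where `∇ ⬝ ∇φᵀ = ∇ (∇ ⬝ φ)`. -/
def stokesPairing (μ : ℝ) (D : Set Plane) (u : Plane → Plane) (p : Plane → ℝ)
    (φ : Plane → Plane) : ℝ :=
  ∫ x in D, (μ * inner ℝ (u x) (Laplacian.laplacian φ x + gradient (divergence φ) x)
    + p x * divergence φ x)

end

end ThinFilm

/-!
Everything is derived from weak forms in which all derivatives fall on the test field, since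
nothing is known about the gradients of `(u_ε - u₀) / ε` and of `u₁`.

**Weak form.** A tube around `Γ`, with coordinates `(ξ, s) ↦ Γ(ξ) - s h(ξ) n(ξ)` and level
function `S` (`exists_tube`), describes the three regions as `S < 0`, `0 < S < ε` and `ε < S`.
Cutting off near the levels `0` and `ε` gives the divergence theorem for fields that jump across
both curves (`divergence_theorem_jump`, `divergence_theorem_pieces`). Applied to the field in the
second Green identity, it yields (`IsTwoFluidSolution.weak_form`) an equation between the
integrals of `p_ε ∇ ⬝ φ` and of `u_ε ⬝ (Δφ + ∇(∇ ⬝ φ))` over `D`, the latter again over the layer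
with factor `μ₂ - μ`, the surface tension on both curves, and the difference of the pairings of
`u_ε` with `(∇φ + ∇φᵀ) n` on the two curves.

**Expansion.** This equation is expanded to orders `1` and `ε` (`Expansion.first_order`). The
outer expansion gives the integrals of `u₁` and `p₁`. The integrals over the thin layer become `ε`
times integrals over `Γ` of `h` times the inner limits (`tendsto_layer_integral`). In the
difference of the pairings the constant `w₂` of the inner expansion cancels. The surface tension
of `Γ_ε` is differentiated in `ε` (`hasDerivAt_integral_tension`), which produces `h''` and `κ'`.
Order `1` says that `(u₀, p₀)` is a Stokes flow with the stress jump `-2κn` across `Γ`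
(`stress_jump`); its normal component gives the jump of `p₀` (`pressure_jump`), by which the
pressure of the inner expansion is expressed by `B₂`. With this, order `ε` is the asserted
equation (`stokesPairing_eq`). The divergence constraint passes to the limit in the same way
(`Expansion.integral_inner_gradient_u₁`).

**Boundary values.** Near a point of `∂D = {ρ = 0}` both `(u_ε - u₀) / ε` and `u₁` are very weak
solutions of the Stokes equations. Testing with `f_σ(ρ) χ η`, where `f_σ(r)` tends to `-r` for
`r < 0` and `f_σ''` concentrates at `r = 0`, shows that the weak form for the field `ρ χ η`, which
vanishes on the boundary but not near it, equals a boundary integral of the velocity against the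
symbol of the equation (`tendsto_boundary_layer`). It is zero for `(u_ε - u₀) / ε`, which vanishes
on `∂D` (`weak_form_boundary`), and hence, as `ε → 0`, also for `u₁`. If the boundary value `η` of
`u₁` were not zero, ellipticity of the symbol would make it positive (`eq_zero_of_weak_form`).
-/

namespace ThinFilm

noncomputable section

/-! ### Linear algebra in the plane -/

lemma inner_eq_coord (x y : Plane) : inner ℝ x y = x 0 * y 0 + x 1 * y 1 := by
  simp [PiLp.inner_apply, Fin.sum_univ_two, mul_comm]

@[simp] lemma rot_apply_zero (v : Plane) : rot v 0 = -v 1 := by simp [rot]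

@[simp] lemma rot_apply_one (v : Plane) : rot v 1 = v 0 := by simp [rot]

@[simp] lemma basisVec_apply (i j : Fin 2) : basisVec i j = if j = i then 1 else 0 := by
  simp [basisVec]

lemma plane_ext {x y : Plane} (h0 : x 0 = y 0) (h1 : x 1 = y 1) : x = y := by
  ext i; fin_cases i <;> simpa

lemma eq_sum_basisVec (v : Plane) : v = v 0 • basisVec 0 + v 1 • basisVec 1 := by
  apply plane_ext <;> simp

/-- The rotation `rot` as a continuous linear map. -/
def rotL : Plane →L[ℝ] Plane :=
  LinearMap.toContinuousLinearMap
    { toFun := rot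
      map_add' := fun x y => by apply plane_ext <;> simp [add_comm]
      map_smul' := fun c x => by apply plane_ext <;> simp }

@[simp] lemma rotL_apply (v : Plane) : rotL v = rot v := rfl

lemma map_eq_coord {F : Type*} [NormedAddCommGroup F] [NormedSpace ℝ F] (A : Plane →L[ℝ] F)
    (v : Plane) : A v = v 0 • A (basisVec 0) + v 1 • A (basisVec 1) := by
  conv_lhs => rw [eq_sum_basisVec v]
  simp

lemma mat_apply_coord (A : Mat) (v : Plane) (i : Fin 2) :
    A v i = v 0 * A (basisVec 0) i + v 1 * A (basisVec 1) i := by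
  rw [map_eq_coord A v]; simp

lemma inner_basisVec (v : Plane) (i : Fin 2) : inner ℝ (basisVec i) v = v i := by
  rw [inner_eq_coord]; fin_cases i <;> simp

lemma adjoint_apply_coord (A : Mat) (v : Plane) (i : Fin 2) :
    ContinuousLinearMap.adjoint A v i
      = A (basisVec i) 0 * v 0 + A (basisVec i) 1 * v 1 := by
  rw [← inner_basisVec, ContinuousLinearMap.adjoint_inner_right, inner_eq_coord]

lemma plusTranspose_apply_coord (A : Mat) (v : Plane) (i : Fin 2) :
    plusTranspose A v i = v 0 * (A (basisVec 0) i + A (basisVec i) 0)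
      + v 1 * (A (basisVec 1) i + A (basisVec i) 1) := by
  rw [plusTranspose, add_apply, PiLp.add_apply, adjoint_apply_coord,
    mat_apply_coord]
  ring

lemma inner_plusTranspose_comm (A : Mat) (v w : Plane) :
    inner ℝ (plusTranspose A v) w = inner ℝ v (plusTranspose A w) := by
  simp only [inner_eq_coord, plusTranspose_apply_coord]; ring

lemma inner_stress_comm (m q : ℝ) (A : Mat) (v w : Plane) :
    inner ℝ (stress m A q v) w = inner ℝ v (stress m A q w) := by
  simp only [stress, sub_apply, smul_apply,
    inner_sub_left, inner_sub_right, inner_smul_left, inner_smul_right,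
    inner_plusTranspose_comm, ContinuousLinearMap.id_apply]
  simp

/-- `A ↦ A + Aᵀ` as a continuous linear map. -/
def plusTransposeL : Mat →L[ℝ] Mat :=
  LinearMap.toContinuousLinearMap
    { toFun := plusTranspose
      map_add' := fun A B => by simp only [plusTranspose, map_add]; abel
      map_smul' := fun c A => by
        ext v i; simp only [plusTranspose_apply_coord, smul_apply,
          PiLp.smul_apply, smul_eq_mul, RingHom.id_apply]; ring }

@[simp] lemma plusTransposeL_apply (A : Mat) : plusTransposeL A = plusTranspose A := rfl

lemma frob_plusTranspose (A B : Mat) : frob A (plusTranspose B)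
    = A (basisVec 0) 0 * (2 * B (basisVec 0) 0)
      + (A (basisVec 0) 1 + A (basisVec 1) 0) * (B (basisVec 0) 1 + B (basisVec 1) 0)
      + A (basisVec 1) 1 * (2 * B (basisVec 1) 1) := by
  simp only [frob, Fin.sum_univ_two, inner_eq_coord, plusTranspose_apply_coord, basisVec_apply]
  simp; ring

/-- The trace of a matrix. -/
def tr (A : Mat) : ℝ := A (basisVec 0) 0 + A (basisVec 1) 1

lemma divergence_eq_tr (f : Plane → Plane) (x : Plane) : divergence f x = tr (fderiv ℝ f x) := by
  simp [divergence, tr, Fin.sum_univ_two]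

lemma continuous_tr : Continuous tr := by
  unfold tr; fun_prop

/-- The trace computed in the orthonormal basis `(v, rot v)`. -/
lemma tr_eq_of_unit (A : Mat) {v : Plane} (hv : ‖v‖ = 1) :
    tr A = inner ℝ v (A v) + inner ℝ (rot v) (A (rot v)) := by
  have h : v 0 * v 0 + v 1 * v 1 = 1 := by
    rw [← inner_eq_coord, real_inner_self_eq_norm_sq, hv]; norm_num
  simp only [inner_eq_coord, mat_apply_coord A v, mat_apply_coord A (rot v), tr,
    rot_apply_zero, rot_apply_one]
  linear_combination (-(A (basisVec 0) 0) - A (basisVec 1) 1) * h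

lemma det_eq_coord (A : Mat) : A.det = A (basisVec 0) 0 * A (basisVec 1) 1
    - A (basisVec 1) 0 * A (basisVec 0) 1 := by
  rw [ContinuousLinearMap.det,
    ← LinearMap.det_toMatrix (EuclideanSpace.basisFun (Fin 2) ℝ).toBasis, Matrix.det_fin_two]
  simp [LinearMap.toMatrix_apply, basisVec]

/-! ### The Green identity for the Stokes operator -/

lemma divergence_eq_coord {f : Plane → Plane} {x : Plane} (hf : DifferentiableAt ℝ f x) :
    divergence f x = fderiv ℝ (fun y => f y 0) x (basisVec 0)
      + fderiv ℝ (fun y => f y 1) x (basisVec 1) := by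
  have h : ∀ i : Fin 2, HasFDerivAt (fun y => f y i)
      ((EuclideanSpace.proj i : Plane →L[ℝ] ℝ).comp (fderiv ℝ f x)) x := fun i =>
    (EuclideanSpace.proj i : Plane →L[ℝ] ℝ).hasFDerivAt.comp x hf.hasFDerivAt
  rw [(h 0).fderiv, (h 1).fderiv]
  simp [divergence, Fin.sum_univ_two]

lemma laplacian_eq_coord (f : Plane → Plane) (x : Plane) :
    Laplacian.laplacian f x = fderiv ℝ (fderiv ℝ f) x (basisVec 0) (basisVec 0)
      + fderiv ℝ (fderiv ℝ f) x (basisVec 1) (basisVec 1) := by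
  rw [InnerProductSpace.laplacian_eq_iteratedFDeriv_orthonormalBasis f
    (EuclideanSpace.basisFun (Fin 2) ℝ)]
  simp [Fin.sum_univ_two, iteratedFDeriv_two_apply, basisVec]

lemma inner_gradient (g : Plane → ℝ) (x v : Plane) : inner ℝ (gradient g x) v = fderiv ℝ g x v := by
  rw [gradient, InnerProductSpace.toDual_symm_apply]

lemma gradient_apply (g : Plane → ℝ) (x : Plane) (i : Fin 2) :
    gradient g x i = fderiv ℝ g x (basisVec i) := by
  rw [← inner_gradient, real_inner_comm, inner_basisVec]

lemma fderiv_divergence {f : Plane → Plane} {x : Plane} (hf : ContDiffAt ℝ 2 f x) (v : Plane) :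
    fderiv ℝ (divergence f) x v = fderiv ℝ (fderiv ℝ f) x v (basisVec 0) 0
      + fderiv ℝ (fderiv ℝ f) x v (basisVec 1) 1 := by
  have h1 : HasFDerivAt (fderiv ℝ f) (fderiv ℝ (fderiv ℝ f) x) x :=
    ((hf.fderiv_right (m := 1) (by norm_num)).differentiableAt (by norm_num)).hasFDerivAt
  have h2 : ∀ i : Fin 2, HasFDerivAt (fun y => fderiv ℝ f y (basisVec i) i)
      ((EuclideanSpace.proj i : Plane →L[ℝ] ℝ).comp
        ((ContinuousLinearMap.apply ℝ Plane (basisVec i)).comp (fderiv ℝ (fderiv ℝ f) x))) x :=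
    fun i => (EuclideanSpace.proj i : Plane →L[ℝ] ℝ).hasFDerivAt.comp x
      ((ContinuousLinearMap.apply ℝ Plane (basisVec i)).hasFDerivAt.comp x h1)
  have h3 : divergence f = fun y => fderiv ℝ f y (basisVec 0) 0 + fderiv ℝ f y (basisVec 1) 1 := by
    ext y; simp [divergence, Fin.sum_univ_two]
  rw [h3, ((h2 0).fun_add (h2 1)).fderiv]
  simp

/-- The operator `φ ↦ Δφ + ∇(∇ ⬝ φ)`, the divergence of `∇φ + ∇φᵀ`. -/
def divSym (φ : Plane → Plane) (x : Plane) : Plane :=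
  Laplacian.laplacian φ x + gradient (divergence φ) x

/-- The vector field `Σ φ - m (∇φ + ∇φᵀ) u`, whose divergence appears in the second Green identity
for the Stokes operator. -/
def stokesFlux (m : ℝ) (u : Plane → Plane) (p : Plane → ℝ) (φ : Plane → Plane) (x : Plane) :
    Plane :=
  stress m (fderiv ℝ u x) (p x) (φ x) - m • plusTranspose (fderiv ℝ φ x) (u x)

lemma stokesFlux_apply (m : ℝ) (u : Plane → Plane) (p : Plane → ℝ) (φ : Plane → Plane)
    (x : Plane) (i : Fin 2) :
    stokesFlux m u p φ x i =
      m * (φ x 0 * (fderiv ℝ u x (basisVec 0) i + fderiv ℝ u x (basisVec i) 0)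
      + φ x 1 * (fderiv ℝ u x (basisVec 1) i + fderiv ℝ u x (basisVec i) 1))
      - p x * φ x i
      - m * (u x 0 * (fderiv ℝ φ x (basisVec 0) i + fderiv ℝ φ x (basisVec i) 0)
      + u x 1 * (fderiv ℝ φ x (basisVec 1) i + fderiv ℝ φ x (basisVec i) 1)) := by
  simp [stokesFlux, stress, plusTranspose_apply_coord]

lemma ContDiffAt.stokesFlux {m : ℝ} {u φ : Plane → Plane} {p : Plane → ℝ} {x : Plane}
    (hu : ContDiffAt ℝ 2 u x) (hp : ContDiffAt ℝ 1 p x) (hφ : ContDiffAt ℝ 2 φ x) :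
    ContDiffAt ℝ 1 (stokesFlux m u p φ) x := by
  have hu' : ContDiffAt ℝ 1 (fderiv ℝ u) x := hu.fderiv_right (by norm_num)
  have hφ' : ContDiffAt ℝ 1 (fderiv ℝ φ) x := hφ.fderiv_right (by norm_num)
  have hu1 : ContDiffAt ℝ 1 u x := hu.of_le (by norm_num)
  have hφ1 : ContDiffAt ℝ 1 φ x := hφ.of_le (by norm_num)
  have h1 : ContDiffAt ℝ 1 (fun y => plusTransposeL (fderiv ℝ u y)) x :=
    plusTransposeL.contDiff.contDiffAt.comp x hu'
  have h2 : ContDiffAt ℝ 1 (fun y => plusTransposeL (fderiv ℝ φ y)) x :=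
    plusTransposeL.contDiff.contDiffAt.comp x hφ'
  have : ThinFilm.stokesFlux m u p φ = fun y =>
      m • plusTransposeL (fderiv ℝ u y) (φ y) - p y • φ y
        - m • plusTransposeL (fderiv ℝ φ y) (u y) := by
    ext y : 1
    simp [ThinFilm.stokesFlux, stress]
  rw [this]
  exact (((h1.clm_apply hφ1).const_smul m).sub (hp.smul hφ1)).sub
    ((h2.clm_apply hu1).const_smul m)

/-- The second Green identity for the Stokes operator, in divergence form. -/
lemma divergence_stokesFlux {m : ℝ} {u φ : Plane → Plane} {p : Plane → ℝ} {x : Plane}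
    (hu : ContDiffAt ℝ 2 u x) (hp : ContDiffAt ℝ 1 p x) (hφ : ContDiffAt ℝ 2 φ x) :
    divergence (stokesFlux m u p φ) x =
      inner ℝ (m • divSym u x - gradient p x) (φ x) - p x * divergence φ x
        - m * inner ℝ (u x) (divSym φ x) := by
  have hF := (ContDiffAt.stokesFlux (m := m) hu hp hφ).differentiableAt (by norm_num)
  rw [divergence_eq_coord hF]
  have D : ∀ {f : Plane → Plane}, ContDiffAt ℝ 2 f x → ∀ i j : Fin 2,
      HasFDerivAt (fun y => fderiv ℝ f y (basisVec i) j)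
        ((EuclideanSpace.proj j : Plane →L[ℝ] ℝ).comp
          ((ContinuousLinearMap.apply ℝ Plane (basisVec i)).comp (fderiv ℝ (fderiv ℝ f) x))) x :=
    fun hf i j => (EuclideanSpace.proj j : Plane →L[ℝ] ℝ).hasFDerivAt.comp x
      ((ContinuousLinearMap.apply ℝ Plane (basisVec i)).hasFDerivAt.comp x
        ((hf.fderiv_right (m := 1) (by norm_num)).differentiableAt (by norm_num)).hasFDerivAt)
  have C : ∀ {f : Plane → Plane}, ContDiffAt ℝ 2 f x → ∀ j : Fin 2,
      HasFDerivAt (fun y => f y j)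
        ((EuclideanSpace.proj j : Plane →L[ℝ] ℝ).comp (fderiv ℝ f x)) x :=
    fun hf j => (EuclideanSpace.proj j : Plane →L[ℝ] ℝ).hasFDerivAt.comp x
      (hf.differentiableAt (by norm_num)).hasFDerivAt
  have hp' := (hp.differentiableAt (by norm_num)).hasFDerivAt
  have T : ∀ i : Fin 2, HasFDerivAt (fun y => stokesFlux m u p φ y i) _ x := fun i => by
    simp only [stokesFlux_apply]
    exact (((((C hφ 0).mul ((D hu 0 i).add (D hu i 0))).add
      ((C hφ 1).mul ((D hu 1 i).add (D hu i 1)))).const_mul m).sub (hp'.mul (C hφ i))).sub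
      ((((C hu 0).mul ((D hφ 0 i).add (D hφ i 0))).add
      ((C hu 1).mul ((D hφ 1 i).add (D hφ i 1)))).const_mul m)
  have su : IsSymmSndFDerivAt ℝ u x := hu.isSymmSndFDerivAt (by simp)
  have sφ : IsSymmSndFDerivAt ℝ φ x := hφ.isSymmSndFDerivAt (by simp)
  have su' := su.eq (basisVec 0) (basisVec 1)
  have sφ' := sφ.eq (basisVec 0) (basisVec 1)
  rw [(T 0).fderiv, (T 1).fderiv]
  simp only [inner_eq_coord, divSym, laplacian_eq_coord, PiLp.add_apply, PiLp.sub_apply,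
    PiLp.smul_apply, gradient_apply, fderiv_divergence hu, fderiv_divergence hφ,
    add_apply, sub_apply, smul_apply,
    ContinuousLinearMap.comp_apply, PiLp.proj_apply, Pi.add_apply, ContinuousLinearMap.apply_apply,
    smul_eq_mul, divergence, Fin.sum_univ_two, su', sφ']
  ring

/-- The Green identity for a solution of the Stokes equations. -/
lemma divergence_stokesFlux_of_stokesIn {m : ℝ} {O : Set Plane} (hO : IsOpen O)
    {u φ : Plane → Plane} {p : Plane → ℝ} (hu : ContDiffOn ℝ 2 u O) (hp : ContDiffOn ℝ 1 p O)
    (hφ : ContDiff ℝ 2 φ) (hS : StokesIn m O u p) {x : Plane} (hx : x ∈ O) :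
    divergence (stokesFlux m u p φ) x =
      - p x * divergence φ x - m * inner ℝ (u x) (divSym φ x) := by
  have hxO := hO.mem_nhds hx
  rw [divergence_stokesFlux (hu.contDiffAt hxO) (hp.contDiffAt hxO) hφ.contDiffAt]
  have h0 : gradient (divergence u) x = 0 := by
    have : divergence u =ᶠ[𝓝 x] fun _ => 0 := by
      filter_upwards [hxO] with y hy using (hS y hy).2
    rw [this.gradient_eq]; simp
  rw [divSym, h0, add_zero, (hS x hx).1]
  simp

/-! ### Differential geometry of the interfaces -/

lemma inner_rot_self (v : Plane) : inner ℝ v (rot v) = 0 := by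
  simp [inner_eq_coord]; ring

lemma inner_rot_rot (v w : Plane) : inner ℝ (rot v) (rot w) = inner ℝ v w := by
  simp [inner_eq_coord]; ring

lemma rot_rot (v : Plane) : rot (rot v) = -v := by
  apply plane_ext <;> simp

lemma norm_rot (v : Plane) : ‖rot v‖ = ‖v‖ := by
  have := inner_rot_rot v v
  rw [real_inner_self_eq_norm_sq, real_inner_self_eq_norm_sq] at this
  exact (pow_left_inj₀ (norm_nonneg _) (norm_nonneg _) two_ne_zero).1 this

lemma eq_of_unit {v : Plane} (hv : ‖v‖ = 1) (w : Plane) :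
    w = inner ℝ w v • v + inner ℝ w (rot v) • rot v := by
  have h : v 0 * v 0 + v 1 * v 1 = 1 := by
    rw [← inner_eq_coord, real_inner_self_eq_norm_sq, hv]; norm_num
  apply plane_ext <;> simp only [PiLp.add_apply, PiLp.smul_apply, smul_eq_mul, inner_eq_coord,
    rot_apply_zero, rot_apply_one]
  · linear_combination (-(w 0)) * h
  · linear_combination (-(w 1)) * h

section Curve

variable {Γ : ℝ → Plane} {h : ℝ → ℝ}

lemma contDiff_tangent (hΓ : ContDiff ℝ 3 Γ) : ContDiff ℝ 2 (tangent Γ) := by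
  have : ContDiff ℝ (2 + 1) Γ := by simpa [show (2 + 1 : WithTop ℕ∞) = 3 by norm_num] using hΓ
  exact (contDiff_succ_iff_deriv.1 this).2.2

lemma contDiff_normal (hΓ : ContDiff ℝ 3 Γ) : ContDiff ℝ 2 (normal Γ) :=
  rotL.contDiff.comp (contDiff_tangent hΓ)

lemma contDiff_curv (hΓ : ContDiff ℝ 3 Γ) : ContDiff ℝ 1 (curv Γ) := by
  have h2 : ContDiff ℝ (1 + 1) (tangent Γ) := by
    simpa [show (1 + 1 : WithTop ℕ∞) = 2 by norm_num] using contDiff_tangent hΓ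
  exact (contDiff_succ_iff_deriv.1 h2).2.2.inner ℝ ((contDiff_normal hΓ).of_le (by norm_num))

lemma norm_tangent (hu : ∀ ξ, ‖deriv Γ ξ‖ = 1) (ξ : ℝ) : ‖tangent Γ ξ‖ = 1 := hu ξ

lemma norm_normal (hu : ∀ ξ, ‖deriv Γ ξ‖ = 1) (ξ : ℝ) : ‖normal Γ ξ‖ = 1 := by
  rw [normal, norm_rot, norm_tangent hu]

lemma hasDerivAt_gamma (hΓ : ContDiff ℝ 3 Γ) (ξ : ℝ) : HasDerivAt Γ (tangent Γ ξ) ξ :=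
  (hΓ.differentiable (by norm_num) ξ).hasDerivAt

lemma hasDerivAt_tangent (hΓ : ContDiff ℝ 3 Γ) (hu : ∀ ξ, ‖deriv Γ ξ‖ = 1) (ξ : ℝ) :
    HasDerivAt (tangent Γ) (curv Γ ξ • normal Γ ξ) ξ := by
  have h1 : HasDerivAt (tangent Γ) (deriv (tangent Γ) ξ) ξ :=
    ((contDiff_tangent hΓ).differentiable (by norm_num) ξ).hasDerivAt
  have h2 : HasDerivAt (fun ζ => inner ℝ (tangent Γ ζ) (tangent Γ ζ)) _ ξ := h1.inner ℝ h1
  have h3 : (fun ζ => inner ℝ (tangent Γ ζ) (tangent Γ ζ)) = fun _ => (1 : ℝ) := by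
    ext ζ; rw [real_inner_self_eq_norm_sq, norm_tangent hu]; norm_num
  rw [h3] at h2
  have h4 := h2.unique (hasDerivAt_const ξ (1 : ℝ))
  have h5 : inner ℝ (deriv (tangent Γ) ξ) (tangent Γ ξ) = 0 := by
    rw [real_inner_comm (deriv (tangent Γ) ξ)] at h4; linarith
  have h6 := eq_of_unit (norm_tangent hu ξ) (deriv (tangent Γ) ξ)
  rw [h5, zero_smul, zero_add] at h6
  rw [h6] at h1
  exact h1

lemma rot_normal (ξ : ℝ) : rot (normal Γ ξ) = -tangent Γ ξ := rot_rot _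

lemma hasDerivAt_normal (hΓ : ContDiff ℝ 3 Γ) (hu : ∀ ξ, ‖deriv Γ ξ‖ = 1) (ξ : ℝ) :
    HasDerivAt (normal Γ) (-(curv Γ ξ • tangent Γ ξ)) ξ := by
  have := rotL.hasFDerivAt.comp_hasDerivAt ξ (hasDerivAt_tangent hΓ hu ξ)
  rw [map_smul, rotL_apply, rot_normal, smul_neg] at this
  exact this

/-- The derivative of `Γ_s` with respect to the parameter of `Γ`. -/
def velocityEps (Γ : ℝ → Plane) (h : ℝ → ℝ) (s ξ : ℝ) : Plane :=
  (1 + s * h ξ * curv Γ ξ) • tangent Γ ξ - (s * deriv h ξ) • normal Γ ξ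

/-- The normal vector of the level curve `Γ_s` that points towards increasing `s`, of length
`|∂_ξ Γ_s|`. -/
def coNormal (Γ : ℝ → Plane) (h : ℝ → ℝ) (s ξ : ℝ) : Plane := -rot (velocityEps Γ h s ξ)

/-- The Jacobian of the coordinates `(ξ, s) ↦ Γ_s(ξ)`, up to sign. -/
def jac (Γ : ℝ → Plane) (h : ℝ → ℝ) (s ξ : ℝ) : ℝ := h ξ * (1 + s * h ξ * curv Γ ξ)

lemma coNormal_zero (ξ : ℝ) : coNormal Γ h 0 ξ = -normal Γ ξ := by
  simp [coNormal, velocityEps, normal]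

lemma jac_zero (ξ : ℝ) : jac Γ h 0 ξ = h ξ := by simp [jac]

lemma gammaEps_zero (ξ : ℝ) : gammaEps Γ h 0 ξ = Γ ξ := by simp [gammaEps]

/-- The coordinates `(ξ, s) ↦ Γ_s(ξ) = Γ(ξ) - s h(ξ) n(ξ)` near the curve `Γ`, as a map of the
plane to itself. -/
def collar (Γ : ℝ → Plane) (h : ℝ → ℝ) (q : Plane) : Plane := gammaEps Γ h (q 1) (q 0)

lemma contDiff_collar (hΓ : ContDiff ℝ 3 Γ) (hh : ContDiff ℝ 2 h) :
    ContDiff ℝ 2 (collar Γ h) := by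
  have p0 : ContDiff ℝ 2 (fun q : Plane => q 0) := (EuclideanSpace.proj 0 : Plane →L[ℝ] ℝ).contDiff
  have p1 : ContDiff ℝ 2 (fun q : Plane => q 1) := (EuclideanSpace.proj 1 : Plane →L[ℝ] ℝ).contDiff
  exact ((hΓ.of_le (by norm_num)).comp p0).sub
    ((p1.mul (hh.comp p0)).smul ((contDiff_normal hΓ).comp p0))

lemma continuous_gammaEps (hΓ : ContDiff ℝ 3 Γ) (hh : ContDiff ℝ 2 h) :
    Continuous (fun z : ℝ × ℝ => gammaEps Γ h z.1 z.2) := by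
  have h1 := hΓ.continuous
  have h2 := hh.continuous
  have h3 := (contDiff_normal hΓ).continuous
  unfold gammaEps; fun_prop

lemma continuous_velocityEps (hΓ : ContDiff ℝ 3 Γ) (hh : ContDiff ℝ 2 h) :
    Continuous (fun z : ℝ × ℝ => velocityEps Γ h z.1 z.2) := by
  have h1 := (contDiff_tangent hΓ).continuous
  have h2 := hh.continuous
  have h3 := (contDiff_normal hΓ).continuous
  have h4 := (contDiff_curv hΓ).continuous
  have h5 := hh.continuous_deriv (by norm_num)
  unfold velocityEps; fun_prop

lemma continuous_coNormal (hΓ : ContDiff ℝ 3 Γ) (hh : ContDiff ℝ 2 h) :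
    Continuous (fun z : ℝ × ℝ => coNormal Γ h z.1 z.2) :=
  (rotL.continuous.comp (continuous_velocityEps hΓ hh)).neg

lemma continuous_jac (hΓ : ContDiff ℝ 3 Γ) (hh : ContDiff ℝ 2 h) :
    Continuous (fun z : ℝ × ℝ => jac Γ h z.1 z.2) := by
  have h2 := hh.continuous
  have h4 := (contDiff_curv hΓ).continuous
  unfold jac; fun_prop

lemma hasDerivAt_gammaEps (hΓ : ContDiff ℝ 3 Γ) (hu : ∀ ξ, ‖deriv Γ ξ‖ = 1)
    (hh : ContDiff ℝ 2 h) (s ξ : ℝ) :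
    HasDerivAt (gammaEps Γ h s) (velocityEps Γ h s ξ) ξ := by
  have h1 : HasDerivAt h (deriv h ξ) ξ := (hh.differentiable (by norm_num) ξ).hasDerivAt
  have := (hasDerivAt_gamma hΓ ξ).sub ((h1.const_mul s).smul (hasDerivAt_normal hΓ hu ξ))
  refine this.congr_deriv ?_
  simp only [velocityEps]; module

lemma hasDerivAt_gammaEps_left (s ξ : ℝ) :
    HasDerivAt (fun t => gammaEps Γ h t ξ) (-(h ξ • normal Γ ξ)) s := by
  have := (((hasDerivAt_id s).mul_const (h ξ)).smul_const (normal Γ ξ)).const_sub (Γ ξ)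
  refine this.congr_deriv ?_
  simp

lemma fderiv_collar_basisVec (hΓ : ContDiff ℝ 3 Γ) (hu : ∀ ξ, ‖deriv Γ ξ‖ = 1)
    (hh : ContDiff ℝ 2 h) (q : Plane) :
    fderiv ℝ (collar Γ h) q (basisVec 0) = velocityEps Γ h (q 1) (q 0) ∧
    fderiv ℝ (collar Γ h) q (basisVec 1) = -(h (q 0) • normal Γ (q 0)) := by
  have hd : HasFDerivAt (collar Γ h) (fderiv ℝ (collar Γ h) q) q :=
    ((contDiff_collar hΓ hh).differentiable (by norm_num) q).hasFDerivAt
  have hl : ∀ i : Fin 2, HasDerivAt (fun t : ℝ => q + t • basisVec i) (basisVec i) 0 := fun i => by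
    simpa using ((hasDerivAt_id (0 : ℝ)).smul_const (basisVec i)).const_add q
  have hd' : ∀ i : Fin 2, HasDerivAt (fun t : ℝ => collar Γ h (q + t • basisVec i))
      (fderiv ℝ (collar Γ h) q (basisVec i)) 0 := fun i => by
    have hd0 : HasFDerivAt (collar Γ h) (fderiv ℝ (collar Γ h) q) (q + (0 : ℝ) • basisVec i) := by
      simpa using hd
    exact hd0.comp_hasDerivAt (0 : ℝ) (hl i)
  constructor
  · refine (hd' 0).unique ?_
    have := (hasDerivAt_gammaEps hΓ hu hh (q 1) (q 0))
    have e : (fun t : ℝ => collar Γ h (q + t • basisVec 0))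
        = fun t => gammaEps Γ h (q 1) (q 0 + t) := by
      ext t : 1; simp [collar]
    rw [e]
    exact HasDerivAt.comp_const_add (q 0) 0 (by simpa using this)
  · refine (hd' 1).unique ?_
    have := (hasDerivAt_gammaEps_left (Γ := Γ) (h := h) (q 1) (q 0))
    have e : (fun t : ℝ => collar Γ h (q + t • basisVec 1))
        = fun t => gammaEps Γ h (q 1 + t) (q 0) := by
      ext t : 1; simp [collar]
    rw [e]
    exact HasDerivAt.comp_const_add (q 1) 0 (by simpa using this)

lemma tangent_sq (hu : ∀ ξ, ‖deriv Γ ξ‖ = 1) (ξ : ℝ) :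
    tangent Γ ξ 0 * tangent Γ ξ 0 + tangent Γ ξ 1 * tangent Γ ξ 1 = 1 := by
  rw [← inner_eq_coord, real_inner_self_eq_norm_sq, norm_tangent hu]; norm_num

lemma det_fderiv_collar (hΓ : ContDiff ℝ 3 Γ) (hu : ∀ ξ, ‖deriv Γ ξ‖ = 1)
    (hh : ContDiff ℝ 2 h) (q : Plane) :
    (fderiv ℝ (collar Γ h) q).det = -jac Γ h (q 1) (q 0) := by
  obtain ⟨h0, h1⟩ := fderiv_collar_basisVec hΓ hu hh q
  rw [det_eq_coord, h0, h1]
  simp only [velocityEps, normal, jac, PiLp.sub_apply, PiLp.smul_apply, PiLp.neg_apply,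
    smul_eq_mul, rot_apply_zero, rot_apply_one]
  linear_combination (-h (q 0) * (1 + q 1 * h (q 0) * curv Γ (q 0))) * tangent_sq hu (q 0)

/-! ### Periodicity along the curve -/

variable {L : ℝ}

lemma periodic_tangent (hp : ∀ ξ, Γ (ξ + L) = Γ ξ) (ξ : ℝ) : tangent Γ (ξ + L) = tangent Γ ξ := by
  rw [tangent, tangent, ← deriv_comp_add_const]
  congr 1; ext1 x; exact hp x

lemma periodic_normal (hp : ∀ ξ, Γ (ξ + L) = Γ ξ) (ξ : ℝ) : normal Γ (ξ + L) = normal Γ ξ := by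
  rw [normal, periodic_tangent hp, normal]

lemma periodic_curv (hp : ∀ ξ, Γ (ξ + L) = Γ ξ) (ξ : ℝ) : curv Γ (ξ + L) = curv Γ ξ := by
  rw [curv, curv, periodic_normal hp, ← deriv_comp_add_const]
  congr 2; ext1 x; exact periodic_tangent hp x

lemma periodic_gammaEps (hp : ∀ ξ, Γ (ξ + L) = Γ ξ) (hph : ∀ ξ, h (ξ + L) = h ξ) (s : ℝ) :
    Function.Periodic (gammaEps Γ h s) L := fun ξ => by
  simp [gammaEps, periodic_normal hp, hp, hph]

end Curve

/-! ### Tubular neighbourhood of the interface -/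

/-- A tubular neighbourhood of `Γ` in `D` of half-width `a` in the coordinates
`(ξ, s) ↦ Γ_s(ξ) = Γ(ξ) - s h(ξ) n(ξ)`, together with a `C¹` level function `S` on `D` which equals
`s` at the point `Γ_s(ξ)` of the tube, and has absolute value at least `a` off the tube. The sets
`Ω₃`, `D₁`, the layer and `Ω₁` are then the parts of `D` where `S < 0`, `0 < S`, `0 < S < ε` and
`ε < S`. -/
structure Tube (D D₁ Ω₃ : Set Plane) (Γ : ℝ → Plane) (L : ℝ) (h : ℝ → ℝ) (a : ℝ)
    (S : Plane → ℝ) : Prop where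
  pos : 0 < a
  contDiffOn_level : ContDiffOn ℝ 1 S D
  level_eq : ∀ s ξ, |s| < a → S (gammaEps Γ h s ξ) = s
  mem_D : ∀ s ξ, |s| < a → gammaEps Γ h s ξ ∈ D
  exists_eq : ∀ x ∈ D, |S x| < a → ∃ ξ ∈ Ico 0 L, x = gammaEps Γ h (S x) ξ
  injOn : ∀ s, |s| < a → InjOn (gammaEps Γ h s) (Ico 0 L)
  mem_D₁_iff : ∀ x ∈ D, (x ∈ D₁ ↔ 0 < S x)
  mem_Ω₃_iff : ∀ x ∈ D, (x ∈ Ω₃ ↔ S x < 0)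
  jac_pos : ∀ s ξ, |s| < a → 0 < jac Γ h s ξ

section Existence

variable {D D₁ Ω₃ : Set Plane} {Γ : ℝ → Plane} {L : ℝ} {h : ℝ → ℝ}

lemma exists_int_of_gamma_eq (hg : Geometry D D₁ Ω₃ Γ L h) {ξ ζ : ℝ} (he : Γ ξ = Γ ζ) :
    ∃ k : ℤ, ζ = ξ + k * L := by
  have hp : Function.Periodic Γ L := hg.periodic_Γ
  have hm : ∀ x, Γ (toIcoMod hg.period_pos 0 x) = Γ x := fun x => by
    rw [toIcoMod]; exact hp.sub_zsmul_eq _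
  have := hg.injective_Γ (by simpa using toIcoMod_mem_Ico hg.period_pos 0 ξ)
    (by simpa using toIcoMod_mem_Ico hg.period_pos 0 ζ) (by rw [hm, hm, he])
  refine ⟨toIcoDiv hg.period_pos 0 ζ - toIcoDiv hg.period_pos 0 ξ, ?_⟩
  have h1 := toIcoMod_add_toIcoDiv_zsmul hg.period_pos 0 ξ
  have h2 := toIcoMod_add_toIcoDiv_zsmul hg.period_pos 0 ζ
  rw [zsmul_eq_mul] at h1 h2
  push_cast
  linear_combination h1 - h2 - this

/-- A property of points of the circle `ℝ / L` that holds locally holds on the whole circle, for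
parameters near a given one. -/
lemma eventually_forall_of_periodic {α : Type*} [TopologicalSpace α] {x₀ : α} (hL : 0 < L)
    {P : α → ℝ → Prop} (hper : ∀ x ξ (k : ℤ), P x (ξ + k * L) → P x ξ)
    (hP : ∀ ξ, ∀ᶠ z : α × ℝ in 𝓝 (x₀, ξ), P z.1 z.2) : ∀ᶠ x in 𝓝 x₀, ∀ ξ, P x ξ := by
  have := (isCompact_Icc (a := (0 : ℝ)) (b := L)).eventually_forall_of_forall_eventually
    (x₀ := x₀) (P := P) (fun ξ _ => hP ξ)
  filter_upwards [this] with x hx ξ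
  apply hper x ξ (-toIcoDiv hL 0 ξ)
  have h1 := toIcoMod_add_toIcoDiv_zsmul hL 0 ξ
  have h2 := toIcoMod_mem_Ico hL 0 ξ
  rw [zsmul_eq_mul] at h1
  have h3 : ξ + ((-toIcoDiv hL 0 ξ : ℤ) : ℝ) * L = toIcoMod hL 0 ξ := by
    push_cast; linear_combination -h1
  rw [h3]
  exact hx _ ⟨h2.1, by simpa using h2.2.le⟩

lemma exists_localInverse_collar (hg : Geometry D D₁ Ω₃ Γ L h) (q : Plane)
    (hq : jac Γ h (q 1) (q 0) ≠ 0) :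
    ∃ e : OpenPartialHomeomorph Plane Plane, q ∈ e.source ∧ (∀ x, e x = collar Γ h x) ∧
      ContDiffAt ℝ 1 e.symm (e q) := by
  have hc := contDiff_collar hg.smooth_Γ hg.smooth_h
  have hd : HasFDerivAt (collar Γ h) (fderiv ℝ (collar Γ h) q) q :=
    (hc.differentiable (by norm_num) q).hasFDerivAt
  have hdet : (fderiv ℝ (collar Γ h) q).det ≠ 0 := by
    rw [det_fderiv_collar hg.smooth_Γ hg.unit_speed hg.smooth_h]; simpa using hq
  let A := (fderiv ℝ (collar Γ h) q).toContinuousLinearEquivOfDetNeZero hdet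
  have hA : HasFDerivAt (collar Γ h) (A : Plane →L[ℝ] Plane) q := by simpa [A] using hd
  have hca : ContDiffAt ℝ 2 (collar Γ h) q := hc.contDiffAt
  refine ⟨hca.toOpenPartialHomeomorph (collar Γ h) hA (by norm_num),
    hca.mem_toOpenPartialHomeomorph_source hA (by norm_num), fun x => ?_, ?_⟩
  · rfl
  · exact (hca.to_localInverse hA (by norm_num)).of_le (by norm_num)

/-- The coordinates `(ξ, s)` are injective, up to the period, near `s = 0`. -/
lemma eventually_collar_inj (hg : Geometry D D₁ Ω₃ Γ L h) :
    ∀ᶠ z : ℝ × ℝ in 𝓝 (0, 0), ∀ ξ ζ : ℝ, gammaEps Γ h z.1 ξ = gammaEps Γ h z.2 ζ →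
      z.1 = z.2 ∧ ∃ k : ℤ, ζ = ξ + k * L := by
  have hper := fun s => periodic_gammaEps hg.periodic_Γ hg.periodic_h s
  have hgc := continuous_gammaEps hg.smooth_Γ hg.smooth_h
  refine eventually_forall_of_periodic (P := fun (z : ℝ × ℝ) ξ => ∀ ζ : ℝ,
    gammaEps Γ h z.1 ξ = gammaEps Γ h z.2 ζ → z.1 = z.2 ∧ ∃ k : ℤ, ζ = ξ + k * L) hg.period_pos
    ?_ fun ξ => ?_
  · intro z ξ k H ζ hζ
    obtain ⟨h1, j, hj⟩ := H ζ (by rw [(hper z.1).int_mul k ξ]; exact hζ)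
    exact ⟨h1, k + j, by rw [hj]; push_cast; ring⟩
  refine eventually_forall_of_periodic (x₀ := ((0, 0), ξ))
    (P := fun (w : (ℝ × ℝ) × ℝ) ζ => gammaEps Γ h w.1.1 w.2 = gammaEps Γ h w.1.2 ζ →
      w.1.1 = w.1.2 ∧ ∃ k : ℤ, ζ = w.2 + k * L) hg.period_pos ?_ fun ζ => ?_
  · intro w ζ k H hζ
    obtain ⟨h1, j, hj⟩ := H (by rw [(hper w.1.2).int_mul k ζ]; exact hζ)
    exact ⟨h1, j - k, by push_cast; linear_combination hj⟩
  by_cases he : Γ ξ = Γ ζ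
  · -- the same point of the curve: the coordinates are locally invertible there
    obtain ⟨k, rfl⟩ := exists_int_of_gamma_eq hg he
    have hj : jac Γ h ((!₂[ξ, 0] : Plane) 1) ((!₂[ξ, 0] : Plane) 0) ≠ 0 := by
      simpa [jac_zero] using (hg.pos_h ξ).ne'
    obtain ⟨e, heq, hee, -⟩ := exists_localInverse_collar hg _ hj
    have hev : ∀ᶠ q : Plane in 𝓝 (!₂[ξ, 0] : Plane), q ∈ e.source := e.open_source.mem_nhds heq
    have hct : Continuous fun y : ℝ × ℝ => (!₂[y.1, y.2] : Plane) := by fun_prop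
    have t1 : Tendsto (fun w : ((ℝ × ℝ) × ℝ) × ℝ => (!₂[w.1.2, w.1.1.1] : Plane))
        (𝓝 (((0, 0), ξ), ξ + k * L)) (𝓝 (!₂[ξ, 0] : Plane)) :=
      (hct.comp (g := fun y : ℝ × ℝ => (!₂[y.1, y.2] : Plane))
        (f := fun w : ((ℝ × ℝ) × ℝ) × ℝ => (w.1.2, w.1.1.1)) (by fun_prop)).tendsto' _ _ rfl
    have t2 : Tendsto (fun w : ((ℝ × ℝ) × ℝ) × ℝ => (!₂[w.2 - k * L, w.1.1.2] : Plane))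
        (𝓝 (((0, 0), ξ), ξ + k * L)) (𝓝 (!₂[ξ, 0] : Plane)) :=
      (hct.comp (g := fun y : ℝ × ℝ => (!₂[y.1, y.2] : Plane))
        (f := fun w : ((ℝ × ℝ) × ℝ) × ℝ => (w.2 - k * L, w.1.1.2)) (by fun_prop)).tendsto' _ _
        (by simp)
    filter_upwards [t1.eventually hev, t2.eventually hev] with w h1 h2 hw
    have h3 : (!₂[w.1.2, w.1.1.1] : Plane) = !₂[w.2 - k * L, w.1.1.2] := by
      refine e.injOn h1 h2 ?_
      rw [hee, hee]
      simp only [collar]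
      have := (hper w.1.1.2).sub_int_mul_eq (x := w.2) k
      simpa [this] using hw
    have h4 := congrArg (fun v : Plane => v 0) h3
    have h5 := congrArg (fun v : Plane => v 1) h3
    simp only at h4 h5
    refine ⟨by simpa using h5, k, ?_⟩
    have : w.1.2 = w.2 - k * L := by simpa using h4
    linarith
  · -- distinct points of the curve: nearby points remain distinct
    have hcont : ContinuousAt (fun w : ((ℝ × ℝ) × ℝ) × ℝ =>
        gammaEps Γ h w.1.1.1 w.1.2 - gammaEps Γ h w.1.1.2 w.2) (((0, 0), ξ), ζ) :=
      ((hgc.comp (f := fun w : ((ℝ × ℝ) × ℝ) × ℝ => (w.1.1.1, w.1.2)) (by fun_prop)).sub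
        (hgc.comp (f := fun w : ((ℝ × ℝ) × ℝ) × ℝ => (w.1.1.2, w.2)) (by fun_prop))).continuousAt
    have hne := hcont.eventually_ne (y := 0) (by
      simpa [gammaEps_zero, sub_eq_zero] using he)
    filter_upwards [hne] with w hw hw'
    exact absurd (sub_eq_zero.2 hw') hw

/-- A `C¹` function that is the identity on `[-a, a]` and constant off `[-2a, 2a]`. -/
lemma exists_truncation {a : ℝ} (ha : 0 < a) : ∃ σ : ℝ → ℝ, ContDiff ℝ 1 σ ∧ Monotone σ ∧
    (∀ s, |s| ≤ a → σ s = s) ∧ (∀ s, 2 * a ≤ s → σ s = σ (2 * a)) ∧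
    (∀ s, s ≤ -(2 * a) → σ s = σ (-(2 * a))) := by
  let β : ContDiffBump (0 : ℝ) := ⟨a, 2 * a, ha, by linarith⟩
  have hβ : Continuous β := β.continuous
  have hint : ∀ x y, IntervalIntegrable β volume x y := fun x y => hβ.intervalIntegrable x y
  have hd : ∀ s, HasDerivAt (fun s => ∫ t in (0 : ℝ)..s, β t) (β s) s := fun s =>
    intervalIntegral.integral_hasDerivAt_right (hint _ _)
      hβ.stronglyMeasurable.stronglyMeasurableAtFilter hβ.continuousAt
  refine ⟨fun s => ∫ t in (0 : ℝ)..s, β t, ?_, ?_, ?_, ?_, ?_⟩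
  · rw [contDiff_one_iff_deriv]
    refine ⟨fun s => (hd s).differentiableAt, ?_⟩
    have : deriv (fun s => ∫ t in (0 : ℝ)..s, β t) = β := funext fun s => (hd s).deriv
    rw [this]; exact hβ
  · exact monotone_of_hasDerivAt_nonneg hd fun s => β.nonneg
  · intro s hs
    have : ∫ t in (0 : ℝ)..s, β t = ∫ t in (0 : ℝ)..s, (1 : ℝ) := by
      refine intervalIntegral.integral_congr fun t ht => ?_
      refine β.one_of_mem_closedBall ?_
      have := abs_le.1 hs
      rw [Real.closedBall_eq_Icc]
      constructor
      · have := ht.1; simp only [β, zero_sub] at *; refine le_trans ?_ this; simp [ha.le]; linarith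
      · have := ht.2; simp only [β, zero_add] at *; refine le_trans this ?_; simp [ha.le]; linarith
    simpa using this
  · intro s hs
    rw [← sub_eq_zero, intervalIntegral.integral_interval_sub_left (hint _ _) (hint _ _)]
    refine intervalIntegral.integral_zero_ae (Filter.Eventually.of_forall fun t ht => ?_)
    rw [uIoc_of_le hs] at ht
    refine β.zero_of_le_dist ?_
    rw [Real.dist_eq, sub_zero]
    exact ht.1.le.trans (le_abs_self t)
  · intro s hs
    rw [← sub_eq_zero, intervalIntegral.integral_interval_sub_left (hint _ _) (hint _ _)]
    refine intervalIntegral.integral_zero_ae (Filter.Eventually.of_forall fun t ht => ?_)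
    rw [uIoc_of_ge hs] at ht
    refine β.zero_of_le_dist ?_
    rw [Real.dist_eq, sub_zero]
    change 2 * a ≤ |t|
    have h1 := neg_abs_le t
    linarith [ht.2]

lemma isCompact_image_gammaEps (hg : Geometry D D₁ Ω₃ Γ L h) {I : Set ℝ} (hI : IsCompact I) :
    IsCompact {x | ∃ s ∈ I, ∃ ξ, gammaEps Γ h s ξ = x} := by
  have : {x | ∃ s ∈ I, ∃ ξ, gammaEps Γ h s ξ = x}
      = (fun z : ℝ × ℝ => gammaEps Γ h z.1 z.2) '' (I ×ˢ Icc 0 L) := by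
    ext x
    constructor
    · rintro ⟨s, hs, ξ, rfl⟩
      have hper := periodic_gammaEps hg.periodic_Γ hg.periodic_h s
      obtain ⟨ζ, hζ, hζ'⟩ := hper.exists_mem_Ico₀ hg.period_pos ξ
      exact ⟨(s, ζ), ⟨hs, hζ.1, hζ.2.le⟩, hζ'.symm⟩
    · rintro ⟨⟨s, ξ⟩, ⟨hs, -⟩, rfl⟩
      exact ⟨s, hs, ξ, rfl⟩
  rw [this]
  exact (hI.prod isCompact_Icc).image (continuous_gammaEps hg.smooth_Γ hg.smooth_h)

/-- For small `b`, the coordinates `(ξ, s)` with `|s| < b` parametrize a neighbourhood of `Γ`. -/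
lemma exists_collar_radius (hg : Geometry D D₁ Ω₃ Γ L h) : ∃ b > 0,
    (∀ s ξ, |s| < b → 0 < jac Γ h s ξ ∧ gammaEps Γ h s ξ ∈ D ∧
      (0 < s → gammaEps Γ h s ξ ∈ D₁) ∧ (s < 0 → gammaEps Γ h s ξ ∈ Ω₃)) ∧
    ∀ s t ξ ζ, |s| < b → |t| < b → gammaEps Γ h s ξ = gammaEps Γ h t ζ →
      s = t ∧ ∃ k : ℤ, ζ = ξ + k * L := by
  have hper := fun s => periodic_gammaEps hg.periodic_Γ hg.periodic_h s
  have hgc := continuous_gammaEps hg.smooth_Γ hg.smooth_h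
  have h1 := eventually_collar_inj hg
  have hjp : ∀ s ξ (k : ℤ), jac Γ h s (ξ + k * L) = jac Γ h s ξ := fun s ξ k => by
    have hf : Function.Periodic (jac Γ h s) L := fun ξ => by
      simp [jac, periodic_curv hg.periodic_Γ, hg.periodic_h]
    exact hf.int_mul k ξ
  have h2 : ∀ᶠ s : ℝ in 𝓝 0, ∀ ξ, 0 < jac Γ h s ξ := by
    refine eventually_forall_of_periodic hg.period_pos (fun s ξ k H => by rwa [hjp] at H)
      fun ξ => ?_
    exact (continuous_jac hg.smooth_Γ hg.smooth_h).continuousAt.eventually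
      (lt_mem_nhds (by simpa [jac_zero] using hg.pos_h ξ))
  have h3 : ∀ᶠ s : ℝ in 𝓝 0, ∀ ξ, gammaEps Γ h s ξ ∈ D := by
    refine eventually_forall_of_periodic hg.period_pos
      (fun s ξ k H => by rwa [(hper s).int_mul k ξ] at H) fun ξ => ?_
    exact hgc.continuousAt.eventually (hg.isOpen_D.mem_nhds
      (by simpa [gammaEps_zero] using hg.range_subset ⟨ξ, rfl⟩))
  rw [Metric.eventually_nhds_iff] at h1
  obtain ⟨b₁, hb₁, h1⟩ := h1
  obtain ⟨b₂, hb₂, h2⟩ := Metric.eventually_nhds_iff.1 h2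
  obtain ⟨b₃, hb₃, h3⟩ := Metric.eventually_nhds_iff.1 h3
  refine ⟨min b₁ (min b₂ b₃), by positivity, ?_, ?_⟩
  swap
  · intro s t ξ ζ hs ht he
    refine h1 (y := (s, t)) ?_ ξ ζ he
    rw [Prod.dist_eq, max_lt_iff, Real.dist_eq, Real.dist_eq]
    simpa using ⟨hs.trans_le (min_le_left _ _), ht.trans_le (min_le_left _ _)⟩
  have hb₂' : min b₁ (min b₂ b₃) ≤ b₂ := (min_le_right _ _).trans (min_le_left _ _)
  have hb₃' : min b₁ (min b₂ b₃) ≤ b₃ := (min_le_right _ _).trans (min_le_right _ _)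
  have hD : ∀ s ξ, |s| < min b₁ (min b₂ b₃) → gammaEps Γ h s ξ ∈ D := fun s ξ hs =>
    h3 (y := s) (by simpa [Real.dist_eq] using hs.trans_le hb₃') ξ
  have hU : ∀ s ξ, |s| < min b₁ (min b₂ b₃) → s ≠ 0 → gammaEps Γ h s ξ ∈ D₁ ∪ Ω₃ := by
    intro s ξ hs hs0
    rw [← hg.decomposition]
    refine ⟨hD s ξ hs, ?_⟩
    rintro ⟨ζ, hζ⟩
    refine hs0 (h1 (y := (s, 0)) ?_ ξ ζ (by simpa [gammaEps_zero] using hζ.symm)).1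
    rw [Prod.dist_eq, max_lt_iff, Real.dist_eq, Real.dist_eq]
    simpa using ⟨hs.trans_le (min_le_left _ _), hb₁⟩
  -- Near `Γ`, the two sides are prescribed; along each normal segment the side cannot change.
  have hside : ∀ ξ, ∀ᶠ s : ℝ in 𝓝[>] 0, gammaEps Γ h s ξ ∈ D₁ ∧ gammaEps Γ h (-s) ξ ∈ Ω₃ := by
    intro ξ
    have ht : Tendsto (fun s : ℝ => s * h ξ) (𝓝[>] 0) (𝓝[>] 0) := by
      refine tendsto_nhdsWithin_iff.2 ⟨?_, ?_⟩
      · exact ((continuous_id.mul continuous_const).tendsto' 0 0 (by simp)).mono_left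
          nhdsWithin_le_nhds
      · filter_upwards [self_mem_nhdsWithin] with s hs using mul_pos hs (hg.pos_h ξ)
    filter_upwards [ht.eventually (hg.sides ξ)] with s hs
    refine ⟨hs.2, ?_⟩
    have := hs.1
    simpa [gammaEps] using this
  have hpos : (0 : ℝ) < min b₁ (min b₂ b₃) := by positivity
  intro s ξ hs
  refine ⟨h2 (y := s) (by simpa [Real.dist_eq] using hs.trans_le hb₂') ξ, hD s ξ hs,
    fun hs0 => ?_, fun hs0 => ?_⟩
  · have hc : IsPreconnected ((fun t => gammaEps Γ h t ξ) '' Ioo 0 (min b₁ (min b₂ b₃))) :=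
      isPreconnected_Ioo.image _
        (hgc.comp (f := fun t : ℝ => (t, ξ)) (by fun_prop)).continuousOn
    have hsub : (fun t => gammaEps Γ h t ξ) '' Ioo 0 (min b₁ (min b₂ b₃)) ⊆ D₁ ∪ Ω₃ := by
      rintro _ ⟨t, ht, rfl⟩
      exact hU t ξ (by rw [abs_of_pos ht.1]; exact ht.2) ht.1.ne'
    obtain ⟨t, ht, ht'⟩ := ((hside ξ).and (Ioo_mem_nhdsGT hpos)).exists
    exact hc.subset_left_of_subset_union hg.isOpen_D₁ hg.isOpen_Ω₃ hg.disjoint_D₁_Ω₃ hsub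
      ⟨_, ⟨t, ht', rfl⟩, ht.1⟩ ⟨s, ⟨hs0, by rwa [abs_of_pos hs0] at hs⟩, rfl⟩
  · have hc : IsPreconnected ((fun t => gammaEps Γ h (-t) ξ) '' Ioo 0 (min b₁ (min b₂ b₃))) :=
      isPreconnected_Ioo.image _
        (hgc.comp (f := fun t : ℝ => (-t, ξ)) (by fun_prop)).continuousOn
    have hsub : (fun t => gammaEps Γ h (-t) ξ) '' Ioo 0 (min b₁ (min b₂ b₃)) ⊆ D₁ ∪ Ω₃ := by
      rintro _ ⟨t, ht, rfl⟩
      exact hU (-t) ξ (by rw [abs_neg, abs_of_pos ht.1]; exact ht.2) (neg_ne_zero.2 ht.1.ne')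
    obtain ⟨t, ht, ht'⟩ := ((hside ξ).and (Ioo_mem_nhdsGT hpos)).exists
    exact hc.subset_right_of_subset_union hg.isOpen_D₁ hg.isOpen_Ω₃ hg.disjoint_D₁_Ω₃ hsub
      ⟨_, ⟨t, ht', rfl⟩, ht.2⟩ ⟨-s, ⟨by linarith, by rwa [abs_of_neg hs0] at hs⟩, by simp⟩

/-- The interface has a tubular neighbourhood. The level function is a truncation of the coordinate
`s` inside a larger tube, and a constant of the appropriate sign on each of `D₁` and `Ω₃`
outside. -/
theorem exists_tube (hg : Geometry D D₁ Ω₃ Γ L h) : ∃ a S, Tube D D₁ Ω₃ Γ L h a S := by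
  classical
  obtain ⟨b, hb, hcol, hinj⟩ := exists_collar_radius hg
  have hper := fun s => periodic_gammaEps hg.periodic_Γ hg.periodic_h s
  -- With `a = b / 3` the truncation is constant for `2 a ≤ |s| < 3 a = b`, so that it extends to
  -- the outside of the tube of half-width `b`.
  have ha : 0 < b / 3 := by positivity
  obtain ⟨σ, hσ1, hσm, hσid, hσp, hσn⟩ := exists_truncation ha
  set a := b / 3 with hadef
  have hcp : a ≤ σ (2 * a) :=
    (hσid a (abs_of_pos ha).le).symm.le.trans (hσm (by linarith))
  have hcn : σ (-(2 * a)) ≤ -a :=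
    (hσm (show -(2 * a) ≤ -a by linarith)).trans
      (hσid (-a) (by rw [abs_neg, abs_of_pos ha])).le
  have hσpos : ∀ s, 0 < s → 0 < σ s := fun s hs => by
    have h1 : 0 < min s a := lt_min hs ha
    have h2 := hσid (min s a) (by rw [abs_of_pos h1]; exact min_le_right _ _)
    exact (h1.trans_eq h2.symm).trans_le (hσm (min_le_left _ _))
  have hσneg : ∀ s, s < 0 → σ s < 0 := fun s hs => by
    have h1 : max s (-a) < 0 := max_lt hs (by linarith)
    have h2 := hσid (max s (-a)) (by rw [abs_of_neg h1]; linarith [le_max_right s (-a)])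
    exact (hσm (le_max_left _ _)).trans_lt (h2.trans_lt h1)
  have hσlt : ∀ s, |σ s| < a → |s| < a := fun s hs => by
    obtain ⟨h1, h2⟩ := abs_lt.1 hs
    rw [abs_lt]
    constructor
    · by_contra! hc
      have := hσm hc
      rw [hσid (-a) (by rw [abs_neg, abs_of_pos ha])] at this
      linarith
    · by_contra! hc
      have := hσm hc
      rw [hσid a (abs_of_pos ha).le] at this
      linarith
  let S : Plane → ℝ := fun x =>
    if hx : ∃ q : ℝ × ℝ, |q.1| < b ∧ gammaEps Γ h q.1 q.2 = x then σ hx.choose.1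
    else if x ∈ D₁ then σ (2 * a) else σ (-(2 * a))
  have hS : ∀ s ξ, |s| < b → S (gammaEps Γ h s ξ) = σ s := by
    intro s ξ hs
    have hx : ∃ q : ℝ × ℝ, |q.1| < b ∧ gammaEps Γ h q.1 q.2 = gammaEps Γ h s ξ := ⟨(s, ξ), hs, rfl⟩
    have : S (gammaEps Γ h s ξ) = σ hx.choose.1 := dif_pos hx
    rw [this, (hinj _ _ _ _ hx.choose_spec.1 hs hx.choose_spec.2).1]
  have hSn : ∀ x, (¬ ∃ q : ℝ × ℝ, |q.1| < b ∧ gammaEps Γ h q.1 q.2 = x) →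
      S x = if x ∈ D₁ then σ (2 * a) else σ (-(2 * a)) := fun x hx => dif_neg hx
  have hab : ∀ s : ℝ, |s| < a → |s| < b := fun s hs => hs.trans (by linarith)
  have hnot1 : ∀ s ξ, |s| < b → gammaEps Γ h s ξ ∈ D₁ → 0 < s := by
    intro s ξ hs hx
    rcases lt_trichotomy s 0 with h0 | rfl | h0
    · exact absurd ((hcol s ξ hs).2.2.2 h0) (hg.disjoint_D₁_Ω₃.notMem_of_mem_left hx)
    · have : gammaEps Γ h 0 ξ ∈ D \ range Γ := by
        rw [hg.decomposition]; exact Or.inl hx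
      exact absurd ⟨ξ, (gammaEps_zero ξ).symm⟩ this.2
    · exact h0
  have hnot3 : ∀ s ξ, |s| < b → gammaEps Γ h s ξ ∈ Ω₃ → s < 0 := by
    intro s ξ hs hx
    rcases lt_trichotomy s 0 with h0 | rfl | h0
    · exact h0
    · have : gammaEps Γ h 0 ξ ∈ D \ range Γ := by
        rw [hg.decomposition]; exact Or.inr hx
      exact absurd ⟨ξ, (gammaEps_zero ξ).symm⟩ this.2
    · exact absurd ((hcol s ξ hs).2.2.1 h0) (hg.disjoint_D₁_Ω₃.notMem_of_mem_right hx)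
  have hsplit : ∀ x ∈ D, (¬ ∃ q : ℝ × ℝ, |q.1| < b ∧ gammaEps Γ h q.1 q.2 = x) →
      x ∈ D₁ ∨ x ∈ Ω₃ := by
    intro x hx hn
    have : x ∈ D \ range Γ := ⟨hx, fun ⟨ξ, hξ⟩ => hn ⟨(0, ξ), by simpa using hb, by
      rw [gammaEps_zero]; exact hξ⟩⟩
    rwa [hg.decomposition] at this
  refine ⟨a, S, ha, ?_, fun s ξ hs => (hS s ξ (hab s hs)).trans (hσid s hs.le),
    fun s ξ hs => (hcol s ξ (hab s hs)).2.1, ?_, ?_, ?_, ?_, fun s ξ hs => (hcol s ξ (hab s hs)).1⟩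
  · -- inside the tube, `S` is the truncation of a coordinate of the local inverse
    intro x hx
    refine ContDiffAt.contDiffWithinAt ?_
    by_cases hxT : ∃ q : ℝ × ℝ, |q.1| < b ∧ gammaEps Γ h q.1 q.2 = x
    · obtain ⟨⟨s, ξ⟩, hs, rfl⟩ := hxT
      simp only at hs ⊢
      obtain ⟨e, heq, hee, hes⟩ := exists_localInverse_collar hg (!₂[ξ, s] : Plane)
        (by simpa using (hcol s ξ hs).1.ne')
      have hex : e (!₂[ξ, s] : Plane) = gammaEps Γ h s ξ := by rw [hee]; simp [collar]
      rw [hex] at hes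
      have hsm : ContDiffAt ℝ 1 (fun y => σ (e.symm y 1)) (gammaEps Γ h s ξ) :=
        hσ1.contDiffAt.comp _
          ((EuclideanSpace.proj 1 : Plane →L[ℝ] ℝ).contDiff.contDiffAt.comp _ hes)
      refine hsm.congr_of_eventuallyEq ?_
      have hmt : gammaEps Γ h s ξ ∈ e.target := hex ▸ e.map_source heq
      have h1 : ContinuousAt (fun y => |e.symm y 1|) (gammaEps Γ h s ξ) :=
        ((EuclideanSpace.proj 1 : Plane →L[ℝ] ℝ).continuous.continuousAt.comp hes.continuousAt).abs
      have h2 : |e.symm (gammaEps Γ h s ξ) 1| < b := by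
        rw [← hex, e.left_inv heq]; simpa using hs
      filter_upwards [e.open_target.mem_nhds hmt, h1.eventually (gt_mem_nhds h2)] with y hy1 hy2
      have h3 : gammaEps Γ h (e.symm y 1) (e.symm y 0) = y := by
        exact (hee (e.symm y)).symm.trans (e.right_inv hy1)
      conv_lhs => rw [← h3]
      exact hS _ _ hy2
    · -- off the tube, `S` is locally constant: a neighbourhood of `x` meets the tube only where
      -- `2 a ≤ |s|`
      have hK : IsClosed {x | ∃ s ∈ Icc (-(2 * a)) (2 * a), ∃ ξ, gammaEps Γ h s ξ = x} :=
        (isCompact_image_gammaEps hg isCompact_Icc).isClosed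
      have hxK : x ∈ {x | ∃ s ∈ Icc (-(2 * a)) (2 * a), ∃ ξ, gammaEps Γ h s ξ = x}ᶜ := by
        rintro ⟨s, hs, ξ, hξ⟩
        exact hxT ⟨(s, ξ), (abs_le.2 hs).trans_lt (by linarith), hξ⟩
      rcases hsplit x hx hxT with hx1 | hx3
      · have : S =ᶠ[𝓝 x] fun _ => σ (2 * a) := by
          filter_upwards [hK.isOpen_compl.mem_nhds hxK, hg.isOpen_D₁.mem_nhds hx1] with y hy hy1
          by_cases hyT : ∃ q : ℝ × ℝ, |q.1| < b ∧ gammaEps Γ h q.1 q.2 = y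
          · obtain ⟨⟨s, ξ⟩, hs, rfl⟩ := hyT
            simp only at hs ⊢
            rw [hS s ξ hs]
            refine hσp s ?_
            by_contra! hc
            exact hy ⟨s, ⟨by linarith [hnot1 s ξ hs hy1], hc.le⟩, ξ, rfl⟩
          · rw [hSn y hyT, if_pos hy1]
        exact contDiffAt_const.congr_of_eventuallyEq this
      · have : S =ᶠ[𝓝 x] fun _ => σ (-(2 * a)) := by
          filter_upwards [hK.isOpen_compl.mem_nhds hxK, hg.isOpen_Ω₃.mem_nhds hx3] with y hy hy1
          by_cases hyT : ∃ q : ℝ × ℝ, |q.1| < b ∧ gammaEps Γ h q.1 q.2 = y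
          · obtain ⟨⟨s, ξ⟩, hs, rfl⟩ := hyT
            simp only at hs ⊢
            rw [hS s ξ hs]
            refine hσn s ?_
            by_contra! hc
            exact hy ⟨s, ⟨hc.le, by linarith [hnot3 s ξ hs hy1]⟩, ξ, rfl⟩
          · rw [hSn y hyT, if_neg (hg.disjoint_D₁_Ω₃.notMem_of_mem_right hy1)]
        exact contDiffAt_const.congr_of_eventuallyEq this
  · intro x hx hxa
    by_cases hxT : ∃ q : ℝ × ℝ, |q.1| < b ∧ gammaEps Γ h q.1 q.2 = x
    · obtain ⟨⟨s, ξ⟩, hs, rfl⟩ := hxT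
      simp only at hs hxa ⊢
      obtain ⟨ζ, hζ, hζ'⟩ := (hper s).exists_mem_Ico₀ hg.period_pos ξ
      refine ⟨ζ, hζ, ?_⟩
      rw [hS s ξ hs] at hxa ⊢
      rw [hσid s (hσlt s hxa).le, hζ']
    · rw [hSn x hxT] at hxa
      obtain ⟨h1, h2⟩ := abs_lt.1 hxa
      split_ifs at h1 h2 <;> linarith
  · intro s hs ξ hξ ζ hζ he
    obtain ⟨-, k, hk⟩ := hinj s s ξ ζ (hab s hs) (hab s hs) he
    have hL := hg.period_pos
    have hk1 : (k : ℝ) < 1 := by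
      by_contra! hc
      nlinarith [hξ.1, hζ.2]
    have hk2 : (-1 : ℝ) < k := by
      by_contra! hc
      nlinarith [hξ.2, hζ.1]
    have hk0 : k = 0 := by
      have h1 : k < 1 := by exact_mod_cast hk1
      have h2 : -1 < k := by exact_mod_cast hk2
      omega
    rw [hk, hk0]; simp
  · intro x hx
    by_cases hxT : ∃ q : ℝ × ℝ, |q.1| < b ∧ gammaEps Γ h q.1 q.2 = x
    · obtain ⟨⟨s, ξ⟩, hs, rfl⟩ := hxT
      simp only at hs ⊢
      rw [hS s ξ hs]
      refine ⟨fun h1 => hσpos s (hnot1 s ξ hs h1), fun h1 => (hcol s ξ hs).2.2.1 ?_⟩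
      by_contra! hc
      have := hσm hc
      rw [hσid 0 (by simpa using ha.le)] at this
      linarith
    · rw [hSn x hxT]
      split_ifs with h1
      · simp only [h1, true_iff]; linarith
      · simp only [h1, false_iff]; linarith
  · intro x hx
    by_cases hxT : ∃ q : ℝ × ℝ, |q.1| < b ∧ gammaEps Γ h q.1 q.2 = x
    · obtain ⟨⟨s, ξ⟩, hs, rfl⟩ := hxT
      simp only at hs ⊢
      rw [hS s ξ hs]
      refine ⟨fun h1 => hσneg s (hnot3 s ξ hs h1), fun h1 => (hcol s ξ hs).2.2.2 ?_⟩
      by_contra! hc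
      have := hσm hc
      rw [hσid 0 (by simpa using ha.le)] at this
      linarith
    · rw [hSn x hxT]
      split_ifs with h1
      · simp only [hg.disjoint_D₁_Ω₃.notMem_of_mem_left h1, false_iff]; linarith
      · simp only [(hsplit x hx hxT).resolve_left h1, true_iff]; linarith

end Existence

/-! ### Integration in the tubular neighbourhood -/

/-- The identification of the plane with `ℝ × ℝ`. -/
def planeEquiv : Plane ≃ᵐ ℝ × ℝ :=
  (MeasurableEquiv.toLp 2 (Fin 2 → ℝ)).symm.trans MeasurableEquiv.finTwoArrow

@[simp] lemma planeEquiv_apply (q : Plane) : planeEquiv q = (q 0, q 1) := rfl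

lemma measurePreserving_planeEquiv : MeasurePreserving planeEquiv volume volume :=
  (volume_preserving_finTwoArrow ℝ).comp (PiLp.volume_preserving_ofLp (Fin 2))

section Collar

variable {D D₁ Ω₃ : Set Plane} {Γ : ℝ → Plane} {L : ℝ} {h : ℝ → ℝ} {a : ℝ} {S : Plane → ℝ}

lemma Tube.level_gammaEps_mem (T : Tube D D₁ Ω₃ Γ L h a S) {s ξ : ℝ} (hs : |s| < a) :
    gammaEps Γ h s ξ ∈ D ∧ S (gammaEps Γ h s ξ) = s := ⟨T.mem_D s ξ hs, T.level_eq s ξ hs⟩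

/-- The rescaled coordinates `(ξ, t) ↦ Γ_{c + δ t}(ξ)`. -/
def collarScaled (Γ : ℝ → Plane) (h : ℝ → ℝ) (c δ : ℝ) (q : Plane) : Plane :=
  collar Γ h !₂[q 0, c + δ * q 1]

lemma hasFDerivAt_collarScaled (hg : Geometry D D₁ Ω₃ Γ L h) (c δ : ℝ) (q : Plane) :
    ∃ A : Mat, HasFDerivAt (collarScaled Γ h c δ) A q ∧
      |A.det| = |δ| * |jac Γ h (c + δ * q 1) (q 0)| := by
  let B : Mat := LinearMap.toContinuousLinearMap
    { toFun := fun v : Plane => !₂[v 0, δ * v 1]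
      map_add' := fun x y => by apply plane_ext <;> simp [mul_add]
      map_smul' := fun r x => by apply plane_ext <;> simp [mul_left_comm] }
  have hB : ∀ v, B v = !₂[v 0, δ * v 1] := fun v => rfl
  have hBd : HasFDerivAt (fun q : Plane => (!₂[q 0, c + δ * q 1] : Plane)) B q := by
    have : (fun q : Plane => (!₂[q 0, c + δ * q 1] : Plane)) = fun q => B q + !₂[0, c] := by
      ext1 v; apply plane_ext <;> simp [hB, add_comm]
    rw [this]
    exact B.hasFDerivAt.add_const _
  have hd := ((contDiff_collar hg.smooth_Γ hg.smooth_h).differentiable (by norm_num)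
    (!₂[q 0, c + δ * q 1])).hasFDerivAt
  refine ⟨_, hd.comp q hBd, ?_⟩
  have : ((fderiv ℝ (collar Γ h) !₂[q 0, c + δ * q 1]).comp B).det
      = (fderiv ℝ (collar Γ h) !₂[q 0, c + δ * q 1]).det * B.det :=
    LinearMap.det_comp _ _
  rw [this, det_fderiv_collar hg.smooth_Γ hg.unit_speed hg.smooth_h, abs_mul, abs_neg, mul_comm]
  congr 1
  rw [det_eq_coord, hB, hB]
  simp

lemma image_collarScaled (T : Tube D D₁ Ω₃ Γ L h a S) {c δ : ℝ} {A : Set ℝ}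
    (hA : ∀ t ∈ A, |c + δ * t| < a) :
    collarScaled Γ h c δ '' (planeEquiv ⁻¹' (Ico 0 L ×ˢ A))
      = {x | x ∈ D ∧ ∃ t ∈ A, S x = c + δ * t} := by
  ext x
  constructor
  · rintro ⟨q, ⟨h0, h1⟩, rfl⟩
    have := T.level_gammaEps_mem (ξ := q 0) (hA _ h1)
    exact ⟨by simpa [collarScaled, collar] using this.1, q 1, h1,
      by simpa [collarScaled, collar] using this.2⟩
  · rintro ⟨hx, t, ht, hSt⟩
    obtain ⟨ξ, hξ, he⟩ := T.exists_eq x hx (by rw [hSt]; exact hA t ht)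
    refine ⟨!₂[ξ, t], ⟨by simpa using hξ, by simpa using ht⟩, ?_⟩
    rw [he, hSt]; simp [collarScaled, collar]

lemma injOn_collarScaled (T : Tube D D₁ Ω₃ Γ L h a S) {c δ : ℝ} (hδ : δ ≠ 0) {A : Set ℝ}
    (hA : ∀ t ∈ A, |c + δ * t| < a) :
    InjOn (collarScaled Γ h c δ) (planeEquiv ⁻¹' (Ico 0 L ×ˢ A)) := by
  rintro q ⟨hq0, hq1⟩ r ⟨hr0, hr1⟩ he
  rw [planeEquiv_apply] at hq0 hq1 hr0 hr1
  simp only at hq0 hq1 hr0 hr1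
  have he' : gammaEps Γ h (c + δ * q 1) (q 0) = gammaEps Γ h (c + δ * r 1) (r 0) := by
    simpa [collarScaled, collar] using he
  have h1 := congrArg S he'
  rw [T.level_eq _ _ (hA _ hq1), T.level_eq _ _ (hA _ hr1)] at h1
  rw [h1] at he'
  have h2 := T.injOn _ (hA _ hr1) hq0 hr0 he'
  refine plane_ext h2 ?_
  have : δ * (q 1 - r 1) = 0 := by linear_combination h1
  rcases mul_eq_zero.1 this with h | h
  · exact absurd h hδ
  · linarith

/-- Change of variables to the coordinates `(ξ, t) ↦ Γ_{c + δ t}(ξ)`. -/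
lemma collar_change_of_variables (hg : Geometry D D₁ Ω₃ Γ L h) (T : Tube D D₁ Ω₃ Γ L h a S)
    {c δ : ℝ} (hδ : δ ≠ 0) {A : Set ℝ} (hAm : MeasurableSet A) (hA : ∀ t ∈ A, |c + δ * t| < a)
    (f : Plane → ℝ) :
    (∫ x in {x | x ∈ D ∧ ∃ t ∈ A, S x = c + δ * t}, f x
      = ∫ z in Ico 0 L ×ˢ A,
        |δ| * jac Γ h (c + δ * z.2) z.1 * f (gammaEps Γ h (c + δ * z.2) z.1)) ∧
    (IntegrableOn f {x | x ∈ D ∧ ∃ t ∈ A, S x = c + δ * t} ↔ IntegrableOn (fun z : ℝ × ℝ =>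
        |δ| * jac Γ h (c + δ * z.2) z.1 * f (gammaEps Γ h (c + δ * z.2) z.1)) (Ico 0 L ×ˢ A)) := by
  choose B hB hdet using hasFDerivAt_collarScaled hg c δ
  have hRm : MeasurableSet (planeEquiv ⁻¹' (Ico 0 L ×ˢ A)) :=
    planeEquiv.measurable (measurableSet_Ico.prod hAm)
  have hinj := injOn_collarScaled T hδ hA
  have hcongr : ∀ q ∈ planeEquiv ⁻¹' (Ico 0 L ×ˢ A),
      |(B q).det| • f (collarScaled Γ h c δ q) =
      (fun z : ℝ × ℝ => |δ| * jac Γ h (c + δ * z.2) z.1 * f (gammaEps Γ h (c + δ * z.2) z.1))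
        (planeEquiv q) := by
    rintro q ⟨-, h1⟩
    have h2 := abs_of_pos (T.jac_pos (c + δ * q 1) (q 0) (hA _ h1))
    rw [hdet, h2]
    simp [collarScaled, collar]
  rw [← image_collarScaled T hA]
  constructor
  · rw [integral_image_eq_integral_abs_det_fderiv_smul volume hRm
      (fun q _ => (hB q).hasFDerivWithinAt) hinj, setIntegral_congr_fun hRm hcongr]
    exact measurePreserving_planeEquiv.setIntegral_preimage_emb planeEquiv.measurableEmbedding
      (fun z : ℝ × ℝ => |δ| * jac Γ h (c + δ * z.2) z.1 * f (gammaEps Γ h (c + δ * z.2) z.1)) _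
  · rw [integrableOn_image_iff_integrableOn_abs_det_fderiv_smul volume hRm
      (fun q _ => (hB q).hasFDerivWithinAt) hinj, integrableOn_congr_fun hcongr hRm]
    exact measurePreserving_planeEquiv.integrableOn_comp_preimage planeEquiv.measurableEmbedding
      (f := fun z : ℝ × ℝ =>
        |δ| * jac Γ h (c + δ * z.2) z.1 * f (gammaEps Γ h (c + δ * z.2) z.1))

/-- The level curves of the tube are null sets. -/
lemma volume_level_eq_zero (hg : Geometry D D₁ Ω₃ Γ L h) (T : Tube D D₁ Ω₃ Γ L h a S)
    {c : ℝ} (hc : |c| < a) : volume {x | x ∈ D ∧ S x = c} = 0 := by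
  have h1 : {x | x ∈ D ∧ S x = c} = {x | x ∈ D ∧ ∃ t ∈ ({0} : Set ℝ), S x = c + 1 * t} := by
    ext x; simp
  rw [h1, ← image_collarScaled T (by simpa using hc)]
  choose B hB hdet using hasFDerivAt_collarScaled hg c 1
  refine addHaar_image_eq_zero_of_differentiableOn_of_addHaar_eq_zero volume
    (fun q _ => (hB q).differentiableAt.differentiableWithinAt) ?_
  rw [measurePreserving_planeEquiv.measure_preimage
    (measurableSet_Ico.prod (measurableSet_singleton 0)).nullMeasurableSet, Measure.volume_eq_prod,
    Measure.prod_prod]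
  simp

/-- The differential of the level function in the coordinates of the tube. -/
lemma jac_mul_fderiv_level (hg : Geometry D D₁ Ω₃ Γ L h) (T : Tube D D₁ Ω₃ Γ L h a S)
    {s ξ : ℝ} (hs : |s| < a) (v : Plane) :
    jac Γ h s ξ * fderiv ℝ S (gammaEps Γ h s ξ) v = inner ℝ v (coNormal Γ h s ξ) := by
  have hd : HasFDerivAt S (fderiv ℝ S (gammaEps Γ h s ξ)) (gammaEps Γ h s ξ) :=
    ((T.contDiffOn_level.contDiffAt (hg.isOpen_D.mem_nhds (T.mem_D s ξ hs))).differentiableAt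
      (by norm_num)).hasFDerivAt
  have h1 := hd.comp_hasDerivAt ξ (hasDerivAt_gammaEps hg.smooth_Γ hg.unit_speed hg.smooth_h s ξ)
  have h1' : HasDerivAt (S ∘ gammaEps Γ h s) 0 ξ :=
    (hasDerivAt_const ξ s).congr_of_eventuallyEq
      (Filter.Eventually.of_forall fun ζ => T.level_eq s ζ hs)
  have e1 := h1.unique h1'
  have h2 := hd.comp_hasDerivAt s (hasDerivAt_gammaEps_left (Γ := Γ) (h := h) s ξ)
  have h2' : HasDerivAt (S ∘ fun t => gammaEps Γ h t ξ) 1 s := by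
    refine (hasDerivAt_id s).congr_of_eventuallyEq ?_
    filter_upwards [continuous_abs.continuousAt.eventually (gt_mem_nhds hs)] with t ht
      using T.level_eq t ξ ht
  have e2 := h2.unique h2'
  -- expand `v` in the basis `(∂_ξ Γ_s, ∂_s Γ_s)`
  have ht := tangent_sq hg.unit_speed ξ
  have hv : jac Γ h s ξ • v = (h ξ * inner ℝ v (tangent Γ ξ)) • velocityEps Γ h s ξ
      + inner ℝ v (coNormal Γ h s ξ) • (-(h ξ • normal Γ ξ)) := by
    apply plane_ext <;> simp only [coNormal, velocityEps, normal, jac, PiLp.sub_apply,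
      PiLp.smul_apply, PiLp.neg_apply, PiLp.add_apply, smul_eq_mul, rot_apply_zero, rot_apply_one,
      inner_eq_coord]
    · linear_combination (-(v 0 * h ξ * (1 + s * h ξ * curv Γ ξ))) * ht
    · linear_combination (-(v 1 * h ξ * (1 + s * h ξ * curv Γ ξ))) * ht
  have := congrArg (fderiv ℝ S (gammaEps Γ h s ξ)) hv
  rw [map_smul, map_add, map_smul, map_smul, e1, e2] at this
  simpa using this

/-! ### The fluid domains in terms of the level function -/

lemma layer_eq (T : Tube D D₁ Ω₃ Γ L h a S) (hpos : ∀ ξ, 0 < h ξ) {ε : ℝ} (hε : ε < a) :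
    layer Γ h ε = {x | x ∈ D ∧ 0 < S x ∧ S x < ε} := by
  ext x
  constructor
  · rintro ⟨ξ, r, hr, hr', rfl⟩
    have hs : r / h ξ < ε := (div_lt_iff₀ (hpos ξ)).2 hr'
    have hs0 : 0 < r / h ξ := div_pos hr (hpos ξ)
    have he : Γ ξ - r • normal Γ ξ = gammaEps Γ h (r / h ξ) ξ := by
      rw [gammaEps, div_mul_cancel₀ _ (hpos ξ).ne']
    have := T.level_gammaEps_mem (ξ := ξ) (s := r / h ξ)
      (by rw [abs_of_pos hs0]; exact hs.trans hε)
    rw [he]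
    exact ⟨this.1, by rw [this.2]; exact ⟨hs0, hs⟩⟩
  · rintro ⟨hx, h0, h1⟩
    obtain ⟨ξ, -, he⟩ := T.exists_eq x hx (by rw [abs_of_pos h0]; exact h1.trans hε)
    exact ⟨ξ, S x * h ξ, mul_pos h0 (hpos ξ), by gcongr; exact hpos ξ, he⟩

lemma closure_layer_eq (hg : Geometry D D₁ Ω₃ Γ L h) (T : Tube D D₁ Ω₃ Γ L h a S) {ε : ℝ}
    (hε0 : 0 < ε) (hε : ε < a) :
    closure (layer Γ h ε) = {x | x ∈ D ∧ 0 ≤ S x ∧ S x ≤ ε} := by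
  have habs : ∀ s ∈ Icc 0 ε, |s| < a := fun s hs => by
    rw [abs_of_nonneg hs.1]; exact hs.2.trans_lt hε
  have e : {x | x ∈ D ∧ 0 ≤ S x ∧ S x ≤ ε} = {x | ∃ s ∈ Icc 0 ε, ∃ ξ, gammaEps Γ h s ξ = x} := by
    ext x
    constructor
    · rintro ⟨hx, h0, h1⟩
      obtain ⟨ξ, -, he⟩ := T.exists_eq x hx (habs _ ⟨h0, h1⟩)
      exact ⟨S x, ⟨h0, h1⟩, ξ, he.symm⟩
    · rintro ⟨s, hs, ξ, rfl⟩
      have := T.level_gammaEps_mem (ξ := ξ) (habs s hs)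
      exact ⟨this.1, by rw [this.2]; exact hs⟩
  apply Subset.antisymm
  · rw [e]
    refine closure_minimal ?_ (isCompact_image_gammaEps hg isCompact_Icc).isClosed
    rw [← e, layer_eq T hg.pos_h hε]
    exact fun x hx => ⟨hx.1, hx.2.1.le, hx.2.2.le⟩
  · rw [e]
    rintro _ ⟨s, hs, ξ, rfl⟩
    have hc : Continuous fun t => gammaEps Γ h t ξ :=
      (continuous_gammaEps hg.smooth_Γ hg.smooth_h).comp (f := fun t : ℝ => (t, ξ)) (by fun_prop)
    have : s ∈ closure (Ioo 0 ε) := by rw [closure_Ioo hε0.ne]; exact hs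
    refine map_mem_closure (f := fun t => gammaEps Γ h t ξ) hc this fun t ht => ?_
    rw [layer_eq T hg.pos_h hε]
    have := T.level_gammaEps_mem (ξ := ξ) (habs t ⟨ht.1.le, ht.2.le⟩)
    exact ⟨this.1, by rw [this.2]; exact ht⟩

lemma D₁_subset (hg : Geometry D D₁ Ω₃ Γ L h) : D₁ ⊆ D := fun x hx =>
  (show x ∈ D \ range Γ by rw [hg.decomposition]; exact Or.inl hx).1

lemma Ω₃_subset (hg : Geometry D D₁ Ω₃ Γ L h) : Ω₃ ⊆ D := fun x hx =>
  (show x ∈ D \ range Γ by rw [hg.decomposition]; exact Or.inr hx).1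

lemma D₁_eq (hg : Geometry D D₁ Ω₃ Γ L h) (T : Tube D D₁ Ω₃ Γ L h a S) :
    D₁ = {x | x ∈ D ∧ 0 < S x} := by
  ext x
  exact ⟨fun hx => ⟨D₁_subset hg hx, (T.mem_D₁_iff x (D₁_subset hg hx)).1 hx⟩,
    fun hx => (T.mem_D₁_iff x hx.1).2 hx.2⟩

lemma Ω₃_eq (hg : Geometry D D₁ Ω₃ Γ L h) (T : Tube D D₁ Ω₃ Γ L h a S) :
    Ω₃ = {x | x ∈ D ∧ S x < 0} := by
  ext x
  exact ⟨fun hx => ⟨Ω₃_subset hg hx, (T.mem_Ω₃_iff x (Ω₃_subset hg hx)).1 hx⟩,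
    fun hx => (T.mem_Ω₃_iff x hx.1).2 hx.2⟩

lemma omega1_eq (hg : Geometry D D₁ Ω₃ Γ L h) (T : Tube D D₁ Ω₃ Γ L h a S) {ε : ℝ}
    (hε0 : 0 < ε) (hε : ε < a) : omega1 D₁ Γ h ε = {x | x ∈ D ∧ ε < S x} := by
  rw [omega1, closure_layer_eq hg T hε0 hε, D₁_eq hg T]
  ext x
  simp only [Set.mem_sdiff, mem_ofPred_eq]
  constructor
  · rintro ⟨⟨hx, h0⟩, h1⟩
    exact ⟨hx, by by_contra! hc; exact h1 ⟨hx, h0.le, hc⟩⟩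
  · rintro ⟨hx, h0⟩
    exact ⟨⟨hx, hε0.trans h0⟩, fun hc => absurd hc.2.2 (not_le.2 h0)⟩

end Collar

/-! ### The divergence theorem with jumps across two level curves -/

/-- A smooth even function that vanishes on `[-1, 1]` and equals `1` off `(-3/2, 3/2)`. -/
def cutoff (t : ℝ) : ℝ := Real.smoothTransition (t ^ 2 - 1)

lemma contDiff_cutoff : ContDiff ℝ 1 cutoff :=
  (Real.smoothTransition.contDiff (n := 1)).comp (by fun_prop)

lemma cutoff_eq_zero {t : ℝ} (ht : |t| ≤ 1) : cutoff t = 0 := by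
  apply Real.smoothTransition.zero_of_nonpos
  have := (sq_le_one_iff_abs_le_one t).2 ht
  linarith

lemma cutoff_eq_one {t : ℝ} (ht : 3 / 2 ≤ |t|) : cutoff t = 1 := by
  apply Real.smoothTransition.one_of_one_le
  have h1 : (3 / 2 : ℝ) ^ 2 ≤ |t| ^ 2 := by gcongr
  rw [sq_abs] at h1
  linarith

lemma abs_cutoff_le (t : ℝ) : |cutoff t| ≤ 1 := by
  rw [cutoff, abs_of_nonneg (Real.smoothTransition.nonneg _)]
  exact Real.smoothTransition.le_one _

lemma continuous_deriv_cutoff : Continuous (deriv cutoff) :=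
  contDiff_cutoff.continuous_deriv (by norm_num)

lemma hasDerivAt_cutoff (t : ℝ) : HasDerivAt cutoff (deriv cutoff t) t :=
  (contDiff_cutoff.differentiable (by norm_num) t).hasDerivAt

lemma deriv_cutoff_eq_zero {t : ℝ} (ht : 2 ≤ |t|) : deriv cutoff t = 0 := by
  have : cutoff =ᶠ[𝓝 t] fun _ => 1 := by
    filter_upwards [continuous_abs.continuousAt.eventually
      (lt_mem_nhds (show (3 / 2 : ℝ) < |t| by linarith))] with s hs using cutoff_eq_one hs.le
  rw [this.deriv_eq]; simp

lemma integral_deriv_cutoff (x y : ℝ) : ∫ t in x..y, deriv cutoff t = cutoff y - cutoff x :=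
  intervalIntegral.integral_deriv_eq_sub (fun t _ => (hasDerivAt_cutoff t).differentiableAt)
    (continuous_deriv_cutoff.intervalIntegrable _ _)

lemma exists_bound_deriv_cutoff : ∃ M, 0 ≤ M ∧ ∀ t, |deriv cutoff t| ≤ M := by
  obtain ⟨M, hM⟩ := (isCompact_Icc (a := (-2 : ℝ)) (b := 2)).exists_bound_of_continuousOn
    continuous_deriv_cutoff.continuousOn
  have hM0 : 0 ≤ M := (norm_nonneg _).trans (hM 0 (by constructor <;> norm_num))
  refine ⟨M, hM0, fun t => ?_⟩
  by_cases ht : |t| ≤ 2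
  · exact hM t (abs_le.1 ht)
  · rw [deriv_cutoff_eq_zero (not_le.1 ht).le]; simpa

/-- The integral over the plane of the divergence of a compactly supported field vanishes. -/
lemma integral_divergence_eq_zero {W : Plane → Plane} (hW : ContDiff ℝ 1 W)
    (hc : HasCompactSupport W) : ∫ x, divergence W x = 0 := by
  have hd : Continuous (fderiv ℝ W) := hW.continuous_fderiv (by norm_num)
  have h1 : ∀ i : Fin 2, Integrable (fun x => fderiv ℝ W x (basisVec i) i) := fun i => by
    refine Continuous.integrable_of_hasCompactSupport (by fun_prop) ?_
    exact (hc.fderiv ℝ).comp_left (g := fun A : Mat => A (basisVec i) i) (by simp)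
  have h0 : ∀ i : Fin 2, ∫ x, fderiv ℝ W x (basisVec i) i = 0 := fun i => by
    have hWi : ContDiff ℝ 1 (fun x => W x i) :=
      (EuclideanSpace.proj i : Plane →L[ℝ] ℝ).contDiff.comp hW
    have e : ∀ x, fderiv ℝ (fun x => W x i) x (basisVec i) = fderiv ℝ W x (basisVec i) i := by
      intro x
      have : HasFDerivAt (fun y => W y i) ((EuclideanSpace.proj i : Plane →L[ℝ] ℝ).comp
          (fderiv ℝ W x)) x := (EuclideanSpace.proj i : Plane →L[ℝ] ℝ).hasFDerivAt.comp x
        (hW.differentiable (by norm_num) x).hasFDerivAt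
      rw [this.fderiv]; rfl
    have hWint : Integrable (fun x => W x i) :=
      hWi.continuous.integrable_of_hasCompactSupport
        (hc.comp_left (g := fun v : Plane => v i) (by simp))
    have := integral_mul_fderiv_eq_neg_fderiv_mul_of_integrable (μ := volume)
      (f := fun _ : Plane => (1 : ℝ)) (g := fun x => W x i) (v := basisVec i)
      (by simp) (by simpa only [one_mul, e] using h1 i) (by simpa using hWint)
      (fun x _ => differentiableAt_const _) (fun x _ => hWi.differentiable (by norm_num) x)
    simpa [e] using this
  simp only [divergence]
  rw [integral_finsetSum _ (fun i _ => h1 i)]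
  simp [h0]

section Collar

variable {D D₁ Ω₃ : Set Plane} {Γ : ℝ → Plane} {L : ℝ} {h : ℝ → ℝ} {a : ℝ} {S : Plane → ℝ}

lemma isOpen_level (hg : Geometry D D₁ Ω₃ Γ L h) (T : Tube D D₁ Ω₃ Γ L h a S)
    {B : Set ℝ} (hB : IsOpen B) : IsOpen {x | x ∈ D ∧ S x ∈ B} :=
  T.contDiffOn_level.continuousOn.isOpen_inter_preimage hg.isOpen_D hB

lemma volume_D_lt_top (hg : Geometry D D₁ Ω₃ Γ L h) : volume D < ⊤ := hg.bounded_D.measure_lt_top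

lemma continuous_collar_arg (hg : Geometry D D₁ Ω₃ Γ L h) (c δ : ℝ) :
    Continuous fun z : ℝ × ℝ => gammaEps Γ h (c + δ * z.2) z.1 :=
  (continuous_gammaEps hg.smooth_Γ hg.smooth_h).comp
    (f := fun z : ℝ × ℝ => (c + δ * z.2, z.1)) (by fun_prop)

lemma aestronglyMeasurable_comp_collar (hg : Geometry D D₁ Ω₃ Γ L h)
    (T : Tube D D₁ Ω₃ Γ L h a S) {c δ : ℝ} (hδ : δ ≠ 0) {A : Set ℝ} (hAm : MeasurableSet A)
    (hA : ∀ t ∈ A, |c + δ * t| < a) {f : Plane → ℝ}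
    (hf : IntegrableOn f {x | x ∈ D ∧ ∃ t ∈ A, S x = c + δ * t}) :
    AEStronglyMeasurable (fun z : ℝ × ℝ => f (gammaEps Γ h (c + δ * z.2) z.1))
      (volume.restrict (Ico 0 L ×ˢ A)) := by
  have h1 := ((collar_change_of_variables hg T hδ hAm hA f).2.1 hf).aestronglyMeasurable
  have hj : Continuous fun z : ℝ × ℝ => |δ| * jac Γ h (c + δ * z.2) z.1 :=
    continuous_const.mul ((continuous_jac hg.smooth_Γ hg.smooth_h).comp
      (f := fun z : ℝ × ℝ => (c + δ * z.2, z.1)) (by fun_prop))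
  have h2 : AEStronglyMeasurable (fun z : ℝ × ℝ => (|δ| * jac Γ h (c + δ * z.2) z.1)⁻¹)
      (volume.restrict (Ico 0 L ×ˢ A)) := hj.measurable.inv.aestronglyMeasurable
  refine (h2.mul h1).congr ?_
  filter_upwards [ae_restrict_mem (measurableSet_Ico.prod hAm)] with z hz
  have := (T.jac_pos (c + δ * z.2) z.1 (hA _ hz.2)).ne'
  have hδ' := abs_ne_zero.2 hδ
  simp only [Pi.mul_apply]
  field_simp

lemma integrableOn_of_bounded {U : Set Plane} (hU : Bornology.IsBounded U) (hUm : MeasurableSet U)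
    {F : Type*} [NormedAddCommGroup F] {f : Plane → F}
    (hf : AEStronglyMeasurable f (volume.restrict U)) {C : ℝ} (hC : ∀ x ∈ U, ‖f x‖ ≤ C) :
    IntegrableOn f U :=
  Integrable.mono' (integrableOn_const hU.measure_lt_top.ne) hf
    ((ae_restrict_iff' hUm).2 (Filter.Eventually.of_forall hC))

lemma exists_bound_coNormal (hg : Geometry D D₁ Ω₃ Γ L h) (b : ℝ) :
    ∃ N, 0 ≤ N ∧ ∀ s ∈ Icc (-b) b, ∀ ξ ∈ Icc 0 L, ‖coNormal Γ h s ξ‖ ≤ N := by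
  obtain ⟨N, hN⟩ := ((isCompact_Icc (a := -b) (b := b)).prod
    (isCompact_Icc (a := (0 : ℝ)) (b := L))).exists_bound_of_continuousOn
    (continuous_coNormal hg.smooth_Γ hg.smooth_h).continuousOn
  exact ⟨max N 0, le_max_right _ _, fun s hs ξ hξ =>
    (hN (s, ξ) ⟨hs, hξ⟩).trans (le_max_left _ _)⟩

/-- If a cutoff function of the level is steepened near the level `c`, its gradient tends to the
surface measure on the level curve, in the sense that integration against it yields the jump of
the normal component. -/
lemma tendsto_integral_deriv_cutoff (hg : Geometry D D₁ Ω₃ Γ L h) (T : Tube D D₁ Ω₃ Γ L h a S)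
    {c : ℝ} (hc : |c| < a) {F : Plane → Plane} (hF : AEStronglyMeasurable F (volume.restrict D))
    {C : ℝ} (hC : ∀ x ∈ D, ‖F x‖ ≤ C) {Gp Gm : ℝ → Plane}
    (hp : ∀ ξ, Tendsto (fun s => F (gammaEps Γ h s ξ)) (𝓝[>] c) (𝓝 (Gp ξ)))
    (hm : ∀ ξ, Tendsto (fun s => F (gammaEps Γ h s ξ)) (𝓝[<] c) (𝓝 (Gm ξ))) :
    Tendsto (fun δ : ℝ => ∫ x in D, δ⁻¹ * deriv cutoff ((S x - c) / δ) * fderiv ℝ S x (F x))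
      (𝓝[>] 0) (𝓝 (∫ ξ in (0 : ℝ)..L, inner ℝ (Gp ξ - Gm ξ) (coNormal Γ h c ξ))) := by
  set A : Set ℝ := Ioo (-2) 2 with hAdef
  have hAm : MeasurableSet A := measurableSet_Ioo
  have hδ0 : 0 < (a - |c|) / 2 := by linarith
  have hA : ∀ δ ∈ Ioo 0 ((a - |c|) / 2), ∀ t ∈ A, |c + δ * t| < a := by
    intro δ hδ t ht
    have h1 : |δ * t| ≤ δ * 2 := by
      rw [abs_mul, abs_of_pos hδ.1]
      exact mul_le_mul_of_nonneg_left (abs_lt.2 ht).le hδ.1.le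
    have := abs_add_le c (δ * t)
    linarith [hδ.2]
  obtain ⟨M, hM0, hM⟩ := exists_bound_deriv_cutoff
  obtain ⟨N, hN0, hN⟩ := exists_bound_coNormal hg a
  have hDm := hg.isOpen_D.measurableSet
  have hcn := continuous_coNormal hg.smooth_Γ hg.smooth_h
  have hC0 : 0 ≤ C := (norm_nonneg _).trans (hC _ (T.mem_D c 0 hc))
  set Φ : ℝ → ℝ × ℝ → ℝ := fun δ z => deriv cutoff z.2 *
    inner ℝ (F (gammaEps Γ h (c + δ * z.2) z.1)) (coNormal Γ h (c + δ * z.2) z.1) with hΦ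
  set Φ₀ : ℝ × ℝ → ℝ := fun z => deriv cutoff z.2 *
    inner ℝ (if 0 < z.2 then Gp z.1 else Gm z.1) (coNormal Γ h c z.1) with hΦ₀
  -- the integral in the rescaled coordinates
  have hcv : ∀ δ ∈ Ioo 0 ((a - |c|) / 2),
      ∫ x in D, δ⁻¹ * deriv cutoff ((S x - c) / δ) * fderiv ℝ S x (F x)
        = ∫ z in Ico 0 L ×ˢ A, Φ δ z := by
    intro δ hδ
    have hδ' := hδ.1.ne'
    rw [setIntegral_eq_of_subset_of_forall_sdiff_eq_zero hDm
      (s := {x | x ∈ D ∧ ∃ t ∈ A, S x = c + δ * t}) (fun x hx => hx.1)]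
    · rw [(collar_change_of_variables hg T hδ' hAm (hA δ hδ) _).1]
      refine setIntegral_congr_fun (measurableSet_Ico.prod hAm) fun z hz => ?_
      have hz2 := hA δ hδ z.2 hz.2
      simp only [hΦ]
      rw [T.level_eq _ _ hz2, ← jac_mul_fderiv_level hg T hz2, abs_of_pos hδ.1,
        show (c + δ * z.2 - c) / δ = z.2 by field_simp; ring]
      field_simp
    · rintro x ⟨hx, hn⟩
      have : 2 ≤ |(S x - c) / δ| := by
        by_contra! hlt
        exact hn ⟨hx, (S x - c) / δ, abs_lt.1 hlt, by field_simp; ring⟩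
      rw [deriv_cutoff_eq_zero this]; simp
  have hmeas : ∀ δ ∈ Ioo 0 ((a - |c|) / 2),
      AEStronglyMeasurable (Φ δ) (volume.restrict (Ico 0 L ×ˢ A)) := by
    intro δ hδ
    have hi : ∀ i : Fin 2, AEStronglyMeasurable
        (fun z : ℝ × ℝ => F (gammaEps Γ h (c + δ * z.2) z.1) i)
        (volume.restrict (Ico 0 L ×ˢ A)) := fun i => by
      refine aestronglyMeasurable_comp_collar hg T hδ.1.ne' hAm (hA δ hδ) (f := fun x => F x i) ?_
      refine IntegrableOn.mono_set ?_ (t := D) (fun x hx => hx.1)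
      exact integrableOn_of_bounded hg.bounded_D hDm
        ((EuclideanSpace.proj i : Plane →L[ℝ] ℝ).continuous.comp_aestronglyMeasurable hF)
        (fun x hx => (PiLp.norm_apply_le (F x) i).trans (hC x hx))
    have hcc : Continuous fun z : ℝ × ℝ => coNormal Γ h (c + δ * z.2) z.1 :=
      hcn.comp (f := fun z : ℝ × ℝ => (c + δ * z.2, z.1)) (by fun_prop)
    have hci : ∀ i : Fin 2, Continuous fun z : ℝ × ℝ => coNormal Γ h (c + δ * z.2) z.1 i :=
      fun i => (EuclideanSpace.proj i : Plane →L[ℝ] ℝ).continuous.comp hcc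
    simp only [hΦ, inner_eq_coord]
    exact (continuous_deriv_cutoff.comp continuous_snd).aestronglyMeasurable.mul
      (((hi 0).mul (hci 0).aestronglyMeasurable).add ((hi 1).mul (hci 1).aestronglyMeasurable))
  have hbound : ∀ δ ∈ Ioo 0 ((a - |c|) / 2), ∀ᵐ z ∂(volume.restrict (Ico 0 L ×ˢ A)),
      ‖Φ δ z‖ ≤ M * (C * N) := by
    intro δ hδ
    filter_upwards [ae_restrict_mem (measurableSet_Ico.prod hAm)] with z hz
    have hz2 := hA δ hδ z.2 hz.2
    rw [hΦ, norm_mul]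
    refine mul_le_mul (hM _) ((norm_inner_le_norm _ _).trans ?_) (norm_nonneg _) hM0
    exact mul_le_mul (hC _ (T.mem_D _ _ hz2))
      (hN _ (abs_le.1 hz2.le) _ ⟨hz.1.1, hz.1.2.le⟩) (norm_nonneg _) hC0
  have hfin : volume (Ico (0 : ℝ) L ×ˢ A) ≠ ⊤ := by
    rw [Measure.volume_eq_prod, Measure.prod_prod]
    simp [hAdef, ENNReal.mul_eq_top]
  have hne : ∀ᵐ z : ℝ × ℝ ∂(volume.restrict (Ico 0 L ×ˢ A)), z.2 ≠ 0 := by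
    refine ae_restrict_of_ae ?_
    have : volume ((univ : Set ℝ) ×ˢ ({0} : Set ℝ)) = 0 := by
      rw [Measure.volume_eq_prod, Measure.prod_prod]; simp
    refine measure_mono_null ?_ this
    intro z hz
    simpa using hz
  have hlim : ∀ᵐ z ∂(volume.restrict (Ico 0 L ×ˢ A)),
      Tendsto (fun δ => Φ δ z) (𝓝[>] 0) (𝓝 (Φ₀ z)) := by
    filter_upwards [hne] with z hz
    have hcont : Tendsto (fun δ : ℝ => c + δ * z.2) (𝓝[>] 0) (𝓝 c) :=
      ((by fun_prop : Continuous fun δ : ℝ => c + δ * z.2).tendsto' 0 c (by simp)).mono_left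
        nhdsWithin_le_nhds
    refine Tendsto.const_mul _ (Tendsto.inner ?_ ?_)
    · by_cases h0 : 0 < z.2
      · rw [if_pos h0]
        refine (hp z.1).comp (tendsto_nhdsWithin_iff.2 ⟨hcont, ?_⟩)
        filter_upwards [self_mem_nhdsWithin] with δ hδ
        exact lt_add_of_pos_right c (mul_pos hδ h0)
      · rw [if_neg h0]
        have h0' : z.2 < 0 := lt_of_le_of_ne (not_lt.1 h0) hz
        refine (hm z.1).comp (tendsto_nhdsWithin_iff.2 ⟨hcont, ?_⟩)
        filter_upwards [self_mem_nhdsWithin] with δ hδ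
        exact add_lt_of_neg_right c (mul_neg_of_pos_of_neg hδ h0')
    · exact ((hcn.comp (f := fun s : ℝ => (s, z.1)) (by fun_prop)).tendsto c).comp hcont
  have hI : ∀ᶠ δ : ℝ in 𝓝[>] 0, δ ∈ Ioo 0 ((a - |c|) / 2) := Ioo_mem_nhdsGT hδ0
  have hDCT : Tendsto (fun δ => ∫ z in Ico 0 L ×ˢ A, Φ δ z) (𝓝[>] 0)
      (𝓝 (∫ z in Ico 0 L ×ˢ A, Φ₀ z)) :=
    tendsto_integral_filter_of_dominated_convergence (fun _ => M * (C * N))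
      (hI.mono hmeas) (hI.mono hbound) (integrableOn_const hfin) hlim
  -- the limit by Fubini
  have hΦ₀i : IntegrableOn Φ₀ (Ico 0 L ×ˢ A) := by
    have hseq : Tendsto (fun n : ℕ => (a - |c|) / 2 * (1 / ((n : ℝ) + 1 + 1))) atTop (𝓝[>] 0) := by
      refine tendsto_nhdsWithin_iff.2 ⟨?_, Filter.Eventually.of_forall fun n => ?_⟩
      · have h1 := (tendsto_one_div_add_atTop_nhds_zero_nat (𝕜 := ℝ)).comp (tendsto_add_atTop_nat 1)
        have h2 := h1.const_mul ((a - |c|) / 2)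
        rw [mul_zero] at h2
        refine h2.congr fun n => ?_
        simp
      · simp only [mem_Ioi]; positivity
    have hn : ∀ n : ℕ, (a - |c|) / 2 * (1 / ((n : ℝ) + 1 + 1)) ∈ Ioo 0 ((a - |c|) / 2) :=
        fun n => by
      refine ⟨by positivity, mul_lt_of_lt_one_right hδ0 ?_⟩
      rw [div_lt_one (by positivity)]
      have : (0 : ℝ) ≤ n := n.cast_nonneg
      linarith
    have hms : AEStronglyMeasurable Φ₀ (volume.restrict (Ico 0 L ×ˢ A)) :=
      aestronglyMeasurable_of_tendsto_ae atTop (fun n => hmeas _ (hn n))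
        (hlim.mono fun z hz => hz.comp hseq)
    refine Integrable.mono' (integrableOn_const (C := M * (C * N)) hfin) hms ?_
    have hb : ∀ᵐ z ∂(volume.restrict (Ico 0 L ×ˢ A)), ∀ n : ℕ,
        ‖Φ ((a - |c|) / 2 * (1 / ((n : ℝ) + 1 + 1))) z‖ ≤ M * (C * N) :=
      ae_all_iff.2 fun n => hbound _ (hn n)
    filter_upwards [hlim, hb] with z hz hbz
    exact le_of_tendsto (hz.comp hseq).norm (Filter.Eventually.of_forall hbz)
  have hval : ∫ z in Ico 0 L ×ˢ A, Φ₀ z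
      = ∫ ξ in (0 : ℝ)..L, inner ℝ (Gp ξ - Gm ξ) (coNormal Γ h c ξ) := by
    rw [Measure.volume_eq_prod, setIntegral_prod _ hΦ₀i,
      intervalIntegral.integral_of_le hg.period_pos.le, ← integral_Ico_eq_integral_Ioc]
    refine setIntegral_congr_fun measurableSet_Ico fun ξ _ => ?_
    simp only [hΦ₀]
    rw [← integral_Ioc_eq_integral_Ioo,
      ← intervalIntegral.integral_of_le (by norm_num : (-2 : ℝ) ≤ 2)]
    have hneg : ∀ t ∈ uIoc (-2 : ℝ) 0, deriv cutoff t *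
        inner ℝ (if 0 < t then Gp ξ else Gm ξ) (coNormal Γ h c ξ)
        = deriv cutoff t * inner ℝ (Gm ξ) (coNormal Γ h c ξ) := by
      intro t ht
      rw [uIoc_of_le (by norm_num)] at ht
      rw [if_neg (not_lt.2 ht.2)]
    have hpos : ∀ t ∈ uIoc (0 : ℝ) 2, deriv cutoff t *
        inner ℝ (if 0 < t then Gp ξ else Gm ξ) (coNormal Γ h c ξ)
        = deriv cutoff t * inner ℝ (Gp ξ) (coNormal Γ h c ξ) := by
      intro t ht
      rw [uIoc_of_le (by norm_num)] at ht
      rw [if_pos ht.1]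
    have i1 : ∀ x y v : ℝ, IntervalIntegrable (fun t => deriv cutoff t * v) volume x y :=
      fun x y v => (continuous_deriv_cutoff.mul continuous_const).intervalIntegrable _ _
    rw [← intervalIntegral.integral_add_adjacent_intervals (b := 0)
      ((i1 _ _ _).congr fun t ht => (hneg t ht).symm)
      ((i1 _ _ _).congr fun t ht => (hpos t ht).symm),
      intervalIntegral.integral_congr_ae (Filter.Eventually.of_forall hneg),
      intervalIntegral.integral_congr_ae (Filter.Eventually.of_forall hpos),
      intervalIntegral.integral_mul_const, intervalIntegral.integral_mul_const,
      integral_deriv_cutoff, integral_deriv_cutoff, cutoff_eq_zero (t := 0) (by simp),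
      cutoff_eq_one (t := 2) (by norm_num), cutoff_eq_one (t := -2) (by norm_num),
      inner_sub_left]
    ring
  rw [← hval]
  refine hDCT.congr' ?_
  filter_upwards [hI] with δ hδ using (hcv δ hδ).symm

end Collar

section Collar

variable {D D₁ Ω₃ : Set Plane} {Γ : ℝ → Plane} {L : ℝ} {h : ℝ → ℝ} {a : ℝ} {S : Plane → ℝ}

lemma ae_level_ne (hg : Geometry D D₁ Ω₃ Γ L h) (T : Tube D D₁ Ω₃ Γ L h a S)
    {c : ℝ} (hc : |c| < a) : ∀ᵐ x ∂(volume.restrict D), S x ≠ c := by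
  rw [ae_restrict_iff' hg.isOpen_D.measurableSet]
  refine measure_mono_null ?_ (volume_level_eq_zero hg T hc)
  intro x hx
  simpa using hx

/-- A function that is continuous off two level curves is measurable. -/
lemma aestronglyMeasurable_of_continuousOn_levels (hg : Geometry D D₁ Ω₃ Γ L h)
    (T : Tube D D₁ Ω₃ Γ L h a S) {ε : ℝ} (hε : |ε| < a) {F : Type*} [NormedAddCommGroup F]
    {f : Plane → F} (hf : ContinuousOn f {x | x ∈ D ∧ S x ≠ 0 ∧ S x ≠ ε}) :
    AEStronglyMeasurable f (volume.restrict D) := by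
  have hO : IsOpen {x | x ∈ D ∧ S x ≠ 0 ∧ S x ≠ ε} := by
    have := isOpen_level hg T (B := {0, ε}ᶜ) (by simp)
    convert this using 3
    simp [not_or]
  have h1 := hf.aestronglyMeasurable (μ := volume) hO.measurableSet
  have h2 : volume.restrict {x | x ∈ D ∧ S x ≠ 0 ∧ S x ≠ ε} = volume.restrict D := by
    have h0 : |(0 : ℝ)| < a := by simpa using T.pos
    have e : {x | x ∈ D ∧ S x ≠ 0 ∧ S x ≠ ε} = D ∩ {x | S x ≠ 0 ∧ S x ≠ ε} := rfl
    refine Measure.restrict_congr_set ?_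
    have := (ae_level_ne hg T h0).and (ae_level_ne hg T hε)
    rw [ae_restrict_iff' hg.isOpen_D.measurableSet] at this
    filter_upwards [this] with x hx
    exact propext ⟨fun hx' => hx'.1, fun hx' => ⟨hx', hx hx'⟩⟩
  rwa [h2] at h1

/-- The divergence theorem in `D` for a compactly supported field which is `C¹` off `Γ` and `Γ_ε`
and has one-sided limits there: the jumps of the normal component appear as surface terms. -/
theorem divergence_theorem_jump (hg : Geometry D D₁ Ω₃ Γ L h) (T : Tube D D₁ Ω₃ Γ L h a S)
    {ε : ℝ} (hε0 : 0 < ε) (hε : ε < a) {F : Plane → Plane}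
    (hF : ContDiffOn ℝ 1 F {x | x ∈ D ∧ S x ≠ 0 ∧ S x ≠ ε}) {K : Set Plane} (hK : IsCompact K)
    (hKD : K ⊆ D) (hFK : ∀ x ∉ K, F x = 0) {C : ℝ} (hC : ∀ x ∈ D, ‖F x‖ ≤ C)
    (hdiv : IntegrableOn (divergence F) D) {Gp Gm Ep Em : ℝ → Plane}
    (hGp : ∀ ξ, Tendsto (fun s => F (gammaEps Γ h s ξ)) (𝓝[>] 0) (𝓝 (Gp ξ)))
    (hGm : ∀ ξ, Tendsto (fun s => F (gammaEps Γ h s ξ)) (𝓝[<] 0) (𝓝 (Gm ξ)))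
    (hEp : ∀ ξ, Tendsto (fun s => F (gammaEps Γ h s ξ)) (𝓝[>] ε) (𝓝 (Ep ξ)))
    (hEm : ∀ ξ, Tendsto (fun s => F (gammaEps Γ h s ξ)) (𝓝[<] ε) (𝓝 (Em ξ))) :
    ∫ x in D, divergence F x =
      -(∫ ξ in (0 : ℝ)..L, inner ℝ (Gp ξ - Gm ξ) (coNormal Γ h 0 ξ))
      - ∫ ξ in (0 : ℝ)..L, inner ℝ (Ep ξ - Em ξ) (coNormal Γ h ε ξ) := by
  have h0a : |(0 : ℝ)| < a := by simpa using T.pos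
  have hεa : |ε| < a := by rwa [abs_of_pos hε0]
  have hDm := hg.isOpen_D.measurableSet
  have hFm := aestronglyMeasurable_of_continuousOn_levels hg T hεa hF.continuousOn
  have hO : IsOpen {x | x ∈ D ∧ S x ≠ 0 ∧ S x ≠ ε} := by
    have := isOpen_level hg T (B := {0, ε}ᶜ) (by simp)
    convert this using 3
    simp [not_or]
  -- For `δ < ε / 4` the factor `ω δ` vanishes near both curves, since one of the two cutoffs is `0`
  -- and the other one is `1` there; it tends to `1` off the curves as `δ → 0`.
  set ω : ℝ → Plane → ℝ := fun δ x => cutoff ((S x - 0) / δ) + cutoff ((S x - ε) / δ) - 1 with hω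
  have hωC : ∀ δ, ContDiffOn ℝ 1 (ω δ) D := fun δ =>
    ((contDiff_cutoff.comp_contDiffOn ((T.contDiffOn_level.sub contDiffOn_const).div_const δ)).add
    (contDiff_cutoff.comp_contDiffOn ((T.contDiffOn_level.sub contDiffOn_const).div_const δ))).sub
    contDiffOn_const
  have hωd : ∀ δ, ∀ x ∈ D, HasFDerivAt (ω δ)
      ((δ⁻¹ * deriv cutoff ((S x - 0) / δ) + δ⁻¹ * deriv cutoff ((S x - ε) / δ)) • fderiv ℝ S x)
      x := by
    intro δ x hx
    have hS : HasFDerivAt S (fderiv ℝ S x) x :=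
      ((T.contDiffOn_level.contDiffAt (hg.isOpen_D.mem_nhds hx)).differentiableAt
        (by norm_num)).hasFDerivAt
    have h1 : ∀ c : ℝ, HasFDerivAt (fun y => cutoff ((S y - c) / δ))
        ((δ⁻¹ * deriv cutoff ((S x - c) / δ)) • fderiv ℝ S x) x := fun c => by
      have h2 : HasFDerivAt (fun y => (S y - c) / δ) (δ⁻¹ • fderiv ℝ S x) x := by
        simpa [div_eq_inv_mul] using (hS.sub_const c).const_mul δ⁻¹
      refine ((hasDerivAt_cutoff _).comp_hasFDerivAt x h2).congr_fderiv ?_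
      rw [smul_smul, mul_comm]
    refine (((h1 0).add (h1 ε)).sub_const 1).congr_fderiv ?_
    rw [add_smul]
  -- the field cut off near the two curves is `C¹` in the plane
  have hW : ∀ δ ∈ Ioo 0 (ε / 4), ContDiff ℝ 1 (fun x => ω δ x • F x) := by
    intro δ hδ
    rw [contDiff_iff_contDiffAt]
    intro x
    by_cases hx : x ∈ D
    · have hxD := hg.isOpen_D.mem_nhds hx
      have hSc : ContinuousAt S x := T.contDiffOn_level.continuousOn.continuousAt hxD
      have hnear : ∀ c c' : ℝ, S x = c → |c - c'| = ε →
          ∀ᶠ y in 𝓝 x, cutoff ((S y - c) / δ) = 0 ∧ cutoff ((S y - c') / δ) = 1 := by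
        intro c c' hc hcc
        have h1 : ∀ᶠ y in 𝓝 x, |S y - c| < δ := by
          have : ContinuousAt (fun y => |S y - c|) x := (hSc.sub continuousAt_const).abs
          exact this.eventually (gt_mem_nhds (by simpa [hc] using hδ.1))
        filter_upwards [h1] with y hy
        constructor
        · apply cutoff_eq_zero
          rw [abs_div, abs_of_pos hδ.1, div_le_one hδ.1]; exact hy.le
        · apply cutoff_eq_one
          rw [abs_div, abs_of_pos hδ.1, le_div_iff₀ hδ.1]
          have := abs_sub_abs_le_abs_sub (c - c') (c - S y)
          rw [show c - c' - (c - S y) = S y - c' by ring, abs_sub_comm c (S y), hcc] at this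
          linarith [hδ.2]
      by_cases h0 : S x = 0
      · have : (fun x => ω δ x • F x) =ᶠ[𝓝 x] fun _ => 0 := by
          filter_upwards [hnear 0 ε h0 (by simp [abs_of_pos hε0])] with y hy
          simp only [hω]; rw [hy.1, hy.2]; simp
        exact contDiffAt_const.congr_of_eventuallyEq this
      by_cases h1 : S x = ε
      · have : (fun x => ω δ x • F x) =ᶠ[𝓝 x] fun _ => 0 := by
          filter_upwards [hnear ε 0 h1 (by simp [abs_of_pos hε0])] with y hy
          simp only [hω]; rw [hy.1, hy.2]; simp
        exact contDiffAt_const.congr_of_eventuallyEq this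
      exact ((hωC δ).contDiffAt hxD).smul (hF.contDiffAt (hO.mem_nhds ⟨hx, h0, h1⟩))
    · have : (fun x => ω δ x • F x) =ᶠ[𝓝 x] fun _ => 0 := by
        filter_upwards [hK.isClosed.isOpen_compl.mem_nhds (fun hxK => hx (hKD hxK))] with y hy
        rw [hFK y hy, smul_zero]
      exact contDiffAt_const.congr_of_eventuallyEq this
  have hWc : ∀ δ, HasCompactSupport (fun x => ω δ x • F x) := fun δ =>
    HasCompactSupport.intro hK fun x hx => by rw [hFK x hx, smul_zero]
  have hωb : ∀ δ x, |ω δ x| ≤ 3 := fun δ x => by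
    have h1 := abs_le.1 (abs_cutoff_le ((S x - 0) / δ))
    have h2 := abs_le.1 (abs_cutoff_le ((S x - ε) / δ))
    simp only [hω]
    rw [abs_le]; constructor <;> linarith
  have hne : ∀ᵐ x ∂(volume.restrict D), x ∈ D ∧ S x ≠ 0 ∧ S x ≠ ε := by
    filter_upwards [ae_restrict_mem hDm, ae_level_ne hg T h0a, ae_level_ne hg T hεa]
      with x h1 h2 h3 using ⟨h1, h2, h3⟩
  have hfS : AEStronglyMeasurable (fun x => fderiv ℝ S x) (volume.restrict D) :=
    ((T.contDiffOn_level.continuousOn_fderiv_of_isOpen hg.isOpen_D (by norm_num))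
      ).aestronglyMeasurable hDm
  -- the identity for the cut off field
  have hId : ∀ δ ∈ Ioo 0 (ε / 4), ∫ x in D, ω δ x * divergence F x =
      -(∫ x in D, δ⁻¹ * deriv cutoff ((S x - 0) / δ) * fderiv ℝ S x (F x))
      - ∫ x in D, δ⁻¹ * deriv cutoff ((S x - ε) / δ) * fderiv ℝ S x (F x) := by
    intro δ hδ
    have h1 := integral_divergence_eq_zero (hW δ hδ) (hWc δ)
    have hsub : ∀ x ∉ D, divergence (fun x => ω δ x • F x) x = 0 := by
      intro x hx
      have : (fun x => ω δ x • F x) =ᶠ[𝓝 x] fun _ => 0 := by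
        filter_upwards [hK.isClosed.isOpen_compl.mem_nhds (fun hxK => hx (hKD hxK))] with y hy
        rw [hFK y hy, smul_zero]
      simp [divergence, this.fderiv_eq]
    rw [← setIntegral_eq_integral_of_forall_compl_eq_zero hsub] at h1
    have hd : ∀ᵐ x ∂(volume.restrict D), divergence (fun x => ω δ x • F x) x =
        ω δ x * divergence F x + (δ⁻¹ * deriv cutoff ((S x - 0) / δ) * fderiv ℝ S x (F x)
          + δ⁻¹ * deriv cutoff ((S x - ε) / δ) * fderiv ℝ S x (F x)) := by
      filter_upwards [hne] with x hx
      have hFd : HasFDerivAt F (fderiv ℝ F x) x :=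
        ((hF.contDiffAt (hO.mem_nhds hx)).differentiableAt (by norm_num)).hasFDerivAt
      have := ((hωd δ x hx.1).smul hFd).fderiv
      rw [divergence_eq_tr, show fderiv ℝ (fun x => ω δ x • F x) x = _ from this, divergence_eq_tr,
        map_eq_coord (fderiv ℝ S x) (F x)]
      simp [tr]
      ring
    rw [integral_congr_ae hd] at h1
    have hc1 : ∀ c : ℝ, IntegrableOn
        (fun x => δ⁻¹ * deriv cutoff ((S x - c) / δ) * fderiv ℝ S x (F x)) D := by
      intro c
      -- the integrand is supported in the compact set `K`, on which `∇S` is bounded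
      obtain ⟨M, hM0, hM⟩ := exists_bound_deriv_cutoff
      obtain ⟨N, hN⟩ := hK.exists_bound_of_continuousOn
        ((T.contDiffOn_level.continuousOn_fderiv_of_isOpen hg.isOpen_D (by norm_num)).mono hKD)
      have hSm : AEStronglyMeasurable S (volume.restrict D) :=
        T.contDiffOn_level.continuousOn.aestronglyMeasurable hDm
      refine integrableOn_of_bounded hg.bounded_D hDm (C := δ⁻¹ * M * (max N 0 * C)) ?_ ?_
      · refine AEStronglyMeasurable.mul ?_ ?_
        · refine AEStronglyMeasurable.const_mul ?_ _
          exact (continuous_deriv_cutoff.comp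
            (by fun_prop : Continuous fun s : ℝ => (s - c) / δ)).comp_aestronglyMeasurable hSm
        · exact (isBoundedBilinearMap_apply.continuous.comp_aestronglyMeasurable
            (hfS.prodMk hFm))
      · intro x hx
        have hδ' := inv_pos.2 hδ.1
        by_cases hxK : x ∈ K
        · rw [norm_mul, norm_mul, Real.norm_of_nonneg hδ'.le]
          gcongr
          · exact hM _
          · refine (ContinuousLinearMap.le_opNorm _ _).trans ?_
            exact mul_le_mul ((hN x hxK).trans (le_max_left _ _)) (hC x hx) (norm_nonneg _)
              (le_max_right _ _)
        · have hC0 : 0 ≤ C := (norm_nonneg _).trans (hC x hx)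
          rw [hFK x hxK]; simp only [map_zero, mul_zero, norm_zero]; positivity
    have hωi : IntegrableOn (fun x => ω δ x * divergence F x) D := by
      refine Integrable.bdd_mul (c := 3) hdiv
        ((hωC δ).continuousOn.aestronglyMeasurable hDm)
        (Filter.Eventually.of_forall fun x => hωb δ x)
    have h2 := integral_add hωi ((hc1 0).add (hc1 ε))
    have h3 := integral_add (hc1 0) (hc1 ε)
    simp only [Pi.add_apply] at h2
    linarith
  -- passage to the limit `δ → 0` on both sides
  have hL : Tendsto (fun δ => ∫ x in D, ω δ x * divergence F x) (𝓝[>] 0)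
      (𝓝 (∫ x in D, divergence F x)) := by
    refine tendsto_integral_filter_of_dominated_convergence (fun x => 3 * ‖divergence F x‖)
      (Filter.Eventually.of_forall fun δ => ((hωC δ).continuousOn.aestronglyMeasurable hDm).mul
        hdiv.aestronglyMeasurable)
      (Filter.Eventually.of_forall fun δ => Filter.Eventually.of_forall fun x => by
        rw [norm_mul]; gcongr; exact hωb δ x)
      (hdiv.norm.const_mul 3) ?_
    filter_upwards [hne] with x hx
    have h1 : ∀ c : ℝ, S x ≠ c → ∀ᶠ δ : ℝ in 𝓝[>] 0, cutoff ((S x - c) / δ) = 1 := by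
      intro c hc
      have hp : 0 < |S x - c| / 2 := half_pos (abs_pos.2 (sub_ne_zero.2 hc))
      filter_upwards [Ioo_mem_nhdsGT hp] with δ hδ
      apply cutoff_eq_one
      rw [abs_div, abs_of_pos hδ.1, le_div_iff₀ hδ.1]
      linarith [hδ.2, hδ.1]
    refine tendsto_const_nhds.congr' ?_
    filter_upwards [h1 0 hx.2.1, h1 ε hx.2.2] with δ e1 e2
    simp only [hω]
    rw [e1, e2]; ring
  have hR := (tendsto_integral_deriv_cutoff hg T h0a hFm hC hGp hGm).neg.sub
    (tendsto_integral_deriv_cutoff hg T hεa hFm hC hEp hEm)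
  refine tendsto_nhds_unique hL (hR.congr' ?_)
  filter_upwards [Ioo_mem_nhdsGT (show 0 < ε / 4 by positivity)] with δ hδ using (hId δ hδ).symm

end Collar

/-! ### Boundary values -/

section ExtendFrom

variable {F : Type*} [TopologicalSpace F] {O : Set Plane} {f : Plane → F} {x : Plane}

lemma IsX0.exists_tendsto (hf : IsX0 O f) (hx : x ∈ closure O) : ∃ y, Tendsto f (𝓝[O] x) (𝓝 y) := by
  obtain ⟨g, hg, he⟩ := hf
  refine ⟨g x, ((hg x hx).mono subset_closure).tendsto.congr' ?_⟩
  filter_upwards [self_mem_nhdsWithin] with y hy using (he hy).symm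

lemma IsX0.tendsto_extendFrom (hf : IsX0 O f) (hx : x ∈ closure O) :
    Tendsto f (𝓝[O] x) (𝓝 (extendFrom O f x)) :=
  _root_.tendsto_extendFrom (hf.exists_tendsto hx)

lemma extendFrom_eq_of_tendsto [T2Space F] (hx : x ∈ closure O) {y : F}
    (h : Tendsto f (𝓝[O] x) (𝓝 y)) : extendFrom O f x = y := extendFrom_eq hx h

lemma IsX0.continuousOn_extendFrom [RegularSpace F] (hf : IsX0 O f) :
    ContinuousOn (extendFrom O f) (closure O) :=
  _root_.continuousOn_extendFrom subset_rfl fun _ hx => hf.exists_tendsto hx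

lemma IsX0.continuousOn (hf : IsX0 O f) : ContinuousOn f O := by
  obtain ⟨g, hg, he⟩ := hf
  exact (hg.mono subset_closure).congr he

lemma IsX0.of_continuousOn {U : Set Plane} (hf : ContinuousOn f U) (h : closure O ⊆ U) :
    IsX0 O f := ⟨f, hf.mono h, fun _ _ => rfl⟩

end ExtendFrom

lemma IsX0.exists_bound {F : Type*} [NormedAddCommGroup F] {O : Set Plane} {f : Plane → F}
    (hf : IsX0 O f) (hO : Bornology.IsBounded O) : ∃ C, 0 ≤ C ∧ ∀ x ∈ O, ‖f x‖ ≤ C := by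
  obtain ⟨g, hg, he⟩ := hf
  obtain ⟨C, hC⟩ := hO.isCompact_closure.exists_bound_of_continuousOn hg
  exact ⟨max C 0, le_max_right _ _, fun x hx => by
    rw [he hx]; exact (hC x (subset_closure hx)).trans (le_max_left _ _)⟩

lemma IsX0.mono {F : Type*} [TopologicalSpace F] {O O' : Set Plane} {f : Plane → F}
    (hf : IsX0 O f) (h : O' ⊆ O) : IsX0 O' f := by
  obtain ⟨g, hg, he⟩ := hf
  exact ⟨g, hg.mono (closure_mono h), fun x hx => he (h hx)⟩

section Collar

variable {D D₁ Ω₃ : Set Plane} {Γ : ℝ → Plane} {L : ℝ} {h : ℝ → ℝ} {a : ℝ} {S : Plane → ℝ}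

lemma tendsto_gammaEps (hg : Geometry D D₁ Ω₃ Γ L h) (c ξ : ℝ) :
    Tendsto (fun s => gammaEps Γ h s ξ) (𝓝 c) (𝓝 (gammaEps Γ h c ξ)) :=
  ((continuous_gammaEps hg.smooth_Γ hg.smooth_h).comp (f := fun t : ℝ => (t, ξ))
    (by fun_prop)).tendsto c

lemma tendsto_gammaEps_nhdsWithin (hg : Geometry D D₁ Ω₃ Γ L h) {c ξ : ℝ} {I : Set ℝ}
    {O : Set Plane} (hI : ∀ᶠ s in 𝓝[I] c, gammaEps Γ h s ξ ∈ O) :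
    Tendsto (fun s => gammaEps Γ h s ξ) (𝓝[I] c) (𝓝[O] (gammaEps Γ h c ξ)) :=
  tendsto_nhdsWithin_iff.2 ⟨(tendsto_gammaEps hg c ξ).mono_left nhdsWithin_le_nhds, hI⟩

lemma tendsto_layer_zero (hg : Geometry D D₁ Ω₃ Γ L h) (T : Tube D D₁ Ω₃ Γ L h a S) {ε : ℝ}
    (hε0 : 0 < ε) (hε : ε < a) (ξ : ℝ) :
    Tendsto (fun s => gammaEps Γ h s ξ) (𝓝[>] 0) (𝓝[layer Γ h ε] (Γ ξ)) := by
  rw [← gammaEps_zero (Γ := Γ) (h := h) ξ]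
  refine tendsto_gammaEps_nhdsWithin hg ?_
  filter_upwards [Ioo_mem_nhdsGT hε0] with s hs
  have := T.level_gammaEps_mem (ξ := ξ) (s := s) (by rw [abs_of_pos hs.1]; exact hs.2.trans hε)
  rw [layer_eq T hg.pos_h hε]
  exact ⟨this.1, by rw [this.2]; exact hs⟩

lemma tendsto_layer_eps (hg : Geometry D D₁ Ω₃ Γ L h) (T : Tube D D₁ Ω₃ Γ L h a S) {ε : ℝ}
    (hε0 : 0 < ε) (hε : ε < a) (ξ : ℝ) :
    Tendsto (fun s => gammaEps Γ h s ξ) (𝓝[<] ε) (𝓝[layer Γ h ε] (gammaEps Γ h ε ξ)) := by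
  refine tendsto_gammaEps_nhdsWithin hg ?_
  filter_upwards [Ioo_mem_nhdsLT hε0] with s hs
  have := T.level_gammaEps_mem (ξ := ξ) (s := s) (by rw [abs_of_pos hs.1]; exact hs.2.trans hε)
  rw [layer_eq T hg.pos_h hε]
  exact ⟨this.1, by rw [this.2]; exact hs⟩

lemma tendsto_omega1_eps (hg : Geometry D D₁ Ω₃ Γ L h) (T : Tube D D₁ Ω₃ Γ L h a S) {ε : ℝ}
    (hε0 : 0 < ε) (hε : ε < a) (ξ : ℝ) :
    Tendsto (fun s => gammaEps Γ h s ξ) (𝓝[>] ε) (𝓝[omega1 D₁ Γ h ε] (gammaEps Γ h ε ξ)) := by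
  refine tendsto_gammaEps_nhdsWithin hg ?_
  filter_upwards [Ioo_mem_nhdsGT hε] with s hs
  have := T.level_gammaEps_mem (ξ := ξ) (s := s)
    (by rw [abs_of_pos (hε0.trans hs.1)]; exact hs.2)
  rw [omega1_eq hg T hε0 hε]
  exact ⟨this.1, by rw [this.2]; exact hs.1⟩

lemma tendsto_Ω₃_zero (hg : Geometry D D₁ Ω₃ Γ L h) (T : Tube D D₁ Ω₃ Γ L h a S) (ξ : ℝ) :
    Tendsto (fun s => gammaEps Γ h s ξ) (𝓝[<] 0) (𝓝[Ω₃] (Γ ξ)) := by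
  rw [← gammaEps_zero (Γ := Γ) (h := h) ξ]
  refine tendsto_gammaEps_nhdsWithin hg ?_
  filter_upwards [Ioo_mem_nhdsLT (show -a < 0 by linarith [T.pos])] with s hs
  have := T.level_gammaEps_mem (ξ := ξ) (s := s) (by rw [abs_of_neg hs.2]; linarith [hs.1])
  rw [Ω₃_eq hg T]
  exact ⟨this.1, by rw [this.2]; exact hs.2⟩

lemma tendsto_D₁_zero (hg : Geometry D D₁ Ω₃ Γ L h) (T : Tube D D₁ Ω₃ Γ L h a S) (ξ : ℝ) :
    Tendsto (fun s => gammaEps Γ h s ξ) (𝓝[>] 0) (𝓝[D₁] (Γ ξ)) := by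
  rw [← gammaEps_zero (Γ := Γ) (h := h) ξ]
  refine tendsto_gammaEps_nhdsWithin hg ?_
  filter_upwards [Ioo_mem_nhdsGT T.pos] with s hs
  have := T.level_gammaEps_mem (ξ := ξ) (s := s) (by rw [abs_of_pos hs.1]; linarith [hs.2])
  rw [D₁_eq hg T]
  exact ⟨this.1, by rw [this.2]; exact hs.1⟩

lemma mem_closure_of_tendsto_path {I : Set ℝ} {c : ℝ} {O : Set Plane} {g : ℝ → Plane} {x : Plane}
    [hne : (𝓝[I] c).NeBot] (ht : Tendsto g (𝓝[I] c) (𝓝[O] x)) : x ∈ closure O :=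
  mem_closure_iff_nhdsWithin_neBot.2 (ht.neBot)

lemma gamma_mem_closure_layer (hg : Geometry D D₁ Ω₃ Γ L h) (T : Tube D D₁ Ω₃ Γ L h a S) {ε : ℝ}
    (hε0 : 0 < ε) (hε : ε < a) (ξ : ℝ) : Γ ξ ∈ closure (layer Γ h ε) :=
  mem_closure_of_tendsto_path (tendsto_layer_zero hg T hε0 hε ξ)

lemma gammaEps_mem_closure_layer (hg : Geometry D D₁ Ω₃ Γ L h) (T : Tube D D₁ Ω₃ Γ L h a S) {ε : ℝ}
    (hε0 : 0 < ε) (hε : ε < a) (ξ : ℝ) : gammaEps Γ h ε ξ ∈ closure (layer Γ h ε) :=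
  mem_closure_of_tendsto_path (tendsto_layer_eps hg T hε0 hε ξ)

lemma gammaEps_mem_closure_omega1 (hg : Geometry D D₁ Ω₃ Γ L h) (T : Tube D D₁ Ω₃ Γ L h a S)
    {ε : ℝ} (hε0 : 0 < ε) (hε : ε < a) (ξ : ℝ) :
    gammaEps Γ h ε ξ ∈ closure (omega1 D₁ Γ h ε) :=
  mem_closure_of_tendsto_path (tendsto_omega1_eps hg T hε0 hε ξ)

lemma gamma_mem_closure_Ω₃ (hg : Geometry D D₁ Ω₃ Γ L h) (T : Tube D D₁ Ω₃ Γ L h a S) (ξ : ℝ) :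
    Γ ξ ∈ closure Ω₃ := mem_closure_of_tendsto_path (tendsto_Ω₃_zero hg T ξ)

lemma gamma_mem_closure_D₁ (hg : Geometry D D₁ Ω₃ Γ L h) (T : Tube D D₁ Ω₃ Γ L h a S) (ξ : ℝ) :
    Γ ξ ∈ closure D₁ := mem_closure_of_tendsto_path (tendsto_D₁_zero hg T ξ)

lemma isOpen_layer (hg : Geometry D D₁ Ω₃ Γ L h) (T : Tube D D₁ Ω₃ Γ L h a S) {ε : ℝ}
    (hε : ε < a) : IsOpen (layer Γ h ε) := by
  rw [layer_eq T hg.pos_h hε]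
  exact isOpen_level hg T (B := Ioo 0 ε) isOpen_Ioo

lemma isOpen_omega1 (hg : Geometry D D₁ Ω₃ Γ L h) (T : Tube D D₁ Ω₃ Γ L h a S) {ε : ℝ}
    (hε0 : 0 < ε) (hε : ε < a) : IsOpen (omega1 D₁ Γ h ε) := by
  rw [omega1_eq hg T hε0 hε]
  exact isOpen_level hg T (B := Ioi ε) isOpen_Ioi

lemma layer_subset_D₁ (hg : Geometry D D₁ Ω₃ Γ L h) (T : Tube D D₁ Ω₃ Γ L h a S) {ε : ℝ}
    (hε : ε < a) : layer Γ h ε ⊆ D₁ := by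
  rw [layer_eq T hg.pos_h hε, D₁_eq hg T]
  exact fun x hx => ⟨hx.1, hx.2.1⟩

lemma omega1_subset_D₁ (ε : ℝ) : omega1 D₁ Γ h ε ⊆ D₁ := sdiff_subset

/-- Integrals over `D` split into integrals over the three fluid domains. -/
lemma setIntegral_split (hg : Geometry D D₁ Ω₃ Γ L h) (T : Tube D D₁ Ω₃ Γ L h a S) {ε : ℝ}
    (hε0 : 0 < ε) (hε : ε < a) {f : Plane → ℝ} (h3 : IntegrableOn f Ω₃)
    (h2 : IntegrableOn f (layer Γ h ε)) (h1 : IntegrableOn f (omega1 D₁ Γ h ε)) :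
    IntegrableOn f D ∧ ∫ x in D, f x =
      (∫ x in Ω₃, f x) + (∫ x in layer Γ h ε, f x) + ∫ x in omega1 D₁ Γ h ε, f x := by
  have h0a : |(0 : ℝ)| < a := by simpa using T.pos
  have hεa : |ε| < a := by rwa [abs_of_pos hε0]
  have hae : ((Ω₃ ∪ layer Γ h ε) ∪ omega1 D₁ Γ h ε : Set Plane) =ᵐ[volume] D := by
    have := (ae_level_ne hg T h0a).and (ae_level_ne hg T hεa)
    rw [ae_restrict_iff' hg.isOpen_D.measurableSet] at this
    rw [Ω₃_eq hg T, layer_eq T hg.pos_h hε, omega1_eq hg T hε0 hε]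
    filter_upwards [this] with x hx
    refine propext ⟨?_, fun hxD => ?_⟩
    · rintro ((hx' | hx') | hx') <;> exact hx'.1
    · have h := hx hxD
      rcases lt_or_gt_of_ne h.1 with h0 | h0
      · exact Or.inl (Or.inl ⟨hxD, h0⟩)
      · rcases lt_or_gt_of_ne h.2 with h1 | h1
        · exact Or.inl (Or.inr ⟨hxD, h0, h1⟩)
        · exact Or.inr ⟨hxD, h1⟩
  have d1 : Disjoint Ω₃ (layer Γ h ε) :=
    (hg.disjoint_D₁_Ω₃.mono_left (layer_subset_D₁ hg T hε)).symm
  have d2 : Disjoint (Ω₃ ∪ layer Γ h ε) (omega1 D₁ Γ h ε) := by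
    refine Disjoint.union_left (hg.disjoint_D₁_Ω₃.mono_left (omega1_subset_D₁ ε)).symm ?_
    exact Set.disjoint_left.2 fun x hx hx' => hx'.2 (subset_closure hx)
  have hm1 := (isOpen_omega1 hg T hε0 hε).measurableSet
  have hm2 := (isOpen_layer hg T hε).measurableSet
  refine ⟨((h3.union h2).union h1).congr_set_ae hae.symm, ?_⟩
  rw [← setIntegral_congr_set hae, setIntegral_union d2 hm1 (h3.union h2) h1,
    setIntegral_union d1 hm2 h3 h2]

/-- The divergence theorem for three fields on the three fluid domains. -/
theorem divergence_theorem_pieces (hg : Geometry D D₁ Ω₃ Γ L h) (T : Tube D D₁ Ω₃ Γ L h a S)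
    {ε : ℝ} (hε0 : 0 < ε) (hε : ε < a) {F₁ F₂ F₃ : Plane → Plane}
    (hF₁ : ContDiffOn ℝ 1 F₁ (omega1 D₁ Γ h ε)) (hF₂ : ContDiffOn ℝ 1 F₂ (layer Γ h ε))
    (hF₃ : ContDiffOn ℝ 1 F₃ Ω₃) (hX₁ : IsX0 (omega1 D₁ Γ h ε) F₁) (hX₂ : IsX0 (layer Γ h ε) F₂)
    (hX₃ : IsX0 Ω₃ F₃) (hi₁ : IntegrableOn (divergence F₁) (omega1 D₁ Γ h ε))
    (hi₂ : IntegrableOn (divergence F₂) (layer Γ h ε)) (hi₃ : IntegrableOn (divergence F₃) Ω₃)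
    {K : Set Plane} (hK : IsCompact K) (hKD : K ⊆ D) (hK₁ : ∀ x ∉ K, F₁ x = 0)
    (hK₂ : ∀ x ∉ K, F₂ x = 0) (hK₃ : ∀ x ∉ K, F₃ x = 0) :
    (∫ x in Ω₃, divergence F₃ x) + (∫ x in layer Γ h ε, divergence F₂ x)
      + ∫ x in omega1 D₁ Γ h ε, divergence F₁ x =
    -(∫ ξ in (0 : ℝ)..L, inner ℝ (extendFrom (layer Γ h ε) F₂ (Γ ξ) - extendFrom Ω₃ F₃ (Γ ξ))
        (coNormal Γ h 0 ξ))
    - ∫ ξ in (0 : ℝ)..L, inner ℝ (extendFrom (omega1 D₁ Γ h ε) F₁ (gammaEps Γ h ε ξ)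
        - extendFrom (layer Γ h ε) F₂ (gammaEps Γ h ε ξ)) (coNormal Γ h ε ξ) := by
  classical
  -- The fields are glued together; the value on the two curves, which are null sets, is arbitrary.
  set F : Plane → Plane := fun x => if S x < 0 then F₃ x else if S x = 0 then 0 else
    if S x < ε then F₂ x else if S x = ε then 0 else F₁ x with hF
  have e₃ : ∀ x ∈ Ω₃, F x = F₃ x := fun x hx => by
    rw [Ω₃_eq hg T] at hx; simp only [hF]; rw [if_pos hx.2]
  have e₂ : ∀ x ∈ layer Γ h ε, F x = F₂ x := fun x hx => by
    rw [layer_eq T hg.pos_h hε] at hx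
    simp only [hF]
    rw [if_neg hx.2.1.le.not_gt, if_neg hx.2.1.ne', if_pos hx.2.2]
  have e₁ : ∀ x ∈ omega1 D₁ Γ h ε, F x = F₁ x := fun x hx => by
    rw [omega1_eq hg T hε0 hε] at hx
    have := hε0.trans hx.2
    simp only [hF]
    rw [if_neg this.le.not_gt, if_neg this.ne', if_neg hx.2.le.not_gt, if_neg hx.2.ne']
  have o₁ := isOpen_omega1 hg T hε0 hε
  have o₂ := isOpen_layer hg T hε
  have o₃ := hg.isOpen_Ω₃
  have hev : ∀ {O : Set Plane} {G : Plane → Plane}, IsOpen O → (∀ x ∈ O, F x = G x) →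
      ∀ x ∈ O, F =ᶠ[𝓝 x] G := fun hO he x hx => by
    filter_upwards [hO.mem_nhds hx] with y hy using he y hy
  have hdv : ∀ {O : Set Plane} {G : Plane → Plane}, IsOpen O → (∀ x ∈ O, F x = G x) →
      EqOn (divergence F) (divergence G) O := fun hO he x hx => by
    simp only [divergence, (hev hO he x hx).fderiv_eq]
  have hD : ∀ x ∈ D, S x ≠ 0 ∧ S x ≠ ε →
      x ∈ Ω₃ ∨ x ∈ layer Γ h ε ∨ x ∈ omega1 D₁ Γ h ε := by
    intro x hx hne
    rw [Ω₃_eq hg T, layer_eq T hg.pos_h hε, omega1_eq hg T hε0 hε]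
    rcases lt_or_gt_of_ne hne.1 with h0 | h0
    · exact Or.inl ⟨hx, h0⟩
    · rcases lt_or_gt_of_ne hne.2 with h1 | h1
      · exact Or.inr (Or.inl ⟨hx, h0, h1⟩)
      · exact Or.inr (Or.inr ⟨hx, h1⟩)
  have bD : ∀ {O : Set Plane}, O ⊆ D → Bornology.IsBounded O := fun hO => hg.bounded_D.subset hO
  obtain ⟨C₁, hC₁0, hC₁⟩ := hX₁.exists_bound (bD ((omega1_subset_D₁ ε).trans (D₁_subset hg)))
  obtain ⟨C₂, hC₂0, hC₂⟩ := hX₂.exists_bound (bD ((layer_subset_D₁ hg T hε).trans (D₁_subset hg)))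
  obtain ⟨C₃, hC₃0, hC₃⟩ := hX₃.exists_bound (bD (Ω₃_subset hg))
  have hbound : ∀ x ∈ D, ‖F x‖ ≤ C₁ + C₂ + C₃ := by
    intro x hx
    by_cases hne : S x ≠ 0 ∧ S x ≠ ε
    · rcases hD x hx hne with h | h | h
      · rw [e₃ x h]; linarith [hC₃ x h]
      · rw [e₂ x h]; linarith [hC₂ x h]
      · rw [e₁ x h]; linarith [hC₁ x h]
    · have : F x = 0 := by
        simp only [hF]
        by_cases h0 : S x = 0
        · simp [h0]
        · have h1 : S x = ε := by
            by_contra h1; exact hne ⟨h0, h1⟩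
          simp [h1, hε0.ne', hε0.le.not_gt]
      rw [this, norm_zero]; positivity
  obtain ⟨hi, hs⟩ := setIntegral_split hg T hε0 hε (f := divergence F)
    (hi₃.congr_fun (hdv o₃ e₃).symm o₃.measurableSet)
    (hi₂.congr_fun (hdv o₂ e₂).symm o₂.measurableSet)
    (hi₁.congr_fun (hdv o₁ e₁).symm o₁.measurableSet)
  rw [setIntegral_congr_fun o₃.measurableSet (hdv o₃ e₃),
    setIntegral_congr_fun o₂.measurableSet (hdv o₂ e₂),
    setIntegral_congr_fun o₁.measurableSet (hdv o₁ e₁)] at hs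
  rw [← hs]
  have hlim : ∀ {O : Set Plane} {G : Plane → Plane} {I : Set ℝ} {c ξ : ℝ} {x : Plane},
      [(𝓝[I] c).NeBot] → IsX0 O G → (∀ x ∈ O, F x = G x) →
      Tendsto (fun s => gammaEps Γ h s ξ) (𝓝[I] c) (𝓝[O] x) →
      Tendsto (fun s => F (gammaEps Γ h s ξ)) (𝓝[I] c) (𝓝 (extendFrom O G x)) := by
    intro O G I c ξ x _ hG he ht
    refine ((hG.tendsto_extendFrom (mem_closure_of_tendsto_path ht)).comp ht).congr' ?_
    filter_upwards [(tendsto_nhdsWithin_iff.1 ht).2] with s hs using (he _ hs).symm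
  refine divergence_theorem_jump hg T hε0 hε ?_ hK hKD ?_ hbound hi
    (fun ξ => hlim hX₂ e₂ (tendsto_layer_zero hg T hε0 hε ξ))
    (fun ξ => hlim hX₃ e₃ (tendsto_Ω₃_zero hg T ξ))
    (fun ξ => hlim hX₁ e₁ (tendsto_omega1_eps hg T hε0 hε ξ))
    (fun ξ => hlim hX₂ e₂ (tendsto_layer_eps hg T hε0 hε ξ))
  · rintro x ⟨hx, hne⟩
    refine ContDiffAt.contDiffWithinAt ?_
    rcases hD x hx hne with h | h | h
    · exact (hF₃.contDiffAt (o₃.mem_nhds h)).congr_of_eventuallyEq (hev o₃ e₃ x h)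
    · exact (hF₂.contDiffAt (o₂.mem_nhds h)).congr_of_eventuallyEq (hev o₂ e₂ x h)
    · exact (hF₁.contDiffAt (o₁.mem_nhds h)).congr_of_eventuallyEq (hev o₁ e₁ x h)
  · intro x hx
    simp only [hF, hK₁ x hx, hK₂ x hx, hK₃ x hx, ite_self]

end Collar

/-! ### The surface tension of the two interfaces -/

/-- Differentiation under the integral sign, for a derivative that is continuous. -/
lemma hasDerivAt_integral_of_continuousOn {f f' : ℝ → ℝ → ℝ} {b L : ℝ} (hb : 0 < b) (hL : 0 ≤ L)
    (hf : ∀ s ∈ Ioo (-b) b, Continuous (f s))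
    (hd : ∀ s ∈ Ioo (-b) b, ∀ ξ, HasDerivAt (fun t => f t ξ) (f' s ξ) s)
    (hf' : ContinuousOn (fun z : ℝ × ℝ => f' z.1 z.2) (Icc (-b) b ×ˢ Icc 0 L)) :
    HasDerivAt (fun s => ∫ ξ in (0 : ℝ)..L, f s ξ) (∫ ξ in (0 : ℝ)..L, f' 0 ξ) 0 := by
  obtain ⟨C, hC⟩ := (isCompact_Icc.prod isCompact_Icc).exists_bound_of_continuousOn hf'
  have hN : Ioo (-b) b ∈ 𝓝 (0 : ℝ) := Ioo_mem_nhds (by linarith) hb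
  have h0 : (0 : ℝ) ∈ Ioo (-b) b := ⟨by linarith, hb⟩
  have hc0 : ContinuousOn (f' 0) (Icc 0 L) :=
    hf'.comp (f := fun ξ : ℝ => ((0 : ℝ), ξ)) (by fun_prop)
      fun ξ hξ => ⟨⟨h0.1.le, h0.2.le⟩, hξ⟩
  refine (intervalIntegral.hasDerivAt_integral_of_dominated_loc_of_deriv_le (μ := volume)
    (bound := fun _ => C) hN ?_ ?_ ?_ ?_ ?_ ?_).2
  · filter_upwards [hN] with s hs using (hf s hs).aestronglyMeasurable
  · exact (hf 0 h0).intervalIntegrable _ _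
  · rw [uIoc_of_le hL]
    exact (hc0.mono Ioc_subset_Icc_self).aestronglyMeasurable measurableSet_Ioc
  · refine Filter.Eventually.of_forall fun ξ hξ s hs => ?_
    rw [uIoc_of_le hL] at hξ
    exact hC (s, ξ) ⟨⟨hs.1.le, hs.2.le⟩, hξ.1.le, hξ.2⟩
  · exact intervalIntegrable_const
  · exact Filter.Eventually.of_forall fun ξ _ s hs => hd s hs ξ

section Curve

variable {Γ : ℝ → Plane} {h : ℝ → ℝ}

lemma hasDerivAt_velocityEps (hΓ : ContDiff ℝ 3 Γ) (hu : ∀ ξ, ‖deriv Γ ξ‖ = 1)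
    (hh : ContDiff ℝ 2 h) (s ξ : ℝ) :
    HasDerivAt (velocityEps Γ h s)
      ((s * (2 * deriv h ξ * curv Γ ξ + h ξ * deriv (curv Γ) ξ)) • tangent Γ ξ
        + (curv Γ ξ + s * (h ξ * curv Γ ξ ^ 2 - deriv (deriv h) ξ)) • normal Γ ξ) ξ := by
  have h1 : HasDerivAt h (deriv h ξ) ξ := (hh.differentiable (by norm_num) ξ).hasDerivAt
  have hh' : ContDiff ℝ 1 (deriv h) := by
    have : ContDiff ℝ (1 + 1) h := by simpa [show (1 + 1 : WithTop ℕ∞) = 2 by norm_num] using hh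
    exact (contDiff_succ_iff_deriv.1 this).2.2
  have h2 : HasDerivAt (deriv h) (deriv (deriv h) ξ) ξ :=
    (hh'.differentiable (by norm_num) ξ).hasDerivAt
  have h3 : HasDerivAt (curv Γ) (deriv (curv Γ) ξ) ξ :=
    ((contDiff_curv hΓ).differentiable (by norm_num) ξ).hasDerivAt
  have := ((((h1.const_mul s).mul h3).const_add 1).smul (hasDerivAt_tangent hΓ hu ξ)).sub
    ((h2.const_mul s).smul (hasDerivAt_normal hΓ hu ξ))
  refine this.congr_deriv ?_
  simp only [Pi.mul_apply]
  module

lemma velocityEps_ne_zero (hu : ∀ ξ, ‖deriv Γ ξ‖ = 1) {s ξ : ℝ}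
    (hs : 0 < 1 + s * h ξ * curv Γ ξ) : velocityEps Γ h s ξ ≠ 0 := by
  intro h0
  have h1 : inner ℝ (velocityEps Γ h s ξ) (tangent Γ ξ) = 1 + s * h ξ * curv Γ ξ := by
    rw [velocityEps, inner_sub_left, inner_smul_left, inner_smul_left, real_inner_self_eq_norm_sq,
      norm_tangent hu, normal, real_inner_comm, inner_rot_self]
    simp
  rw [h0, inner_zero_left] at h1
  linarith

/-- The quantity `κ_s` in terms of the first two derivatives of `Γ_s`. -/
lemma curvEps_eq (hΓ : ContDiff ℝ 3 Γ) (hu : ∀ ξ, ‖deriv Γ ξ‖ = 1) (hh : ContDiff ℝ 2 h)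
    {s ξ : ℝ} (hs : 0 < 1 + s * h ξ * curv Γ ξ) :
    curvEps Γ h s ξ = ‖velocityEps Γ h s ξ‖⁻¹ ^ 2 *
      inner ℝ (deriv (velocityEps Γ h s) ξ) (rot (velocityEps Γ h s ξ)) := by
  have hV : deriv (gammaEps Γ h s) = velocityEps Γ h s :=
    funext fun ζ => (hasDerivAt_gammaEps hΓ hu hh s ζ).deriv
  have hne := velocityEps_ne_zero hu hs
  have hd : HasDerivAt (velocityEps Γ h s) (deriv (velocityEps Γ h s) ξ) ξ :=
    (hasDerivAt_velocityEps hΓ hu hh s ξ).differentiableAt.hasDerivAt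
  have hnd : DifferentiableAt ℝ (fun ζ => ‖velocityEps Γ h s ζ‖⁻¹) ξ :=
    (hd.differentiableAt.norm ℝ hne).inv (norm_ne_zero_iff.2 hne)
  have h1 := hnd.hasDerivAt.smul hd
  have h2 := (rotL.hasFDerivAt.comp_hasDerivAt ξ h1).neg
  have h3 : normalEps Γ h s =
      -(rotL ∘ ((fun ζ => ‖velocityEps Γ h s ζ‖⁻¹) • velocityEps Γ h s)) := by
    ext ζ : 1
    simp only [normalEps, tangentEps, hV]
    rfl
  rw [curvEps, h3, h2.deriv, tangentEps, hV]
  simp only [inner_eq_coord, map_add, map_smul, rotL_apply, PiLp.neg_apply, PiLp.add_apply,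
    PiLp.smul_apply, smul_eq_mul, rot_apply_zero, rot_apply_one]
  ring

lemma coNormal_eq_norm_smul_normalEps (hΓ : ContDiff ℝ 3 Γ) (hu : ∀ ξ, ‖deriv Γ ξ‖ = 1)
    (hh : ContDiff ℝ 2 h) {s ξ : ℝ} (hs : 0 < 1 + s * h ξ * curv Γ ξ) :
    coNormal Γ h s ξ = ‖velocityEps Γ h s ξ‖ • normalEps Γ h s ξ := by
  have hV : deriv (gammaEps Γ h s) ξ = velocityEps Γ h s ξ :=
    (hasDerivAt_gammaEps hΓ hu hh s ξ).deriv
  have hne := norm_ne_zero_iff.2 (velocityEps_ne_zero hu hs)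
  rw [normalEps, tangentEps, hV, coNormal, ← rotL_apply, ← rotL_apply, map_smul, smul_neg,
    smul_smul, mul_inv_cancel₀ hne, one_smul]

/-- The density, with respect to `dξ`, of the force that the surface tension of `Γ_s` exerts
against the test field `φ`. -/
def tension (Γ : ℝ → Plane) (h : ℝ → ℝ) (φ : Plane → Plane) (s ξ : ℝ) : ℝ :=
  ((1 + s * h ξ * curv Γ ξ) * (curv Γ ξ + s * (h ξ * curv Γ ξ ^ 2 - deriv (deriv h) ξ))
    + s * deriv h ξ * (s * (2 * deriv h ξ * curv Γ ξ + h ξ * deriv (curv Γ) ξ)))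
  / ((1 + s * h ξ * curv Γ ξ) ^ 2 + (s * deriv h ξ) ^ 2)
  * ((1 + s * h ξ * curv Γ ξ) * inner ℝ (normal Γ ξ) (φ (gammaEps Γ h s ξ))
    + s * deriv h ξ * inner ℝ (tangent Γ ξ) (φ (gammaEps Γ h s ξ)))

lemma tension_zero (φ : Plane → Plane) (ξ : ℝ) :
    tension Γ h φ 0 ξ = curv Γ ξ * inner ℝ (normal Γ ξ) (φ (Γ ξ)) := by
  simp [tension, gammaEps_zero]

/-- The stress condition on `Γ_s` turns the jump of the flux into the density `tension`. -/
lemma curvEps_mul_inner_coNormal (hΓ : ContDiff ℝ 3 Γ) (hu : ∀ ξ, ‖deriv Γ ξ‖ = 1)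
    (hh : ContDiff ℝ 2 h) (φ : Plane → Plane) {s ξ : ℝ} (hs : 0 < 1 + s * h ξ * curv Γ ξ) :
    curvEps Γ h s ξ * inner ℝ (φ (gammaEps Γ h s ξ)) (coNormal Γ h s ξ)
      = -tension Γ h φ s ξ := by
  have ht := tangent_sq hu ξ
  have hn : ‖velocityEps Γ h s ξ‖⁻¹ ^ 2
      = ((1 + s * h ξ * curv Γ ξ) ^ 2 + (s * deriv h ξ) ^ 2)⁻¹ := by
    rw [inv_pow, ← real_inner_self_eq_norm_sq, inner_eq_coord]
    congr 1
    simp only [velocityEps, normal, PiLp.sub_apply, PiLp.smul_apply, smul_eq_mul, rot_apply_zero,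
      rot_apply_one]
    linear_combination ((1 + s * h ξ * curv Γ ξ) ^ 2 + (s * deriv h ξ) ^ 2) * ht
  have hi : inner ℝ (deriv (velocityEps Γ h s) ξ) (rot (velocityEps Γ h s ξ))
      = (1 + s * h ξ * curv Γ ξ) * (curv Γ ξ + s * (h ξ * curv Γ ξ ^ 2 - deriv (deriv h) ξ))
    + s * deriv h ξ * (s * (2 * deriv h ξ * curv Γ ξ + h ξ * deriv (curv Γ) ξ)) := by
    rw [(hasDerivAt_velocityEps hΓ hu hh s ξ).deriv, inner_eq_coord]
    simp only [velocityEps, normal, PiLp.sub_apply, PiLp.add_apply, PiLp.smul_apply, smul_eq_mul,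
      rot_apply_zero, rot_apply_one]
    linear_combination ((1 + s * h ξ * curv Γ ξ) *
      (curv Γ ξ + s * (h ξ * curv Γ ξ ^ 2 - deriv (deriv h) ξ))
      + s * deriv h ξ * (s * (2 * deriv h ξ * curv Γ ξ + h ξ * deriv (curv Γ) ξ))) * ht
  have hc : inner ℝ (φ (gammaEps Γ h s ξ)) (coNormal Γ h s ξ)
      = -((1 + s * h ξ * curv Γ ξ) * inner ℝ (normal Γ ξ) (φ (gammaEps Γ h s ξ))
        + s * deriv h ξ * inner ℝ (tangent Γ ξ) (φ (gammaEps Γ h s ξ))) := by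
    simp only [inner_eq_coord, coNormal, velocityEps, normal, PiLp.sub_apply, PiLp.smul_apply,
      PiLp.neg_apply, smul_eq_mul, rot_apply_zero, rot_apply_one]
    ring
  rw [curvEps_eq hΓ hu hh hs, hn, hi, hc, tension]
  ring

lemma continuous_deriv_curv (hΓ : ContDiff ℝ 3 Γ) : Continuous (deriv (curv Γ)) :=
  (contDiff_curv hΓ).continuous_deriv (by norm_num)

lemma continuous_deriv_deriv (hh : ContDiff ℝ 2 h) : Continuous (deriv (deriv h)) := by
  have : ContDiff ℝ (1 + 1) h := by simpa [show (1 + 1 : WithTop ℕ∞) = 2 by norm_num] using hh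
  exact (contDiff_succ_iff_deriv.1 this).2.2.continuous_deriv (by norm_num)

/-- The derivative of `tension` with respect to `s`. -/
def tensionDeriv (Γ : ℝ → Plane) (h : ℝ → ℝ) (φ : Plane → Plane) (s ξ : ℝ) : ℝ :=
  let α := 1 + s * h ξ * curv Γ ξ
  let β := s * deriv h ξ
  let A₁ := 2 * deriv h ξ * curv Γ ξ + h ξ * deriv (curv Γ) ξ
  let B₁ := h ξ * curv Γ ξ ^ 2 - deriv (deriv h) ξ
  let N := α * (curv Γ ξ + s * B₁) + β * (s * A₁)
  let N' := h ξ * curv Γ ξ * (curv Γ ξ + s * B₁) + α * B₁ + (deriv h ξ * (s * A₁) + β * A₁)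
  let M := α ^ 2 + β ^ 2
  let M' := 2 * α * (h ξ * curv Γ ξ) + 2 * β * deriv h ξ
  let w := -(h ξ • fderiv ℝ φ (gammaEps Γ h s ξ) (normal Γ ξ))
  (N' * M - N * M') / M ^ 2 * (α * inner ℝ (normal Γ ξ) (φ (gammaEps Γ h s ξ))
      + β * inner ℝ (tangent Γ ξ) (φ (gammaEps Γ h s ξ)))
    + N / M * ((h ξ * curv Γ ξ * inner ℝ (normal Γ ξ) (φ (gammaEps Γ h s ξ))
        + α * inner ℝ (normal Γ ξ) w)
      + (deriv h ξ * inner ℝ (tangent Γ ξ) (φ (gammaEps Γ h s ξ))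
        + β * inner ℝ (tangent Γ ξ) w))

lemma hasDerivAt_tension {φ : Plane → Plane} (hφ : ContDiff ℝ 1 φ) {s ξ : ℝ}
    (hs : 0 < 1 + s * h ξ * curv Γ ξ) :
    HasDerivAt (fun t => tension Γ h φ t ξ) (tensionDeriv Γ h φ s ξ) s := by
  have hα : HasDerivAt (fun t => 1 + t * h ξ * curv Γ ξ) (h ξ * curv Γ ξ) s := by
    simpa using (((hasDerivAt_id s).mul_const (h ξ)).mul_const (curv Γ ξ)).const_add 1
  have hβ : HasDerivAt (fun t => t * deriv h ξ) (deriv h ξ) s := by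
    simpa using (hasDerivAt_id s).mul_const (deriv h ξ)
  have hB : HasDerivAt (fun t => curv Γ ξ + t * (h ξ * curv Γ ξ ^ 2 - deriv (deriv h) ξ))
      (h ξ * curv Γ ξ ^ 2 - deriv (deriv h) ξ) s := by
    simpa using ((hasDerivAt_id s).mul_const (h ξ * curv Γ ξ ^ 2 - deriv (deriv h) ξ)).const_add
      (curv Γ ξ)
  have hA : HasDerivAt (fun t => t * (2 * deriv h ξ * curv Γ ξ + h ξ * deriv (curv Γ) ξ))
      (2 * deriv h ξ * curv Γ ξ + h ξ * deriv (curv Γ) ξ) s := by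
    simpa using (hasDerivAt_id s).mul_const (2 * deriv h ξ * curv Γ ξ + h ξ * deriv (curv Γ) ξ)
  have hφd : HasDerivAt (fun t => φ (gammaEps Γ h t ξ))
      (-(h ξ • fderiv ℝ φ (gammaEps Γ h s ξ) (normal Γ ξ))) s := by
    have := ((hφ.differentiable (by norm_num) (gammaEps Γ h s ξ)).hasFDerivAt).comp_hasDerivAt s
      (hasDerivAt_gammaEps_left (Γ := Γ) (h := h) s ξ)
    exact this.congr_deriv (by simp)
  have hin : ∀ v : Plane, HasDerivAt (fun t => inner ℝ v (φ (gammaEps Γ h t ξ)))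
      (inner ℝ v (-(h ξ • fderiv ℝ φ (gammaEps Γ h s ξ) (normal Γ ξ)))) s := fun v => by
    simpa using (hasDerivAt_const s v).inner ℝ hφd
  have hM : (1 + s * h ξ * curv Γ ξ) ^ 2 + (s * deriv h ξ) ^ 2 ≠ 0 := by positivity
  have := (((hα.fun_mul hB).fun_add (hβ.fun_mul hA)).fun_div ((hα.fun_pow 2).fun_add (hβ.fun_pow 2))
    hM).fun_mul ((hα.fun_mul (hin (normal Γ ξ))).fun_add (hβ.fun_mul (hin (tangent Γ ξ))))
  refine this.congr_deriv ?_
  simp [tensionDeriv]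

lemma continuousOn_tensionDeriv (hΓ : ContDiff ℝ 3 Γ) (hh : ContDiff ℝ 2 h) {φ : Plane → Plane}
    (hφ : ContDiff ℝ 1 φ) {U : Set (ℝ × ℝ)} (hU : ∀ z ∈ U, 0 < 1 + z.1 * h z.2 * curv Γ z.2) :
    ContinuousOn (fun z : ℝ × ℝ => tensionDeriv Γ h φ z.1 z.2) U := by
  have c1 := (contDiff_tangent hΓ).continuous
  have c2 := hh.continuous
  have c3 := (contDiff_normal hΓ).continuous
  have c4 := (contDiff_curv hΓ).continuous
  have c5 := hh.continuous_deriv (by norm_num)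
  have c6 := continuous_deriv_curv hΓ
  have c7 := continuous_deriv_deriv hh
  have c8 : Continuous (fun z : ℝ × ℝ => φ (gammaEps Γ h z.1 z.2)) :=
    hφ.continuous.comp (continuous_gammaEps hΓ hh)
  have c9 : Continuous (fun z : ℝ × ℝ => fderiv ℝ φ (gammaEps Γ h z.1 z.2) (normal Γ z.2)) :=
    ((hφ.continuous_fderiv (by norm_num)).comp (continuous_gammaEps hΓ hh)).clm_apply (by fun_prop)
  obtain ⟨G, hG⟩ : ∃ G : ℝ × ℝ → Plane, ∀ z, φ (gammaEps Γ h z.1 z.2) = G z := ⟨_, fun _ => rfl⟩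
  obtain ⟨G', hG'⟩ : ∃ G' : ℝ × ℝ → Plane,
    ∀ z, fderiv ℝ φ (gammaEps Γ h z.1 z.2) (normal Γ z.2) = G' z := ⟨_, fun _ => rfl⟩
  simp only [hG] at c8
  simp only [hG'] at c9
  simp only [tensionDeriv, hG, hG']
  refine ContinuousOn.add (ContinuousOn.mul (ContinuousOn.div
    (Continuous.continuousOn (by fun_prop)) (Continuous.continuousOn (by fun_prop)) ?_)
    (Continuous.continuousOn (by fun_prop))) (ContinuousOn.mul (ContinuousOn.div
    (Continuous.continuousOn (by fun_prop)) (Continuous.continuousOn (by fun_prop)) ?_)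
    (Continuous.continuousOn (by fun_prop)))
  · intro z hz; have := hU z hz; positivity
  · intro z hz; have := hU z hz; positivity

lemma continuous_tension (hΓ : ContDiff ℝ 3 Γ) (hh : ContDiff ℝ 2 h) {φ : Plane → Plane}
    (hφ : Continuous φ) {s : ℝ} (hs : ∀ ξ, 0 < 1 + s * h ξ * curv Γ ξ) :
    Continuous (tension Γ h φ s) := by
  have c1 := (contDiff_tangent hΓ).continuous
  have c2 := hh.continuous
  have c3 := (contDiff_normal hΓ).continuous
  have c4 := (contDiff_curv hΓ).continuous
  have c5 := hh.continuous_deriv (by norm_num)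
  have c6 := continuous_deriv_curv hΓ
  have c7 := continuous_deriv_deriv hh
  have c8 : Continuous (fun ξ : ℝ => φ (gammaEps Γ h s ξ)) :=
    hφ.comp ((continuous_gammaEps hΓ hh).comp (f := fun ξ : ℝ => (s, ξ)) (by fun_prop))
  obtain ⟨G, hG⟩ : ∃ G : ℝ → Plane, ∀ ξ, φ (gammaEps Γ h s ξ) = G ξ := ⟨_, fun _ => rfl⟩
  simp only [hG] at c8
  unfold tension
  simp only [hG]
  refine Continuous.mul (Continuous.div (by fun_prop) (by fun_prop) ?_) (by fun_prop)
  intro ξ; have := hs ξ; positivity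

end Curve

/-- The first variation of the force exerted by the surface tension of `Γ_s`. The derivative of the
density contains the tangential divergence of the test field; the tangential derivatives are removed
by integrating `∂_ξ (κ h τ ⬝ φ)` over the closed curve. -/
lemma hasDerivAt_integral_tension {D D₁ Ω₃ : Set Plane} {Γ : ℝ → Plane} {L : ℝ} {h : ℝ → ℝ} {a : ℝ}
    {S : Plane → ℝ} (hg : Geometry D D₁ Ω₃ Γ L h) (T : Tube D D₁ Ω₃ Γ L h a S)
    {φ : Plane → Plane} (hφ : ContDiff ℝ 1 φ) :
    HasDerivAt (fun s => ∫ ξ in (0 : ℝ)..L, tension Γ h φ s ξ)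
      (-(∫ ξ in (0 : ℝ)..L, deriv (deriv h) ξ * inner ℝ (normal Γ ξ) (φ (Γ ξ)))
        - (∫ ξ in (0 : ℝ)..L, deriv (curv Γ) ξ * h ξ * inner ℝ (tangent Γ ξ) (φ (Γ ξ)))
        - ∫ ξ in (0 : ℝ)..L, h ξ * curv Γ ξ * divergence φ (Γ ξ)) 0 := by
  have hΓ := hg.smooth_Γ
  have hu := hg.unit_speed
  have hh := hg.smooth_h
  have hpos : ∀ s ξ, |s| < a → 0 < 1 + s * h ξ * curv Γ ξ := fun s ξ hs =>
    (pos_iff_pos_of_mul_pos (T.jac_pos s ξ hs)).1 (hg.pos_h ξ)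
  have ha2 : 0 < a / 2 := half_pos T.pos
  have hab : ∀ s ∈ Icc (-(a / 2)) (a / 2), |s| < a := fun s hs =>
    (abs_le.2 hs).trans_lt (by linarith)
  have key := hasDerivAt_integral_of_continuousOn (f := tension Γ h φ) (f' := tensionDeriv Γ h φ)
    ha2 hg.period_pos.le
    (fun s hs => continuous_tension hΓ hh hφ.continuous
      fun ξ => hpos s ξ (hab s ⟨hs.1.le, hs.2.le⟩))
    (fun s hs ξ => hasDerivAt_tension hφ (hpos s ξ (hab s ⟨hs.1.le, hs.2.le⟩)))
    (continuousOn_tensionDeriv hΓ hh hφ fun z hz => hpos _ _ (hab _ hz.1))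
  refine key.congr_deriv ?_
  have c1 := (contDiff_tangent hΓ).continuous
  have c2 := hh.continuous
  have c3 := (contDiff_normal hΓ).continuous
  have c4 := (contDiff_curv hΓ).continuous
  have c5 := hh.continuous_deriv (by norm_num)
  have c6 := continuous_deriv_curv hΓ
  have c7 := continuous_deriv_deriv hh
  have c8 : Continuous (fun ξ : ℝ => φ (Γ ξ)) := hφ.continuous.comp hΓ.continuous
  have c9 : Continuous (fun ξ : ℝ => fderiv ℝ φ (Γ ξ)) :=
    (hφ.continuous_fderiv (by norm_num)).comp hΓ.continuous
  have c10 : Continuous (fun ξ : ℝ => divergence φ (Γ ξ)) := by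
    simp only [divergence_eq_tr]; exact continuous_tr.comp c9
  -- integration by parts on the closed curve
  have hibp : ∀ ξ, HasDerivAt (fun ξ => curv Γ ξ * h ξ * inner ℝ (tangent Γ ξ) (φ (Γ ξ)))
      ((deriv (curv Γ) ξ * h ξ + curv Γ ξ * deriv h ξ) * inner ℝ (tangent Γ ξ) (φ (Γ ξ))
        + curv Γ ξ * h ξ * (inner ℝ (tangent Γ ξ) (fderiv ℝ φ (Γ ξ) (tangent Γ ξ))
          + inner ℝ (curv Γ ξ • normal Γ ξ) (φ (Γ ξ)))) ξ := fun ξ =>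
    ((((contDiff_curv hΓ).differentiable (by norm_num) ξ).hasDerivAt.mul
      (hh.differentiable (by norm_num) ξ).hasDerivAt).mul
      ((hasDerivAt_tangent hΓ hu ξ).inner ℝ
        ((hφ.differentiable (by norm_num) (Γ ξ)).hasFDerivAt.comp_hasDerivAt ξ
          (hasDerivAt_gamma hΓ ξ))))
  have hcl : ∫ ξ in (0 : ℝ)..L, ((deriv (curv Γ) ξ * h ξ + curv Γ ξ * deriv h ξ)
        * inner ℝ (tangent Γ ξ) (φ (Γ ξ))
        + curv Γ ξ * h ξ * (inner ℝ (tangent Γ ξ) (fderiv ℝ φ (Γ ξ) (tangent Γ ξ))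
          + inner ℝ (curv Γ ξ • normal Γ ξ) (φ (Γ ξ)))) = 0 := by
    rw [intervalIntegral.integral_eq_sub_of_hasDerivAt (fun ξ _ => hibp ξ)
      (Continuous.intervalIntegrable (by fun_prop) _ _)]
    have p1 := periodic_curv hg.periodic_Γ 0
    have p2 := hg.periodic_h 0
    have p3 := periodic_tangent hg.periodic_Γ 0
    have p4 := hg.periodic_Γ 0
    rw [zero_add] at p1 p2 p3 p4
    rw [p1, p2, p3, p4, sub_self]
  have i1 : IntervalIntegrable (fun ξ => deriv (deriv h) ξ * inner ℝ (normal Γ ξ) (φ (Γ ξ)))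
      volume 0 L := Continuous.intervalIntegrable (by fun_prop) _ _
  have i2 : IntervalIntegrable
      (fun ξ => deriv (curv Γ) ξ * h ξ * inner ℝ (tangent Γ ξ) (φ (Γ ξ))) volume 0 L :=
    Continuous.intervalIntegrable (by fun_prop) _ _
  have i3 : IntervalIntegrable (fun ξ => h ξ * curv Γ ξ * divergence φ (Γ ξ)) volume 0 L :=
    Continuous.intervalIntegrable (by fun_prop) _ _
  have i4 : IntervalIntegrable (fun ξ => (deriv (curv Γ) ξ * h ξ + curv Γ ξ * deriv h ξ)
        * inner ℝ (tangent Γ ξ) (φ (Γ ξ))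
        + curv Γ ξ * h ξ * (inner ℝ (tangent Γ ξ) (fderiv ℝ φ (Γ ξ) (tangent Γ ξ))
          + inner ℝ (curv Γ ξ • normal Γ ξ) (φ (Γ ξ)))) volume 0 L :=
    Continuous.intervalIntegrable (by fun_prop) _ _
  have hsum : ((-(∫ ξ in (0 : ℝ)..L, deriv (deriv h) ξ * inner ℝ (normal Γ ξ) (φ (Γ ξ)))
        - (∫ ξ in (0 : ℝ)..L, deriv (curv Γ) ξ * h ξ * inner ℝ (tangent Γ ξ) (φ (Γ ξ))))
        - ∫ ξ in (0 : ℝ)..L, h ξ * curv Γ ξ * divergence φ (Γ ξ)) + 0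
      = ∫ ξ in (0 : ℝ)..L, (-(deriv (deriv h) ξ * inner ℝ (normal Γ ξ) (φ (Γ ξ)))
        - deriv (curv Γ) ξ * h ξ * inner ℝ (tangent Γ ξ) (φ (Γ ξ))
        - h ξ * curv Γ ξ * divergence φ (Γ ξ)
        + ((deriv (curv Γ) ξ * h ξ + curv Γ ξ * deriv h ξ) * inner ℝ (tangent Γ ξ) (φ (Γ ξ))
        + curv Γ ξ * h ξ * (inner ℝ (tangent Γ ξ) (fderiv ℝ φ (Γ ξ) (tangent Γ ξ))
          + inner ℝ (curv Γ ξ • normal Γ ξ) (φ (Γ ξ))))) := by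
    have j1 := i1.neg
    have j2 := j1.sub i2
    have j3 := j2.sub i3
    refine (congrArg₂ _ ?_ hcl.symm).trans (intervalIntegral.integral_add j3 i4).symm
    refine (congrArg₂ _ ?_ rfl).trans (intervalIntegral.integral_sub j2 i3).symm
    refine (congrArg₂ _ ?_ rfl).trans (intervalIntegral.integral_sub j1 i2).symm
    exact intervalIntegral.integral_neg.symm
  rw [← add_zero (_ - _), hsum]
  refine intervalIntegral.integral_congr fun ξ _ => ?_
  simp only [tensionDeriv, gammaEps_zero, divergence_eq_tr,
    tr_eq_of_unit (fderiv ℝ φ (Γ ξ)) (norm_tangent hu ξ), inner_neg_right, inner_smul_right,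
    inner_smul_left]
  simp only [normal]
  simp
  ring

/-! ### Weak form of the two-fluid problem -/

section Flux

variable {O : Set Plane} {u φ : Plane → Plane} {p : Plane → ℝ} {m : ℝ}

lemma IsX0.comp₂ {F G H : Type*} [TopologicalSpace F] [TopologicalSpace G] [TopologicalSpace H]
    {f : Plane → F} {g : Plane → G} (hf : IsX0 O f) (hg : IsX0 O g) {c : F × G → H}
    (hc : Continuous c) : IsX0 O (fun x => c (f x, g x)) := by
  obtain ⟨f', hf', ef⟩ := hf
  obtain ⟨g', hg', eg⟩ := hg
  exact ⟨fun x => c (f' x, g' x), hc.comp_continuousOn (hf'.prodMk hg'),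
    fun x hx => by simp only [ef hx, eg hx]⟩

lemma IsX0.of_continuous {F : Type*} [TopologicalSpace F] {f : Plane → F} (hf : Continuous f) :
    IsX0 O f := IsX0.of_continuousOn hf.continuousOn (subset_univ _)

lemma continuous_plusTranspose_apply {X : Type*} [TopologicalSpace X] {A : X → Mat} {v : X → Plane}
    (hA : Continuous A) (hv : Continuous v) : Continuous fun x => plusTranspose (A x) (v x) :=
  (plusTransposeL.continuous.comp hA).clm_apply hv

lemma tendsto_plusTranspose_apply {X : Type*} {l : Filter X} {A : X → Mat} {v : X → Plane}
    {A₀ : Mat} {v₀ : Plane} (hA : Tendsto A l (𝓝 A₀)) (hv : Tendsto v l (𝓝 v₀)) :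
    Tendsto (fun y => plusTranspose (A y) (v y)) l (𝓝 (plusTranspose A₀ v₀)) := by
  have hc : Continuous fun z : Mat × Plane => plusTranspose z.1 z.2 :=
    continuous_plusTranspose_apply continuous_fst continuous_snd
  have h1 := (hc.tendsto (A₀, v₀)).comp (hA.prodMk_nhds hv)
  simpa only [Function.comp_def] using h1

lemma IsX0.stokesFlux (hu : IsX1 O u) (hp : IsX0 O p) (hφ : ContDiff ℝ 2 φ) :
    IsX0 O (stokesFlux m u p φ) := by
  have h1 : IsX0 O φ := IsX0.of_continuous hφ.continuous
  have h2 : IsX0 O (fderiv ℝ φ) := IsX0.of_continuous (hφ.continuous_fderiv (by norm_num))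
  have h3 : IsX0 O fun x => stress m (fderiv ℝ u x) (p x) (φ x) := by
    refine IsX0.comp₂ (IsX0.comp₂ hu.2.2 hp continuous_id) h1
      (c := fun z : (Mat × ℝ) × Plane => stress m z.1.1 z.1.2 z.2) ?_
    have := continuous_plusTranspose_apply (A := fun z : (Mat × ℝ) × Plane => z.1.1)
      (v := fun z => z.2) (by fun_prop) (by fun_prop)
    simp only [stress, sub_apply, smul_apply, ContinuousLinearMap.id_apply]
    fun_prop
  have h4 : IsX0 O fun x => plusTranspose (fderiv ℝ φ x) (u x) :=
    IsX0.comp₂ h2 hu.2.1 (c := fun z : Mat × Plane => plusTranspose z.1 z.2)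
      (continuous_plusTranspose_apply continuous_fst continuous_snd)
  exact IsX0.comp₂ h3 h4 (c := fun z : Plane × Plane => z.1 - m • z.2) (by fun_prop)

lemma extendFrom_stokesFlux (hu : IsX1 O u) (hp : IsX0 O p) (hφ : ContDiff ℝ 2 φ) {x : Plane}
    (hx : x ∈ closure O) :
    extendFrom O (stokesFlux m u p φ) x = stressFrom m O u p x (φ x)
      - m • plusTranspose (fderiv ℝ φ x) (extendFrom O u x) := by
  refine extendFrom_eq_of_tendsto hx ?_
  have h1 := hu.2.2.tendsto_extendFrom hx
  have h2 := hu.2.1.tendsto_extendFrom hx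
  have h3 := hp.tendsto_extendFrom hx
  have h4 : Tendsto φ (𝓝[O] x) (𝓝 (φ x)) := hφ.continuous.continuousAt.mono_left nhdsWithin_le_nhds
  have h5 : Tendsto (fderiv ℝ φ) (𝓝[O] x) (𝓝 (fderiv ℝ φ x)) :=
    (hφ.continuous_fderiv (by norm_num)).continuousAt.mono_left nhdsWithin_le_nhds
  have h6 : Tendsto (fun y => stress m (fderiv ℝ u y) (p y) (φ y)) (𝓝[O] x)
      (𝓝 (stressFrom m O u p x (φ x))) := by
    simp only [stress, stressFrom, sub_apply, smul_apply, ContinuousLinearMap.id_apply]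
    exact ((tendsto_plusTranspose_apply h1 h4).const_smul m).sub (h3.smul h4)
  have h7 : Tendsto (fun y => m • plusTranspose (fderiv ℝ φ y) (u y)) (𝓝[O] x)
      (𝓝 (m • plusTranspose (fderiv ℝ φ x) (extendFrom O u x))) :=
    (tendsto_plusTranspose_apply h5 h2).const_smul m
  exact h6.sub h7

end Flux

lemma divSym_eq {φ : Plane → Plane} {x : Plane} (hφ : ContDiffAt ℝ 2 φ x) :
    divSym φ x = fderiv ℝ (fderiv ℝ φ) x (basisVec 0) (basisVec 0)
      + fderiv ℝ (fderiv ℝ φ) x (basisVec 1) (basisVec 1)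
      + ∑ i, (fderiv ℝ (fderiv ℝ φ) x (basisVec i) (basisVec 0) 0
      + fderiv ℝ (fderiv ℝ φ) x (basisVec i) (basisVec 1) 1) • basisVec i := by
  rw [divSym, laplacian_eq_coord]
  congr 1
  apply plane_ext <;> simp [gradient_apply, fderiv_divergence hφ, Fin.sum_univ_two]

lemma continuousOn_divSym {O : Set Plane} (hO : IsOpen O) {φ : Plane → Plane}
    (hφ : ContDiffOn ℝ 2 φ O) : ContinuousOn (divSym φ) O := by
  have h2 : ContinuousOn (fderiv ℝ (fderiv ℝ φ)) O :=
    (hφ.fderiv_of_isOpen hO (m := 1) (by norm_num)).continuousOn_fderiv_of_isOpen hO (by norm_num)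
  refine ContinuousOn.congr ?_ fun x hx => divSym_eq (hφ.contDiffAt (hO.mem_nhds hx))
  fun_prop

lemma continuous_divSym {φ : Plane → Plane} (hφ : ContDiff ℝ 2 φ) : Continuous (divSym φ) :=
  continuousOn_univ.1 (continuousOn_divSym isOpen_univ hφ.contDiffOn)

lemma continuous_divergence {φ : Plane → Plane} (hφ : ContDiff ℝ 1 φ) :
    Continuous (divergence φ) := by
  simp only [funext (divergence_eq_tr φ)]
  exact continuous_tr.comp (hφ.continuous_fderiv (by norm_num))

/-- Test fields of class `C²`. Smooth test fields would not suffice, because test fields built from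
the defining functions of the boundary `∂D` are only of class `C²`. -/
structure IsTest2 (D : Set Plane) (φ : Plane → Plane) : Prop where
  contDiff : ContDiff ℝ 2 φ
  compact : HasCompactSupport φ
  subset : tsupport φ ⊆ D

lemma IsTest2.eq_zero {D : Set Plane} {φ : Plane → Plane} (_hφ : IsTest2 D φ) {x : Plane}
    (hx : x ∉ tsupport φ) : φ x = 0 ∧ fderiv ℝ φ x = 0 ∧ divergence φ x = 0 ∧ divSym φ x = 0 := by
  have h0 : φ =ᶠ[𝓝 x] 0 := notMem_tsupport_iff_eventuallyEq.1 hx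
  have h1 : fderiv ℝ φ =ᶠ[𝓝 x] 0 := by
    filter_upwards [h0.eventuallyEq_nhds] with y hy
    rw [hy.fderiv_eq]; simp
  have h2 : divergence φ =ᶠ[𝓝 x] 0 := by
    filter_upwards [h1] with y hy
    simp [divergence, hy]
  refine ⟨h0.self_of_nhds, h1.self_of_nhds, h2.self_of_nhds, ?_⟩
  rw [divSym, laplacian_eq_coord, h1.fderiv_eq, gradient, h2.fderiv_eq]
  simp

section Weak

variable {D D₁ Ω₃ : Set Plane} {Γ : ℝ → Plane} {L : ℝ} {h : ℝ → ℝ} {a : ℝ} {S : Plane → ℝ}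

lemma extendFrom_eq_of_continuousOn_closure {F : Type*} [TopologicalSpace F] [T2Space F]
    {O : Set Plane} {f : Plane → F} {x : Plane} (hO : O ⊆ D) (hf : ContinuousOn f (closure D))
    (hx : x ∈ closure O) : extendFrom O f x = f x :=
  extendFrom_eq_of_tendsto hx
    ((hf x (closure_mono hO hx)).mono_left (nhdsWithin_mono x (hO.trans subset_closure)))

lemma integrableOn_of_isX0 (hg : Geometry D D₁ Ω₃ Γ L h) {O : Set Plane} (hO : IsOpen O)
    (hOD : O ⊆ D) {f : Plane → ℝ} (hf : IsX0 O f) : IntegrableOn f O := by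
  have hb := hg.bounded_D.subset hOD
  obtain ⟨C, -, hC⟩ := hf.exists_bound hb
  exact integrableOn_of_bounded hb hO.measurableSet
    (hf.continuousOn.aestronglyMeasurable hO.measurableSet) hC

lemma integrableOn_of_continuousOn_closure (hg : Geometry D D₁ Ω₃ Γ L h) {f : Plane → ℝ}
    (hf : ContinuousOn f (closure D)) : IntegrableOn f D :=
  (hf.integrableOn_compact hg.bounded_D.isCompact_closure).mono_set subset_closure

/-- The jump of `∫ M w ⬝ n` between the two interfaces, where `M = ∇φ + ∇φᵀ`. -/
def jumpPairing (Γ : ℝ → Plane) (L : ℝ) (h : ℝ → ℝ) (φ w : Plane → Plane) (ε : ℝ) : ℝ :=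
  ∫ ξ in (0 : ℝ)..L,
    (inner ℝ (plusTranspose (fderiv ℝ φ (gammaEps Γ h ε ξ)) (w (gammaEps Γ h ε ξ)))
        (coNormal Γ h ε ξ)
      - inner ℝ (plusTranspose (fderiv ℝ φ (Γ ξ)) (w (Γ ξ))) (coNormal Γ h 0 ξ))

lemma gammaEps_mem_D (T : Tube D D₁ Ω₃ Γ L h a S) {ε : ℝ} (hε0 : 0 < ε) (hε : ε < a) (ξ : ℝ) :
    gammaEps Γ h ε ξ ∈ D := T.mem_D ε ξ (by rwa [abs_of_pos hε0])

lemma gamma_mem_D (hg : Geometry D D₁ Ω₃ Γ L h) (ξ : ℝ) : Γ ξ ∈ D :=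
  hg.range_subset (mem_range_self ξ)

lemma continuous_comp_gammaEps (hg : Geometry D D₁ Ω₃ Γ L h) (T : Tube D D₁ Ω₃ Γ L h a S)
    {F : Type*} [TopologicalSpace F] {w : Plane → F}
    (hw : ContinuousOn w (closure D)) {ε : ℝ} (hε0 : 0 ≤ ε) (hε : ε < a) :
    Continuous fun ξ => w (gammaEps Γ h ε ξ) :=
  hw.comp_continuous ((continuous_gammaEps hg.smooth_Γ hg.smooth_h).comp
    (f := fun ξ : ℝ => (ε, ξ)) (by fun_prop))
    fun ξ => subset_closure (T.mem_D ε ξ (by rwa [abs_of_nonneg hε0]))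

lemma continuous_jump_integrand (hg : Geometry D D₁ Ω₃ Γ L h) (T : Tube D D₁ Ω₃ Γ L h a S)
    {φ w : Plane → Plane} (hφ : ContDiff ℝ 2 φ) (hw : ContinuousOn w (closure D)) {ε : ℝ}
    (hε0 : 0 ≤ ε) (hε : ε < a) :
    Continuous fun ξ =>
      inner ℝ (plusTranspose (fderiv ℝ φ (gammaEps Γ h ε ξ)) (w (gammaEps Γ h ε ξ)))
        (coNormal Γ h ε ξ) := by
  have h1 := continuous_comp_gammaEps hg T hw hε0 hε
  have h2 := continuous_comp_gammaEps hg T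
    (hφ.continuous_fderiv (by norm_num)).continuousOn hε0 hε
  exact (continuous_plusTranspose_apply h2 h1).inner
    ((continuous_coNormal hg.smooth_Γ hg.smooth_h).comp (f := fun ξ : ℝ => (ε, ξ)) (by fun_prop))

lemma continuous_jump_integrand_zero (hg : Geometry D D₁ Ω₃ Γ L h) (T : Tube D D₁ Ω₃ Γ L h a S)
    {φ w : Plane → Plane} (hφ : ContDiff ℝ 2 φ) (hw : ContinuousOn w (closure D)) :
    Continuous fun ξ =>
      inner ℝ (plusTranspose (fderiv ℝ φ (Γ ξ)) (w (Γ ξ))) (coNormal Γ h 0 ξ) := by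
  have := continuous_jump_integrand hg T hφ hw le_rfl T.pos
  simpa only [gammaEps_zero] using this

/-- The weak form of the two-fluid Stokes problem, with all derivatives on the test field. -/
theorem IsTwoFluidSolution.weak_form {μ μ₂ ε : ℝ} {U u : Plane → Plane} {p : Plane → ℝ}
    (hg : Geometry D D₁ Ω₃ Γ L h) (T : Tube D D₁ Ω₃ Γ L h a S)
    (hs : IsTwoFluidSolution μ μ₂ D D₁ Ω₃ Γ h U ε u p) (hε0 : 0 < ε) (hε : ε < a)
    {φ : Plane → Plane} (hφ : IsTest2 D φ) :
    IntegrableOn (fun x => p x * divergence φ x) D ∧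
    (∫ x in D, p x * divergence φ x) + μ * (∫ x in D, inner ℝ (u x) (divSym φ x))
      + (μ₂ - μ) * ∫ x in layer Γ h ε, inner ℝ (u x) (divSym φ x) =
    -(∫ ξ in (0 : ℝ)..L, curv Γ ξ * inner ℝ (normal Γ ξ) (φ (Γ ξ)))
      - (∫ ξ in (0 : ℝ)..L, tension Γ h φ ε ξ) + (μ₂ - μ) * jumpPairing Γ L h φ u ε := by
  have o₁ := isOpen_omega1 hg T hε0 hε
  have o₂ := isOpen_layer hg T hε
  have o₃ := hg.isOpen_Ω₃
  have s₁ : omega1 D₁ Γ h ε ⊆ D := (omega1_subset_D₁ ε).trans (D₁_subset hg)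
  have s₂ : layer Γ h ε ⊆ D := (layer_subset_D₁ hg T hε).trans (D₁_subset hg)
  have s₃ : Ω₃ ⊆ D := Ω₃_subset hg
  have cE := continuous_divSym hφ.contDiff
  have cd := continuous_divergence (hφ.contDiff.of_le (by norm_num))
  have hreg : ∀ {O : Set Plane} {m : ℝ}, IsOpen O → O ⊆ D → RegularIn O u p → StokesIn m O u p →
      ContDiffOn ℝ 1 (stokesFlux m u p φ) O ∧ IntegrableOn (fun x => p x * divergence φ x) O ∧
      IntegrableOn (fun x => inner ℝ (u x) (divSym φ x)) O ∧
      IntegrableOn (divergence (stokesFlux m u p φ)) O ∧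
      ∫ x in O, divergence (stokesFlux m u p φ) x
        = -(∫ x in O, p x * divergence φ x) - m * ∫ x in O, inner ℝ (u x) (divSym φ x) := by
    intro O m hO hOD hr hst
    have i1 : IntegrableOn (fun x => p x * divergence φ x) O :=
      integrableOn_of_isX0 hg hO hOD (hr.2.2.2.comp₂ (IsX0.of_continuous cd)
        (c := fun z : ℝ × ℝ => z.1 * z.2) (by fun_prop))
    have i2 : IntegrableOn (fun x => inner ℝ (u x) (divSym φ x)) O :=
      integrableOn_of_isX0 hg hO hOD (hr.2.1.2.1.comp₂ (IsX0.of_continuous cE)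
        (c := fun z : Plane × Plane => inner ℝ z.1 z.2) (by fun_prop))
    have i1' : IntegrableOn (fun x => -(p x * divergence φ x)) O := i1.neg
    have he : EqOn (divergence (stokesFlux m u p φ))
        (fun x => -(p x * divergence φ x) - m * inner ℝ (u x) (divSym φ x)) O := fun x hx => by
      rw [divergence_stokesFlux_of_stokesIn hO hr.1 hr.2.2.1 hφ.contDiff hst hx]; ring
    refine ⟨fun x hx => (ContDiffAt.stokesFlux (hr.1.contDiffAt (hO.mem_nhds hx))
      (hr.2.2.1.contDiffAt (hO.mem_nhds hx)) hφ.contDiff.contDiffAt).contDiffWithinAt, i1, i2,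
      (integrableOn_congr_fun he hO.measurableSet).2 (i1'.sub (i2.const_mul m)), ?_⟩
    rw [setIntegral_congr_fun hO.measurableSet he, integral_sub i1' (i2.const_mul m),
      integral_neg, integral_const_mul]
  obtain ⟨c₁, p₁, e₁, d₁, f₁⟩ := hreg o₁ s₁ hs.regular₁ hs.stokes₁
  obtain ⟨c₂, p₂, e₂, d₂, f₂⟩ := hreg o₂ s₂ hs.regular₂ hs.stokes₂
  obtain ⟨c₃, p₃, e₃, d₃, f₃⟩ := hreg o₃ s₃ hs.regular₃ hs.stokes₃
  have hz : ∀ m, ∀ x ∉ tsupport φ, stokesFlux m u p φ x = 0 := fun m x hx => by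
    obtain ⟨h0, h1, -⟩ := hφ.eq_zero hx
    rw [stokesFlux, h0, h1, ← plusTransposeL_apply, map_zero, map_zero]; simp
  have key := divergence_theorem_pieces hg T hε0 hε c₁ c₂ c₃
    (IsX0.stokesFlux hs.regular₁.2.1 hs.regular₁.2.2.2 hφ.contDiff)
    (IsX0.stokesFlux hs.regular₂.2.1 hs.regular₂.2.2.2 hφ.contDiff)
    (IsX0.stokesFlux hs.regular₃.2.1 hs.regular₃.2.2.2 hφ.contDiff)
    d₁ d₂ d₃ hφ.compact hφ.subset (hz _) (hz _) (hz _)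
  obtain ⟨ip, sp⟩ := setIntegral_split hg T hε0 hε p₃ p₂ p₁
  obtain ⟨-, se⟩ := setIntegral_split hg T hε0 hε e₃ e₂ e₁
  refine ⟨ip, ?_⟩
  have hs0 : ∀ s ξ, |s| < a → 0 < 1 + s * h ξ * curv Γ ξ := fun s ξ hs =>
    (pos_iff_pos_of_mul_pos (T.jac_pos s ξ hs)).1 (hg.pos_h ξ)
  -- The fluxes jump by the prescribed stress jumps and, since `u` is continuous, by the viscosity
  -- contrast times `(∇φ + ∇φᵀ) u`.
  have j0 : ∀ ξ, inner ℝ (extendFrom (layer Γ h ε) (stokesFlux μ₂ u p φ) (Γ ξ)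
      - extendFrom Ω₃ (stokesFlux μ u p φ) (Γ ξ)) (coNormal Γ h 0 ξ)
      = -(curv Γ ξ * inner ℝ (normal Γ ξ) (φ (Γ ξ))) - (μ₂ - μ) *
        inner ℝ (plusTranspose (fderiv ℝ φ (Γ ξ)) (u (Γ ξ))) (coNormal Γ h 0 ξ) := by
    intro ξ
    have m2 := gamma_mem_closure_layer hg T hε0 hε ξ
    have m3 := gamma_mem_closure_Ω₃ hg T ξ
    rw [extendFrom_stokesFlux hs.regular₂.2.1 hs.regular₂.2.2.2 hφ.contDiff m2,
      extendFrom_stokesFlux hs.regular₃.2.1 hs.regular₃.2.2.2 hφ.contDiff m3,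
      extendFrom_eq_of_continuousOn_closure s₂ hs.continuous_u m2,
      extendFrom_eq_of_continuousOn_closure s₃ hs.continuous_u m3]
    have hp := congrArg (fun v => inner ℝ (φ (Γ ξ)) v) (hs.stress_plus ξ)
    simp only [sub_apply, inner_sub_right, inner_smul_right] at hp
    simp only [stressFrom] at hp ⊢
    simp only [coNormal_zero, inner_neg_right, inner_sub_left, inner_stress_comm, inner_smul_left,
      conj_trivial]
    rw [real_inner_comm (φ (Γ ξ)) (normal Γ ξ)]
    linear_combination hp
  have j1 : ∀ ξ, inner ℝ (extendFrom (omega1 D₁ Γ h ε) (stokesFlux μ u p φ) (gammaEps Γ h ε ξ)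
      - extendFrom (layer Γ h ε) (stokesFlux μ₂ u p φ) (gammaEps Γ h ε ξ)) (coNormal Γ h ε ξ)
      = -tension Γ h φ ε ξ + (μ₂ - μ) * inner ℝ (plusTranspose
        (fderiv ℝ φ (gammaEps Γ h ε ξ)) (u (gammaEps Γ h ε ξ))) (coNormal Γ h ε ξ) := by
    intro ξ
    have m2 := gammaEps_mem_closure_layer hg T hε0 hε ξ
    have m1 := gammaEps_mem_closure_omega1 hg T hε0 hε ξ
    have hpos := hs0 ε ξ (by rwa [abs_of_pos hε0])
    rw [extendFrom_stokesFlux hs.regular₂.2.1 hs.regular₂.2.2.2 hφ.contDiff m2,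
      extendFrom_stokesFlux hs.regular₁.2.1 hs.regular₁.2.2.2 hφ.contDiff m1,
      extendFrom_eq_of_continuousOn_closure s₂ hs.continuous_u m2,
      extendFrom_eq_of_continuousOn_closure s₁ hs.continuous_u m1,
      ← curvEps_mul_inner_coNormal hg.smooth_Γ hg.unit_speed hg.smooth_h φ hpos,
      coNormal_eq_norm_smul_normalEps hg.smooth_Γ hg.unit_speed hg.smooth_h hpos]
    have hp := congrArg (fun v => inner ℝ (φ (gammaEps Γ h ε ξ)) v) (hs.stress_minus ξ)
    simp only [sub_apply, inner_sub_right, inner_smul_right] at hp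
    simp only [stressFrom] at hp ⊢
    simp only [inner_smul_right, inner_sub_left, inner_stress_comm, inner_smul_left,
      conj_trivial]
    linear_combination (-‖velocityEps Γ h ε ξ‖) * hp
  have ct := continuous_tension hg.smooth_Γ hg.smooth_h hφ.contDiff.continuous
    fun ξ => hs0 ε ξ (by rwa [abs_of_pos hε0])
  have cJ := continuous_jump_integrand hg T hφ.contDiff hs.continuous_u hε0.le hε
  have cJ0 := continuous_jump_integrand_zero hg T hφ.contDiff hs.continuous_u
  have cκ : Continuous fun ξ => curv Γ ξ * inner ℝ (normal Γ ξ) (φ (Γ ξ)) :=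
    (contDiff_curv hg.smooth_Γ).continuous.mul ((contDiff_normal hg.smooth_Γ).continuous.inner
      (hφ.contDiff.continuous.comp hg.smooth_Γ.continuous))
  have cκ' : Continuous fun ξ => -(curv Γ ξ * inner ℝ (normal Γ ξ) (φ (Γ ξ))) := cκ.neg
  have ct' : Continuous fun ξ => -tension Γ h φ ε ξ := ct.neg
  have k0 : ∫ ξ in (0 : ℝ)..L, (-(curv Γ ξ * inner ℝ (normal Γ ξ) (φ (Γ ξ))) - (μ₂ - μ) *
        inner ℝ (plusTranspose (fderiv ℝ φ (Γ ξ)) (u (Γ ξ))) (coNormal Γ h 0 ξ))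
      = -(∫ ξ in (0 : ℝ)..L, curv Γ ξ * inner ℝ (normal Γ ξ) (φ (Γ ξ))) - (μ₂ - μ) *
        ∫ ξ in (0 : ℝ)..L,
          inner ℝ (plusTranspose (fderiv ℝ φ (Γ ξ)) (u (Γ ξ))) (coNormal Γ h 0 ξ) := by
    rw [intervalIntegral.integral_sub (cκ'.intervalIntegrable _ _)
      ((cJ0.const_mul _).intervalIntegrable _ _), intervalIntegral.integral_neg,
      intervalIntegral.integral_const_mul]
  have k1 : ∫ ξ in (0 : ℝ)..L, (-tension Γ h φ ε ξ + (μ₂ - μ) * inner ℝ (plusTranspose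
        (fderiv ℝ φ (gammaEps Γ h ε ξ)) (u (gammaEps Γ h ε ξ))) (coNormal Γ h ε ξ))
      = -(∫ ξ in (0 : ℝ)..L, tension Γ h φ ε ξ) + (μ₂ - μ) *
        ∫ ξ in (0 : ℝ)..L, inner ℝ (plusTranspose
        (fderiv ℝ φ (gammaEps Γ h ε ξ)) (u (gammaEps Γ h ε ξ))) (coNormal Γ h ε ξ) := by
    rw [intervalIntegral.integral_add (ct'.intervalIntegrable _ _)
      ((cJ.const_mul _).intervalIntegrable _ _), intervalIntegral.integral_neg,
      intervalIntegral.integral_const_mul]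
  rw [intervalIntegral.integral_congr fun ξ _ => j0 ξ,
    intervalIntegral.integral_congr fun ξ _ => j1 ξ, k0, k1, f₁, f₂, f₃] at key
  rw [jumpPairing, intervalIntegral.integral_sub (cJ.intervalIntegrable _ _)
    (cJ0.intervalIntegrable _ _), sp, se]
  linear_combination -key

end Weak

/-- The first Green identity: `∇ ⬝ ((∇φ + ∇φᵀ) w) = ∇w : (∇φ + ∇φᵀ) + w ⬝ (Δφ + ∇(∇ ⬝ φ))`. -/
lemma divergence_plusTranspose_apply {φ w : Plane → Plane} {x : Plane} (hφ : ContDiffAt ℝ 2 φ x)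
    (hw : ContDiffAt ℝ 1 w x) :
    divergence (fun y => plusTranspose (fderiv ℝ φ y) (w y)) x
      = frob (fderiv ℝ w x) (plusTranspose (fderiv ℝ φ x)) + inner ℝ (w x) (divSym φ x) := by
  have h2 : HasFDerivAt (fderiv ℝ φ) (fderiv ℝ (fderiv ℝ φ) x) x :=
    ((hφ.fderiv_right (m := 1) (by norm_num)).differentiableAt (by norm_num)).hasFDerivAt
  have hwd := (hw.differentiableAt (by norm_num)).hasFDerivAt
  have h3 := ((plusTransposeL.hasFDerivAt.comp x h2).clm_apply hwd)
  have h4 : fderiv ℝ (fun y => plusTranspose (fderiv ℝ φ y) (w y)) x = _ := h3.fderiv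
  have hsymm : ∀ v v', fderiv ℝ (fderiv ℝ φ) x v v' = fderiv ℝ (fderiv ℝ φ) x v' v := fun v v' =>
    (hφ.isSymmSndFDerivAt (by simp)).eq v v'
  rw [divergence_eq_tr, h4, frob_plusTranspose, inner_eq_coord]
  have e : ∀ i, divSym φ x i = fderiv ℝ (fderiv ℝ φ) x (basisVec 0) (basisVec 0) i
      + fderiv ℝ (fderiv ℝ φ) x (basisVec 1) (basisVec 1) i
      + (fderiv ℝ (fderiv ℝ φ) x (basisVec i) (basisVec 0) 0
      + fderiv ℝ (fderiv ℝ φ) x (basisVec i) (basisVec 1) 1) := fun i => by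
    rw [divSym, laplacian_eq_coord, PiLp.add_apply, PiLp.add_apply, gradient_apply,
      fderiv_divergence hφ]
  simp only [tr, add_apply, ContinuousLinearMap.comp_apply, ContinuousLinearMap.flip_apply,
    Function.comp_apply, plusTransposeL_apply, PiLp.add_apply, plusTranspose_apply_coord, e]
  rw [hsymm (basisVec 1) (basisVec 0)]
  ring

lemma divergence_smul {ψ : Plane → ℝ} {w : Plane → Plane} {x : Plane}
    (hψ : DifferentiableAt ℝ ψ x) (hw : DifferentiableAt ℝ w x) :
    divergence (fun y => ψ y • w y) x = ψ x * divergence w x + inner ℝ (w x) (gradient ψ x) := by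
  have h : fderiv ℝ (fun y => ψ y • w y) x = _ := (hψ.hasFDerivAt.smul hw.hasFDerivAt).fderiv
  rw [divergence_eq_tr, divergence_eq_tr, h, real_inner_comm, inner_gradient, map_eq_coord]
  simp [tr]
  ring

section Weak

variable {D D₁ Ω₃ : Set Plane} {Γ : ℝ → Plane} {L : ℝ} {h : ℝ → ℝ} {a : ℝ} {S : Plane → ℝ}

lemma isX0_frob {O : Set Plane} {w φ : Plane → Plane} (hw : IsX1 O w) (hφ : ContDiff ℝ 2 φ) :
    IsX0 O fun x => frob (fderiv ℝ w x) (plusTranspose (fderiv ℝ φ x)) := by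
  have hc : Continuous fun z : Mat × Mat => frob z.1 (plusTranspose z.2) := by
    simp only [frob_plusTranspose]; fun_prop
  exact hw.2.2.comp₂ (IsX0.of_continuous (hφ.continuous_fderiv (by norm_num))) hc

lemma isX0_inner {O : Set Plane} {w E : Plane → Plane} (hw : IsX0 O w) (hE : Continuous E) :
    IsX0 O fun x => inner ℝ (w x) (E x) :=
  hw.comp₂ (IsX0.of_continuous hE) (c := fun z : Plane × Plane => inner ℝ z.1 z.2) (by fun_prop)

/-- The jump pairing of a field that is smooth in the layer, as an integral over the layer. -/
lemma jumpPairing_eq (hg : Geometry D D₁ Ω₃ Γ L h) (T : Tube D D₁ Ω₃ Γ L h a S) {ε : ℝ}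
    (hε0 : 0 < ε) (hε : ε < a) {w φ : Plane → Plane} (hwc : ContinuousOn w (closure D))
    (hw : IsX1 D₁ w) (hφ : IsTest2 D φ) :
    jumpPairing Γ L h φ w ε = (∫ x in layer Γ h ε,
      frob (fderiv ℝ w x) (plusTranspose (fderiv ℝ φ x)))
      + ∫ x in layer Γ h ε, inner ℝ (w x) (divSym φ x) := by
  have o₂ := isOpen_layer hg T hε
  have s₁ := layer_subset_D₁ hg T hε
  have s₂ : layer Γ h ε ⊆ D := s₁.trans (D₁_subset hg)
  have hw₂ : IsX1 (layer Γ h ε) w := ⟨hw.1.mono s₁, hw.2.1.mono s₁, hw.2.2.mono s₁⟩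
  have cE := continuous_divSym hφ.contDiff
  set F : Plane → Plane := fun y => plusTranspose (fderiv ℝ φ y) (w y) with hF
  have he : EqOn (divergence F) (fun x => frob (fderiv ℝ w x) (plusTranspose (fderiv ℝ φ x))
      + inner ℝ (w x) (divSym φ x)) (layer Γ h ε) := fun x hx =>
    divergence_plusTranspose_apply hφ.contDiff.contDiffAt (hw₂.1.contDiffAt (o₂.mem_nhds hx))
  have i1 := integrableOn_of_isX0 hg o₂ s₂ (isX0_frob hw₂ hφ.contDiff)
  have i2 := integrableOn_of_isX0 hg o₂ s₂ (isX0_inner hw₂.2.1 cE)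
  have cM : ContDiff ℝ 1 (fun y => plusTransposeL (fderiv ℝ φ y)) :=
    plusTransposeL.contDiff.comp (hφ.contDiff.fderiv_right (by norm_num))
  have cF : ContDiffOn ℝ 1 F (layer Γ h ε) := cM.contDiffOn.clm_apply hw₂.1
  have xF : IsX0 (layer Γ h ε) F := IsX0.comp₂ (IsX0.of_continuous
    (hφ.contDiff.continuous_fderiv (by norm_num))) hw₂.2.1
    (c := fun z : Mat × Plane => plusTranspose z.1 z.2)
    (continuous_plusTranspose_apply continuous_fst continuous_snd)
  have d0 : divergence (fun _ : Plane => (0 : Plane)) = fun _ => 0 := by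
    ext1 x; simp [divergence]
  have x0 : ∀ O : Set Plane, IsX0 O (fun _ : Plane => (0 : Plane)) := fun O =>
    IsX0.of_continuous continuous_const
  have e0 : ∀ (O : Set Plane), ∀ x ∈ closure O, extendFrom O (fun _ : Plane => (0 : Plane)) x = 0 :=
    fun O x hx => extendFrom_eq_of_tendsto hx tendsto_const_nhds
  have i0 : ∀ O : Set Plane, IntegrableOn (divergence (fun _ : Plane => (0 : Plane))) O :=
    fun O => by rw [d0]; exact integrableOn_zero
  -- the divergence theorem for the field that equals `F` in the layer and vanishes outside
  have key := divergence_theorem_pieces hg T hε0 hε contDiffOn_const cF contDiffOn_const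
    (x0 _) xF (x0 _) (i0 _) ((integrableOn_congr_fun he o₂.measurableSet).2 (i1.add i2)) (i0 _)
    hφ.compact hφ.subset (fun _ _ => rfl)
    (fun x hx => by
      simp only [hF]
      rw [(hφ.eq_zero hx).2.1, ← plusTransposeL_apply, map_zero]; simp) (fun _ _ => rfl)
  have cx : ContinuousOn F (closure D) := by
    have : ContinuousOn (fun y => plusTransposeL (fderiv ℝ φ y) (w y)) (closure D) :=
      cM.continuous.continuousOn.clm_apply hwc
    exact this
  rw [d0, integral_zero, integral_zero, zero_add, add_zero,
    setIntegral_congr_fun o₂.measurableSet he, integral_add i1 i2] at key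
  rw [key, jumpPairing, intervalIntegral.integral_sub
    ((continuous_jump_integrand hg T hφ.contDiff hwc hε0.le hε).intervalIntegrable _ _)
    ((continuous_jump_integrand_zero hg T hφ.contDiff hwc).intervalIntegrable _ _)]
  have a1 : ∀ ξ, extendFrom (layer Γ h ε) F (Γ ξ)
      - extendFrom Ω₃ (fun _ : Plane => (0 : Plane)) (Γ ξ) = F (Γ ξ) := fun ξ => by
    rw [e0 _ _ (gamma_mem_closure_Ω₃ hg T ξ), sub_zero,
      extendFrom_eq_of_continuousOn_closure s₂ cx (gamma_mem_closure_layer hg T hε0 hε ξ)]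
  have a2 : ∀ ξ, extendFrom (omega1 D₁ Γ h ε) (fun _ : Plane => (0 : Plane)) (gammaEps Γ h ε ξ)
      - extendFrom (layer Γ h ε) F (gammaEps Γ h ε ξ) = -F (gammaEps Γ h ε ξ) := fun ξ => by
    rw [e0 _ _ (gammaEps_mem_closure_omega1 hg T hε0 hε ξ), zero_sub,
      extendFrom_eq_of_continuousOn_closure s₂ cx (gammaEps_mem_closure_layer hg T hε0 hε ξ)]
  simp only [a1, a2, inner_neg_left, intervalIntegral.integral_neg]
  simp only [hF]
  ring

/-- The velocity is divergence free in the sense of distributions in `D`. -/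
theorem IsTwoFluidSolution.integral_inner_gradient {μ μ₂ ε : ℝ} {U u : Plane → Plane}
    {p : Plane → ℝ} (hg : Geometry D D₁ Ω₃ Γ L h) (T : Tube D D₁ Ω₃ Γ L h a S)
    (hs : IsTwoFluidSolution μ μ₂ D D₁ Ω₃ Γ h U ε u p) (hε0 : 0 < ε) (hε : ε < a)
    {ψ : Plane → ℝ} (hψ : ContDiff ℝ 1 ψ) (hc : HasCompactSupport ψ) (hsub : tsupport ψ ⊆ D) :
    ∫ x in D, inner ℝ (u x) (gradient ψ x) = 0 := by
  have o₁ := isOpen_omega1 hg T hε0 hε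
  have o₂ := isOpen_layer hg T hε
  have o₃ := hg.isOpen_Ω₃
  have s₁ : omega1 D₁ Γ h ε ⊆ D := (omega1_subset_D₁ ε).trans (D₁_subset hg)
  have s₂ : layer Γ h ε ⊆ D := (layer_subset_D₁ hg T hε).trans (D₁_subset hg)
  have s₃ : Ω₃ ⊆ D := Ω₃_subset hg
  have cg : Continuous (gradient ψ) :=
    (InnerProductSpace.toDual ℝ Plane).symm.continuous.comp (hψ.continuous_fderiv (by norm_num))
  set F : Plane → Plane := fun x => ψ x • u x with hF
  have cx : ContinuousOn F (closure D) := hψ.continuous.continuousOn.smul hs.continuous_u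
  have hreg : ∀ {O : Set Plane} {m : ℝ}, IsOpen O → O ⊆ D → RegularIn O u p → StokesIn m O u p →
      ContDiffOn ℝ 1 F O ∧ IsX0 O F ∧ IntegrableOn (fun x => inner ℝ (u x) (gradient ψ x)) O ∧
      EqOn (divergence F) (fun x => inner ℝ (u x) (gradient ψ x)) O := by
    intro O m hO hOD hr hst
    refine ⟨hψ.contDiffOn.smul hr.2.1.1, IsX0.of_continuousOn cx (closure_mono hOD),
      integrableOn_of_isX0 hg hO hOD (isX0_inner hr.2.1.2.1 cg), fun x hx => ?_⟩
    rw [hF, divergence_smul (hψ.differentiable (by norm_num) x)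
      ((hr.2.1.1.contDiffAt (hO.mem_nhds hx)).differentiableAt (by norm_num)), (hst x hx).2]
    simp
  obtain ⟨c₁, x₁, i₁, e₁⟩ := hreg o₁ s₁ hs.regular₁ hs.stokes₁
  obtain ⟨c₂, x₂, i₂, e₂⟩ := hreg o₂ s₂ hs.regular₂ hs.stokes₂
  obtain ⟨c₃, x₃, i₃, e₃⟩ := hreg o₃ s₃ hs.regular₃ hs.stokes₃
  have hz : ∀ x ∉ tsupport ψ, F x = 0 := fun x hx => by
    simp [hF, image_eq_zero_of_notMem_tsupport hx]
  have key := divergence_theorem_pieces hg T hε0 hε c₁ c₂ c₃ x₁ x₂ x₃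
    ((integrableOn_congr_fun e₁ o₁.measurableSet).2 i₁)
    ((integrableOn_congr_fun e₂ o₂.measurableSet).2 i₂)
    ((integrableOn_congr_fun e₃ o₃.measurableSet).2 i₃) hc hsub hz hz hz
  rw [setIntegral_congr_fun o₁.measurableSet e₁, setIntegral_congr_fun o₂.measurableSet e₂,
    setIntegral_congr_fun o₃.measurableSet e₃] at key
  rw [(setIntegral_split hg T hε0 hε i₃ i₂ i₁).2, key]
  have a1 : ∀ ξ, extendFrom (layer Γ h ε) F (Γ ξ) - extendFrom Ω₃ F (Γ ξ) = 0 := fun ξ => by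
    rw [extendFrom_eq_of_continuousOn_closure s₂ cx (gamma_mem_closure_layer hg T hε0 hε ξ),
      extendFrom_eq_of_continuousOn_closure s₃ cx (gamma_mem_closure_Ω₃ hg T ξ), sub_self]
  have a2 : ∀ ξ, extendFrom (omega1 D₁ Γ h ε) F (gammaEps Γ h ε ξ)
      - extendFrom (layer Γ h ε) F (gammaEps Γ h ε ξ) = 0 := fun ξ => by
    rw [extendFrom_eq_of_continuousOn_closure s₁ cx (gammaEps_mem_closure_omega1 hg T hε0 hε ξ),
      extendFrom_eq_of_continuousOn_closure s₂ cx (gammaEps_mem_closure_layer hg T hε0 hε ξ),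
      sub_self]
  simp [a1, a2]

end Weak

/-! ### The outer and the inner expansion -/

/-- The hypotheses on the solutions for small `ε` and on their expansions. -/
structure Expansion (μ μ₂ : ℝ) (D D₁ Ω₃ : Set Plane) (Γ : ℝ → Plane) (L : ℝ) (h : ℝ → ℝ)
    (U : Plane → Plane) (u : ℝ → Plane → Plane) (p : ℝ → Plane → ℝ) (u₀ u₁ : Plane → Plane)
    (p₀ p₁ : Plane → ℝ) : Prop where
  geometry : Geometry D D₁ Ω₃ Γ L h
  sol : ∀ᶠ ε : ℝ in 𝓝[>] 0, IsTwoFluidSolution μ μ₂ D D₁ Ω₃ Γ h U ε (u ε) (p ε)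
  continuous_u₀ : ContinuousOn u₀ (closure D)
  regular₁ : RegularIn D₁ u₀ p₀
  regular₃ : RegularIn Ω₃ u₀ p₀
  isX0_u₁ : IsX0 D₁ u₁ ∧ IsX0 Ω₃ u₁
  isX0_p₁ : IsX0 D₁ p₁ ∧ IsX0 Ω₃ p₁
  bound_u : ∃ C : ℝ, ∀ᶠ ε : ℝ in 𝓝[>] 0, ∀ x ∈ D, ‖ε⁻¹ • (u ε x - u₀ x)‖ ≤ C
  lim_u : ∀ x ∈ D₁ ∪ Ω₃, Tendsto (fun ε : ℝ => ε⁻¹ • (u ε x - u₀ x)) (𝓝[>] 0) (𝓝 (u₁ x))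
  lim_p : ∀ x ∈ D₁ ∪ Ω₃, Tendsto (fun ε : ℝ => ε⁻¹ * (p ε x - p₀ x)) (𝓝[>] 0) (𝓝 (p₁ x))
  dom_p : ∃ g : Plane → ℝ, IntegrableOn g D ∧ ∀ᶠ ε : ℝ in 𝓝[>] 0,
    ∀ x ∈ omega1 D₁ Γ h ε ∪ Ω₃, |ε⁻¹ * (p ε x - p₀ x)| ≤ g x
  bound_p : ∃ C : ℝ, ∀ᶠ ε : ℝ in 𝓝[>] 0, ∀ x ∈ layer Γ h ε, |p ε x| ≤ C
  inner_expansion : ∀ ξ : ℝ, InnerConvergence μ μ₂ D₁ Ω₃ Γ h u₀ p₀ u p ξ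

section Limits

variable {D D₁ Ω₃ : Set Plane} {Γ : ℝ → Plane} {L : ℝ} {h : ℝ → ℝ} {a : ℝ} {S : Plane → ℝ}

/-- Averages over the layer converge to integrals over the curve, with weight `h`. -/
lemma tendsto_layer_integral (hg : Geometry D D₁ Ω₃ Γ L h) (T : Tube D D₁ Ω₃ Γ L h a S)
    {f : ℝ → Plane → ℝ} {f₀ : ℝ → ℝ} {C : ℝ}
    (hf : ∀ᶠ ε in 𝓝[>] 0, ContinuousOn (f ε) (layer Γ h ε))
    (hC : ∀ᶠ ε in 𝓝[>] 0, ∀ x ∈ layer Γ h ε, |f ε x| ≤ C)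
    (hl : ∀ ξ, ∀ t ∈ Ioo (0 : ℝ) 1,
      Tendsto (fun ε => f ε (gammaEps Γ h (ε * t) ξ)) (𝓝[>] 0) (𝓝 (f₀ ξ))) :
    Tendsto (fun ε => ε⁻¹ * ∫ x in layer Γ h ε, f ε x) (𝓝[>] 0)
      (𝓝 (∫ ξ in (0 : ℝ)..L, h ξ * f₀ ξ)) := by
  set A : Set ℝ := Ioo 0 1 with hAdef
  have hAm : MeasurableSet A := measurableSet_Ioo
  have hA : ∀ ε ∈ Ioo 0 a, ∀ t ∈ A, |0 + ε * t| < a := by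
    intro ε hε t ht
    rw [zero_add, abs_of_pos (mul_pos hε.1 ht.1)]
    nlinarith [hε.1, hε.2, ht.1, ht.2]
  have hlay : ∀ ε ∈ Ioo 0 a, layer Γ h ε = {x | x ∈ D ∧ ∃ t ∈ A, S x = 0 + ε * t} := by
    intro ε hε
    rw [layer_eq T hg.pos_h hε.2]
    ext x
    refine and_congr_right fun _ => ⟨fun hx => ⟨S x / ε, ⟨div_pos hx.1 hε.1,
      (div_lt_one hε.1).2 hx.2⟩, ?_⟩, ?_⟩
    · have := hε.1.ne'
      field_simp; ring
    · rintro ⟨t, ht, e⟩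
      rw [e, zero_add]
      exact ⟨mul_pos hε.1 ht.1, mul_lt_of_lt_one_right hε.1 ht.2⟩
  obtain ⟨J, hJ⟩ := ((isCompact_Icc (a := -a) (b := a)).prod
    (isCompact_Icc (a := (0 : ℝ)) (b := L))).exists_bound_of_continuousOn
    (continuous_jac hg.smooth_Γ hg.smooth_h).continuousOn
  have hmem : ∀ᶠ ε : ℝ in 𝓝[>] 0, ε ∈ Ioo 0 a := Ioo_mem_nhdsGT T.pos
  have hpt : ∀ ε ∈ Ioo 0 a, ∀ z ∈ Ico 0 L ×ˢ A, gammaEps Γ h (0 + ε * z.2) z.1 ∈ layer Γ h ε := by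
    intro ε hε z hz
    have := T.level_gammaEps_mem (ξ := z.1) (hA ε hε z.2 hz.2)
    rw [hlay ε hε]
    exact ⟨this.1, z.2, hz.2, this.2⟩
  have hmeas : MeasurableSet (Ico 0 L ×ˢ A) := measurableSet_Ico.prod hAm
  have hDCT : Tendsto (fun ε => ∫ z in Ico 0 L ×ˢ A,
      jac Γ h (0 + ε * z.2) z.1 * f ε (gammaEps Γ h (0 + ε * z.2) z.1)) (𝓝[>] 0)
      (𝓝 (∫ z in Ico 0 L ×ˢ A, h z.1 * f₀ z.1)) := by
    refine tendsto_integral_filter_of_dominated_convergence (fun _ => J * C) ?_ ?_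
      (integrableOn_const (by
        rw [Measure.volume_eq_prod, Measure.prod_prod]; simp [hAdef])) ?_
    · filter_upwards [hmem, hf] with ε hε hfε
      have hj : Continuous fun z : ℝ × ℝ => jac Γ h (0 + ε * z.2) z.1 :=
        (continuous_jac hg.smooth_Γ hg.smooth_h).comp
          (f := fun z : ℝ × ℝ => (0 + ε * z.2, z.1)) (by fun_prop)
      exact (hj.continuousOn.mul (hfε.comp (continuous_collar_arg hg 0 ε).continuousOn
        (hpt ε hε))).aestronglyMeasurable hmeas
    · filter_upwards [hmem, hC] with ε hε hCε
      filter_upwards [ae_restrict_mem hmeas] with z hz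
      rw [norm_mul]
      have h1 := hJ (0 + ε * z.2, z.1) ⟨abs_le.1 (hA ε hε z.2 hz.2).le, hz.1.1, hz.1.2.le⟩
      exact mul_le_mul h1 (hCε _ (hpt ε hε z hz)) (norm_nonneg _) ((norm_nonneg _).trans h1)
    · filter_upwards [ae_restrict_mem hmeas] with z hz
      have h1 : Tendsto (fun ε : ℝ => jac Γ h (0 + ε * z.2) z.1) (𝓝[>] 0) (𝓝 (h z.1)) := by
        have hj : Continuous fun ε : ℝ => jac Γ h (0 + ε * z.2) z.1 :=
          (continuous_jac hg.smooth_Γ hg.smooth_h).comp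
            (f := fun ε : ℝ => (0 + ε * z.2, z.1)) (by fun_prop)
        exact (hj.tendsto' 0 _ (by simp [jac_zero])).mono_left nhdsWithin_le_nhds
      have h2 := hl z.1 z.2 hz.2
      simp only [zero_add] at h1 ⊢
      exact h1.mul h2
  have hval : ∫ z in Ico 0 L ×ˢ A, h z.1 * f₀ z.1 = ∫ ξ in (0 : ℝ)..L, h ξ * f₀ ξ := by
    have := setIntegral_prod_mul (μ := volume) (ν := volume) (fun ξ => h ξ * f₀ ξ)
      (fun _ : ℝ => (1 : ℝ)) (Ico 0 L) A
    simp only [mul_one, ← Measure.volume_eq_prod] at this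
    rw [this, intervalIntegral.integral_of_le hg.period_pos.le, ← integral_Ico_eq_integral_Ioc]
    simp [hAdef]
  rw [← hval]
  refine hDCT.congr' ?_
  filter_upwards [hmem] with ε hε
  rw [hlay ε hε, (collar_change_of_variables hg T hε.1.ne' hAm (hA ε hε) (f ε)).1,
    ← integral_const_mul]
  refine setIntegral_congr_fun hmeas fun z _ => ?_
  have := hε.1.ne'
  simp only [abs_of_pos hε.1]
  field_simp

/-- Up to the null set `Γ`, the domain `D` consists of `D₁` and `Ω₃`. -/
lemma ae_mem_D₁_union_Ω₃ (hg : Geometry D D₁ Ω₃ Γ L h) (T : Tube D D₁ Ω₃ Γ L h a S) :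
    ((D₁ ∪ Ω₃ : Set Plane) =ᵐ[volume] D) := by
  have := ae_level_ne hg T (c := 0) (by simpa using T.pos)
  rw [ae_restrict_iff' hg.isOpen_D.measurableSet] at this
  rw [Ω₃_eq hg T, D₁_eq hg T]
  filter_upwards [this] with x hx
  refine propext ⟨?_, fun hxD => ?_⟩
  · rintro (hx' | hx') <;> exact hx'.1
  · rcases lt_or_gt_of_ne (hx hxD) with h0 | h0
    · exact Or.inr ⟨hxD, h0⟩
    · exact Or.inl ⟨hxD, h0⟩

lemma setIntegral_split₂ (hg : Geometry D D₁ Ω₃ Γ L h) (T : Tube D D₁ Ω₃ Γ L h a S)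
    {f : Plane → ℝ} (h1 : IntegrableOn f D₁) (h3 : IntegrableOn f Ω₃) :
    IntegrableOn f D ∧ ∫ x in D, f x = (∫ x in D₁, f x) + ∫ x in Ω₃, f x := by
  have hae := ae_mem_D₁_union_Ω₃ hg T
  refine ⟨(h1.union h3).congr_set_ae hae.symm, ?_⟩
  rw [← setIntegral_congr_set hae,
    setIntegral_union hg.disjoint_D₁_Ω₃ hg.isOpen_Ω₃.measurableSet h1 h3]

lemma integrableOn_of_isX0₂ (hg : Geometry D D₁ Ω₃ Γ L h) (T : Tube D D₁ Ω₃ Γ L h a S)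
    {f : Plane → ℝ} (h1 : IsX0 D₁ f) (h3 : IsX0 Ω₃ f) : IntegrableOn f D :=
  (setIntegral_split₂ hg T (integrableOn_of_isX0 hg hg.isOpen_D₁ (D₁_subset hg) h1)
    (integrableOn_of_isX0 hg hg.isOpen_Ω₃ (Ω₃_subset hg) h3)).1

end Limits

namespace Expansion

variable {μ μ₂ : ℝ} {D D₁ Ω₃ : Set Plane} {Γ : ℝ → Plane} {L : ℝ} {h : ℝ → ℝ}
  {U : Plane → Plane} {u : ℝ → Plane → Plane} {p : ℝ → Plane → ℝ} {u₀ u₁ : Plane → Plane}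
  {p₀ p₁ : Plane → ℝ} {a : ℝ} {S : Plane → ℝ}

lemma eventually_sol (X : Expansion μ μ₂ D D₁ Ω₃ Γ L h U u p u₀ u₁ p₀ p₁)
    (T : Tube D D₁ Ω₃ Γ L h a S) : ∀ᶠ ε : ℝ in 𝓝[>] 0, 0 < ε ∧ ε < a ∧
    IsTwoFluidSolution μ μ₂ D D₁ Ω₃ Γ h U ε (u ε) (p ε) := by
  filter_upwards [X.sol, Ioo_mem_nhdsGT T.pos] with ε h1 h2 using ⟨h2.1, h2.2, h1⟩

/-- Integrals of the rescaled velocity against a continuous field. -/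
lemma tendsto_integral_velocity (X : Expansion μ μ₂ D D₁ Ω₃ Γ L h U u p u₀ u₁ p₀ p₁)
    (T : Tube D D₁ Ω₃ Γ L h a S) {E : Plane → Plane} (hE : Continuous E) :
    Tendsto (fun ε => ε⁻¹ * ((∫ x in D, inner ℝ (u ε x) (E x)) - ∫ x in D, inner ℝ (u₀ x) (E x)))
      (𝓝[>] 0) (𝓝 (∫ x in D, inner ℝ (u₁ x) (E x))) := by
  have hg := X.geometry
  obtain ⟨C, hC⟩ := X.bound_u
  obtain ⟨N, hN⟩ := hg.bounded_D.isCompact_closure.exists_bound_of_continuousOn hE.continuousOn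
  have hint : ∀ {w : Plane → Plane}, ContinuousOn w (closure D) →
      IntegrableOn (fun x => inner ℝ (w x) (E x)) D := fun hw =>
    integrableOn_of_continuousOn_closure hg (hw.inner hE.continuousOn)
  have hDm := hg.isOpen_D.measurableSet
  have key : Tendsto (fun ε => ∫ x in D, inner ℝ (ε⁻¹ • (u ε x - u₀ x)) (E x)) (𝓝[>] 0)
      (𝓝 (∫ x in D, inner ℝ (u₁ x) (E x))) := by
    refine tendsto_integral_filter_of_dominated_convergence (fun _ => C * N) ?_ ?_
      (integrableOn_const (volume_D_lt_top hg).ne) ?_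
    · filter_upwards [X.sol] with ε hs
      exact ((((hs.continuous_u.sub X.continuous_u₀).const_smul ε⁻¹).inner
        hE.continuousOn).mono subset_closure).aestronglyMeasurable hDm
    · filter_upwards [hC] with ε hCε
      filter_upwards [ae_restrict_mem hDm] with x hx
      refine (norm_inner_le_norm _ _).trans ?_
      exact mul_le_mul (hCε x hx) (hN x (subset_closure hx)) (norm_nonneg _)
        ((norm_nonneg _).trans (hCε x hx))
    · rw [← Measure.restrict_congr_set (ae_mem_D₁_union_Ω₃ hg T)]
      filter_upwards [ae_restrict_mem (hg.isOpen_D₁.union hg.isOpen_Ω₃).measurableSet] with x hx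
      exact (X.lim_u x hx).inner tendsto_const_nhds
  refine key.congr' ?_
  filter_upwards [X.sol] with ε hs
  rw [← integral_sub (hint hs.continuous_u) (hint X.continuous_u₀), ← integral_const_mul]
  refine integral_congr_ae (Filter.Eventually.of_forall fun x => ?_)
  simp only [inner_smul_left, inner_sub_left, conj_trivial]

/-- The leading order velocity and its correction are divergence free in the sense of distributions
in `D`. -/
lemma integral_inner_gradient_u₁ (X : Expansion μ μ₂ D D₁ Ω₃ Γ L h U u p u₀ u₁ p₀ p₁)
    (T : Tube D D₁ Ω₃ Γ L h a S) {ψ : Plane → ℝ} (hψ : ContDiff ℝ 1 ψ) (hc : HasCompactSupport ψ)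
    (hsub : tsupport ψ ⊆ D) :
    ∫ x in D, inner ℝ (u₀ x) (gradient ψ x) = 0 ∧ ∫ x in D, inner ℝ (u₁ x) (gradient ψ x) = 0 := by
  have cg : Continuous (gradient ψ) :=
    (InnerProductSpace.toDual ℝ Plane).symm.continuous.comp (hψ.continuous_fderiv (by norm_num))
  have h1 := X.tendsto_integral_velocity T cg
  have h0 : ∀ᶠ ε in 𝓝[>] 0, ∫ x in D, inner ℝ (u ε x) (gradient ψ x) = 0 := by
    filter_upwards [X.eventually_sol T] with ε hs
    exact hs.2.2.integral_inner_gradient X.geometry T hs.1 hs.2.1 hψ hc hsub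
  have hz : ∫ x in D, inner ℝ (u₀ x) (gradient ψ x) = 0 := by
    -- the quotients `(0 - ∫ u₀ ⬝ ∇ψ) / ε` converge, so that their numerator vanishes
    have h2 : Tendsto (fun ε : ℝ => ε) (𝓝[>] 0) (𝓝 0) := tendsto_id.mono_left nhdsWithin_le_nhds
    have h3 := h2.mul h1
    rw [zero_mul] at h3
    have h4 : Tendsto (fun _ : ℝ => -∫ x in D, inner ℝ (u₀ x) (gradient ψ x)) (𝓝[>] 0) (𝓝 0) := by
      refine h3.congr' ?_
      filter_upwards [h0, self_mem_nhdsWithin] with ε e hε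
      have : ε ≠ 0 := (show (0 : ℝ) < ε from hε).ne'
      rw [e]; field_simp; ring
    simpa using tendsto_nhds_unique tendsto_const_nhds h4
  refine ⟨hz, tendsto_nhds_unique h1 (tendsto_const_nhds.congr' ?_)⟩
  filter_upwards [h0] with ε e
  rw [e, hz]; simp

/-- The inner pressure in the layer. -/
def layerPressure (μ μ₂ : ℝ) (D₁ Ω₃ : Set Plane) (u₀ : Plane → Plane) (p₀ : Plane → ℝ)
    (Γ : ℝ → Plane) (ξ : ℝ) : ℝ :=
  (extendFrom Ω₃ p₀ (Γ ξ) + extendFrom D₁ p₀ (Γ ξ)) / 2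
    - 2 * (μ - μ₂) * inner ℝ (normal Γ ξ) (gradFrom D₁ u₀ Γ ξ (normal Γ ξ))

lemma inner_neg_smul_normal (hg : Geometry D D₁ Ω₃ Γ L h) (r ξ : ℝ) :
    inner ℝ (-(r • normal Γ ξ)) (normal Γ ξ) = -r := by
  rw [inner_neg_left, inner_smul_left, real_inner_self_eq_norm_sq, norm_normal hg.unit_speed]
  simp

lemma gammaEps_mul (ε t ξ : ℝ) :
    gammaEps Γ h (ε * t) ξ = Γ ξ + ε • (-((t * h ξ) • normal Γ ξ)) := by
  rw [gammaEps, smul_neg, smul_smul, sub_eq_add_neg, mul_assoc]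

/-- The pressure in the layer converges to the inner pressure. -/
lemma tendsto_pressure_layer (X : Expansion μ μ₂ D D₁ Ω₃ Γ L h U u p u₀ u₁ p₀ p₁) (ξ : ℝ) {t : ℝ}
    (ht : t ∈ Ioo (0 : ℝ) 1) :
    Tendsto (fun ε => p ε (gammaEps Γ h (ε * t) ξ)) (𝓝[>] 0)
      (𝓝 (layerPressure μ μ₂ D₁ Ω₃ u₀ p₀ Γ ξ)) := by
  have hg := X.geometry
  have hh := hg.pos_h ξ
  have hy := inner_neg_smul_normal hg (t * h ξ) ξ
  have h1 : 0 < t * h ξ := mul_pos ht.1 hh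
  have h2 : t * h ξ < h ξ := mul_lt_of_lt_one_left hh ht.2
  have hc := ((X.inner_expansion ξ).2 {-((t * h ξ) • normal Γ ξ)} isCompact_singleton
    (by rintro y rfl; rw [hy]; exact ⟨by linarith, by linarith⟩)).tendsto_at (mem_singleton _)
  have hv : innerP μ μ₂ D₁ Ω₃ u₀ p₀ Γ h ξ (-((t * h ξ) • normal Γ ξ))
      = layerPressure μ μ₂ D₁ Ω₃ u₀ p₀ Γ ξ := by
    rw [innerP, hy, if_neg (by linarith), if_pos (by linarith), layerPressure]
  rw [hv] at hc
  refine hc.congr' ?_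
  filter_upwards [self_mem_nhdsWithin] with ε hε
  have : ε ≠ 0 := (show (0 : ℝ) < ε from hε).ne'
  rw [gammaEps_mul, ← mul_assoc, inv_mul_cancel₀ this, one_mul]

lemma tendsto_gammaEps_mul (X : Expansion μ μ₂ D D₁ Ω₃ Γ L h U u p u₀ u₁ p₀ p₁)
    (T : Tube D D₁ Ω₃ Γ L h a S) (ξ : ℝ) {t : ℝ} (ht : 0 < t) :
    Tendsto (fun ε => gammaEps Γ h (ε * t) ξ) (𝓝[>] 0) (𝓝[D₁] (Γ ξ)) := by
  refine (tendsto_D₁_zero X.geometry T ξ).comp (tendsto_nhdsWithin_iff.2 ⟨?_, ?_⟩)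
  · exact ((by fun_prop : Continuous fun ε : ℝ => ε * t).tendsto' 0 0 (by simp)).mono_left
      nhdsWithin_le_nhds
  · filter_upwards [self_mem_nhdsWithin] with ε hε using mul_pos hε ht

/-- The one-sided derivative of `u₀` along the path `ε ↦ Γ_ε(ξ)`, from the limit of the derivative
on the side of `D₁`. -/
lemma tendsto_slope_u₀ (X : Expansion μ μ₂ D D₁ Ω₃ Γ L h U u p u₀ u₁ p₀ p₁)
    (T : Tube D D₁ Ω₃ Γ L h a S) (ξ : ℝ) :
    Tendsto (fun ε => ε⁻¹ • (u₀ (gammaEps Γ h ε ξ) - u₀ (Γ ξ))) (𝓝[>] 0)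
      (𝓝 (-(h ξ • gradFrom D₁ u₀ Γ ξ (normal Γ ξ)))) := by
  have hg := X.geometry
  have hmem : ∀ s ∈ Ioo 0 a, gammaEps Γ h s ξ ∈ D₁ := fun s hs => by
    have := T.level_gammaEps_mem (ξ := ξ) (s := s) (by rw [abs_of_pos hs.1]; exact hs.2)
    rw [D₁_eq hg T]; exact ⟨this.1, by rw [this.2]; exact hs.1⟩
  have hd : ∀ s ∈ Ioo 0 a, HasDerivAt (fun s => u₀ (gammaEps Γ h s ξ))
      (fderiv ℝ u₀ (gammaEps Γ h s ξ) (-(h ξ • normal Γ ξ))) s := fun s hs =>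
    (((X.regular₁.2.1.1.contDiffAt (hg.isOpen_D₁.mem_nhds (hmem s hs))).differentiableAt
      (by norm_num)).hasFDerivAt).comp_hasDerivAt s (hasDerivAt_gammaEps_left s ξ)
  have hlim : Tendsto (fun s => deriv (fun s => u₀ (gammaEps Γ h s ξ)) s) (𝓝[>] 0)
      (𝓝 (gradFrom D₁ u₀ Γ ξ (-(h ξ • normal Γ ξ)))) := by
    have h1 := (X.regular₁.2.1.2.2.tendsto_extendFrom (gamma_mem_closure_D₁ hg T ξ)).comp
      (tendsto_D₁_zero hg T ξ)
    have h2 : Tendsto (fun s => fderiv ℝ u₀ (gammaEps Γ h s ξ) (-(h ξ • normal Γ ξ))) (𝓝[>] 0)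
        (𝓝 (gradFrom D₁ u₀ Γ ξ (-(h ξ • normal Γ ξ)))) :=
      ((ContinuousLinearMap.apply ℝ Plane (-(h ξ • normal Γ ξ))).continuous.tendsto _).comp h1
    refine h2.congr' ?_
    filter_upwards [Ioo_mem_nhdsGT T.pos] with s hs using (hd s hs).deriv.symm
  have hcont : ContinuousWithinAt (fun s => u₀ (gammaEps Γ h s ξ)) (Ioo 0 a) 0 := by
    have h1 := X.continuous_u₀ (Γ ξ) (subset_closure (gamma_mem_D hg ξ))
    have h2 : Tendsto (fun s => gammaEps Γ h s ξ) (𝓝[Ioo 0 a] 0) (𝓝[closure D] (Γ ξ)) := by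
      have := (tendsto_D₁_zero hg T ξ).mono_left (nhdsWithin_mono 0
        (Ioo_subset_Ioi_self : Ioo 0 a ⊆ Ioi 0))
      exact this.mono_right (nhdsWithin_mono _ ((D₁_subset hg).trans subset_closure))
    have h3 := h1.tendsto.comp h2
    rwa [ContinuousWithinAt, gammaEps_zero]
  have := hasDerivWithinAt_Ici_of_tendsto_deriv
    (fun s hs => (hd s hs).differentiableAt.differentiableWithinAt) hcont
    (Ioo_mem_nhdsGT T.pos) hlim
  have h2 := (hasDerivWithinAt_iff_tendsto_slope.1 this)
  have h3 : Ici (0 : ℝ) \ {0} = Ioi 0 := by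
    ext x; simp [lt_iff_le_and_ne, eq_comm]
  rw [h3] at h2
  rw [map_neg, map_smul] at h2
  refine h2.congr' ?_
  filter_upwards with ε
  simp [slope, gammaEps_zero]

/-- The limits of the rescaled velocity correction on the two sides of the layer. The constant `w₂`
is not determined, but the two limits differ by a known vector. -/
lemma exists_tendsto_velocity_interfaces
    (X : Expansion μ μ₂ D D₁ Ω₃ Γ L h U u p u₀ u₁ p₀ p₁) (T : Tube D D₁ Ω₃ Γ L h a S) (ξ : ℝ) :
    ∃ w₂ : Plane, Tendsto (fun ε => ε⁻¹ • (u ε (Γ ξ) - u₀ (Γ ξ))) (𝓝[>] 0) (𝓝 w₂) ∧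
      Tendsto (fun ε => ε⁻¹ • (u ε (gammaEps Γ h ε ξ) - u₀ (gammaEps Γ h ε ξ))) (𝓝[>] 0)
        (𝓝 (w₂ - h ξ • (matB2 μ μ₂ D₁ u₀ Γ ξ - gradFrom D₁ u₀ Γ ξ) (normal Γ ξ))) := by
  have hg := X.geometry
  have hh := hg.pos_h ξ
  obtain ⟨w₂, hw⟩ := (X.inner_expansion ξ).1
  refine ⟨w₂, ?_, ?_⟩
  · have hc := (hw {0} isCompact_singleton).tendsto_at (mem_singleton _)
    rw [innerV, inner_zero_left, if_neg (lt_irrefl _), if_pos (by linarith), map_zero,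
      zero_add] at hc
    simpa using hc
  · have hy := inner_neg_smul_normal hg (h ξ) ξ
    have hc := (hw {-(h ξ • normal Γ ξ)} isCompact_singleton).tendsto_at (mem_singleton _)
    rw [innerV, hy, if_neg (by linarith), if_pos le_rfl] at hc
    have := hc.sub (X.tendsto_slope_u₀ T ξ)
    refine (this.congr fun ε => ?_).trans_eq ?_
    · rw [← smul_sub]
      congr 1
      have := gammaEps_mul (Γ := Γ) (h := h) ε 1 ξ
      rw [mul_one, one_mul] at this
      rw [← this]; abel
    · congr 1
      rw [map_neg, map_smul, sub_apply, smul_sub]; abel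

/-- The jump pairing of the rescaled velocity correction, in the limit. Both interfaces approach
the same curve, with opposite orientations, so that the unknown constant of the inner velocity
cancels. -/
lemma tendsto_jumpPairing (X : Expansion μ μ₂ D D₁ Ω₃ Γ L h U u p u₀ u₁ p₀ p₁)
    (T : Tube D D₁ Ω₃ Γ L h a S) {φ : Plane → Plane} (hφ : ContDiff ℝ 2 φ) :
    Tendsto (fun ε => ε⁻¹ * (jumpPairing Γ L h φ (u ε) ε - jumpPairing Γ L h φ u₀ ε)) (𝓝[>] 0)
      (𝓝 (∫ ξ in (0 : ℝ)..L, h ξ *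
        inner ℝ ((matB2 μ μ₂ D₁ u₀ Γ ξ - gradFrom D₁ u₀ Γ ξ) (normal Γ ξ))
          (plusTranspose (fderiv ℝ φ (Γ ξ)) (normal Γ ξ)))) := by
  have hg := X.geometry
  obtain ⟨C, hC⟩ := X.bound_u
  obtain ⟨N, hN0, hN⟩ := exists_bound_coNormal hg a
  have cM : Continuous fun x => plusTransposeL (fderiv ℝ φ x) :=
    plusTransposeL.continuous.comp (hφ.continuous_fderiv (by norm_num))
  obtain ⟨M, hM⟩ := hg.bounded_D.isCompact_closure.exists_bound_of_continuousOn cM.continuousOn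
  -- the integrand, with the rescaled velocity
  set w : ℝ → Plane → Plane := fun ε x => ε⁻¹ • (u ε x - u₀ x) with hw
  set F : ℝ → ℝ → ℝ := fun ε ξ =>
    inner ℝ (plusTranspose (fderiv ℝ φ (gammaEps Γ h ε ξ)) (w ε (gammaEps Γ h ε ξ)))
        (coNormal Γ h ε ξ)
      - inner ℝ (plusTranspose (fderiv ℝ φ (Γ ξ)) (w ε (Γ ξ))) (coNormal Γ h 0 ξ) with hF
  have hwc : ∀ {ε}, IsTwoFluidSolution μ μ₂ D D₁ Ω₃ Γ h U ε (u ε) (p ε) →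
      ContinuousOn (w ε) (closure D) := fun {ε} hs =>
    (hs.continuous_u.sub X.continuous_u₀).const_smul ε⁻¹
  have hFc : ∀ ε, 0 < ε → ε < a → IsTwoFluidSolution μ μ₂ D D₁ Ω₃ Γ h U ε (u ε) (p ε) →
      Continuous (F ε) := fun ε h0 h1 hs =>
    (continuous_jump_integrand hg T hφ (hwc hs) h0.le h1).sub
      (continuous_jump_integrand_zero hg T hφ (hwc hs))
  have hbd : ∀ {x v : Plane} {s ξ : ℝ}, x ∈ D → ‖v‖ ≤ C → s ∈ Icc (-a) a → ξ ∈ Icc 0 L →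
      ‖inner ℝ (plusTranspose (fderiv ℝ φ x) v) (coNormal Γ h s ξ)‖ ≤ M * C * N := by
    intro x v s ξ hx hv hs hξ
    have hMx := hM x (subset_closure hx)
    have hM0 : 0 ≤ M := (norm_nonneg _).trans hMx
    have hC0 : 0 ≤ C := (norm_nonneg _).trans hv
    refine (norm_inner_le_norm _ _).trans (mul_le_mul ?_ (hN s hs ξ hξ) (norm_nonneg _)
      (mul_nonneg hM0 hC0))
    exact ((plusTransposeL (fderiv ℝ φ x)).le_opNorm v).trans
      (mul_le_mul hMx hv (norm_nonneg _) hM0)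
  have key : Tendsto (fun ε => ∫ ξ in (0 : ℝ)..L, F ε ξ) (𝓝[>] 0)
      (𝓝 (∫ ξ in (0 : ℝ)..L, h ξ *
        inner ℝ ((matB2 μ μ₂ D₁ u₀ Γ ξ - gradFrom D₁ u₀ Γ ξ) (normal Γ ξ))
          (plusTranspose (fderiv ℝ φ (Γ ξ)) (normal Γ ξ)))) := by
    refine intervalIntegral.tendsto_integral_filter_of_dominated_convergence
      (fun _ => M * C * N + M * C * N) ?_ ?_ intervalIntegrable_const ?_
    · filter_upwards [X.eventually_sol T] with ε hs
      exact (hFc ε hs.1 hs.2.1 hs.2.2).aestronglyMeasurable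
    · filter_upwards [X.eventually_sol T, hC] with ε hs hCε
      refine Filter.Eventually.of_forall fun ξ hξ => ?_
      rw [uIoc_of_le hg.period_pos.le] at hξ
      have hξ' : ξ ∈ Icc 0 L := ⟨hξ.1.le, hξ.2⟩
      have h1 := gammaEps_mem_D T hs.1 hs.2.1 ξ
      have h2 := gamma_mem_D hg ξ
      refine (norm_sub_le _ _).trans (add_le_add (hbd h1 (hCε _ h1) ?_ hξ')
        (hbd h2 (hCε _ h2) ?_ hξ'))
      · exact ⟨by linarith [hs.1, hs.2.1], hs.2.1.le⟩
      · exact ⟨by linarith [T.pos], T.pos.le⟩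
    · refine Filter.Eventually.of_forall fun ξ _ => ?_
      obtain ⟨w₂, h1, h2⟩ := X.exists_tendsto_velocity_interfaces T ξ
      have hγ : Tendsto (fun ε => gammaEps Γ h ε ξ) (𝓝[>] 0) (𝓝 (Γ ξ)) := by
        have := tendsto_gammaEps hg 0 ξ
        rw [gammaEps_zero] at this
        exact this.mono_left nhdsWithin_le_nhds
      have hc : Tendsto (fun ε => coNormal Γ h ε ξ) (𝓝[>] 0) (𝓝 (coNormal Γ h 0 ξ)) :=
        (((continuous_coNormal hg.smooth_Γ hg.smooth_h).comp
          (f := fun s : ℝ => (s, ξ)) (by fun_prop)).tendsto 0).mono_left nhdsWithin_le_nhds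
      have hφγ := ((hφ.continuous_fderiv (by norm_num)).tendsto (Γ ξ)).comp hγ
      have h3 := ((tendsto_plusTranspose_apply hφγ h2).inner (𝕜 := ℝ) hc).sub
        ((tendsto_plusTranspose_apply (tendsto_const_nhds (x := fderiv ℝ φ (Γ ξ))) h1).inner
          (𝕜 := ℝ) (tendsto_const_nhds (x := coNormal Γ h 0 ξ)))
      refine h3.trans_eq ?_
      congr 1
      rw [coNormal_zero, map_sub, map_smul, inner_sub_left, inner_smul_left,
        inner_plusTranspose_comm _ ((_ : Mat) _)]
      simp only [inner_neg_right, map_neg, conj_trivial]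
      ring
  refine key.congr' ?_
  filter_upwards [X.eventually_sol T] with ε hs
  have i1 : ∀ {v : Plane → Plane}, ContinuousOn v (closure D) → Continuous fun ξ =>
      inner ℝ (plusTranspose (fderiv ℝ φ (gammaEps Γ h ε ξ)) (v (gammaEps Γ h ε ξ)))
        (coNormal Γ h ε ξ)
      - inner ℝ (plusTranspose (fderiv ℝ φ (Γ ξ)) (v (Γ ξ))) (coNormal Γ h 0 ξ) := fun hv =>
    (continuous_jump_integrand hg T hφ hv hs.1.le hs.2.1).sub
      (continuous_jump_integrand_zero hg T hφ hv)
  rw [jumpPairing, jumpPairing, ← intervalIntegral.integral_sub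
    ((i1 hs.2.2.continuous_u).intervalIntegrable _ _)
    ((i1 X.continuous_u₀).intervalIntegrable _ _), ← intervalIntegral.integral_const_mul]
  refine intervalIntegral.integral_congr fun ξ _ => ?_
  simp only [hF, hw, map_smul, map_sub, inner_smul_left, inner_sub_left, conj_trivial]
  ring

end Expansion

/-! ### The first-order identity with the inner pressure -/

/-- The jump of the normal derivative, paired with `M + Mᵀ`, turns the gradient of `u₀` from the
side of `D₁` into the matrix `B₂`. -/
lemma frob_matB2_sub {μ μ₂ : ℝ} {D₁ : Set Plane} {u₀ : Plane → Plane} {Γ : ℝ → Plane}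
    (hu : ∀ ξ, ‖deriv Γ ξ‖ = 1) (ξ : ℝ) (M : Mat) :
    inner ℝ ((matB2 μ μ₂ D₁ u₀ Γ ξ - gradFrom D₁ u₀ Γ ξ) (normal Γ ξ))
        (plusTranspose M (normal Γ ξ))
      + frob (gradFrom D₁ u₀ Γ ξ) (plusTranspose M)
      = frob (matB2 μ μ₂ D₁ u₀ Γ ξ) (plusTranspose M) := by
  have hn : inner ℝ (normal Γ ξ) (normal Γ ξ) = (1 : ℝ) := by
    rw [real_inner_self_eq_norm_sq, norm_normal hu]; norm_num
  rw [matB2, add_sub_cancel_left]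
  set c := (μ / μ₂ - 1) * inner ℝ (tangent Γ ξ)
    (plusTranspose (gradFrom D₁ u₀ Γ ξ) (normal Γ ξ))
  have h1 : ∀ v, tensor (tangent Γ ξ) (normal Γ ξ) v = inner ℝ (normal Γ ξ) v • tangent Γ ξ :=
    fun v => by simp [tensor]
  simp only [frob_plusTranspose, add_apply, smul_apply, h1, hn, inner_eq_coord,
    plusTranspose_apply_coord, PiLp.add_apply, PiLp.smul_apply, smul_eq_mul, basisVec_apply]
  simp
  ring

namespace Expansion

variable {μ μ₂ : ℝ} {D D₁ Ω₃ : Set Plane} {Γ : ℝ → Plane} {L : ℝ} {h : ℝ → ℝ}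
  {U : Plane → Plane} {u : ℝ → Plane → Plane} {p : ℝ → Plane → ℝ} {u₀ u₁ : Plane → Plane}
  {p₀ p₁ : Plane → ℝ} {a : ℝ} {S : Plane → ℝ}

lemma continuous_gradFrom (X : Expansion μ μ₂ D D₁ Ω₃ Γ L h U u p u₀ u₁ p₀ p₁)
    (T : Tube D D₁ Ω₃ Γ L h a S) : Continuous (gradFrom D₁ u₀ Γ) :=
  (X.regular₁.2.1.2.2.continuousOn_extendFrom).comp_continuous X.geometry.smooth_Γ.continuous
    fun ξ => gamma_mem_closure_D₁ X.geometry T ξ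

lemma continuous_gradFrom₃ (X : Expansion μ μ₂ D D₁ Ω₃ Γ L h U u p u₀ u₁ p₀ p₁)
    (T : Tube D D₁ Ω₃ Γ L h a S) : Continuous (gradFrom Ω₃ u₀ Γ) :=
  (X.regular₃.2.1.2.2.continuousOn_extendFrom).comp_continuous X.geometry.smooth_Γ.continuous
    fun ξ => gamma_mem_closure_Ω₃ X.geometry T ξ

lemma continuous_pressure_D₁ (X : Expansion μ μ₂ D D₁ Ω₃ Γ L h U u p u₀ u₁ p₀ p₁)
    (T : Tube D D₁ Ω₃ Γ L h a S) : Continuous fun ξ => extendFrom D₁ p₀ (Γ ξ) :=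
  (X.regular₁.2.2.2.continuousOn_extendFrom).comp_continuous X.geometry.smooth_Γ.continuous
    fun ξ => gamma_mem_closure_D₁ X.geometry T ξ

lemma continuous_pressure_Ω₃ (X : Expansion μ μ₂ D D₁ Ω₃ Γ L h U u p u₀ u₁ p₀ p₁)
    (T : Tube D D₁ Ω₃ Γ L h a S) : Continuous fun ξ => extendFrom Ω₃ p₀ (Γ ξ) :=
  (X.regular₃.2.2.2.continuousOn_extendFrom).comp_continuous X.geometry.smooth_Γ.continuous
    fun ξ => gamma_mem_closure_Ω₃ X.geometry T ξ

lemma integrableOn_p₀ (X : Expansion μ μ₂ D D₁ Ω₃ Γ L h U u p u₀ u₁ p₀ p₁)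
    (T : Tube D D₁ Ω₃ Γ L h a S) {d : Plane → ℝ} (hd : Continuous d) :
    IntegrableOn (fun x => p₀ x * d x) D :=
  integrableOn_of_isX0₂ X.geometry T
    (X.regular₁.2.2.2.comp₂ (IsX0.of_continuous hd) (c := fun z : ℝ × ℝ => z.1 * z.2) (by fun_prop))
    (X.regular₃.2.2.2.comp₂ (IsX0.of_continuous hd) (c := fun z : ℝ × ℝ => z.1 * z.2) (by fun_prop))

lemma integrableOn_p₁ (X : Expansion μ μ₂ D D₁ Ω₃ Γ L h U u p u₀ u₁ p₀ p₁)
    (T : Tube D D₁ Ω₃ Γ L h a S) {d : Plane → ℝ} (hd : Continuous d) :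
    IntegrableOn (fun x => p₁ x * d x) D :=
  integrableOn_of_isX0₂ X.geometry T
    (X.isX0_p₁.1.comp₂ (IsX0.of_continuous hd) (c := fun z : ℝ × ℝ => z.1 * z.2) (by fun_prop))
    (X.isX0_p₁.2.comp₂ (IsX0.of_continuous hd) (c := fun z : ℝ × ℝ => z.1 * z.2) (by fun_prop))

lemma integrableOn_u₁ (X : Expansion μ μ₂ D D₁ Ω₃ Γ L h U u p u₀ u₁ p₀ p₁)
    (T : Tube D D₁ Ω₃ Γ L h a S) {E : Plane → Plane} (hE : Continuous E) :
    IntegrableOn (fun x => inner ℝ (u₁ x) (E x)) D :=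
  integrableOn_of_isX0₂ X.geometry T (isX0_inner X.isX0_u₁.1 hE) (isX0_inner X.isX0_u₁.2 hE)

lemma isX0_pressure_layer {ε : ℝ} (X : Expansion μ μ₂ D D₁ Ω₃ Γ L h U u p u₀ u₁ p₀ p₁)
    (T : Tube D D₁ Ω₃ Γ L h a S) (hε : ε < a)
    (hs : IsTwoFluidSolution μ μ₂ D D₁ Ω₃ Γ h U ε (u ε) (p ε)) :
    IsX0 (layer Γ h ε) (fun x => p ε x - p₀ x) :=
  hs.regular₂.2.2.2.comp₂ (X.regular₁.2.2.2.mono (layer_subset_D₁ X.geometry T hε))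
    (c := fun z : ℝ × ℝ => z.1 - z.2) (by fun_prop)

/-- The contribution of the pressure outside the layer, by dominated convergence. -/
lemma tendsto_integral_pressure_outside
    (X : Expansion μ μ₂ D D₁ Ω₃ Γ L h U u p u₀ u₁ p₀ p₁) (T : Tube D D₁ Ω₃ Γ L h a S)
    {d : Plane → ℝ} (hd : Continuous d) :
    Tendsto (fun ε => ε⁻¹ * ∫ x in omega1 D₁ Γ h ε ∪ Ω₃, (p ε x - p₀ x) * d x)
      (𝓝[>] 0) (𝓝 (∫ x in D, p₁ x * d x)) := by
  have hg := X.geometry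
  obtain ⟨g, hgi, hgd⟩ := X.dom_p
  obtain ⟨N, hN⟩ := hg.bounded_D.isCompact_closure.exists_bound_of_continuousOn hd.continuousOn
  have hDm := hg.isOpen_D.measurableSet
  have hO : ∀ ε, 0 < ε → ε < a → IsOpen (omega1 D₁ Γ h ε ∪ Ω₃) := fun ε h0 h1 =>
    (isOpen_omega1 hg T h0 h1).union hg.isOpen_Ω₃
  have hsub : ∀ ε, omega1 D₁ Γ h ε ∪ Ω₃ ⊆ D := fun ε =>
    union_subset ((omega1_subset_D₁ ε).trans (D₁_subset hg)) (Ω₃_subset hg)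
  set F : ℝ → Plane → ℝ := fun ε => (omega1 D₁ Γ h ε ∪ Ω₃).indicator
    fun x => ε⁻¹ * (p ε x - p₀ x) * d x with hF
  have key : Tendsto (fun ε => ∫ x in D, F ε x) (𝓝[>] 0) (𝓝 (∫ x in D, p₁ x * d x)) := by
    refine tendsto_integral_filter_of_dominated_convergence (fun x => ‖g x‖ * N) ?_ ?_
      (hgi.norm.mul_const N) ?_
    · filter_upwards [X.eventually_sol T] with ε hs
      have o₁ := isOpen_omega1 hg T hs.1 hs.2.1
      have hc : ContinuousOn (fun x => ε⁻¹ * (p ε x - p₀ x) * d x) (omega1 D₁ Γ h ε ∪ Ω₃) := by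
        refine ContinuousOn.union_of_isOpen ?_ ?_ o₁ hg.isOpen_Ω₃
        · exact (continuousOn_const.mul (hs.2.2.regular₁.2.2.1.continuousOn.sub
            (X.regular₁.2.2.1.continuousOn.mono (omega1_subset_D₁ ε)))).mul hd.continuousOn
        · exact (continuousOn_const.mul (hs.2.2.regular₃.2.2.1.continuousOn.sub
            X.regular₃.2.2.1.continuousOn)).mul hd.continuousOn
      have hm := (hO ε hs.1 hs.2.1).measurableSet
      refine (aestronglyMeasurable_indicator_iff hm).2 ?_
      rw [Measure.restrict_restrict hm, inter_eq_left.2 (hsub ε)]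
      exact hc.aestronglyMeasurable hm
    · filter_upwards [hgd] with ε hε
      filter_upwards [ae_restrict_mem hDm] with x hx
      have hN' := hN x (subset_closure hx)
      simp only [hF]
      by_cases hm : x ∈ omega1 D₁ Γ h ε ∪ Ω₃
      · rw [indicator_of_mem hm, norm_mul]
        exact mul_le_mul ((hε x hm).trans (le_abs_self _)) hN' (norm_nonneg _) (norm_nonneg _)
      · rw [indicator_of_notMem hm, norm_zero]
        exact mul_nonneg (norm_nonneg _) ((norm_nonneg _).trans hN')
    · rw [← Measure.restrict_congr_set (ae_mem_D₁_union_Ω₃ hg T)]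
      filter_upwards [ae_restrict_mem (hg.isOpen_D₁.union hg.isOpen_Ω₃).measurableSet] with x hx
      have hev : ∀ᶠ ε : ℝ in 𝓝[>] 0, x ∈ omega1 D₁ Γ h ε ∪ Ω₃ := by
        rcases hx with hx | hx
        · rw [D₁_eq hg T] at hx
          filter_upwards [Ioo_mem_nhdsGT (lt_min hx.2 T.pos)] with ε hε
          rw [omega1_eq hg T hε.1 (hε.2.trans_le (min_le_right _ _))]
          exact Or.inl ⟨hx.1, hε.2.trans_le (min_le_left _ _)⟩
        · exact Filter.Eventually.of_forall fun ε => Or.inr hx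
      refine ((X.lim_p x hx).mul_const (d x)).congr' ?_
      filter_upwards [hev] with ε hε
      simp only [hF]
      rw [indicator_of_mem hε]
  refine key.congr' ?_
  filter_upwards [X.eventually_sol T] with ε hs
  have hm := (hO ε hs.1 hs.2.1).measurableSet
  rw [← integral_const_mul, setIntegral_indicator hm, inter_eq_right.2 (hsub ε)]
  refine setIntegral_congr_fun hm fun x _ => ?_
  ring

/-- The pressures in the layer. -/
lemma tendsto_integral_pressure_layer
    (X : Expansion μ μ₂ D D₁ Ω₃ Γ L h U u p u₀ u₁ p₀ p₁) (T : Tube D D₁ Ω₃ Γ L h a S)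
    {d : Plane → ℝ} (hd : Continuous d) :
    Tendsto (fun ε => ε⁻¹ * ∫ x in layer Γ h ε, (p ε x - p₀ x) * d x) (𝓝[>] 0)
      (𝓝 (∫ ξ in (0 : ℝ)..L, h ξ * ((layerPressure μ μ₂ D₁ Ω₃ u₀ p₀ Γ ξ
        - extendFrom D₁ p₀ (Γ ξ)) * d (Γ ξ)))) := by
  have hg := X.geometry
  obtain ⟨C, hC⟩ := X.bound_p
  obtain ⟨C₀, -, hC₀⟩ := X.regular₁.2.2.2.exists_bound (hg.bounded_D.subset (D₁_subset hg))
  obtain ⟨N, hN⟩ := hg.bounded_D.isCompact_closure.exists_bound_of_continuousOn hd.continuousOn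
  refine tendsto_layer_integral hg T (C := (C + C₀) * N) ?_ ?_ ?_
  · filter_upwards [X.eventually_sol T] with ε hs
    exact (X.isX0_pressure_layer T hs.2.1 hs.2.2).continuousOn.mul hd.continuousOn
  · filter_upwards [X.eventually_sol T, hC] with ε hs hCε x hx
    have hx₁ := layer_subset_D₁ hg T hs.2.1 hx
    rw [abs_mul]
    refine mul_le_mul ((abs_sub _ _).trans (add_le_add (hCε x hx) (hC₀ x hx₁)))
      (hN x (subset_closure (D₁_subset hg hx₁))) (abs_nonneg _) ?_
    exact add_nonneg ((abs_nonneg _).trans (hCε x hx)) ((norm_nonneg _).trans (hC₀ x hx₁))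
  · intro ξ t ht
    have h1 := X.tendsto_gammaEps_mul T ξ ht.1
    exact ((X.tendsto_pressure_layer ξ ht).sub
      ((X.regular₁.2.2.2.tendsto_extendFrom (gamma_mem_closure_D₁ hg T ξ)).comp h1)).mul
      ((hd.tendsto _).comp (h1.mono_right nhdsWithin_le_nhds))

lemma tendsto_integral_gradient_layer
    (X : Expansion μ μ₂ D D₁ Ω₃ Γ L h U u p u₀ u₁ p₀ p₁) (T : Tube D D₁ Ω₃ Γ L h a S)
    {φ : Plane → Plane} (hφ : ContDiff ℝ 2 φ) :
    Tendsto (fun ε => ε⁻¹ * ∫ x in layer Γ h ε, frob (fderiv ℝ u₀ x)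
      (plusTranspose (fderiv ℝ φ x))) (𝓝[>] 0)
      (𝓝 (∫ ξ in (0 : ℝ)..L, h ξ * frob (gradFrom D₁ u₀ Γ ξ)
        (plusTranspose (fderiv ℝ φ (Γ ξ))))) := by
  have hg := X.geometry
  have hx := isX0_frob X.regular₁.2.1 hφ
  obtain ⟨C, -, hC⟩ := hx.exists_bound (hg.bounded_D.subset (D₁_subset hg))
  refine tendsto_layer_integral hg T (C := C) ?_ ?_ ?_
  · filter_upwards [X.eventually_sol T] with ε hs
    exact hx.continuousOn.mono (layer_subset_D₁ hg T hs.2.1)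
  · filter_upwards [X.eventually_sol T] with ε hs x hx'
    exact hC x (layer_subset_D₁ hg T hs.2.1 hx')
  · intro ξ t ht
    have h1 := X.tendsto_gammaEps_mul T ξ ht.1
    have h2 := (X.regular₁.2.1.2.2.tendsto_extendFrom (gamma_mem_closure_D₁ hg T ξ)).comp h1
    have h3 := ((hφ.continuous_fderiv (by norm_num)).tendsto (Γ ξ)).comp
      (h1.mono_right nhdsWithin_le_nhds)
    have hc : Continuous fun z : Mat × Mat => frob z.1 (plusTranspose z.2) := by
      simp only [frob_plusTranspose]; fun_prop
    have h4 := (hc.tendsto (gradFrom D₁ u₀ Γ ξ, fderiv ℝ φ (Γ ξ))).comp (h2.prodMk_nhds h3)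
    simpa only [Function.comp_def] using h4

/-- The velocity correction is of order `ε`, and so is the area of the layer. -/
lemma tendsto_integral_velocity_layer
    (X : Expansion μ μ₂ D D₁ Ω₃ Γ L h U u p u₀ u₁ p₀ p₁) (T : Tube D D₁ Ω₃ Γ L h a S)
    {E : Plane → Plane} (hE : Continuous E) :
    Tendsto (fun ε => ε⁻¹ * ((∫ x in layer Γ h ε, inner ℝ (u ε x) (E x))
      - ∫ x in layer Γ h ε, inner ℝ (u₀ x) (E x))) (𝓝[>] 0) (𝓝 0) := by
  have hg := X.geometry
  obtain ⟨C, hC⟩ := X.bound_u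
  obtain ⟨N, hN⟩ := hg.bounded_D.isCompact_closure.exists_bound_of_continuousOn hE.continuousOn
  have hint : ∀ {w : Plane → Plane} {ε : ℝ}, ε < a → ContinuousOn w (closure D) →
      IntegrableOn (fun x => inner ℝ (w x) (E x)) (layer Γ h ε) := fun hε hw =>
    (integrableOn_of_continuousOn_closure hg (hw.inner hE.continuousOn)).mono_set
      ((layer_subset_D₁ hg T hε).trans (D₁_subset hg))
  have hsub : ∀ {ε : ℝ}, ε < a → layer Γ h ε ⊆ D := fun hε =>
    (layer_subset_D₁ hg T hε).trans (D₁_subset hg)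
  have hid : Tendsto (fun ε : ℝ => ε) (𝓝[>] 0) (𝓝 0) := tendsto_id.mono_left nhdsWithin_le_nhds
  have hCN : ∀ {ε : ℝ} {x : Plane}, (∀ x ∈ D, ‖ε⁻¹ • (u ε x - u₀ x)‖ ≤ C) → x ∈ D →
      ‖inner ℝ (ε⁻¹ • (u ε x - u₀ x)) (E x)‖ ≤ C * N := fun hCε hx =>
    (norm_inner_le_norm _ _).trans (mul_le_mul (hCε _ hx) (hN _ (subset_closure hx))
      (norm_nonneg _) ((norm_nonneg _).trans (hCε _ hx)))
  have key := tendsto_layer_integral hg T (C := C * N * a) (f₀ := fun _ => 0)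
    (f := fun ε x => ε * inner ℝ (ε⁻¹ • (u ε x - u₀ x)) (E x)) ?_ ?_ ?_
  · simp only [mul_zero, intervalIntegral.integral_zero] at key
    refine key.congr' ?_
    filter_upwards [X.eventually_sol T] with ε hs
    have h0 := hs.1.ne'
    rw [← integral_sub (hint hs.2.1 hs.2.2.continuous_u) (hint hs.2.1 X.continuous_u₀)]
    congr 1
    refine integral_congr_ae (Filter.Eventually.of_forall fun x => ?_)
    simp only [inner_smul_left, inner_sub_left, conj_trivial]
    field_simp
  · filter_upwards [X.eventually_sol T] with ε hs
    exact continuousOn_const.mul (((((hs.2.2.continuous_u.sub X.continuous_u₀).const_smul ε⁻¹).inner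
      hE.continuousOn).mono subset_closure).mono (hsub hs.2.1))
  · filter_upwards [X.eventually_sol T, hC] with ε hs hCε x hx
    have h1 := hCN hCε (hsub hs.2.1 hx)
    rw [abs_mul, abs_of_pos hs.1, mul_comm]
    exact mul_le_mul h1 hs.2.1.le hs.1.le ((norm_nonneg _).trans h1)
  · intro ξ t ht
    refine squeeze_zero_norm' (a := fun ε => ε * (C * N)) ?_ (by simpa using hid.mul_const (C * N))
    filter_upwards [X.eventually_sol T, hC] with ε hs hCε
    rw [norm_mul, Real.norm_of_nonneg hs.1.le]
    refine mul_le_mul_of_nonneg_left (hCN hCε (T.mem_D _ ξ ?_)) hs.1.le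
    rw [abs_of_pos (mul_pos hs.1 ht.1)]
    exact (mul_lt_of_lt_one_right hs.1 ht.2).trans hs.2.1

/-- The identities obtained from the weak form of the two-fluid problem at the orders `ε⁰` and
`ε¹`. -/
theorem first_order (X : Expansion μ μ₂ D D₁ Ω₃ Γ L h U u p u₀ u₁ p₀ p₁)
    (T : Tube D D₁ Ω₃ Γ L h a S) {φ : Plane → Plane} (hφ : IsTest2 D φ) :
    (∫ x in D, p₀ x * divergence φ x) + μ * (∫ x in D, inner ℝ (u₀ x) (divSym φ x))
      = -2 * ∫ ξ in (0 : ℝ)..L, curv Γ ξ * inner ℝ (normal Γ ξ) (φ (Γ ξ)) ∧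
    (∫ x in D, p₁ x * divergence φ x) + μ * (∫ x in D, inner ℝ (u₁ x) (divSym φ x))
      + (∫ ξ in (0 : ℝ)..L, h ξ * ((layerPressure μ μ₂ D₁ Ω₃ u₀ p₀ Γ ξ
        - extendFrom D₁ p₀ (Γ ξ)) * divergence φ (Γ ξ)))
      = (∫ ξ in (0 : ℝ)..L, deriv (deriv h) ξ * inner ℝ (normal Γ ξ) (φ (Γ ξ)))
        + (∫ ξ in (0 : ℝ)..L, deriv (curv Γ) ξ * h ξ * inner ℝ (tangent Γ ξ) (φ (Γ ξ)))
        + (∫ ξ in (0 : ℝ)..L, h ξ * curv Γ ξ * divergence φ (Γ ξ))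
        + (μ₂ - μ) * ((∫ ξ in (0 : ℝ)..L, h ξ * inner ℝ
            ((matB2 μ μ₂ D₁ u₀ Γ ξ - gradFrom D₁ u₀ Γ ξ) (normal Γ ξ))
            (plusTranspose (fderiv ℝ φ (Γ ξ)) (normal Γ ξ)))
          + ∫ ξ in (0 : ℝ)..L, h ξ * frob (gradFrom D₁ u₀ Γ ξ)
            (plusTranspose (fderiv ℝ φ (Γ ξ)))) := by
  have hg := X.geometry
  have cE := continuous_divSym hφ.contDiff
  have cd := continuous_divergence (hφ.contDiff.of_le (by norm_num))
  set κI := ∫ ξ in (0 : ℝ)..L, curv Γ ξ * inner ℝ (normal Γ ξ) (φ (Γ ξ)) with hκI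
  have tV := X.tendsto_integral_velocity T cE
  have tO := X.tendsto_integral_pressure_outside T cd
  have tL := X.tendsto_integral_pressure_layer T cd
  have tG := X.tendsto_integral_gradient_layer T hφ.contDiff
  have tE := X.tendsto_integral_velocity_layer T cE
  have tJ := X.tendsto_jumpPairing T hφ.contDiff
  have hder := hasDerivAt_integral_tension hg T
    (hφ.contDiff.of_le (by norm_num : (1 : WithTop ℕ∞) ≤ 2))
  set T' := -(∫ ξ in (0 : ℝ)..L, deriv (deriv h) ξ * inner ℝ (normal Γ ξ) (φ (Γ ξ)))
        - (∫ ξ in (0 : ℝ)..L, deriv (curv Γ) ξ * h ξ * inner ℝ (tangent Γ ξ) (φ (Γ ξ)))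
        - ∫ ξ in (0 : ℝ)..L, h ξ * curv Γ ξ * divergence φ (Γ ξ) with hT'
  have tT : Tendsto (fun ε => ε⁻¹ * ((∫ ξ in (0 : ℝ)..L, tension Γ h φ ε ξ) - κI)) (𝓝[>] 0)
      (𝓝 T') := by
    have h1 := hasDerivAt_iff_tendsto_slope.1 hder
    have h2 := h1.mono_left (nhdsWithin_mono (0 : ℝ)
      (fun x (hx : 0 < x) => (hx.ne' : x ≠ 0) : Ioi (0 : ℝ) ⊆ {0}ᶜ))
    refine h2.congr fun ε => ?_
    simp only [slope, sub_zero, tension_zero, vsub_eq_sub, smul_eq_mul, hκI]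
  set Z := (∫ x in D, p₀ x * divergence φ x) + μ * (∫ x in D, inner ℝ (u₀ x) (divSym φ x)) with hZ
  -- The weak form for `u ε`, minus the limit terms, over `ε`. The layer term of `u₀` is rewritten
  -- by `jumpPairing_eq`, so that every term on the right converges.
  have hid : ∀ᶠ ε : ℝ in 𝓝[>] 0, -(ε⁻¹ * (Z + 2 * κI)) =
      ε⁻¹ * (∫ x in omega1 D₁ Γ h ε ∪ Ω₃, (p ε x - p₀ x) * divergence φ x)
      + ε⁻¹ * (∫ x in layer Γ h ε, (p ε x - p₀ x) * divergence φ x)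
      + μ * (ε⁻¹ * ((∫ x in D, inner ℝ (u ε x) (divSym φ x))
        - ∫ x in D, inner ℝ (u₀ x) (divSym φ x)))
      + ε⁻¹ * ((∫ ξ in (0 : ℝ)..L, tension Γ h φ ε ξ) - κI)
      - (μ₂ - μ) * (ε⁻¹ * (∫ x in layer Γ h ε, frob (fderiv ℝ u₀ x)
          (plusTranspose (fderiv ℝ φ x)))
        + ε⁻¹ * (jumpPairing Γ L h φ (u ε) ε - jumpPairing Γ L h φ u₀ ε)
        - ε⁻¹ * ((∫ x in layer Γ h ε, inner ℝ (u ε x) (divSym φ x))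
          - ∫ x in layer Γ h ε, inner ℝ (u₀ x) (divSym φ x))) := by
    filter_upwards [X.eventually_sol T] with ε hs
    obtain ⟨hi, hw⟩ := hs.2.2.weak_form hg T hs.1 hs.2.1 hφ
    have hj := jumpPairing_eq hg T hs.1 hs.2.1 X.continuous_u₀ X.regular₁.2.1 hφ
    have hi₀ := X.integrableOn_p₀ T cd
    have hd : IntegrableOn (fun x => (p ε x - p₀ x) * divergence φ x) D := by
      refine (hi.sub hi₀).congr (Filter.Eventually.of_forall fun x => ?_)
      simp only [Pi.sub_apply]; ring
    have s₁ : omega1 D₁ Γ h ε ⊆ D := (omega1_subset_D₁ ε).trans (D₁_subset hg)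
    have s₂ : layer Γ h ε ⊆ D := (layer_subset_D₁ hg T hs.2.1).trans (D₁_subset hg)
    have hsp := (setIntegral_split hg T hs.1 hs.2.1 (hd.mono_set (Ω₃_subset hg))
      (hd.mono_set s₂) (hd.mono_set s₁)).2
    have hun : ∫ x in omega1 D₁ Γ h ε ∪ Ω₃, (p ε x - p₀ x) * divergence φ x
        = (∫ x in omega1 D₁ Γ h ε, (p ε x - p₀ x) * divergence φ x)
          + ∫ x in Ω₃, (p ε x - p₀ x) * divergence φ x :=
      setIntegral_union (hg.disjoint_D₁_Ω₃.mono_left (omega1_subset_D₁ ε))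
        hg.isOpen_Ω₃.measurableSet (hd.mono_set s₁) (hd.mono_set (Ω₃_subset hg))
    have hsub : ∫ x in D, (p ε x - p₀ x) * divergence φ x
        = (∫ x in D, p ε x * divergence φ x) - ∫ x in D, p₀ x * divergence φ x := by
      rw [← integral_sub hi hi₀]
      refine integral_congr_ae (Filter.Eventually.of_forall fun x => ?_)
      simp only; ring
    rw [hun]
    linear_combination (-ε⁻¹) * hw - ε⁻¹ * hsub + ε⁻¹ * hsp + (-(μ₂ - μ)) * ε⁻¹ * hj
  have hlim := (((tO.add tL).add (tV.const_mul μ)).add tT).sub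
    (((tG.add tJ).sub tE).const_mul (μ₂ - μ))
  have hlim' := hlim.congr' (hid.mono fun ε e => e.symm)
  -- the left-hand side converges as well, so that the term of order `ε⁰` vanishes
  have hZ0 : Z + 2 * κI = 0 := by
    have h2 : Tendsto (fun ε : ℝ => ε) (𝓝[>] 0) (𝓝 0) := tendsto_id.mono_left nhdsWithin_le_nhds
    have h3 := h2.mul hlim'
    rw [zero_mul] at h3
    have h4 : Tendsto (fun _ : ℝ => -(Z + 2 * κI)) (𝓝[>] 0) (𝓝 0) := by
      refine h3.congr' ?_
      filter_upwards [self_mem_nhdsWithin] with ε hε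
      have : ε ≠ 0 := (show (0 : ℝ) < ε from hε).ne'
      field_simp
    have h5 := tendsto_nhds_unique tendsto_const_nhds h4
    linarith
  refine ⟨by linarith, ?_⟩
  rw [hZ0] at hlim'
  simp only [mul_zero, neg_zero] at hlim'
  have := tendsto_nhds_unique tendsto_const_nhds hlim'
  linarith

end Expansion

/-! ### The limit problem -/

lemma integrable_of_continuousOn_compact {K : Set Plane} (hK : IsCompact K) {f : Plane → ℝ}
    (hf : ContinuousOn f K) (h0 : ∀ x ∉ K, f x = 0) : Integrable f :=
  (integrableOn_iff_integrable_of_support_subset fun x hx => by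
    by_contra hxK; exact hx (h0 x hxK)).1 (hf.integrableOn_compact hK)

lemma eventuallyEq_zero_of_notMem {F : Type*} [Zero F] {K : Set Plane} (hK : IsCompact K)
    {f : Plane → F} (h0 : ∀ x ∉ K, f x = 0) {x : Plane} (hx : x ∉ K) : f =ᶠ[𝓝 x] fun _ => 0 := by
  filter_upwards [hK.isClosed.isOpen_compl.mem_nhds hx] with y hy using h0 y hy

lemma integral_divergence_eq_zero_of_support {O K : Set Plane} (hO : IsOpen O) (hK : IsCompact K)
    (hKO : K ⊆ O) {F : Plane → Plane} (hF : ContDiffOn ℝ 1 F O) (h0 : ∀ x ∉ K, F x = 0) :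
    ∫ x, divergence F x = 0 := by
  refine integral_divergence_eq_zero (contDiff_iff_contDiffAt.2 fun x => ?_)
    (HasCompactSupport.intro hK h0)
  by_cases hx : x ∈ K
  · exact hF.contDiffAt (hO.mem_nhds (hKO hx))
  · exact contDiffAt_const.congr_of_eventuallyEq (eventuallyEq_zero_of_notMem hK h0 hx)

/-- The fundamental lemma of the calculus of variations for continuous functions. -/
lemma eqOn_zero_of_integral_mul {O : Set Plane} (hO : IsOpen O) {f : Plane → ℝ}
    (hf : ContinuousOn f O) (h : ∀ ψ : Plane → ℝ, ContDiff ℝ 2 ψ → HasCompactSupport ψ →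
      tsupport ψ ⊆ O → ∫ x, ψ x * f x = 0) : ∀ x ∈ O, f x = 0 := by
  have h1 := hO.ae_eq_zero_of_integral_contDiff_smul_eq_zero (μ := volume)
    (hf.locallyIntegrableOn hO.measurableSet) fun g hg hc hs => by
      simpa using h g (by exact_mod_cast contDiff_infty.1 hg 2) hc hs
  exact Measure.eqOn_open_of_ae_eq (μ := volume) (g := fun _ => 0)
    ((ae_restrict_iff' hO.measurableSet).2 h1) hO hf continuousOn_const

lemma IsTest2.smul_const {O : Set Plane} {ψ : Plane → ℝ} (hψ : ContDiff ℝ 2 ψ)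
    (hc : HasCompactSupport ψ) (hs : tsupport ψ ⊆ O) (v : Plane) :
    IsTest2 O (fun x => ψ x • v) :=
  ⟨hψ.smul contDiff_const, hc.smul_right, (closure_mono (fun x hx => by
    rw [Function.mem_support] at hx ⊢
    intro h; exact hx (by rw [h, zero_smul]))).trans hs⟩

namespace Expansion

variable {μ μ₂ : ℝ} {D D₁ Ω₃ : Set Plane} {Γ : ℝ → Plane} {L : ℝ} {h : ℝ → ℝ}
  {U : Plane → Plane} {u : ℝ → Plane → Plane} {p : ℝ → Plane → ℝ} {u₀ u₁ : Plane → Plane}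
  {p₀ p₁ : Plane → ℝ} {a : ℝ} {S : Plane → ℝ}

/-- The leading order velocity is divergence free. -/
lemma divergence_u₀ (X : Expansion μ μ₂ D D₁ Ω₃ Γ L h U u p u₀ u₁ p₀ p₁)
    (T : Tube D D₁ Ω₃ Γ L h a S) {O : Set Plane} (hO : IsOpen O) (hOD : O ⊆ D)
    (hu : ContDiffOn ℝ 1 u₀ O) : ∀ x ∈ O, divergence u₀ x = 0 := by
  have hdc : ContinuousOn (divergence u₀) O := by
    simp only [funext (divergence_eq_tr u₀)]
    exact continuous_tr.comp_continuousOn (hu.continuousOn_fderiv_of_isOpen hO (by norm_num))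
  refine eqOn_zero_of_integral_mul hO hdc fun ψ hψ hc hs => ?_
  have hψ1 : ContDiff ℝ 1 ψ := hψ.of_le (by norm_num)
  have hz : ∀ x ∉ tsupport ψ, ψ x = 0 := fun x hx => image_eq_zero_of_notMem_tsupport hx
  have hgz : ∀ x ∉ tsupport ψ, gradient ψ x = 0 := fun x hx => by
    rw [gradient, (notMem_tsupport_iff_eventuallyEq.1 hx).fderiv_eq]; simp
  have cg : Continuous (gradient ψ) :=
    (InnerProductSpace.toDual ℝ Plane).symm.continuous.comp (hψ1.continuous_fderiv (by norm_num))
  have h1 := integral_divergence_eq_zero_of_support hO hc hs (F := fun x => ψ x • u₀ x)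
    (hψ1.contDiffOn.smul hu) fun x hx => by rw [hz x hx, zero_smul]
  have h2 : ∀ x, divergence (fun x => ψ x • u₀ x) x
      = ψ x * divergence u₀ x + inner ℝ (u₀ x) (gradient ψ x) := by
    intro x
    by_cases hx : x ∈ tsupport ψ
    · exact divergence_smul (hψ1.differentiable (by norm_num) x)
        ((hu.contDiffAt (hO.mem_nhds (hs hx))).differentiableAt (by norm_num))
    · have := eventuallyEq_zero_of_notMem hc (f := fun x => ψ x • u₀ x)
        (fun x hx => by rw [hz x hx, zero_smul]) hx
      rw [divergence, this.fderiv_eq, hz x hx, hgz x hx]; simp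
  have i1 : Integrable fun x => ψ x * divergence u₀ x :=
    integrable_of_continuousOn_compact hc (hψ.continuous.continuousOn.mul (hdc.mono hs))
      fun x hx => by rw [hz x hx, zero_mul]
  have i2 : Integrable fun x => inner ℝ (u₀ x) (gradient ψ x) :=
    integrable_of_continuousOn_compact hc ((hu.continuousOn.mono hs).inner cg.continuousOn)
      fun x hx => by rw [hgz x hx, inner_zero_right]
  have h3 := (X.integral_inner_gradient_u₁ T hψ1 hc (hs.trans hOD)).1
  rw [setIntegral_eq_integral_of_forall_compl_eq_zero fun x hx => by
    rw [hgz x fun hx' => hx (hOD (hs hx')), inner_zero_right]] at h3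
  rw [integral_congr_ae (Filter.Eventually.of_forall h2), integral_add i1 i2, h3, add_zero] at h1
  exact h1

/-- The leading order stress is divergence free. -/
lemma momentum_u₀ (X : Expansion μ μ₂ D D₁ Ω₃ Γ L h U u p u₀ u₁ p₀ p₁)
    (T : Tube D D₁ Ω₃ Γ L h a S) {O : Set Plane} (hO : IsOpen O) (hOD : O ⊆ D)
    (hOΓ : ∀ ξ, Γ ξ ∉ O) (hr : RegularIn O u₀ p₀) :
    ∀ x ∈ O, μ • divSym u₀ x - gradient p₀ x = 0 := by
  have hg := X.geometry
  have hGc : ContinuousOn (gradient p₀) O :=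
    (InnerProductSpace.toDual ℝ Plane).symm.continuous.comp_continuousOn
      (hr.2.2.1.continuousOn_fderiv_of_isOpen hO (by norm_num))
  have hc : ContinuousOn (fun x => μ • divSym u₀ x - gradient p₀ x) O :=
    ((continuousOn_divSym hO hr.1).const_smul μ).sub hGc
  have key : ∀ v : Plane, ∀ x ∈ O, inner ℝ (μ • divSym u₀ x - gradient p₀ x) v = 0 := by
    intro v
    refine eqOn_zero_of_integral_mul hO (hc.inner continuousOn_const) fun ψ hψ hcs hs => ?_
    set φ : Plane → Plane := fun x => ψ x • v with hφ
    have tO : IsTest2 O φ := IsTest2.smul_const hψ hcs hs v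
    have tD : IsTest2 D φ := ⟨tO.contDiff, tO.compact, tO.subset.trans hOD⟩
    have cE := continuous_divSym tO.contDiff
    have cd := continuous_divergence (tO.contDiff.of_le (by norm_num))
    have hF : ContDiffOn ℝ 1 (stokesFlux μ u₀ p₀ φ) O := fun x hx =>
      (ContDiffAt.stokesFlux (hr.1.contDiffAt (hO.mem_nhds hx))
        (hr.2.2.1.contDiffAt (hO.mem_nhds hx)) tO.contDiff.contDiffAt).contDiffWithinAt
    have hF0 : ∀ x ∉ tsupport φ, stokesFlux μ u₀ p₀ φ x = 0 := fun x hx => by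
      obtain ⟨h0, h1, -⟩ := tO.eq_zero hx
      rw [stokesFlux, h0, h1, ← plusTransposeL_apply, map_zero, map_zero]; simp
    have h1 := integral_divergence_eq_zero_of_support hO tO.compact tO.subset hF hF0
    have h2 : ∀ x, divergence (stokesFlux μ u₀ p₀ φ) x =
        ψ x * inner ℝ (μ • divSym u₀ x - gradient p₀ x) v
          - (p₀ x * divergence φ x + μ * inner ℝ (u₀ x) (divSym φ x)) := by
      intro x
      by_cases hx : x ∈ tsupport φ
      · have hxO := hO.mem_nhds (tO.subset hx)
        rw [divergence_stokesFlux (hr.1.contDiffAt hxO) (hr.2.2.1.contDiffAt hxO)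
          tO.contDiff.contDiffAt]
        simp only [hφ, inner_smul_right]; ring
      · obtain ⟨h0, -, h3, h4⟩ := tO.eq_zero hx
        have h5 : ψ x * inner ℝ (μ • divSym u₀ x - gradient p₀ x) v = 0 := by
          rw [← inner_smul_right]
          simp only [hφ] at h0
          rw [h0, inner_zero_right]
        rw [h3, h4, h5, divergence,
          (eventuallyEq_zero_of_notMem tO.compact hF0 hx).fderiv_eq]
        simp
    have i1 : Integrable fun x => ψ x * inner ℝ (μ • divSym u₀ x - gradient p₀ x) v :=
      integrable_of_continuousOn_compact hcs
        (hψ.continuous.continuousOn.mul ((hc.inner continuousOn_const).mono hs))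
        fun x hx => by rw [image_eq_zero_of_notMem_tsupport hx, zero_mul]
    have i2 : Integrable fun x => p₀ x * divergence φ x :=
      integrable_of_continuousOn_compact tO.compact
        ((hr.2.2.1.continuousOn.mono tO.subset).mul cd.continuousOn)
        fun x hx => by rw [(tO.eq_zero hx).2.2.1, mul_zero]
    have i3 : Integrable fun x => inner ℝ (u₀ x) (divSym φ x) :=
      integrable_of_continuousOn_compact tO.compact
        ((hr.1.continuousOn.mono tO.subset).inner cE.continuousOn)
        fun x hx => by rw [(tO.eq_zero hx).2.2.2, inner_zero_right]
    have h3 := (X.first_order T tD).1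
    have h4 : ∀ ξ, curv Γ ξ * inner ℝ (normal Γ ξ) (φ (Γ ξ)) = 0 := fun ξ => by
      rw [(tO.eq_zero fun h => hOΓ ξ (tO.subset h)).1, inner_zero_right, mul_zero]
    rw [setIntegral_eq_integral_of_forall_compl_eq_zero fun x hx => by
        rw [(tO.eq_zero fun h => hx (hOD (tO.subset h))).2.2.1, mul_zero],
      setIntegral_eq_integral_of_forall_compl_eq_zero fun x hx => by
        rw [(tO.eq_zero fun h => hx (hOD (tO.subset h))).2.2.2, inner_zero_right]] at h3
    simp only [h4, intervalIntegral.integral_zero, mul_zero] at h3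
    have i3' : Integrable fun x => μ * inner ℝ (u₀ x) (divSym φ x) := i3.const_mul μ
    have i23 : Integrable fun x => p₀ x * divergence φ x + μ * inner ℝ (u₀ x) (divSym φ x) :=
      i2.add i3'
    rw [integral_congr_ae (Filter.Eventually.of_forall h2), integral_sub i1 i23,
      integral_add i2 i3', integral_const_mul, h3, sub_zero] at h1
    exact h1
  intro x hx
  exact inner_self_eq_zero.1 (key (μ • divSym u₀ x - gradient p₀ x) x hx)

/-- The weak form of the jump condition for the leading order stress: integration by parts in the
identity of order `ε⁰`, where `(u₀, p₀)` satisfies the Stokes equations off `Γ`. -/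
lemma integral_stress_jump (X : Expansion μ μ₂ D D₁ Ω₃ Γ L h U u p u₀ u₁ p₀ p₁)
    (T : Tube D D₁ Ω₃ Γ L h a S) {φ : Plane → Plane} (hφ : IsTest2 D φ) :
    ∫ ξ in (0 : ℝ)..L, inner ℝ (φ (Γ ξ)) ((stressFrom μ D₁ u₀ p₀ (Γ ξ)
      - stressFrom μ Ω₃ u₀ p₀ (Γ ξ)) (normal Γ ξ))
      = 2 * ∫ ξ in (0 : ℝ)..L, curv Γ ξ * inner ℝ (normal Γ ξ) (φ (Γ ξ)) := by
  have hg := X.geometry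
  -- The level `ε` is arbitrary: the flux does not jump across `Γ_ε`.
  obtain ⟨ε, hε0, hε⟩ := exists_between T.pos
  set F := stokesFlux μ u₀ p₀ φ with hF
  have cE := continuous_divSym hφ.contDiff
  have cd := continuous_divergence (hφ.contDiff.of_le (by norm_num))
  have o₁ := isOpen_omega1 hg T hε0 hε
  have o₂ := isOpen_layer hg T hε
  have s₁ := omega1_subset_D₁ (D₁ := D₁) (Γ := Γ) (h := h) ε
  have s₂ := layer_subset_D₁ hg T hε
  have hreg : ∀ {O : Set Plane}, IsOpen O → O ⊆ D → (∀ ξ, Γ ξ ∉ O) → RegularIn O u₀ p₀ →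
      ContDiffOn ℝ 1 F O ∧ IsX0 O F ∧
      IsX0 O (fun x => -(p₀ x * divergence φ x + μ * inner ℝ (u₀ x) (divSym φ x))) ∧
      EqOn (divergence F) (fun x => -(p₀ x * divergence φ x
        + μ * inner ℝ (u₀ x) (divSym φ x))) O := by
    intro O hO hOD hOΓ hr
    refine ⟨fun x hx => (ContDiffAt.stokesFlux (hr.1.contDiffAt (hO.mem_nhds hx))
      (hr.2.2.1.contDiffAt (hO.mem_nhds hx)) hφ.contDiff.contDiffAt).contDiffWithinAt,
      IsX0.stokesFlux hr.2.1 hr.2.2.2 hφ.contDiff, ?_, fun x hx => ?_⟩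
    · exact (hr.2.2.2.comp₂ (IsX0.of_continuous cd) (c := fun z : ℝ × ℝ => z.1 * z.2)
        (by fun_prop)).comp₂ (isX0_inner hr.2.1.2.1 cE) (c := fun z : ℝ × ℝ => -(z.1 + μ * z.2))
        (by fun_prop)
    · rw [hF, divergence_stokesFlux (hr.1.contDiffAt (hO.mem_nhds hx))
        (hr.2.2.1.contDiffAt (hO.mem_nhds hx)) hφ.contDiff.contDiffAt,
        X.momentum_u₀ T hO hOD hOΓ hr x hx, inner_zero_left]
      ring
  have hΓ : ∀ ξ, Γ ξ ∉ D₁ ∪ Ω₃ := fun ξ hξ => by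
    rw [← hg.decomposition] at hξ; exact hξ.2 (mem_range_self ξ)
  obtain ⟨c₁, x₁, i₁, e₁⟩ := hreg hg.isOpen_D₁ (D₁_subset hg) (fun ξ hξ => hΓ ξ (Or.inl hξ))
    X.regular₁
  obtain ⟨c₃, x₃, i₃, e₃⟩ := hreg hg.isOpen_Ω₃ (Ω₃_subset hg) (fun ξ hξ => hΓ ξ (Or.inr hξ))
    X.regular₃
  have I₃ := integrableOn_of_isX0 hg hg.isOpen_Ω₃ (Ω₃_subset hg) i₃
  have I₁ := integrableOn_of_isX0 hg hg.isOpen_D₁ (D₁_subset hg) i₁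
  have hz : ∀ x ∉ tsupport φ, F x = 0 := fun x hx => by
    obtain ⟨h0, h1, -⟩ := hφ.eq_zero hx
    rw [hF, stokesFlux, h0, h1, ← plusTransposeL_apply, map_zero, map_zero]; simp
  have key := divergence_theorem_pieces hg T hε0 hε (c₁.mono s₁) (c₁.mono s₂) c₃
    (x₁.mono s₁) (x₁.mono s₂) x₃
    ((integrableOn_congr_fun (e₁.mono s₁) o₁.measurableSet).2 (I₁.mono_set s₁))
    ((integrableOn_congr_fun (e₁.mono s₂) o₂.measurableSet).2 (I₁.mono_set s₂))
    ((integrableOn_congr_fun e₃ hg.isOpen_Ω₃.measurableSet).2 I₃) hφ.compact hφ.subset hz hz hz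
  rw [setIntegral_congr_fun o₁.measurableSet (e₁.mono s₁),
    setIntegral_congr_fun o₂.measurableSet (e₁.mono s₂),
    setIntegral_congr_fun hg.isOpen_Ω₃.measurableSet e₃,
    ← (setIntegral_split hg T hε0 hε I₃ (I₁.mono_set s₂) (I₁.mono_set s₁)).2, integral_neg,
    integral_add (X.integrableOn_p₀ T cd) ((integrableOn_of_continuousOn_closure hg
      (X.continuous_u₀.inner cE.continuousOn)).const_mul μ), integral_const_mul,
    (X.first_order T hφ).1] at key
  have a1 : ∀ ξ, inner ℝ (extendFrom (layer Γ h ε) F (Γ ξ) - extendFrom Ω₃ F (Γ ξ))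
      (coNormal Γ h 0 ξ) = -inner ℝ (φ (Γ ξ)) ((stressFrom μ D₁ u₀ p₀ (Γ ξ)
      - stressFrom μ Ω₃ u₀ p₀ (Γ ξ)) (normal Γ ξ)) := fun ξ => by
    have m1 := gamma_mem_closure_D₁ hg T ξ
    have m3 := gamma_mem_closure_Ω₃ hg T ξ
    have : extendFrom (layer Γ h ε) F (Γ ξ) = extendFrom D₁ F (Γ ξ) :=
      extendFrom_eq_of_tendsto (gamma_mem_closure_layer hg T hε0 hε ξ)
        ((x₁.tendsto_extendFrom m1).mono_left (nhdsWithin_mono _ s₂))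
    rw [this, hF, extendFrom_stokesFlux X.regular₁.2.1 X.regular₁.2.2.2 hφ.contDiff m1,
      extendFrom_stokesFlux X.regular₃.2.1 X.regular₃.2.2.2 hφ.contDiff m3,
      extendFrom_eq_of_continuousOn_closure (D₁_subset hg) X.continuous_u₀ m1,
      extendFrom_eq_of_continuousOn_closure (Ω₃_subset hg) X.continuous_u₀ m3]
    simp only [stressFrom]
    simp only [coNormal_zero, inner_neg_right, inner_sub_left, inner_stress_comm, sub_apply,
      inner_sub_right]
    ring
  have a2 : ∀ ξ, extendFrom (omega1 D₁ Γ h ε) F (gammaEps Γ h ε ξ)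
      - extendFrom (layer Γ h ε) F (gammaEps Γ h ε ξ) = 0 := fun ξ => by
    have hm := gammaEps_mem_D T hε0 hε ξ
    have hm₁ : gammaEps Γ h ε ξ ∈ D₁ := by
      rw [D₁_eq hg T]
      exact ⟨hm, by rw [T.level_eq ε ξ (by rwa [abs_of_pos hε0])]; exact hε0⟩
    have hct := (c₁.continuousOn _ hm₁)
    rw [extendFrom_eq_of_tendsto (gammaEps_mem_closure_omega1 hg T hε0 hε ξ)
        (hct.mono_left (nhdsWithin_mono _ s₁)),
      extendFrom_eq_of_tendsto (gammaEps_mem_closure_layer hg T hε0 hε ξ)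
        (hct.mono_left (nhdsWithin_mono _ s₂)), sub_self]
  simp only [a1, a2, inner_zero_left, intervalIntegral.integral_neg,
    intervalIntegral.integral_zero] at key
  linarith

end Expansion

/-- The fundamental lemma of the calculus of variations on the closed curve `Γ`. -/
lemma periodic_integrand_eq_zero {D D₁ Ω₃ : Set Plane} {Γ : ℝ → Plane} {L : ℝ} {h : ℝ → ℝ}
    (hg : Geometry D D₁ Ω₃ Γ L h) {G : ℝ → Plane} (hG : Continuous G)
    (hp : Function.Periodic G L)
    (hi : ∀ φ, IsTest2 D φ → ∫ ξ in (0 : ℝ)..L, inner ℝ (φ (Γ ξ)) (G ξ) = 0) (ξ₀ : ℝ) :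
    G ξ₀ = 0 := by
  by_contra hne
  obtain ⟨ζ, hζ, hGζ⟩ := hp.exists_mem_Ico₀ hg.period_pos ξ₀
  rw [hGζ] at hne
  -- `Γ ζ` has a neighbourhood that avoids all points of the curve with `G ζ ⬝ G ξ ≤ 0`
  set C : Set ℝ := {ξ ∈ Icc 0 L | inner ℝ (G ζ) (G ξ) ≤ 0} with hC
  have hCc : IsCompact C := by
    refine isCompact_Icc.of_isClosed_subset ?_ fun x hx => hx.1
    have hcG : Continuous fun ξ => inner ℝ (G ζ) (G ξ) := continuous_const.inner hG
    exact isClosed_Icc.inter (isClosed_le hcG continuous_const)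
  have hnot : Γ ζ ∉ Γ '' C := by
    rintro ⟨ξ, hξ, he⟩
    obtain ⟨k, rfl⟩ := exists_int_of_gamma_eq hg he
    have : G (ξ + k * L) = G ξ := by simpa using (hp.int_mul k) ξ
    have h2 := hξ.2
    rw [← this] at h2
    rw [real_inner_self_eq_norm_sq] at h2
    exact hne (norm_eq_zero.1 (pow_eq_zero_iff two_ne_zero |>.1 (le_antisymm h2 (sq_nonneg _))))
  have hO : IsOpen (D ∩ (Γ '' C)ᶜ) :=
    hg.isOpen_D.inter (hCc.image hg.smooth_Γ.continuous).isClosed.isOpen_compl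
  have hmem : Γ ζ ∈ D ∩ (Γ '' C)ᶜ := ⟨hg.range_subset (mem_range_self ζ), hnot⟩
  obtain ⟨ψ, hψs, hψc, hψ, hψr, hψ1⟩ := exists_contDiff_tsupport_subset (n := 2) (hO.mem_nhds hmem)
  have hnn : ∀ x, 0 ≤ ψ x := fun x => (hψr (mem_range_self x)).1
  have h1 := hi (fun x => ψ x • G ζ) (IsTest2.smul_const hψ hψc (hψs.trans inter_subset_left) _)
  have hcont : Continuous fun ξ => inner ℝ (ψ (Γ ξ) • G ζ) (G ξ) :=
    ((hψ.continuous.comp hg.smooth_Γ.continuous).smul continuous_const).inner hG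
  refine absurd h1 (intervalIntegral.integral_pos hg.period_pos hcont.continuousOn ?_
    ⟨ζ, ⟨hζ.1, hζ.2.le⟩, ?_⟩).ne'
  · intro ξ hξ
    rw [inner_smul_left]
    by_cases hξC : ξ ∈ C
    · have : ψ (Γ ξ) = 0 := image_eq_zero_of_notMem_tsupport fun hm =>
        (hψs hm).2 ⟨ξ, hξC, rfl⟩
      rw [this]; simp
    · have : 0 < inner ℝ (G ζ) (G ξ) := by
        by_contra hle
        exact hξC ⟨⟨hξ.1.le, hξ.2⟩, not_lt.1 hle⟩
      exact mul_nonneg (hnn _) this.le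
  · rw [inner_smul_left, hψ1]
    simpa using pow_pos (norm_pos_iff.2 hne) 2

namespace Expansion

variable {μ μ₂ : ℝ} {D D₁ Ω₃ : Set Plane} {Γ : ℝ → Plane} {L : ℝ} {h : ℝ → ℝ}
  {U : Plane → Plane} {u : ℝ → Plane → Plane} {p : ℝ → Plane → ℝ} {u₀ u₁ : Plane → Plane}
  {p₀ p₁ : Plane → ℝ} {a : ℝ} {S : Plane → ℝ}

/-- The leading order stress jumps by the surface tension of two coinciding interfaces. -/
lemma stress_jump (X : Expansion μ μ₂ D D₁ Ω₃ Γ L h U u p u₀ u₁ p₀ p₁)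
    (T : Tube D D₁ Ω₃ Γ L h a S) (ξ : ℝ) :
    (stressFrom μ D₁ u₀ p₀ (Γ ξ) - stressFrom μ Ω₃ u₀ p₀ (Γ ξ)) (normal Γ ξ)
      = (2 * curv Γ ξ) • normal Γ ξ := by
  have hg := X.geometry
  have c1 := (contDiff_normal hg.smooth_Γ).continuous
  have c2 := (contDiff_curv hg.smooth_Γ).continuous
  have hs : ∀ {A : ℝ → Mat} {q : ℝ → ℝ}, Continuous A → Continuous q →
      Continuous fun ξ => stress μ (A ξ) (q ξ) (normal Γ ξ) := fun hA hq => by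
    simp only [stress, sub_apply, smul_apply, ContinuousLinearMap.id_apply]
    exact ((continuous_plusTranspose_apply hA c1).const_smul μ).sub (hq.smul c1)
  have hc1 : Continuous fun ξ => stressFrom μ D₁ u₀ p₀ (Γ ξ) (normal Γ ξ) :=
    hs (X.continuous_gradFrom T) (X.continuous_pressure_D₁ T)
  have hc3 : Continuous fun ξ => stressFrom μ Ω₃ u₀ p₀ (Γ ξ) (normal Γ ξ) :=
    hs (X.continuous_gradFrom₃ T) (X.continuous_pressure_Ω₃ T)
  set G : ℝ → Plane := fun ξ => (stressFrom μ D₁ u₀ p₀ (Γ ξ) - stressFrom μ Ω₃ u₀ p₀ (Γ ξ))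
    (normal Γ ξ) - (2 * curv Γ ξ) • normal Γ ξ with hG
  have hG' : G ξ = 0 := by
    refine periodic_integrand_eq_zero hg ?_ (fun ξ => ?_) (fun φ hφ => ?_) ξ
    · exact (hc1.sub hc3).sub ((continuous_const.mul c2).smul c1)
    · simp only [hG, hg.periodic_Γ, periodic_normal hg.periodic_Γ, periodic_curv hg.periodic_Γ]
    · have h1 := X.integral_stress_jump T hφ
      have cφ : Continuous fun ξ => φ (Γ ξ) := hφ.contDiff.continuous.comp hg.smooth_Γ.continuous
      have i1 : Continuous fun ξ => inner ℝ (φ (Γ ξ)) ((stressFrom μ D₁ u₀ p₀ (Γ ξ)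
          - stressFrom μ Ω₃ u₀ p₀ (Γ ξ)) (normal Γ ξ)) := cφ.inner (hc1.sub hc3)
      have i2 : Continuous fun ξ => 2 * (curv Γ ξ * inner ℝ (normal Γ ξ) (φ (Γ ξ))) :=
        continuous_const.mul (c2.mul (c1.inner cφ))
      rw [← intervalIntegral.integral_const_mul, ← sub_eq_zero,
        ← intervalIntegral.integral_sub (i1.intervalIntegrable _ _) (i2.intervalIntegrable _ _)]
        at h1
      refine Eq.trans ?_ h1
      apply intervalIntegral.integral_congr
      intro ξ _
      show inner ℝ (φ (Γ ξ)) ((stressFrom μ D₁ u₀ p₀ (Γ ξ) - stressFrom μ Ω₃ u₀ p₀ (Γ ξ))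
        (normal Γ ξ) - (2 * curv Γ ξ) • normal Γ ξ) = _
      rw [inner_sub_right, real_inner_smul_right, real_inner_comm (normal Γ ξ) (φ (Γ ξ))]
      ring
  exact sub_eq_zero.1 hG'

/-- The incompressibility of `u₀`, passed to the one-sided boundary values of the gradient. -/
lemma tr_gradFrom (X : Expansion μ μ₂ D D₁ Ω₃ Γ L h U u p u₀ u₁ p₀ p₁)
    (T : Tube D D₁ Ω₃ Γ L h a S) (ξ : ℝ) :
    tr (gradFrom D₁ u₀ Γ ξ) = 0 ∧ tr (gradFrom Ω₃ u₀ Γ ξ) = 0 := by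
  have hg := X.geometry
  have key : ∀ {O : Set Plane}, IsOpen O → O ⊆ D → RegularIn O u₀ p₀ → Γ ξ ∈ closure O →
      tr (gradFrom O u₀ Γ ξ) = 0 := by
    intro O hO hOD hr hm
    have h1 := (continuous_tr.tendsto _).comp (hr.2.1.2.2.tendsto_extendFrom hm)
    have : (𝓝[O] (Γ ξ)).NeBot := mem_closure_iff_nhdsWithin_neBot.1 hm
    refine tendsto_nhds_unique h1 (tendsto_const_nhds.congr' ?_)
    filter_upwards [self_mem_nhdsWithin] with x hx
    have := X.divergence_u₀ T hO hOD hr.2.1.1 x hx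
    rw [divergence_eq_tr] at this
    exact this.symm
  exact ⟨key hg.isOpen_D₁ (D₁_subset hg) X.regular₁ (gamma_mem_closure_D₁ hg T ξ),
    key hg.isOpen_Ω₃ (Ω₃_subset hg) X.regular₃ (gamma_mem_closure_Ω₃ hg T ξ)⟩

/-- The inner velocity is a locally uniform limit of continuous functions, and therefore
continuous. -/
lemma continuous_innerV (X : Expansion μ μ₂ D D₁ Ω₃ Γ L h U u p u₀ u₁ p₀ p₁) (ξ : ℝ) :
    ∃ w₂, Continuous (innerV μ μ₂ D₁ Ω₃ u₀ Γ h ξ w₂) := by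
  have hg := X.geometry
  obtain ⟨w₂, hw⟩ := (X.inner_expansion ξ).1
  refine ⟨w₂, continuous_iff_continuousAt.2 fun y => ?_⟩
  have hK := hw (Metric.closedBall 0 (‖y‖ + 1)) (isCompact_closedBall _ _)
  have hy : Metric.closedBall (0 : Plane) (‖y‖ + 1) ∈ 𝓝 y :=
    mem_of_superset (Metric.isOpen_ball.mem_nhds (by simp)) Metric.ball_subset_closedBall
  refine (hK.continuousOn (Filter.Eventually.frequently ?_)).continuousAt hy
  obtain ⟨r, hr, hball⟩ := Metric.isOpen_iff.1 hg.isOpen_D _ (gamma_mem_D hg ξ)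
  filter_upwards [X.sol, Ioo_mem_nhdsGT (div_pos hr (by positivity : 0 < ‖y‖ + 1))] with ε hs hε
  refine ((hs.continuous_u.comp
    (by fun_prop : Continuous fun z : Plane => Γ ξ + ε • z).continuousOn
    fun z hz => subset_closure (hball ?_)).sub continuousOn_const).const_smul ε⁻¹
  rw [mem_closedBall_zero_iff] at hz
  rw [mem_ball_iff_norm, add_sub_cancel_left, norm_smul, Real.norm_of_nonneg hε.1.le]
  have := (lt_div_iff₀ (by positivity)).1 hε.2
  exact (mul_le_mul_of_nonneg_left hz hε.1.le).trans_lt this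

/-- The tangential derivatives of `u₀` from the two sides agree, because the inner velocity is
continuous across the line `y ⬝ n = 0`. -/
lemma gradFrom_tangent (X : Expansion μ μ₂ D D₁ Ω₃ Γ L h U u p u₀ u₁ p₀ p₁) (ξ : ℝ) :
    gradFrom Ω₃ u₀ Γ ξ (tangent Γ ξ) = gradFrom D₁ u₀ Γ ξ (tangent Γ ξ) := by
  have hg := X.geometry
  have hh := hg.pos_h ξ
  obtain ⟨w₂, hw⟩ := X.continuous_innerV ξ
  have htn : inner ℝ (tangent Γ ξ) (normal Γ ξ) = 0 := inner_rot_self _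
  have hnn : inner ℝ (normal Γ ξ) (normal Γ ξ) = (1 : ℝ) := by
    rw [real_inner_self_eq_norm_sq, norm_normal hg.unit_speed]; norm_num
  have hpath : Continuous fun s : ℝ => tangent Γ ξ + s • normal Γ ξ := by fun_prop
  have h1 : Tendsto (fun s : ℝ => innerV μ μ₂ D₁ Ω₃ u₀ Γ h ξ w₂ (tangent Γ ξ + s • normal Γ ξ))
      (𝓝[>] 0) (𝓝 (innerV μ μ₂ D₁ Ω₃ u₀ Γ h ξ w₂ (tangent Γ ξ))) :=
    ((hw.comp hpath).tendsto' 0 _ (by simp)).mono_left nhdsWithin_le_nhds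
  have h2 : Tendsto (fun s : ℝ => gradFrom Ω₃ u₀ Γ ξ (tangent Γ ξ + s • normal Γ ξ) + w₂)
      (𝓝[>] 0) (𝓝 (gradFrom Ω₃ u₀ Γ ξ (tangent Γ ξ) + w₂)) :=
    ((by fun_prop : Continuous fun s : ℝ => gradFrom Ω₃ u₀ Γ ξ (tangent Γ ξ + s • normal Γ ξ)
      + w₂).tendsto' 0 _ (by simp)).mono_left nhdsWithin_le_nhds
  have h3 := tendsto_nhds_unique h1 (h2.congr' (by
    filter_upwards [self_mem_nhdsWithin] with s hs
    rw [innerV, if_pos]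
    rw [inner_add_left, inner_smul_left, htn, hnn]
    simpa using hs))
  rw [innerV, htn, if_neg (lt_irrefl _), if_pos (by linarith)] at h3
  have h4 := add_right_cancel h3
  rw [← h4, matB2, add_apply, smul_apply]
  simp [tensor, real_inner_comm (tangent Γ ξ) (normal Γ ξ), htn]

/-- The normal derivative of the normal velocity is continuous across the curve: by
incompressibility it is minus the tangential derivative of the tangential velocity. -/
lemma inner_normal_gradFrom (X : Expansion μ μ₂ D D₁ Ω₃ Γ L h U u p u₀ u₁ p₀ p₁)
    (T : Tube D D₁ Ω₃ Γ L h a S) (ξ : ℝ) :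
    inner ℝ (normal Γ ξ) (gradFrom Ω₃ u₀ Γ ξ (normal Γ ξ))
      = inner ℝ (normal Γ ξ) (gradFrom D₁ u₀ Γ ξ (normal Γ ξ)) := by
  have ht := norm_tangent X.geometry.unit_speed ξ
  obtain ⟨h1, h3⟩ := X.tr_gradFrom T ξ
  rw [tr_eq_of_unit _ ht] at h1 h3
  rw [X.gradFrom_tangent ξ] at h3
  simp only [normal]
  linarith

/-- The jump of the leading order pressure: the normal component of `stress_jump`, in which the
viscous stresses cancel. -/
lemma pressure_jump (X : Expansion μ μ₂ D D₁ Ω₃ Γ L h U u p u₀ u₁ p₀ p₁)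
    (T : Tube D D₁ Ω₃ Γ L h a S) (ξ : ℝ) :
    extendFrom Ω₃ p₀ (Γ ξ) - extendFrom D₁ p₀ (Γ ξ) = 2 * curv Γ ξ := by
  have hg := X.geometry
  have hnn : inner ℝ (normal Γ ξ) (normal Γ ξ) = (1 : ℝ) := by
    rw [real_inner_self_eq_norm_sq, norm_normal hg.unit_speed]; norm_num
  have h1 := congrArg (fun v => inner ℝ (normal Γ ξ) v) (X.stress_jump T ξ)
  have h2 := X.inner_normal_gradFrom T ξ
  have hp : ∀ A : Mat, inner ℝ (normal Γ ξ) (plusTranspose A (normal Γ ξ))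
      = 2 * inner ℝ (normal Γ ξ) (A (normal Γ ξ)) := fun A => by
    rw [plusTranspose, add_apply, inner_add_right, ContinuousLinearMap.adjoint_inner_right,
      real_inner_comm (normal Γ ξ) (A _)]
    ring
  simp only [stressFrom, stress, sub_apply, smul_apply, ContinuousLinearMap.id_apply,
    inner_sub_right, inner_smul_right, hnn, hp] at h1
  simp only [gradFrom] at h2
  linear_combination h1 + 2 * μ * h2

/-- The difference of `B₂` and `B₁` is tangential. -/
lemma inner_normal_matB2 (ξ : ℝ) :
    inner ℝ (normal Γ ξ) (matB2 μ μ₂ D₁ u₀ Γ ξ (normal Γ ξ))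
      = inner ℝ (normal Γ ξ) (gradFrom D₁ u₀ Γ ξ (normal Γ ξ)) := by
  have htn : inner ℝ (normal Γ ξ) (tangent Γ ξ) = 0 := by
    rw [real_inner_comm]; exact inner_rot_self _
  simp [matB2, tensor, inner_add_right, inner_smul_right, htn]

/-- The equation satisfied by the first-order corrections. -/
theorem stokesPairing_eq (X : Expansion μ μ₂ D D₁ Ω₃ Γ L h U u p u₀ u₁ p₀ p₁)
    (T : Tube D D₁ Ω₃ Γ L h a S) {φ : Plane → Plane} (hφ : IsTest2 D φ) :
    stokesPairing μ D u₁ p₁ φ =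
      (μ₂ - μ) * (∫ ξ in (0 : ℝ)..L, h ξ *
          frob (matB2 μ μ₂ D₁ u₀ Γ ξ) (plusTranspose (fderiv ℝ φ (Γ ξ))))
        + 2 * (μ - μ₂) * (∫ ξ in (0 : ℝ)..L, h ξ *
          inner ℝ (normal Γ ξ) (matB2 μ μ₂ D₁ u₀ Γ ξ (normal Γ ξ)) * divergence φ (Γ ξ))
        + (∫ ξ in (0 : ℝ)..L, deriv (deriv h) ξ * inner ℝ (normal Γ ξ) (φ (Γ ξ)))
        + (∫ ξ in (0 : ℝ)..L, deriv (curv Γ) ξ * h ξ * inner ℝ (tangent Γ ξ) (φ (Γ ξ))) := by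
  have hg := X.geometry
  have hfirst := (X.first_order T hφ).2
  have cE := continuous_divSym hφ.contDiff
  have cd := continuous_divergence (hφ.contDiff.of_le (by norm_num))
  have c1 := (contDiff_normal hg.smooth_Γ).continuous
  have c2 := hg.smooth_h.continuous
  have c3 := X.continuous_gradFrom T
  have c4 := (contDiff_tangent hg.smooth_Γ).continuous
  have c5 := (contDiff_curv hg.smooth_Γ).continuous
  have c6 : Continuous fun ξ => divergence φ (Γ ξ) := cd.comp hg.smooth_Γ.continuous
  have c7 : Continuous fun ξ => fderiv ℝ φ (Γ ξ) :=
    (hφ.contDiff.continuous_fderiv (by norm_num)).comp hg.smooth_Γ.continuous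
  have cn : Continuous fun ξ => inner ℝ (normal Γ ξ) (gradFrom D₁ u₀ Γ ξ (normal Γ ξ)) :=
    c1.inner (c3.clm_apply c1)
  have cf : Continuous fun ξ => frob (gradFrom D₁ u₀ Γ ξ) (plusTranspose (fderiv ℝ φ (Γ ξ))) := by
    have hc : Continuous fun z : Mat × Mat => frob z.1 (plusTranspose z.2) := by
      simp only [frob_plusTranspose]; fun_prop
    have := hc.comp (c3.prodMk c7)
    simpa only [Function.comp_def] using this
  have cB : Continuous fun ξ => (matB2 μ μ₂ D₁ u₀ Γ ξ - gradFrom D₁ u₀ Γ ξ) (normal Γ ξ) := by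
    have : ∀ ξ, (matB2 μ μ₂ D₁ u₀ Γ ξ - gradFrom D₁ u₀ Γ ξ) (normal Γ ξ)
        = ((μ / μ₂ - 1) * inner ℝ (tangent Γ ξ)
          (plusTranspose (gradFrom D₁ u₀ Γ ξ) (normal Γ ξ))) •
          (inner ℝ (normal Γ ξ) (normal Γ ξ) : ℝ) • tangent Γ ξ := fun ξ => by
      simp [matB2, tensor]
    simp only [this]
    have e1 : Continuous fun ξ => inner ℝ (tangent Γ ξ)
        (plusTranspose (gradFrom D₁ u₀ Γ ξ) (normal Γ ξ)) :=
      c4.inner (continuous_plusTranspose_apply c3 c1)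
    have e2 : Continuous fun ξ => (inner ℝ (normal Γ ξ) (normal Γ ξ) : ℝ) := c1.inner c1
    exact (continuous_const.mul e1).smul (e2.smul c4)
  have cI : Continuous fun ξ => inner ℝ ((matB2 μ μ₂ D₁ u₀ Γ ξ - gradFrom D₁ u₀ Γ ξ) (normal Γ ξ))
      (plusTranspose (fderiv ℝ φ (Γ ξ)) (normal Γ ξ)) :=
    cB.inner (continuous_plusTranspose_apply c7 c1)
  -- the two contributions of the gradients add up to the one with `B₂`
  have hB : (∫ ξ in (0 : ℝ)..L, h ξ * inner ℝ
            ((matB2 μ μ₂ D₁ u₀ Γ ξ - gradFrom D₁ u₀ Γ ξ) (normal Γ ξ))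
            (plusTranspose (fderiv ℝ φ (Γ ξ)) (normal Γ ξ)))
          + (∫ ξ in (0 : ℝ)..L, h ξ * frob (gradFrom D₁ u₀ Γ ξ)
            (plusTranspose (fderiv ℝ φ (Γ ξ))))
      = ∫ ξ in (0 : ℝ)..L, h ξ *
          frob (matB2 μ μ₂ D₁ u₀ Γ ξ) (plusTranspose (fderiv ℝ φ (Γ ξ))) := by
    have e1 : Continuous fun ξ => h ξ * inner ℝ
        ((matB2 μ μ₂ D₁ u₀ Γ ξ - gradFrom D₁ u₀ Γ ξ) (normal Γ ξ))
        (plusTranspose (fderiv ℝ φ (Γ ξ)) (normal Γ ξ)) := c2.mul cI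
    have e2 : Continuous fun ξ => h ξ * frob (gradFrom D₁ u₀ Γ ξ)
        (plusTranspose (fderiv ℝ φ (Γ ξ))) := c2.mul cf
    rw [← intervalIntegral.integral_add (e1.intervalIntegrable _ _)
      (e2.intervalIntegrable _ _)]
    refine intervalIntegral.integral_congr fun ξ _ => ?_
    rw [← mul_add, frob_matB2_sub hg.unit_speed]
  -- by the jump of `p₀`, the pressure in the layer exceeds `p₀¹` by `κ - 2 (μ - μ₂) n ⬝ B₂ n`
  have hP : (∫ ξ in (0 : ℝ)..L, h ξ * ((layerPressure μ μ₂ D₁ Ω₃ u₀ p₀ Γ ξ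
        - extendFrom D₁ p₀ (Γ ξ)) * divergence φ (Γ ξ)))
      = (∫ ξ in (0 : ℝ)..L, h ξ * curv Γ ξ * divergence φ (Γ ξ))
        - 2 * (μ - μ₂) * ∫ ξ in (0 : ℝ)..L, h ξ *
          inner ℝ (normal Γ ξ) (matB2 μ μ₂ D₁ u₀ Γ ξ (normal Γ ξ)) * divergence φ (Γ ξ) := by
    simp only [inner_normal_matB2]
    have e1 : Continuous fun ξ => h ξ * curv Γ ξ * divergence φ (Γ ξ) := (c2.mul c5).mul c6
    have e2 : Continuous fun ξ => 2 * (μ - μ₂) * (h ξ *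
        inner ℝ (normal Γ ξ) (gradFrom D₁ u₀ Γ ξ (normal Γ ξ)) * divergence φ (Γ ξ)) :=
      continuous_const.mul ((c2.mul cn).mul c6)
    rw [← intervalIntegral.integral_const_mul, ← intervalIntegral.integral_sub
      (e1.intervalIntegrable _ _) (e2.intervalIntegrable _ _)]
    refine intervalIntegral.integral_congr fun ξ _ => ?_
    have := X.pressure_jump T ξ
    simp only [layerPressure]
    linear_combination (h ξ * divergence φ (Γ ξ) / 2) * this
  have hS : stokesPairing μ D u₁ p₁ φ = (∫ x in D, p₁ x * divergence φ x)
      + μ * ∫ x in D, inner ℝ (u₁ x) (divSym φ x) := by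
    rw [← integral_const_mul, ← integral_add (X.integrableOn_p₁ T cd)
      ((X.integrableOn_u₁ T cE).const_mul μ)]
    refine integral_congr_ae (Filter.Eventually.of_forall fun x => ?_)
    simp only [divSym]; ring
  rw [hB, hP] at hfirst
  rw [hS]
  linarith

end Expansion

/-! ### Test fields that concentrate at the boundary -/

/-- The primitive of the smooth transition function: a smooth function that vanishes on the
negative half line and has slope one on `[1, ∞)`. -/
def ramp (t : ℝ) : ℝ := ∫ s in (0 : ℝ)..t, Real.smoothTransition s

lemma hasDerivAt_ramp (t : ℝ) : HasDerivAt ramp (Real.smoothTransition t) t :=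
  Real.smoothTransition.continuous.integral_hasStrictDerivAt 0 t |>.hasDerivAt

lemma hasDerivAt_smoothTransition (t : ℝ) :
    HasDerivAt Real.smoothTransition (deriv Real.smoothTransition t) t :=
  ((Real.smoothTransition.contDiff (n := 1)).differentiable (by norm_num) t).hasDerivAt

lemma ramp_of_nonpos {t : ℝ} (ht : t ≤ 0) : ramp t = 0 := by
  rw [ramp, intervalIntegral.integral_symm, intervalIntegral.integral_congr (g := fun _ => 0)]
  · simp
  · intro s hs
    rw [uIcc_of_le ht] at hs
    exact Real.smoothTransition.zero_of_nonpos hs.2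

lemma ramp_bounds {t : ℝ} (ht : 0 ≤ t) : t - 1 ≤ ramp t ∧ ramp t ≤ t := by
  have hd : Differentiable ℝ ramp := fun t => (hasDerivAt_ramp t).differentiableAt
  have h0 : ramp 0 = 0 := ramp_of_nonpos le_rfl
  constructor
  · rcases le_total t 1 with h1 | h1
    · have : 0 ≤ ramp t :=
        intervalIntegral.integral_nonneg ht fun s _ => Real.smoothTransition.nonneg s
      linarith
    · have h2 : ramp t - ramp 1 = t - 1 := by
        rw [ramp, ramp, intervalIntegral.integral_interval_sub_left
          (Real.smoothTransition.continuous.intervalIntegrable _ _)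
          (Real.smoothTransition.continuous.intervalIntegrable _ _),
          intervalIntegral.integral_congr (g := fun _ => 1)]
        · simp
        · intro s hs
          rw [uIcc_of_le h1] at hs
          exact Real.smoothTransition.one_of_one_le hs.1
      have : 0 ≤ ramp 1 :=
        intervalIntegral.integral_nonneg zero_le_one fun s _ => Real.smoothTransition.nonneg s
      linarith
  · have := intervalIntegral.integral_mono_on (μ := volume) ht
      (Real.smoothTransition.continuous.intervalIntegrable 0 t)
      (intervalIntegrable_const (c := (1 : ℝ))) fun s _ => Real.smoothTransition.le_one s
    simpa [ramp] using this

/-- The truncation at scale `σ` of the negative part: it vanishes for `r ≥ -σ` and equals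
`-r` up to an additive constant of size `σ` for `r ≤ -2σ`. -/
def truncNeg (σ r : ℝ) : ℝ := σ * ramp (-1 - r / σ)

/-- The derivative of `truncNeg`. -/
def truncNeg' (σ r : ℝ) : ℝ := -Real.smoothTransition (-1 - r / σ)

/-- The second derivative of `truncNeg`: an approximation of a Dirac mass at `0`, with support in
`[-2σ, -σ]`. -/
def truncNeg'' (σ r : ℝ) : ℝ := σ⁻¹ * deriv Real.smoothTransition (-1 - r / σ)

section TruncNeg

variable {σ r : ℝ}

lemma hasDerivAt_truncNeg (hσ : 0 < σ) : HasDerivAt (truncNeg σ) (truncNeg' σ r) r := by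
  have h1 : HasDerivAt (fun r : ℝ => -1 - r / σ) (-(1 / σ)) r :=
    ((hasDerivAt_id r).div_const σ).const_sub (-1)
  refine (((hasDerivAt_ramp _).comp r h1).const_mul σ).congr_deriv ?_
  rw [truncNeg']; field_simp

lemma hasDerivAt_truncNeg' : HasDerivAt (truncNeg' σ) (truncNeg'' σ r) r := by
  have h1 : HasDerivAt (fun r : ℝ => -1 - r / σ) (-(1 / σ)) r :=
    ((hasDerivAt_id r).div_const σ).const_sub (-1)
  refine ((hasDerivAt_smoothTransition _).comp r h1).fun_neg.congr_deriv ?_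
  rw [truncNeg'']; ring

lemma continuous_truncNeg'' : Continuous (truncNeg'' σ) := by
  have := (Real.smoothTransition.contDiff (n := 1)).continuous_deriv le_rfl
  unfold truncNeg''
  exact continuous_const.mul (this.comp (by fun_prop))

lemma truncNeg''_nonneg (hσ : 0 < σ) : 0 ≤ truncNeg'' σ r :=
  mul_nonneg (inv_nonneg.2 hσ.le) Real.smoothTransition.monotone.deriv_nonneg

lemma trunc_eq_zero (hσ : 0 < σ) (hr : -σ < r) :
    truncNeg σ r = 0 ∧ truncNeg' σ r = 0 ∧ truncNeg'' σ r = 0 := by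
  have h1 : -1 - r / σ < 0 := by
    have : -1 < r / σ := by rw [lt_div_iff₀ hσ]; linarith
    linarith
  refine ⟨by rw [truncNeg, ramp_of_nonpos h1.le, mul_zero], by
    rw [truncNeg', Real.smoothTransition.zero_of_nonpos h1.le, neg_zero], ?_⟩
  have : Real.smoothTransition =ᶠ[𝓝 (-1 - r / σ)] fun _ => 0 := by
    filter_upwards [Iio_mem_nhds h1] with s hs using
      Real.smoothTransition.zero_of_nonpos (le_of_lt hs)
  rw [truncNeg'', this.deriv_eq]; simp

lemma truncNeg''_eq_zero (hσ : 0 < σ) (hr : r < -(2 * σ)) : truncNeg'' σ r = 0 := by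
  have h1 : 1 < -1 - r / σ := by
    have : r / σ < -2 := by rw [div_lt_iff₀ hσ]; linarith
    linarith
  have : Real.smoothTransition =ᶠ[𝓝 (-1 - r / σ)] fun _ => 1 := by
    filter_upwards [Ioi_mem_nhds h1] with s hs using
      Real.smoothTransition.one_of_one_le (le_of_lt hs)
  rw [truncNeg'', this.deriv_eq]; simp

lemma abs_truncNeg'_le : |truncNeg' σ r| ≤ 1 := by
  rw [truncNeg', abs_neg, abs_of_nonneg (Real.smoothTransition.nonneg _)]
  exact Real.smoothTransition.le_one _

lemma abs_truncNeg_le (hσ : 0 < σ) : |truncNeg σ r| ≤ |r| := by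
  rcases le_total (-1 - r / σ) 0 with h1 | h1
  · rw [truncNeg, ramp_of_nonpos h1, mul_zero, abs_zero]; exact abs_nonneg r
  · have h2 := ramp_bounds h1
    have h3 : 0 ≤ ramp (-1 - r / σ) :=
      intervalIntegral.integral_nonneg h1 fun s _ => Real.smoothTransition.nonneg s
    rw [truncNeg, abs_of_nonneg (mul_nonneg hσ.le h3)]
    calc σ * ramp (-1 - r / σ) ≤ σ * (-1 - r / σ) := mul_le_mul_of_nonneg_left h2.2 hσ.le
      _ = -σ - r := by field_simp
      _ ≤ |r| := by linarith [neg_abs_le r]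

lemma tendsto_truncNeg' (hr : r < 0) : Tendsto (fun σ => truncNeg' σ r) (𝓝[>] 0) (𝓝 (-1)) := by
  refine tendsto_const_nhds.congr' ?_
  filter_upwards [Ioo_mem_nhdsGT (by linarith : 0 < -r / 2)] with σ hσ
  have : r / σ < -2 := by rw [div_lt_iff₀ hσ.1]; linarith [hσ.2]
  rw [truncNeg', Real.smoothTransition.one_of_one_le (by linarith)]

lemma tendsto_truncNeg (hr : r < 0) : Tendsto (fun σ => truncNeg σ r) (𝓝[>] 0) (𝓝 (-r)) := by
  have h0 : Tendsto (fun σ : ℝ => σ) (𝓝[>] 0) (𝓝 0) := tendsto_id.mono_left nhdsWithin_le_nhds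
  have hl : Tendsto (fun σ : ℝ => -r - 2 * σ) (𝓝[>] 0) (𝓝 (-r)) := by
    simpa using (h0.const_mul 2).const_sub (-r)
  have hu : Tendsto (fun σ : ℝ => -r - σ) (𝓝[>] 0) (𝓝 (-r)) := by
    simpa using h0.const_sub (-r)
  refine tendsto_of_tendsto_of_tendsto_of_le_of_le' hl hu ?_ ?_ <;>
  · filter_upwards [Ioo_mem_nhdsGT (by linarith : 0 < -r / 2)] with σ hσ
    have h1 : 0 ≤ -1 - r / σ := by
      have : r / σ < -2 := by rw [div_lt_iff₀ hσ.1]; linarith [hσ.2]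
      linarith
    have h2 := ramp_bounds h1
    have e : σ * (-1 - r / σ) = -σ - r := by have := hσ.1.ne'; field_simp
    have h3 := mul_le_mul_of_nonneg_left h2.1 hσ.1.le
    have h4 := mul_le_mul_of_nonneg_left h2.2 hσ.1.le
    rw [truncNeg]
    linarith

lemma contDiff_truncNeg (hσ : 0 < σ) : ContDiff ℝ 2 (truncNeg σ) := by
  have h2 : ContDiff ℝ 1 (truncNeg' σ) := by
    unfold truncNeg'
    exact (Real.smoothTransition.contDiff.comp (by fun_prop)).neg
  have h1 : deriv (truncNeg σ) = truncNeg' σ := funext fun r => (hasDerivAt_truncNeg hσ).deriv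
  rw [show (2 : WithTop ℕ∞) = 1 + 1 by norm_num, contDiff_succ_iff_deriv]
  exact ⟨fun r => (hasDerivAt_truncNeg hσ).differentiableAt, by simp, h1 ▸ h2⟩

end TruncNeg

/-- The vector field `η Δψ + ∇∂_η ψ` as a function of the second derivative of `ψ`. -/
def symOf (η : Plane) (B : Plane →L[ℝ] Plane →L[ℝ] ℝ) : Plane :=
  (B (basisVec 0) (basisVec 0) + B (basisVec 1) (basisVec 1)) • η
    + ∑ i, (B (basisVec i) η) • basisVec i

lemma divergence_smul_const {ψ : Plane → ℝ} (η : Plane) {x : Plane} (hψ : DifferentiableAt ℝ ψ x) :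
    divergence (fun y => ψ y • η) x = fderiv ℝ ψ x η := by
  have hη := eq_sum_basisVec η
  rw [divergence, fderiv_smul_const hψ]
  conv_rhs => rw [hη]
  simp [Fin.sum_univ_two, mul_comm]

lemma divSym_smul_const {ψ : Plane → ℝ} (hψ : ContDiff ℝ 2 ψ) (η x : Plane) :
    divSym (fun y => ψ y • η) x = symOf η (fderiv ℝ (fderiv ℝ ψ) x) := by
  have h1 : fderiv ℝ (fun y => ψ y • η) = fun y => (fderiv ℝ ψ y).smulRight η := funext fun y =>
    fderiv_smul_const ((hψ.differentiable (by norm_num)) y) η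
  have h2 : DifferentiableAt ℝ (fderiv ℝ ψ) x :=
    (hψ.fderiv_right (m := 1) (by norm_num)).differentiable (by norm_num) x
  have h3 : ∀ v w, fderiv ℝ (fderiv ℝ (fun y => ψ y • η)) x v w
      = (fderiv ℝ (fderiv ℝ ψ) x v w) • η := by
    intro v w
    have h4 : HasFDerivAt (fun y => (fderiv ℝ ψ y).smulRight η)
        ((ContinuousLinearMap.smulRightL ℝ Plane Plane).flip η ∘L (fderiv ℝ (fderiv ℝ ψ) x)) x :=
      ((ContinuousLinearMap.smulRightL ℝ Plane Plane).flip η).hasFDerivAt.comp x h2.hasFDerivAt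
    rw [h1, h4.fderiv]; simp
  have hη := eq_sum_basisVec η
  have hs : ContDiff ℝ 2 fun y => ψ y • η := hψ.smul contDiff_const
  rw [divSym_eq hs.contDiffAt, symOf]
  simp only [h3]
  rw [add_smul]
  congr 2
  funext i
  conv_rhs => rw [hη]
  simp [mul_comm]

/-- The second derivative of `f (ρ) χ`, without the term with `f''`. -/
def lowerOrder (ρ χ : Plane → ℝ) (f' f : ℝ) (x : Plane) : Plane →L[ℝ] Plane →L[ℝ] ℝ :=
  f' • (χ x • fderiv ℝ (fderiv ℝ ρ) x + (fderiv ℝ ρ x).smulRight (fderiv ℝ χ x)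
    + (fderiv ℝ χ x).smulRight (fderiv ℝ ρ x)) + f • fderiv ℝ (fderiv ℝ χ) x

section Product

variable {f f' f'' : ℝ → ℝ} {ρ χ : Plane → ℝ}

lemma fderiv_comp_mul (hf : ∀ r, HasDerivAt f (f' r) r) (hρ : ContDiff ℝ 2 ρ) (hχ : ContDiff ℝ 2 χ)
    (x : Plane) : fderiv ℝ (fun y => f (ρ y) * χ y) x
      = (f' (ρ x) * χ x) • fderiv ℝ ρ x + f (ρ x) • fderiv ℝ χ x := by
  have h1 := (hρ.differentiable (by norm_num) x).hasFDerivAt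
  have h2 := (hχ.differentiable (by norm_num) x).hasFDerivAt
  have h3 : HasFDerivAt (fun y => f (ρ y) * χ y) _ x :=
    ((hf (ρ x)).comp_hasFDerivAt x h1).mul h2
  rw [h3.fderiv]
  ext v; simp; ring

lemma fderiv_fderiv_comp_mul (hf : ∀ r, HasDerivAt f (f' r) r)
    (hf' : ∀ r, HasDerivAt f' (f'' r) r) (hρ : ContDiff ℝ 2 ρ) (hχ : ContDiff ℝ 2 χ)
    (x : Plane) : fderiv ℝ (fderiv ℝ (fun y => f (ρ y) * χ y)) x
      = (f'' (ρ x) * χ x) • (fderiv ℝ ρ x).smulRight (fderiv ℝ ρ x)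
        + lowerOrder ρ χ (f' (ρ x)) (f (ρ x)) x := by
  have h1 := (hρ.differentiable (by norm_num) x).hasFDerivAt
  have h2 := (hχ.differentiable (by norm_num) x).hasFDerivAt
  have h3 := ((hρ.fderiv_right (m := 1) (by norm_num)).differentiable (by norm_num) x).hasFDerivAt
  have h4 := ((hχ.fderiv_right (m := 1) (by norm_num)).differentiable (by norm_num) x).hasFDerivAt
  rw [funext (fderiv_comp_mul hf hρ hχ)]
  have h5 : HasFDerivAt (fun y => (f' (ρ y) * χ y) • fderiv ℝ ρ y + f (ρ y) • fderiv ℝ χ y) _ x :=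
    ((((hf' (ρ x)).comp_hasFDerivAt x h1).mul h2).smul h3).add
      (((hf (ρ x)).comp_hasFDerivAt x h1).smul h4)
  rw [h5.fderiv]
  ext v w
  simp [lowerOrder]
  ring

end Product

lemma symOf_add (η : Plane) (A B : Plane →L[ℝ] Plane →L[ℝ] ℝ) :
    symOf η (A + B) = symOf η A + symOf η B := by
  simp only [symOf, add_apply, add_smul, Finset.sum_add_distrib]; abel

lemma symOf_smul (η : Plane) (c : ℝ) (A : Plane →L[ℝ] Plane →L[ℝ] ℝ) :
    symOf η (c • A) = c • symOf η A := by
  simp only [symOf, smul_apply, smul_add, Finset.smul_sum, smul_smul, ← mul_add, smul_eq_mul]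

lemma continuous_symOf (η : Plane) : Continuous (symOf η) := by
  have h : ∀ v w : Plane, Continuous fun B : Plane →L[ℝ] Plane →L[ℝ] ℝ => B v w := fun v w =>
    (continuous_id.clm_apply continuous_const).clm_apply continuous_const
  exact (((h _ _).add (h _ _)).smul continuous_const).add
    (continuous_finsetSum _ fun i _ => (h _ _).smul continuous_const)

lemma continuous_smulRight {X : Type*} [TopologicalSpace X] {A B : X → Plane →L[ℝ] ℝ}
    (hA : Continuous A) (hB : Continuous B) : Continuous fun x => (A x).smulRight (B x) :=
  ((ContinuousLinearMap.smulRightL ℝ Plane (Plane →L[ℝ] ℝ)).continuous.comp hA).clm_apply hB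

section BoundaryLayer

variable {W : Set Plane} {ρ χ : Plane → ℝ}

/-- In `{ρ < 0}` the functions `f' (ρ)` and `f (ρ)`, with `f = truncNeg σ`, are bounded by `1` and
`|ρ|` and tend to `-1` and `-ρ`. The terms without `f''` in the derivatives of `f (ρ) χ` therefore
converge, by dominated convergence, to those of `-ρ χ`. -/
lemma tendsto_integral_truncNeg {F : Type*} [NormedAddCommGroup F] [InnerProductSpace ℝ F]
    (hW : MeasurableSet W) (hneg : ∀ x ∈ W, ρ x < 0) (hρ : Continuous ρ) {w P Q : Plane → F}
    (hw : IntegrableOn w W) (hP : Continuous P) (hPc : HasCompactSupport P) (hQ : Continuous Q)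
    (hQc : HasCompactSupport Q) :
    (∀ σ > 0, IntegrableOn (fun x => inner ℝ (w x)
      (truncNeg' σ (ρ x) • P x + truncNeg σ (ρ x) • Q x)) W) ∧
    Tendsto (fun σ => ∫ x in W, inner ℝ (w x)
      (truncNeg' σ (ρ x) • P x + truncNeg σ (ρ x) • Q x)) (𝓝[>] 0)
      (𝓝 (-∫ x in W, inner ℝ (w x) (P x + ρ x • Q x))) := by
  obtain ⟨C₁, hC₁⟩ := hPc.exists_bound_of_continuous hP
  obtain ⟨C₂, hC₂⟩ := (hQc.smul_left (f := ρ)).exists_bound_of_continuous (hρ.smul hQ)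
  have hb : ∀ σ > 0, ∀ x, ‖inner ℝ (w x) (truncNeg' σ (ρ x) • P x + truncNeg σ (ρ x) • Q x)‖
      ≤ ‖w x‖ * (C₁ + C₂) := by
    intro σ hσ x
    refine (norm_inner_le_norm _ _).trans (mul_le_mul_of_nonneg_left ?_ (norm_nonneg _))
    refine (norm_add_le _ _).trans (add_le_add ?_ ?_)
    · rw [norm_smul]
      exact (mul_le_of_le_one_left (norm_nonneg _) abs_truncNeg'_le).trans (hC₁ x)
    · have := hC₂ x
      simp only [Pi.smul_apply', norm_smul] at this ⊢
      exact (mul_le_mul_of_nonneg_right (abs_truncNeg_le hσ) (norm_nonneg _)).trans this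
  have hm : ∀ σ > 0, AEStronglyMeasurable (fun x => inner ℝ (w x)
      (truncNeg' σ (ρ x) • P x + truncNeg σ (ρ x) • Q x)) (volume.restrict W) := by
    intro σ hσ
    have c1 : Continuous (truncNeg' σ) := continuous_iff_continuousAt.2 fun r =>
      hasDerivAt_truncNeg'.continuousAt
    have c2 : Continuous (truncNeg σ) := (contDiff_truncNeg hσ).continuous
    exact hw.1.inner (((c1.comp hρ).smul hP).add ((c2.comp hρ).smul hQ)).aestronglyMeasurable
  have hint : Integrable (fun x => ‖w x‖ * (C₁ + C₂)) (volume.restrict W) := hw.norm.mul_const _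
  refine ⟨fun σ hσ => hint.mono' (hm σ hσ) (Filter.Eventually.of_forall (hb σ hσ)), ?_⟩
  rw [← integral_neg]
  refine tendsto_integral_filter_of_dominated_convergence _ ?_ ?_ hint ?_
  · filter_upwards [self_mem_nhdsWithin] with σ hσ using hm σ hσ
  · filter_upwards [self_mem_nhdsWithin] with σ hσ using Filter.Eventually.of_forall (hb σ hσ)
  · refine (ae_restrict_iff' hW).2 (Filter.Eventually.of_forall fun x hx => ?_)
    have h1 := (tendsto_truncNeg' (hneg x hx)).smul_const (P x)
    have h2 := (tendsto_truncNeg (hneg x hx)).smul_const (Q x)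
    have h3 : Tendsto (fun σ => inner ℝ (w x) (truncNeg' σ (ρ x) • P x + truncNeg σ (ρ x) • Q x))
        (𝓝[>] 0) (𝓝 (inner ℝ (w x) ((-1 : ℝ) • P x + (-ρ x) • Q x))) :=
      Tendsto.inner tendsto_const_nhds (h1.add h2)
    convert h3 using 2
    rw [← inner_neg_right]
    congr 1
    module

lemma fderiv_eq_zero_of_notMem_tsupport {x : Plane} (hx : x ∉ tsupport χ) :
    χ x = 0 ∧ fderiv ℝ χ x = 0 := by
  have h0 : χ =ᶠ[𝓝 x] 0 := notMem_tsupport_iff_eventuallyEq.1 hx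
  exact ⟨h0.self_of_nhds, by rw [h0.fderiv_eq]; simp⟩

/-- The measures `f'' (ρ) ∂ₑρ dx`, with `f = truncNeg σ`, concentrate at the boundary `{ρ = 0}`.
Their limit is determined by means of an integration by parts. -/
lemma tendsto_integral_truncNeg'' (hW : MeasurableSet W) (hWf : volume W ≠ ⊤)
    (hneg : ∀ x ∈ W, ρ x < 0) (hmem : ∀ x ∈ tsupport χ, ρ x < 0 → x ∈ W) (hρ : ContDiff ℝ 2 ρ)
    (hχ : ContDiff ℝ 2 χ) (hc : HasCompactSupport χ) (e : Plane) :
    Tendsto (fun σ => ∫ x in W, truncNeg'' σ (ρ x) * χ x * fderiv ℝ ρ x e) (𝓝[>] 0)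
      (𝓝 (∫ x in W, fderiv ℝ χ x e)) := by
  have cχ : Continuous fun x => fderiv ℝ χ x e :=
    (hχ.continuous_fderiv (by norm_num)).clm_apply continuous_const
  have cρ : Continuous fun x => fderiv ℝ ρ x e :=
    (hρ.continuous_fderiv (by norm_num)).clm_apply continuous_const
  have hcχ : HasCompactSupport fun x => fderiv ℝ χ x e :=
    (hc.fderiv (𝕜 := ℝ)).comp_left (g := fun A : Plane →L[ℝ] ℝ => A e) (by simp)
  have key := tendsto_integral_truncNeg hW hneg hρ.continuous (w := fun _ => (1 : ℝ)) (Q := 0)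
    (integrableOn_const hWf) cχ hcχ continuous_const HasCompactSupport.zero
  have hlim := key.2.neg
  rw [neg_neg] at hlim
  simp only [Pi.zero_apply, smul_eq_mul, RCLike.inner_apply, conj_trivial, mul_one, mul_zero,
    add_zero] at hlim key
  refine hlim.congr' ?_
  filter_upwards [self_mem_nhdsWithin] with σ hσ
  have hσ : 0 < σ := hσ
  have hf : ContDiff ℝ 1 (truncNeg' σ) := by
    unfold truncNeg'
    exact (Real.smoothTransition.contDiff.comp (by fun_prop)).neg
  have hψ : ContDiff ℝ 1 fun x => truncNeg' σ (ρ x) * χ x :=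
    (hf.comp (hρ.of_le (by norm_num))).mul (hχ.of_le (by norm_num))
  -- The field `f' (ρ) χ e` has compact support, and it vanishes where `ρ > -σ`.
  have h0 := integral_divergence_eq_zero (W := fun x => (truncNeg' σ (ρ x) * χ x) • e)
    (hψ.smul contDiff_const) ((hc.mul_left (f := fun x => truncNeg' σ (ρ x))).smul_right)
  have hdiv : ∀ x, divergence (fun x => (truncNeg' σ (ρ x) * χ x) • e) x
      = truncNeg'' σ (ρ x) * χ x * fderiv ℝ ρ x e + truncNeg' σ (ρ x) * fderiv ℝ χ x e := by
    intro x
    rw [divergence_smul_const e (hψ.differentiable (by norm_num) x),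
      fderiv_comp_mul (fun r => hasDerivAt_truncNeg') hρ hχ]
    simp
  have hz : ∀ x, x ∉ W → truncNeg'' σ (ρ x) * χ x * fderiv ℝ ρ x e
      + truncNeg' σ (ρ x) * fderiv ℝ χ x e = 0 := by
    intro x hx
    by_cases hs : x ∈ tsupport χ
    · have hr : 0 ≤ ρ x := not_lt.1 fun h => hx (hmem x hs h)
      have := trunc_eq_zero hσ (by linarith : -σ < ρ x)
      rw [this.2.1, this.2.2]; ring
    · have := fderiv_eq_zero_of_notMem_tsupport hs
      rw [this.1, this.2]; simp
  simp only [hdiv] at h0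
  rw [← setIntegral_eq_integral_of_forall_compl_eq_zero hz, integral_add ?_ (key.1 σ hσ)] at h0
  · linarith
  · have hcont : Continuous fun x => truncNeg'' σ (ρ x) * χ x * fderiv ℝ ρ x e :=
      ((continuous_truncNeg''.comp hρ.continuous).mul hχ.continuous).mul cρ
    exact (hcont.integrable_of_hasCompactSupport
      ((hc.mul_left (f := fun x => truncNeg'' σ (ρ x))).mul_right)).integrableOn

/-- If `(w, q)` solves the Stokes equations in the weak sense, then the boundary values of `w`,
tested by the concentrating measures, are given by the weak form for a test field `ρ χ η` that
vanishes on the boundary only. -/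
lemma tendsto_boundary_layer (hW : MeasurableSet W)
    (hneg : ∀ x ∈ W, ρ x < 0) (hmem : ∀ x ∈ tsupport χ, ρ x < 0 → x ∈ W) (hρ : ContDiff ℝ 2 ρ)
    (hχ : ContDiff ℝ 2 χ) (hc : HasCompactSupport χ) {w : Plane → Plane} {q : Plane → ℝ} {μ : ℝ}
    (hw : IntegrableOn w W) (hq : IntegrableOn q W)
    (weak : ∀ φ, IsTest2 W φ → (∫ x in W, q x * divergence φ x)
      + μ * (∫ x in W, inner ℝ (w x) (divSym φ x)) = 0) (η : Plane) :
    Tendsto (fun σ => μ * ∫ x in W, truncNeg'' σ (ρ x) * χ x * inner ℝ (w x)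
        (symOf η ((fderiv ℝ ρ x).smulRight (fderiv ℝ ρ x)))) (𝓝[>] 0)
      (𝓝 ((∫ x in W, q x * divergence (fun y => (ρ y * χ y) • η) x)
        + μ * ∫ x in W, inner ℝ (w x) (divSym (fun y => (ρ y * χ y) • η) x))) := by
  -- The divergence of `f (ρ) χ η` is `f' (ρ) P₁ + f (ρ) Q₁`, and its second derivatives contribute
  -- `f' (ρ) P₂ + f (ρ) Q₂` besides the term with `f''`.
  set P₁ : Plane → ℝ := fun x => χ x * fderiv ℝ ρ x η with hP₁
  set Q₁ : Plane → ℝ := fun x => fderiv ℝ χ x η with hQ₁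
  set P₂ : Plane → Plane := fun x => symOf η (lowerOrder ρ χ 1 0 x) with hP₂
  set Q₂ : Plane → Plane := fun x => symOf η (lowerOrder ρ χ 0 1 x) with hQ₂
  have hlow : ∀ a b x, symOf η (lowerOrder ρ χ a b x) = a • P₂ x + b • Q₂ x := by
    intro a b x
    rw [hP₂, hQ₂, ← symOf_smul, ← symOf_smul, ← symOf_add]
    congr 1
    simp only [lowerOrder]; module
  have cρ := hρ.continuous_fderiv (by norm_num)
  have cχ := hχ.continuous_fderiv (by norm_num)
  have cρ2 : Continuous (fderiv ℝ (fderiv ℝ ρ)) :=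
    (hρ.fderiv_right (m := 1) (by norm_num)).continuous_fderiv (by norm_num)
  have cχ2 : Continuous (fderiv ℝ (fderiv ℝ χ)) :=
    (hχ.fderiv_right (m := 1) (by norm_num)).continuous_fderiv (by norm_num)
  have clow : ∀ a b, Continuous (lowerOrder ρ χ a b) := by
    intro a b
    have e1 : Continuous fun x => (fderiv ℝ ρ x).smulRight (fderiv ℝ χ x) :=
      continuous_smulRight cρ cχ
    have e2 : Continuous fun x => (fderiv ℝ χ x).smulRight (fderiv ℝ ρ x) :=
      continuous_smulRight cχ cρ
    exact ((((hχ.continuous.smul cρ2).add e1).add e2).const_smul a).add (cχ2.const_smul b)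
  have hlow0 : ∀ a b, ∀ x ∉ tsupport χ, symOf η (lowerOrder ρ χ a b x) = 0 := by
    intro a b x hx
    have h0 : χ =ᶠ[𝓝 x] 0 := notMem_tsupport_iff_eventuallyEq.1 hx
    have h1 : fderiv ℝ χ =ᶠ[𝓝 x] 0 := by
      filter_upwards [h0.eventuallyEq_nhds] with y hy
      rw [hy.fderiv_eq]; simp
    have h2 : fderiv ℝ (fderiv ℝ χ) x = 0 := by rw [h1.fderiv_eq]; simp
    have : lowerOrder ρ χ a b x = 0 := by
      simp only [lowerOrder, h0.self_of_nhds, h1.self_of_nhds, h2, Pi.zero_apply, zero_smul,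
        smul_zero, zero_add, add_zero]
      ext; simp
    rw [this]; simp [symOf]
  have k2 := tendsto_integral_truncNeg hW hneg hρ.continuous (P := P₂) (Q := Q₂) hw
    ((continuous_symOf η).comp (clow 1 0)) (HasCompactSupport.intro hc (hlow0 1 0))
    ((continuous_symOf η).comp (clow 0 1)) (HasCompactSupport.intro hc (hlow0 0 1))
  have k1 := tendsto_integral_truncNeg hW hneg hρ.continuous (P := P₁) (Q := Q₁) hq
    (hχ.continuous.mul (cρ.clm_apply continuous_const)) hc.mul_right
    (cχ.clm_apply continuous_const)
    ((hc.fderiv (𝕜 := ℝ)).comp_left (g := fun A : Plane →L[ℝ] ℝ => A η) (by simp))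
  have hlim := (k1.2.add (k2.2.const_mul μ)).neg
  have hρχ : ContDiff ℝ 2 fun y => ρ y * χ y := hρ.mul hχ
  have hid : ∀ r : ℝ, HasDerivAt (fun r : ℝ => r) ((fun _ : ℝ => (1 : ℝ)) r) r := hasDerivAt_id
  have l1 : ∀ x, inner ℝ (q x) (P₁ x + ρ x • Q₁ x)
      = q x * divergence (fun y => (ρ y * χ y) • η) x := by
    intro x
    rw [divergence_smul_const η (hρχ.differentiable (by norm_num) x),
      fderiv_comp_mul (f := fun r => r) hid hρ hχ]
    simp [hP₁, hQ₁, mul_comm]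
  have l2 : ∀ x, P₂ x + ρ x • Q₂ x = divSym (fun y => (ρ y * χ y) • η) x := by
    intro x
    rw [divSym_smul_const hρχ, fderiv_fderiv_comp_mul (f := fun r => r) (f'' := fun _ => 0) hid
      (fun r => hasDerivAt_const r 1) hρ hχ, symOf_add, symOf_smul, zero_mul, zero_smul, zero_add,
      hlow, one_smul]
  simp only [l1, l2] at hlim
  -- The weak form for `f (ρ) χ η` expresses the integral with `f''` by those of lower order.
  convert hlim.congr' ?_ using 2
  · ring
  filter_upwards [self_mem_nhdsWithin] with σ hσ
  have hσ : 0 < σ := hσ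
  have hψ : ContDiff ℝ 2 fun x => truncNeg σ (ρ x) * χ x :=
    ((contDiff_truncNeg hσ).comp hρ).mul hχ
  have hsub : tsupport (fun x => truncNeg σ (ρ x) * χ x) ⊆ W := by
    have hcl : IsClosed (tsupport χ ∩ {x | ρ x ≤ -σ}) :=
      (isClosed_tsupport χ).inter (isClosed_le hρ.continuous continuous_const)
    refine (closure_minimal (fun x hx => ?_) hcl).trans fun x hx =>
      hmem x hx.1 (lt_of_le_of_lt hx.2 (by linarith))
    rw [Function.mem_support] at hx
    have hle : ρ x ≤ -σ := by
      by_contra h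
      exact hx (by rw [(trunc_eq_zero hσ (not_le.1 h)).1, zero_mul])
    exact ⟨subset_tsupport χ fun h => hx (by rw [h, mul_zero]), hle⟩
  have hwk := weak _ (IsTest2.smul_const hψ (hc.mul_left (f := fun x => truncNeg σ (ρ x))) hsub η)
  have d1 : ∀ x, q x * divergence (fun y => (truncNeg σ (ρ y) * χ y) • η) x
      = inner ℝ (q x) (truncNeg' σ (ρ x) • P₁ x + truncNeg σ (ρ x) • Q₁ x) := by
    intro x
    rw [divergence_smul_const η (hψ.differentiable (by norm_num) x),
      fderiv_comp_mul (fun r => hasDerivAt_truncNeg hσ) hρ hχ]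
    simp [hP₁, hQ₁]; ring
  have d2 : ∀ x, inner ℝ (w x) (divSym (fun y => (truncNeg σ (ρ y) * χ y) • η) x)
      = truncNeg'' σ (ρ x) * χ x * inner ℝ (w x)
        (symOf η ((fderiv ℝ ρ x).smulRight (fderiv ℝ ρ x)))
        + inner ℝ (w x) (truncNeg' σ (ρ x) • P₂ x + truncNeg σ (ρ x) • Q₂ x) := by
    intro x
    rw [divSym_smul_const hψ, fderiv_fderiv_comp_mul (fun r => hasDerivAt_truncNeg hσ)
      (fun r => hasDerivAt_truncNeg') hρ hχ, symOf_add, symOf_smul, hlow, inner_add_right,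
      real_inner_smul_right]
  simp only [d1, d2] at hwk
  rw [integral_add _ (k2.1 σ hσ)] at hwk
  · linarith
  · have cE : Continuous fun x => (truncNeg'' σ (ρ x) * χ x) •
        symOf η ((fderiv ℝ ρ x).smulRight (fderiv ℝ ρ x)) := by
      have e1 : Continuous fun x => (fderiv ℝ ρ x).smulRight (fderiv ℝ ρ x) :=
        continuous_smulRight cρ cρ
      exact ((continuous_truncNeg''.comp hρ.continuous).mul hχ.continuous).smul
        ((continuous_symOf η).comp e1)
    have hcE : HasCompactSupport fun x => (truncNeg'' σ (ρ x) * χ x) •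
        symOf η ((fderiv ℝ ρ x).smulRight (fderiv ℝ ρ x)) :=
      (hc.mul_left (f := fun x => truncNeg'' σ (ρ x))).smul_right
    obtain ⟨C, hC⟩ := hcE.exists_bound_of_continuous cE
    refine (hw.norm.mul_const C).mono' ?_ (Filter.Eventually.of_forall fun x => ?_)
    · have := hw.1.inner (𝕜 := ℝ) (cE.aestronglyMeasurable (μ := volume.restrict W))
      simpa only [real_inner_smul_right] using this
    · rw [← real_inner_smul_right]
      exact (norm_inner_le_norm _ _).trans (mul_le_mul_of_nonneg_left (hC x) (norm_nonneg _))

end BoundaryLayer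

/-! ### Local charts at the outer boundary -/

/-- Near `x₀`, the set `D` is the region `{ρ < 0}`, and the differential of `ρ` is close to the
inner product with the unit vector `e`. -/
structure BoundaryChart (D : Set Plane) (x₀ : Plane) (ρ : Plane → ℝ) (e : Plane) (r : ℝ) :
    Prop where
  smooth : ContDiff ℝ 2 ρ
  unit : ‖e‖ = 1
  pos : 0 < r
  mem_iff : ∀ y ∈ Metric.ball x₀ r, y ∈ D ↔ ρ y < 0
  close : ∀ y ∈ Metric.ball x₀ r, ‖fderiv ℝ ρ y - innerSL ℝ e‖ ≤ 1 / 8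
  zero : ρ x₀ = 0

/-- A local defining function of the `C²` boundary, divided by the norm of its gradient at `x₀` and
extended to the plane, is a chart. -/
lemma exists_boundaryChart {D : Set Plane} (hD : IsOpen D) (hC : HasC2Boundary D) {x₀ : Plane}
    (hx₀ : x₀ ∈ frontier D) {r₀ : ℝ} (hr₀ : 0 < r₀) :
    ∃ ρ e r, r ≤ r₀ ∧ BoundaryChart D x₀ ρ e r := by
  obtain ⟨V, ρ, hV, hxV, hρ, hd, hm⟩ := hC x₀ hx₀
  -- a plateau function makes `ρ` global without changing it near `x₀`
  obtain ⟨δ, hδ, hδV⟩ := Metric.isOpen_iff.1 hV x₀ hxV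
  let β : ContDiffBump x₀ := ⟨δ / 3, δ / 2, by linarith, by linarith⟩
  have hne : ‖fderiv ℝ ρ x₀‖ ≠ 0 := norm_ne_zero_iff.2 (hd x₀ hxV)
  set g : Plane → ℝ := fun y => ‖fderiv ℝ ρ x₀‖⁻¹ * (β y * ρ y) with hg
  have hβs : tsupport β ⊆ V := by
    rw [β.tsupport_eq]
    exact (Metric.closedBall_subset_ball (show δ / 2 < δ by linarith)).trans hδV
  have hgs : ContDiff ℝ 2 g := by
    refine contDiff_const.mul (contDiff_iff_contDiffAt.2 fun x => ?_)
    by_cases hx : x ∈ tsupport β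
    · exact β.contDiff.contDiffAt.mul (hρ.contDiffAt (hV.mem_nhds (hβs hx)))
    · refine (contDiffAt_const (c := (0 : ℝ))).congr_of_eventuallyEq ?_
      filter_upwards [notMem_tsupport_iff_eventuallyEq.1 hx] with y hy
      rw [hy]; simp
  have hgρ : ∀ y ∈ Metric.ball x₀ (δ / 3), g y = ‖fderiv ℝ ρ x₀‖⁻¹ * ρ y := by
    intro y hy
    rw [hg]
    simp only
    rw [β.one_of_mem_closedBall (Metric.ball_subset_closedBall hy), one_mul]
  have hd0 : fderiv ℝ g x₀ = ‖fderiv ℝ ρ x₀‖⁻¹ • fderiv ℝ ρ x₀ := by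
    have : g =ᶠ[𝓝 x₀] fun y => ‖fderiv ℝ ρ x₀‖⁻¹ * ρ y := by
      filter_upwards [Metric.ball_mem_nhds x₀ (by linarith : 0 < δ / 3)] with y hy using hgρ y hy
    rw [this.fderiv_eq, fderiv_const_mul
      ((hρ.contDiffAt (hV.mem_nhds hxV)).differentiableAt (by norm_num))]
  set e : Plane := (InnerProductSpace.toDual ℝ Plane).symm (fderiv ℝ g x₀) with he
  have hei : innerSL ℝ e = fderiv ℝ g x₀ := by
    ext v; simp [he]
  have hcont := (hgs.continuous_fderiv (by norm_num)).continuousAt (x := x₀)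
  obtain ⟨r₁, hr₁, h1⟩ := Metric.continuousAt_iff.1 hcont (1 / 8) (by norm_num)
  have hmem : ∀ y ∈ Metric.ball x₀ (δ / 3), y ∈ D ↔ g y < 0 := by
    intro y hy
    rw [hm y (hδV (Metric.ball_subset_ball (by linarith) hy)), hgρ y hy]
    have : 0 < ‖fderiv ℝ ρ x₀‖⁻¹ := inv_pos.2 (lt_of_le_of_ne (norm_nonneg _) hne.symm)
    constructor
    · intro h; exact mul_neg_of_pos_of_neg this h
    · intro h; by_contra hh; exact absurd (mul_nonneg this.le (not_lt.1 hh)) (not_le.2 h)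
  refine ⟨g, e, min r₀ (min r₁ (δ / 3)), min_le_left _ _, hgs, ?_, ?_, ?_, ?_, ?_⟩
  · rw [he, LinearIsometryEquiv.norm_map, hd0, norm_smul, norm_inv, norm_norm, inv_mul_cancel₀ hne]
  · exact lt_min hr₀ (lt_min hr₁ (by linarith))
  · intro y hy
    exact hmem y (Metric.ball_subset_ball ((min_le_right _ _).trans (min_le_right _ _)) hy)
  · intro y hy
    have := h1 (Metric.mem_ball.1
      (Metric.ball_subset_ball ((min_le_right _ _).trans (min_le_left _ _)) hy))
    rw [dist_eq_norm] at this
    rw [hei]; exact this.le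
  · have hx : x₀ ∈ Metric.ball x₀ (δ / 3) := Metric.mem_ball_self (by linarith)
    refine le_antisymm ?_ (not_lt.1 fun h => ?_)
    · refine closure_minimal (t := {y | g y ≤ 0} ∪ (Metric.ball x₀ (δ / 3))ᶜ) (s := D) ?_ ?_
        (frontier_subset_closure hx₀) |>.resolve_right fun h => h hx
      · intro y hy
        by_cases hyb : y ∈ Metric.ball x₀ (δ / 3)
        · exact Or.inl ((hmem y hyb).1 hy).le
        · exact Or.inr hyb
      · exact (isClosed_le hgs.continuous continuous_const).union
          Metric.isOpen_ball.isClosed_compl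
    · have := (hmem x₀ hx).2 h
      rw [hD.frontier_eq] at hx₀
      exact hx₀.2 this

namespace BoundaryChart

variable {D : Set Plane} {x₀ : Plane} {ρ : Plane → ℝ} {e : Plane} {r : ℝ}

lemma mono (c : BoundaryChart D x₀ ρ e r) {r' : ℝ} (h0 : 0 < r') (hr : r' ≤ r) :
    BoundaryChart D x₀ ρ e r' where
  smooth := c.smooth
  unit := c.unit
  pos := h0
  mem_iff y hy := c.mem_iff y (Metric.ball_subset_ball hr hy)
  close y hy := c.close y (Metric.ball_subset_ball hr hy)
  zero := c.zero

lemma abs_sub_le (c : BoundaryChart D x₀ ρ e r) {y z : Plane} (hy : y ∈ Metric.ball x₀ r)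
    (hz : z ∈ Metric.ball x₀ r) : |ρ z - ρ y - inner ℝ e (z - y)| ≤ 1 / 8 * ‖z - y‖ := by
  have hd : ∀ x ∈ Metric.ball x₀ r, HasFDerivWithinAt ρ (fderiv ℝ ρ x) (Metric.ball x₀ r) x :=
    fun x _ => (c.smooth.differentiable (by norm_num) x).hasFDerivAt.hasFDerivWithinAt
  have := (convex_ball x₀ r).norm_image_sub_le_of_norm_hasFDerivWithin_le' hd c.close hy hz
  simpa using this

lemma sub_smul_mem (c : BoundaryChart D x₀ ρ e r) {δ t : ℝ} {y : Plane} (hδ : 3 * δ ≤ r)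
    (ht : t ∈ Icc 0 (2 * δ)) (hy : y ∈ Metric.ball x₀ δ) : y - t • e ∈ Metric.ball x₀ r := by
  rw [mem_ball_iff_norm] at hy ⊢
  have : ‖t • e‖ = t := by rw [norm_smul, c.unit, mul_one, Real.norm_of_nonneg ht.1]
  calc ‖y - t • e - x₀‖ = ‖(y - x₀) - t • e‖ := by congr 1; abel
    _ ≤ ‖y - x₀‖ + ‖t • e‖ := norm_sub_le _ _
    _ < r := by rw [this]; linarith [ht.2]

/-- Near a boundary point, `D` is locally connected: the points of `D` near `x₀` lie in the same
part of any decomposition into two disjoint open sets. -/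
lemma subset_or_subset (c : BoundaryChart D x₀ ρ e r) {O₁ O₃ : Set Plane} (h₁ : IsOpen O₁)
    (h₃ : IsOpen O₃) (hd : Disjoint O₁ O₃) (hO : D ∩ Metric.ball x₀ r ⊆ O₁ ∪ O₃) {δ : ℝ}
    (hδ0 : 0 < δ) (hδ : 3 * δ ≤ r) :
    D ∩ Metric.ball x₀ δ ⊆ O₁ ∨ D ∩ Metric.ball x₀ δ ⊆ O₃ := by
  have hlt : δ < r := by linarith
  have hsub := Metric.ball_subset_ball (x := x₀) hlt.le
  -- The shifted ball `A` lies inside `D`, and each point of `D` near `x₀` is joined to `A` by a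
  -- segment in the direction `-e`, along which `ρ` decreases.
  set A : Set Plane := (fun y => y - (2 * δ) • e) '' Metric.ball x₀ δ with hA
  have hAc : IsPreconnected A :=
    (convex_ball x₀ δ).isPreconnected.image _ (by fun_prop)
  have hAD : A ⊆ D ∩ Metric.ball x₀ r := by
    rintro _ ⟨y, hy, rfl⟩
    have hm := c.sub_smul_mem hδ (t := 2 * δ) ⟨by linarith, le_rfl⟩ hy
    refine ⟨(c.mem_iff _ hm).2 ?_, hm⟩
    have h1 := (abs_le.1 (c.abs_sub_le (Metric.mem_ball_self c.pos) hm)).2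
    simp only [c.zero] at h1
    rw [mem_ball_iff_norm] at hy
    have h2 : inner ℝ e (y - (2 * δ) • e - x₀) = inner ℝ e (y - x₀) - 2 * δ := by
      rw [show y - (2 * δ) • e - x₀ = (y - x₀) - (2 * δ) • e by abel, inner_sub_right,
        real_inner_smul_right, real_inner_self_eq_norm_sq, c.unit]; ring
    have h3 : inner ℝ e (y - x₀) ≤ ‖y - x₀‖ := by
      simpa [c.unit] using real_inner_le_norm e (y - x₀)
    have h4 : ‖y - (2 * δ) • e - x₀‖ ≤ 3 * δ := by
      calc ‖y - (2 * δ) • e - x₀‖ = ‖(y - x₀) - (2 * δ) • e‖ := by congr 1; abel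
        _ ≤ ‖y - x₀‖ + ‖(2 * δ) • e‖ := norm_sub_le _ _
        _ ≤ 3 * δ := by
          rw [norm_smul, c.unit, mul_one, Real.norm_of_nonneg (by linarith)]; linarith
    rw [h2] at h1
    linarith
  have hseg : ∀ y ∈ D ∩ Metric.ball x₀ δ, (fun t : ℝ => y - t • e) '' Icc 0 (2 * δ)
      ⊆ D ∩ Metric.ball x₀ r := by
    rintro y ⟨hyD, hy⟩ _ ⟨t, ht, rfl⟩
    have hm := c.sub_smul_mem hδ ht hy
    refine ⟨(c.mem_iff _ hm).2 ?_, hm⟩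
    have h1 := (abs_le.1 (c.abs_sub_le (hsub hy) hm)).2
    have h2 : y - t • e - y = -(t • e) := by abel
    rw [h2, norm_neg, inner_neg_right, real_inner_smul_right, real_inner_self_eq_norm_sq,
      norm_smul, c.unit, Real.norm_of_nonneg ht.1] at h1
    have := (c.mem_iff _ (hsub hy)).1 hyD
    linarith [ht.1]
  have hsegc : ∀ y, IsPreconnected ((fun t : ℝ => y - t • e) '' Icc 0 (2 * δ)) := fun y =>
    isPreconnected_Icc.image _ (by fun_prop)
  have hx₀ : x₀ - (2 * δ) • e ∈ A := ⟨x₀, Metric.mem_ball_self hδ0, rfl⟩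
  have main : ∀ {P Q : Set Plane}, IsOpen P → IsOpen Q → Disjoint P Q →
      D ∩ Metric.ball x₀ r ⊆ P ∪ Q → x₀ - (2 * δ) • e ∈ P → D ∩ Metric.ball x₀ δ ⊆ P := by
    intro P Q hP hQ hPQ hs hx y hy
    have hAP : A ⊆ P := hAc.subset_left_of_subset_union hP hQ hPQ (hAD.trans hs) ⟨_, hx₀, hx⟩
    have := (hsegc y).subset_left_of_subset_union hP hQ hPQ ((hseg y hy).trans hs)
      ⟨y - (2 * δ) • e, ⟨2 * δ, ⟨by linarith, le_rfl⟩, rfl⟩, hAP ⟨y, hy.2, rfl⟩⟩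
    exact this ⟨0, ⟨le_rfl, by linarith⟩, by simp⟩
  rcases hO (hAD hx₀) with h | h
  · exact Or.inl (main h₁ h₃ hd hO h)
  · exact Or.inr (main h₃ h₁ hd.symm (by rwa [union_comm]) h)

end BoundaryChart

/-- A smooth function that is positive exactly on the ball with centre `c` and radius `R`. -/
def ballBump (c : Plane) (R : ℝ) (y : Plane) : ℝ := expNegInvGlue (R ^ 2 - ‖y - c‖ ^ 2)

section BallBump

variable {c : Plane} {R : ℝ}

lemma contDiff_ballBump : ContDiff ℝ 2 (ballBump c R) :=
  expNegInvGlue.contDiff.comp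
    (contDiff_const.sub ((contDiff_norm_sq ℝ).comp (contDiff_id.sub contDiff_const)))

lemma ballBump_nonneg (y : Plane) : 0 ≤ ballBump c R y := expNegInvGlue.nonneg _

lemma tsupport_ballBump (hR : 0 < R) : tsupport (ballBump c R) ⊆ Metric.closedBall c R := by
  refine closure_minimal (fun y hy => ?_) Metric.isClosed_closedBall
  rw [mem_closedBall_iff_norm]
  by_contra h
  refine hy (expNegInvGlue.zero_of_nonpos ?_)
  nlinarith [not_le.1 h]

lemma hasCompactSupport_ballBump (hR : 0 < R) : HasCompactSupport (ballBump c R) :=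
  (isCompact_closedBall c R).of_isClosed_subset (isClosed_tsupport _) (tsupport_ballBump hR)

lemma fderiv_ballBump (y e : Plane) : fderiv ℝ (ballBump c R) y e
    = (R ^ 2 - ‖y - c‖ ^ 2)⁻¹ ^ 2 * ballBump c R y * (-2 * inner ℝ e (y - c)) := by
  have h1 := expNegInvGlue.hasDerivAt_polynomial_eval_inv_mul 1 (R ^ 2 - ‖y - c‖ ^ 2)
  simp only [Polynomial.eval_one, one_mul, Polynomial.derivative_one, sub_zero, mul_one,
    Polynomial.eval_pow, Polynomial.eval_X] at h1
  have h2 : HasFDerivAt (fun y => R ^ 2 - ‖y - c‖ ^ 2) (-(2 • (innerSL ℝ (y - c)))) y := by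
    have := ((hasFDerivAt_id y).sub_const c).norm_sq.const_sub (R ^ 2)
    simpa using this
  have h3 : HasFDerivAt (ballBump c R) _ y := h1.comp_hasFDerivAt y h2
  rw [h3.fderiv]
  simp only [smul_apply, neg_apply, innerSL_apply_apply, smul_eq_mul, nsmul_eq_mul, ballBump,
    real_inner_comm e (y - c)]
  push_cast
  ring

end BallBump

/-! ### Vanishing of boundary values -/

/-- The quadratic form of the principal symbol of `Δ + ∇(∇ ⬝ ·)` at the covector `A`. -/
lemma inner_symOf_smulRight (A : Plane →L[ℝ] ℝ) (v η : Plane) :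
    inner ℝ v (symOf η (A.smulRight A)) = ‖A‖ ^ 2 * inner ℝ v η + A η * A v := by
  obtain ⟨a, rfl⟩ := (InnerProductSpace.toDual ℝ Plane).surjective A
  have h1 : ‖a‖ ^ 2 = a 0 ^ 2 + a 1 ^ 2 := by
    rw [EuclideanSpace.real_norm_sq_eq, Fin.sum_univ_two]
  rw [LinearIsometryEquiv.norm_map, h1]
  simp [symOf, inner_add_right, real_inner_smul_right, inner_eq_coord, basisVec,
    Fin.sum_univ_two, EuclideanSpace.inner_single_right]
  ring

lemma abs_inner_symOf_le (A : Plane →L[ℝ] ℝ) (v η : Plane) :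
    |inner ℝ v (symOf η (A.smulRight A))| ≤ 2 * ‖A‖ ^ 2 * (‖v‖ * ‖η‖) := by
  rw [inner_symOf_smulRight]
  have h1 := abs_real_inner_le_norm v η
  have h2 : |A η * A v| ≤ (‖A‖ * ‖η‖) * (‖A‖ * ‖v‖) := by
    rw [abs_mul]
    exact mul_le_mul (A.le_opNorm η) (A.le_opNorm v) (abs_nonneg _) (by positivity)
  have h3 : |‖A‖ ^ 2 * inner ℝ v η| ≤ ‖A‖ ^ 2 * (‖v‖ * ‖η‖) := by
    rw [abs_mul, abs_of_nonneg (sq_nonneg ‖A‖)]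
    exact mul_le_mul_of_nonneg_left h1 (sq_nonneg _)
  refine (abs_add_le _ _).trans ((add_le_add h3 h2).trans (le_of_eq ?_))
  ring

/-- Ellipticity: the symbol is coercive, also when its two arguments differ slightly. -/
lemma le_inner_symOf (A : Plane →L[ℝ] ℝ) {v η : Plane} (hv : ‖v - η‖ ≤ ‖η‖ / 4) :
    ‖A‖ ^ 2 * ‖η‖ ^ 2 / 2 ≤ inner ℝ v (symOf η (A.smulRight A)) := by
  have h1 : v = η + (v - η) := by abel
  have h2 := neg_abs_le (inner ℝ (v - η) (symOf η (A.smulRight A)))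
  have h3 := abs_inner_symOf_le A (v - η) η
  have h4 : 2 * ‖A‖ ^ 2 * (‖v - η‖ * ‖η‖) ≤ 2 * ‖A‖ ^ 2 * (‖η‖ / 4 * ‖η‖) := by gcongr
  have h5 : ‖A‖ ^ 2 * ‖η‖ ^ 2 ≤ inner ℝ η (symOf η (A.smulRight A)) := by
    rw [inner_symOf_smulRight, real_inner_self_eq_norm_sq]
    nlinarith [mul_self_nonneg (A η)]
  rw [h1, inner_add_left]
  nlinarith

namespace BoundaryChart

variable {D : Set Plane} {x₀ : Plane} {ρ : Plane → ℝ} {e : Plane} {r δ : ℝ}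

lemma norm_fderiv_bounds (c : BoundaryChart D x₀ ρ e r) {y : Plane} (hy : y ∈ Metric.ball x₀ r) :
    7 / 8 ≤ ‖fderiv ℝ ρ y‖ ∧ ‖fderiv ℝ ρ y‖ ≤ 9 / 8 ∧ 7 / 8 ≤ fderiv ℝ ρ y e ∧
      fderiv ℝ ρ y e ≤ 9 / 8 := by
  have h0 := c.close y hy
  have h1 : ‖innerSL ℝ e‖ = 1 := by rw [innerSL_apply_norm, c.unit]
  have h2 := abs_norm_sub_norm_le (fderiv ℝ ρ y) (innerSL ℝ e)
  rw [h1] at h2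
  have h3 := abs_le.1 (h2.trans h0)
  have h4 : |fderiv ℝ ρ y e - 1| ≤ 1 / 8 := by
    have := (fderiv ℝ ρ y - innerSL ℝ e).le_opNorm e
    simp only [sub_apply, innerSL_apply_apply, real_inner_self_eq_norm_sq, c.unit, mul_one,
      one_pow, Real.norm_eq_abs] at this
    exact this.trans h0
  have h5 := abs_le.1 h4
  refine ⟨by linarith [h3.1], by linarith [h3.2], by linarith [h5.1], by linarith [h5.2]⟩

lemma tsupport_subset (c : BoundaryChart D x₀ ρ e r) (hδ : 0 < δ) (hδr : 3 * δ < r) :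
    tsupport (ballBump (x₀ + δ • e) (2 * δ)) ⊆ Metric.ball x₀ r := by
  refine (tsupport_ballBump (by linarith)).trans fun y hy => ?_
  rw [mem_closedBall_iff_norm] at hy
  rw [mem_ball_iff_norm]
  calc ‖y - x₀‖ = ‖(y - (x₀ + δ • e)) + δ • e‖ := by congr 1; abel
    _ ≤ ‖y - (x₀ + δ • e)‖ + ‖δ • e‖ := norm_add_le _ _
    _ < r := by rw [norm_smul, c.unit, mul_one, Real.norm_of_nonneg hδ.le]; linarith

/-- The bump is centred at `x₀ + δ e`, outside of `D`; seen from the centre, the points of `D` in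
its support lie in the direction `-e`. -/
lemma inner_sub_center_neg (c : BoundaryChart D x₀ ρ e r) (hδ : 0 < δ) {y : Plane}
    (hy : y ∈ D ∩ Metric.ball x₀ r) (hyc : ‖y - (x₀ + δ • e)‖ < 2 * δ) :
    inner ℝ e (y - (x₀ + δ • e)) < 0 := by
  have h0 : ‖y - x₀‖ < 3 * δ := by
    calc ‖y - x₀‖ = ‖(y - (x₀ + δ • e)) + δ • e‖ := by congr 1; abel
    _ ≤ ‖y - (x₀ + δ • e)‖ + ‖δ • e‖ := norm_add_le _ _
    _ < 3 * δ := by rw [norm_smul, c.unit, mul_one, Real.norm_of_nonneg hδ.le]; linarith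
  have h1 := (abs_le.1 (c.abs_sub_le (Metric.mem_ball_self c.pos) hy.2)).1
  have h2 := (c.mem_iff y hy.2).1 hy.1
  rw [c.zero] at h1
  rw [show y - (x₀ + δ • e) = (y - x₀) - δ • e by abel, inner_sub_right, real_inner_smul_right,
    real_inner_self_eq_norm_sq, c.unit]
  linarith

/-- The concentrating measures do not vanish in the limit: the bump is centred outside of `D`, and
therefore increases in the direction `e` at all points of `D`. -/
lemma integral_fderiv_ballBump_pos (c : BoundaryChart D x₀ ρ e r) (hD : IsOpen D) (hδ : 0 < δ)
    (hδr : 3 * δ < r) :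
    0 < ∫ x in D ∩ Metric.ball x₀ r, fderiv ℝ (ballBump (x₀ + δ • e) (2 * δ)) x e := by
  have hW : IsOpen (D ∩ Metric.ball x₀ r) := hD.inter Metric.isOpen_ball
  have cont : Continuous fun x => fderiv ℝ (ballBump (x₀ + δ • e) (2 * δ)) x e :=
    (contDiff_ballBump.continuous_fderiv (by norm_num)).clm_apply continuous_const
  have hpos : ∀ y ∈ D ∩ Metric.ball x₀ r, ‖y - (x₀ + δ • e)‖ < 2 * δ →
      0 < fderiv ℝ (ballBump (x₀ + δ • e) (2 * δ)) y e := by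
    intro y hy hyc
    have h1 := c.inner_sub_center_neg hδ hy hyc
    have h2 : 0 < (2 * δ) ^ 2 - ‖y - (x₀ + δ • e)‖ ^ 2 := by
      nlinarith [norm_nonneg (y - (x₀ + δ • e))]
    rw [fderiv_ballBump]
    exact mul_pos (mul_pos (by positivity) (expNegInvGlue.pos_of_pos h2)) (by linarith)
  rw [setIntegral_pos_iff_support_of_nonneg_ae]
  · have hO : IsOpen ((D ∩ Metric.ball x₀ r) ∩ Metric.ball (x₀ + δ • e) (2 * δ)) :=
      hW.inter Metric.isOpen_ball
    have hne : ((D ∩ Metric.ball x₀ r) ∩ Metric.ball (x₀ + δ • e) (2 * δ)).Nonempty := by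
      have hn : ‖(δ / 2) • e‖ = δ / 2 := by
        rw [norm_smul, c.unit, mul_one, Real.norm_of_nonneg (by linarith)]
      have hm : x₀ - (δ / 2) • e ∈ Metric.ball x₀ r := by
        rw [mem_ball_iff_norm, sub_sub_cancel_left, norm_neg, hn]; linarith
      refine ⟨x₀ - (δ / 2) • e, ⟨(c.mem_iff _ hm).2 ?_, hm⟩, ?_⟩
      · have h1 := (abs_le.1 (c.abs_sub_le (Metric.mem_ball_self c.pos) hm)).2
        rw [c.zero, sub_sub_cancel_left, norm_neg, hn, inner_neg_right, real_inner_smul_right,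
          real_inner_self_eq_norm_sq, c.unit] at h1
        linarith
      · rw [mem_ball_iff_norm, show x₀ - (δ / 2) • e - (x₀ + δ • e) = (-(3 / 2 * δ)) • e by module,
          norm_smul, c.unit, mul_one, norm_neg, Real.norm_of_nonneg (by linarith)]
        linarith
    refine (hO.measure_pos volume hne).trans_le (measure_mono fun y hy => ⟨?_, hy.1⟩)
    exact (hpos y hy.1 (mem_ball_iff_norm.1 hy.2)).ne'
  · refine (ae_restrict_iff' hW.measurableSet).2 (Filter.Eventually.of_forall fun y hy => ?_)
    by_cases hyc : ‖y - (x₀ + δ • e)‖ < 2 * δ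
    · exact (hpos y hy hyc).le
    · have : ballBump (x₀ + δ • e) (2 * δ) y = 0 :=
        expNegInvGlue.zero_of_nonpos (by nlinarith [not_lt.1 hyc])
      simp only [Pi.zero_apply]
      rw [fderiv_ballBump, this]; simp
  · exact (cont.integrable_of_hasCompactSupport
      (((hasCompactSupport_ballBump (by linarith)).fderiv (𝕜 := ℝ)).comp_left
        (g := fun A : Plane →L[ℝ] ℝ => A e) (by simp))).integrableOn

/-- The instance of `tendsto_integral_truncNeg''` for the chart and its bump. -/
lemma concentration (c : BoundaryChart D x₀ ρ e r) (hD : IsOpen D) (hδ : 0 < δ)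
    (hδr : 3 * δ < r) :
    Tendsto (fun σ => ∫ x in D ∩ Metric.ball x₀ r, truncNeg'' σ (ρ x)
        * ballBump (x₀ + δ • e) (2 * δ) x * fderiv ℝ ρ x e) (𝓝[>] 0)
      (𝓝 (∫ x in D ∩ Metric.ball x₀ r, fderiv ℝ (ballBump (x₀ + δ • e) (2 * δ)) x e)) := by
  refine tendsto_integral_truncNeg'' (hD.inter Metric.isOpen_ball).measurableSet
    (measure_ne_top_of_subset inter_subset_right measure_ball_lt_top.ne)
    (fun x hx => (c.mem_iff x hx.2).1 hx.1) (fun x hx h => ?_) c.smooth contDiff_ballBump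
    (hasCompactSupport_ballBump (by linarith)) e
  have := c.tsupport_subset hδ hδr hx
  exact ⟨(c.mem_iff x this).2 h, this⟩

/-- The instance of `tendsto_boundary_layer` for the chart and its bump. -/
lemma boundary_layer (c : BoundaryChart D x₀ ρ e r) (hD : IsOpen D) (hδ : 0 < δ)
    (hδr : 3 * δ < r) {w : Plane → Plane} {q : Plane → ℝ} {μ : ℝ}
    (hw : IntegrableOn w (D ∩ Metric.ball x₀ r)) (hq : IntegrableOn q (D ∩ Metric.ball x₀ r))
    (weak : ∀ φ, IsTest2 (D ∩ Metric.ball x₀ r) φ →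
      (∫ x in D ∩ Metric.ball x₀ r, q x * divergence φ x)
      + μ * (∫ x in D ∩ Metric.ball x₀ r, inner ℝ (w x) (divSym φ x)) = 0) (η : Plane) :
    Tendsto (fun σ => μ * ∫ x in D ∩ Metric.ball x₀ r,
        truncNeg'' σ (ρ x) * ballBump (x₀ + δ • e) (2 * δ) x * inner ℝ (w x)
        (symOf η ((fderiv ℝ ρ x).smulRight (fderiv ℝ ρ x)))) (𝓝[>] 0)
      (𝓝 ((∫ x in D ∩ Metric.ball x₀ r,
          q x * divergence (fun y => (ρ y * ballBump (x₀ + δ • e) (2 * δ) y) • η) x)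
        + μ * ∫ x in D ∩ Metric.ball x₀ r, inner ℝ (w x)
          (divSym (fun y => (ρ y * ballBump (x₀ + δ • e) (2 * δ) y) • η) x))) := by
  refine tendsto_boundary_layer (hD.inter Metric.isOpen_ball).measurableSet
    (fun x hx => (c.mem_iff x hx.2).1 hx.1) (fun x hx h => ?_) c.smooth contDiff_ballBump
    (hasCompactSupport_ballBump (by linarith)) hw hq weak η
  have := c.tsupport_subset hδ hδr hx
  exact ⟨(c.mem_iff x this).2 h, this⟩

lemma integrable_layer (c : BoundaryChart D x₀ ρ e r) (hδ : 0 < δ) (σ : ℝ) {w : Plane → Plane}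
    (hw : IntegrableOn w (D ∩ Metric.ball x₀ r)) (η : Plane) :
    IntegrableOn (fun x => truncNeg'' σ (ρ x) * ballBump (x₀ + δ • e) (2 * δ) x * inner ℝ (w x)
        (symOf η ((fderiv ℝ ρ x).smulRight (fderiv ℝ ρ x)))) (D ∩ Metric.ball x₀ r) := by
  have cρ := c.smooth.continuous_fderiv (by norm_num)
  have cE : Continuous fun x => (truncNeg'' σ (ρ x) * ballBump (x₀ + δ • e) (2 * δ) x) •
      symOf η ((fderiv ℝ ρ x).smulRight (fderiv ℝ ρ x)) :=
    ((continuous_truncNeg''.comp c.smooth.continuous).mul contDiff_ballBump.continuous).smul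
      ((continuous_symOf η).comp (continuous_smulRight cρ cρ))
  have hcE : HasCompactSupport fun x => (truncNeg'' σ (ρ x) * ballBump (x₀ + δ • e) (2 * δ) x) •
      symOf η ((fderiv ℝ ρ x).smulRight (fderiv ℝ ρ x)) :=
    ((hasCompactSupport_ballBump (by linarith)).mul_left
      (f := fun x => truncNeg'' σ (ρ x))).smul_right
  obtain ⟨C, hC⟩ := hcE.exists_bound_of_continuous cE
  refine (hw.norm.mul_const C).mono' ?_ (Filter.Eventually.of_forall fun x => ?_)
  · have := hw.1.inner (𝕜 := ℝ) (cE.aestronglyMeasurable (μ := volume.restrict _))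
    simpa only [real_inner_smul_right] using this
  · rw [← real_inner_smul_right]
    exact (norm_inner_le_norm _ _).trans (mul_le_mul_of_nonneg_left (hC x) (norm_nonneg _))

lemma integrable_weight (c : BoundaryChart D x₀ ρ e r) (hδ : 0 < δ) (σ : ℝ) :
    IntegrableOn (fun x => truncNeg'' σ (ρ x) * ballBump (x₀ + δ • e) (2 * δ) x
        * fderiv ℝ ρ x e) (D ∩ Metric.ball x₀ r) := by
  have cρ : Continuous fun x => fderiv ℝ ρ x e :=
    (c.smooth.continuous_fderiv (by norm_num)).clm_apply continuous_const
  have hcont : Continuous fun x => truncNeg'' σ (ρ x) * ballBump (x₀ + δ • e) (2 * δ) x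
        * fderiv ℝ ρ x e :=
    ((continuous_truncNeg''.comp c.smooth.continuous).mul contDiff_ballBump.continuous).mul cρ
  exact (hcont.integrable_of_hasCompactSupport
    (((hasCompactSupport_ballBump (by linarith)).mul_left
      (f := fun x => truncNeg'' σ (ρ x))).mul_right)).integrableOn

/-- For a velocity that is continuous up to the boundary and vanishes there, the weak form holds
for test fields that vanish on the boundary only. -/
lemma weak_form_boundary (c : BoundaryChart D x₀ ρ e r) (hD : IsOpen D)
    (hDb : Bornology.IsBounded D) (hδ : 0 < δ)
    (hδr : 3 * δ < r) {w : Plane → Plane} {q : Plane → ℝ} {μ : ℝ}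
    (hw : ContinuousOn w (closure D)) (hw0 : ∀ x ∈ frontier D, w x = 0)
    (hq : IntegrableOn q (D ∩ Metric.ball x₀ r))
    (weak : ∀ φ, IsTest2 (D ∩ Metric.ball x₀ r) φ →
      (∫ x in D ∩ Metric.ball x₀ r, q x * divergence φ x)
      + μ * (∫ x in D ∩ Metric.ball x₀ r, inner ℝ (w x) (divSym φ x)) = 0) (η : Plane) :
    (∫ x in D ∩ Metric.ball x₀ r,
          q x * divergence (fun y => (ρ y * ballBump (x₀ + δ • e) (2 * δ) y) • η) x)
        + μ * ∫ x in D ∩ Metric.ball x₀ r, inner ℝ (w x)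
          (divSym (fun y => (ρ y * ballBump (x₀ + δ • e) (2 * δ) y) • η) x) = 0 := by
  set W := D ∩ Metric.ball x₀ r with hWdef
  set χ := ballBump (x₀ + δ • e) (2 * δ) with hχ
  have hWm : MeasurableSet W := (hD.inter Metric.isOpen_ball).measurableSet
  have hwi : IntegrableOn w W := (hw.integrableOn_compact hDb.isCompact_closure).mono_set
    (inter_subset_left.trans subset_closure)
  have h1 := c.boundary_layer hD hδ hδr hwi hq weak η
  refine tendsto_nhds_unique h1 ?_
  suffices hz : Tendsto (fun σ => ∫ x in W, truncNeg'' σ (ρ x) * χ x * inner ℝ (w x)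
      (symOf η ((fderiv ℝ ρ x).smulRight (fderiv ℝ ρ x)))) (𝓝[>] 0) (𝓝 0) by
    have := hz.const_mul μ
    rwa [mul_zero] at this
  have h2 := c.concentration hD hδ hδr
  set J := ∫ x in W, fderiv ℝ χ x e with hJ
  have hJ0 : 0 < J := c.integral_fderiv_ballBump_pos hD hδ hδr
  rw [Metric.tendsto_nhds]
  intro κ hκ
  -- The integrand is at most `4 ‖η‖ ‖w‖` times the weight, whose integral is less than `J + 1` for
  -- small `σ`. Thus `‖w‖ ≤ κ'` on the support of the weight suffices.
  set κ' : ℝ := κ / (4 * (‖η‖ + 1) * (J + 1)) with hκ'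
  have hκ'0 : 0 < κ' := by positivity
  -- This holds near the boundary, by continuity and compactness.
  obtain ⟨σ₀, hσ₀, hsmall⟩ : ∃ σ₀ > 0, ∀ x ∈ W, x ∈ tsupport χ → -σ₀ ≤ ρ x → ‖w x‖ ≤ κ' := by
    set K := closure D ∩ tsupport χ with hK
    have hKc : IsCompact K := hDb.isCompact_closure.inter_right (isClosed_tsupport χ)
    have hcl : IsCompact (K ∩ {x | κ' ≤ ‖w x‖}) := by
      have hcw : ContinuousOn (fun x => ‖w x‖) K := (hw.mono inter_subset_left).norm
      exact hKc.of_isClosed_subset (hcw.preimage_isClosed_of_isClosed hKc.isClosed isClosed_Ici)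
        inter_subset_left
    rcases (K ∩ {x | κ' ≤ ‖w x‖}).eq_empty_or_nonempty with he | hne
    · refine ⟨1, one_pos, fun x hx hs _ => ?_⟩
      by_contra h
      have : x ∈ K ∩ {x | κ' ≤ ‖w x‖} := ⟨⟨subset_closure hx.1, hs⟩, (not_le.1 h).le⟩
      rw [he] at this; exact this
    · obtain ⟨z, hz, hmax⟩ := hcl.exists_isMaxOn hne c.smooth.continuous.continuousOn
      have hzD : z ∈ D := by
        by_contra hzD
        have hf : z ∈ frontier D := by rw [hD.frontier_eq]; exact ⟨hz.1.1, hzD⟩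
        have := hz.2
        simp only [mem_ofPred_eq, hw0 z hf, norm_zero] at this
        linarith
      have hρz : ρ z < 0 := (c.mem_iff z (c.tsupport_subset hδ hδr hz.1.2)).1 hzD
      refine ⟨-ρ z / 2, by linarith, fun x hx hs hρ => ?_⟩
      by_contra h
      have : ρ x ≤ ρ z := hmax (⟨⟨subset_closure hx.1, hs⟩, (not_le.1 h).le⟩ :
        x ∈ K ∩ {x | κ' ≤ ‖w x‖})
      linarith
  have hbd : ∀ᶠ σ in 𝓝[>] 0, ∫ x in W, truncNeg'' σ (ρ x) * χ x * fderiv ℝ ρ x e < J + 1 :=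
    h2.eventually_lt_const (by linarith)
  filter_upwards [hbd, Ioo_mem_nhdsGT (half_pos hσ₀)] with σ hσJ hσ
  rw [Real.dist_eq, sub_zero]
  have hle : ∀ x ∈ W, ‖truncNeg'' σ (ρ x) * χ x * inner ℝ (w x)
      (symOf η ((fderiv ℝ ρ x).smulRight (fderiv ℝ ρ x)))‖
      ≤ 4 * ‖η‖ * κ' * (truncNeg'' σ (ρ x) * χ x * fderiv ℝ ρ x e) := by
    intro x hx
    have hb := c.norm_fderiv_bounds hx.2
    have h0 : 0 ≤ truncNeg'' σ (ρ x) * χ x :=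
      mul_nonneg (truncNeg''_nonneg hσ.1) (ballBump_nonneg x)
    rw [norm_mul, Real.norm_of_nonneg h0, Real.norm_eq_abs]
    by_cases hs : x ∈ tsupport χ ∧ -σ₀ ≤ ρ x
    · have hwx := hsmall x hx hs.1 hs.2
      have h3 := abs_inner_symOf_le (fderiv ℝ ρ x) (w x) η
      have h4 : 2 * ‖fderiv ℝ ρ x‖ ^ 2 ≤ 4 * fderiv ℝ ρ x e := by nlinarith
      have h5 : 2 * ‖fderiv ℝ ρ x‖ ^ 2 * (‖w x‖ * ‖η‖)
          ≤ 4 * fderiv ℝ ρ x e * (κ' * ‖η‖) := by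
        refine mul_le_mul h4 (mul_le_mul_of_nonneg_right hwx (norm_nonneg _)) (by positivity)
          (by linarith)
      calc _ ≤ truncNeg'' σ (ρ x) * χ x * (4 * fderiv ℝ ρ x e * (κ' * ‖η‖)) :=
            mul_le_mul_of_nonneg_left (h3.trans h5) h0
        _ = _ := by ring
    · have hz : truncNeg'' σ (ρ x) * χ x = 0 := by
        by_cases hs1 : x ∈ tsupport χ
        · have : ρ x < -σ₀ := not_le.1 fun h => hs ⟨hs1, h⟩
          rw [truncNeg''_eq_zero hσ.1 (by linarith [hσ.2]), zero_mul]
        · rw [image_eq_zero_of_notMem_tsupport hs1, mul_zero]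
      rw [hz]; simp
  have hI := c.integrable_weight hδ σ
  calc |∫ x in W, truncNeg'' σ (ρ x) * χ x * inner ℝ (w x)
        (symOf η ((fderiv ℝ ρ x).smulRight (fderiv ℝ ρ x)))|
      ≤ ∫ x in W, 4 * ‖η‖ * κ' * (truncNeg'' σ (ρ x) * χ x * fderiv ℝ ρ x e) :=
        norm_integral_le_of_norm_le (hI.const_mul _)
          ((ae_restrict_iff' hWm).2 (Filter.Eventually.of_forall hle))
    _ = 4 * ‖η‖ * κ' * ∫ x in W, truncNeg'' σ (ρ x) * χ x * fderiv ℝ ρ x e := by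
        rw [integral_const_mul]
    _ ≤ 4 * ‖η‖ * κ' * (J + 1) := mul_le_mul_of_nonneg_left hσJ.le (by positivity)
    _ < 4 * (‖η‖ + 1) * κ' * (J + 1) := by
        have := mul_pos hκ'0 (by linarith : 0 < J + 1)
        nlinarith
    _ = κ := by rw [hκ']; field_simp

/-- If the weak form holds for the test fields that vanish on the boundary only, then a velocity
that is close to `η` near the boundary point has `η = 0`. -/
lemma eq_zero_of_weak_form (c : BoundaryChart D x₀ ρ e r) (hD : IsOpen D) (hδ : 0 < δ)
    (hδr : 3 * δ < r) {w : Plane → Plane} {q : Plane → ℝ} {μ : ℝ} (hμ : 0 < μ)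
    (hw : IntegrableOn w (D ∩ Metric.ball x₀ r)) (hq : IntegrableOn q (D ∩ Metric.ball x₀ r))
    (weak : ∀ φ, IsTest2 (D ∩ Metric.ball x₀ r) φ →
      (∫ x in D ∩ Metric.ball x₀ r, q x * divergence φ x)
      + μ * (∫ x in D ∩ Metric.ball x₀ r, inner ℝ (w x) (divSym φ x)) = 0) {η : Plane}
    (hη : ∀ x ∈ D ∩ Metric.ball x₀ r, ‖w x - η‖ ≤ ‖η‖ / 4)
    (h0 : (∫ x in D ∩ Metric.ball x₀ r,
          q x * divergence (fun y => (ρ y * ballBump (x₀ + δ • e) (2 * δ) y) • η) x)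
        + μ * ∫ x in D ∩ Metric.ball x₀ r, inner ℝ (w x)
          (divSym (fun y => (ρ y * ballBump (x₀ + δ • e) (2 * δ) y) • η) x) = 0) : η = 0 := by
  have hWm : MeasurableSet (D ∩ Metric.ball x₀ r) := (hD.inter Metric.isOpen_ball).measurableSet
  have h1 := c.boundary_layer hD hδ hδr hw hq weak η
  rw [h0] at h1
  have h2 := (c.concentration hD hδ hδr).const_mul (μ * (‖η‖ ^ 2 / 4))
  -- By ellipticity the integrand is at least `‖η‖² / 4` times the weight, whose integral has a
  -- positive limit.
  have h3 := le_of_tendsto_of_tendsto h2 h1 (by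
    filter_upwards [self_mem_nhdsWithin] with σ hσ
    rw [mul_assoc, ← integral_const_mul]
    refine mul_le_mul_of_nonneg_left (setIntegral_mono_on
      ((c.integrable_weight hδ σ).const_mul _) (c.integrable_layer hδ σ hw η) hWm
      fun x hx => ?_) hμ.le
    have hb := c.norm_fderiv_bounds hx.2
    have hnn : 0 ≤ truncNeg'' σ (ρ x) * ballBump (x₀ + δ • e) (2 * δ) x :=
      mul_nonneg (truncNeg''_nonneg hσ) (ballBump_nonneg x)
    have h4 := le_inner_symOf (fderiv ℝ ρ x) (hη x hx)
    have h5 : fderiv ℝ ρ x e / 4 ≤ ‖fderiv ℝ ρ x‖ ^ 2 / 2 := by nlinarith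
    calc _ = truncNeg'' σ (ρ x) * ballBump (x₀ + δ • e) (2 * δ) x
          * (fderiv ℝ ρ x e / 4 * ‖η‖ ^ 2) := by ring
      _ ≤ _ := mul_le_mul_of_nonneg_left ((mul_le_mul_of_nonneg_right h5 (sq_nonneg _)).trans
          (le_of_eq_of_le (by ring) h4)) hnn)
  have hJ := c.integral_fderiv_ballBump_pos hD hδ hδr
  by_contra hne
  have : 0 < ‖η‖ ^ 2 := by positivity
  have h6 : 0 < μ * (‖η‖ ^ 2 / 4) := by positivity
  exact absurd h3 (not_le.2 (mul_pos h6 hJ))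

end BoundaryChart

/-! ### The boundary values of the first-order velocity -/

/-- Near a boundary point of `D` there are no points of the layer. -/
lemma exists_ball_disjoint {D D₁ Ω₃ : Set Plane} {Γ : ℝ → Plane} {L : ℝ} {h : ℝ → ℝ} {a : ℝ}
    {S : Plane → ℝ} (hg : Geometry D D₁ Ω₃ Γ L h) (T : Tube D D₁ Ω₃ Γ L h a S) {x₀ : Plane}
    (hx₀ : x₀ ∉ D) : ∃ r > 0, ∀ s ∈ Icc 0 (a / 2), ∀ ξ, gammaEps Γ h s ξ ∉ Metric.ball x₀ r := by
  set K : Set Plane := (fun z : ℝ × ℝ => gammaEps Γ h z.1 z.2) '' (Icc 0 (a / 2) ×ˢ Icc 0 L)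
    with hK
  have hKc : IsCompact K := (isCompact_Icc.prod isCompact_Icc).image
    (continuous_gammaEps hg.smooth_Γ hg.smooth_h)
  have hmem : ∀ s ∈ Icc 0 (a / 2), ∀ ξ, gammaEps Γ h s ξ ∈ K := by
    intro s hs ξ
    obtain ⟨ζ, hζ, he⟩ := (periodic_gammaEps hg.periodic_Γ hg.periodic_h s :
      Function.Periodic (gammaEps Γ h s) L).exists_mem_Ico₀ hg.period_pos ξ
    exact ⟨(s, ζ), ⟨hs, Ico_subset_Icc_self hζ⟩, he.symm⟩
  have hx : x₀ ∉ K := by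
    rintro ⟨z, hz, rfl⟩
    refine hx₀ (T.mem_D z.1 z.2 ?_)
    rw [abs_of_nonneg hz.1.1]
    linarith [hz.1.2, T.pos]
  obtain ⟨r, hr, hb⟩ := Metric.isOpen_iff.1 hKc.isClosed.isOpen_compl x₀ hx
  exact ⟨r, hr, fun s hs ξ hmb => hb hmb (hmem s hs ξ)⟩

/-- Away from the interfaces the two-fluid problem is the Stokes problem. -/
lemma IsTwoFluidSolution.weak_form_away {μ μ₂ ε : ℝ} {D D₁ Ω₃ : Set Plane} {Γ : ℝ → Plane} {L : ℝ}
    {h : ℝ → ℝ} {a : ℝ} {S : Plane → ℝ} {U u : Plane → Plane} {p : Plane → ℝ}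
    (hg : Geometry D D₁ Ω₃ Γ L h) (T : Tube D D₁ Ω₃ Γ L h a S)
    (hs : IsTwoFluidSolution μ μ₂ D D₁ Ω₃ Γ h U ε u p) (hε0 : 0 < ε) (hε : ε < a)
    {φ : Plane → Plane} (hφ : IsTest2 D φ)
    (hd : ∀ s ∈ Icc 0 ε, ∀ ξ, gammaEps Γ h s ξ ∉ tsupport φ) :
    (∫ x in D, p x * divergence φ x) + μ * (∫ x in D, inner ℝ (u x) (divSym φ x)) = 0 := by
  have hΓ : ∀ ξ, Γ ξ ∉ tsupport φ := fun ξ => by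
    have := hd 0 ⟨le_rfl, hε0.le⟩ ξ
    simpa [gammaEps] using this
  have h1 := (hs.weak_form hg T hε0 hε hφ).2
  have h2 : ∫ x in layer Γ h ε, inner ℝ (u x) (divSym φ x) = 0 := by
    refine setIntegral_eq_zero_of_forall_eq_zero fun x hx => ?_
    obtain ⟨ξ, r, hr0, hr, rfl⟩ := hx
    have hh := hg.pos_h ξ
    have := hd (r / h ξ) ⟨by positivity, by rw [div_le_iff₀ hh]; exact hr.le⟩ ξ
    rw [gammaEps, div_mul_cancel₀ _ hh.ne'] at this
    rw [(hφ.eq_zero this).2.2.2, inner_zero_right]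
  have hε' : ∀ ξ, gammaEps Γ h ε ξ ∉ tsupport φ := hd ε ⟨hε0.le, le_rfl⟩
  have h3 : ∫ ξ in (0 : ℝ)..L, tension Γ h φ ε ξ = 0 := by
    simp [tension, fun ξ => (hφ.eq_zero (hε' ξ)).1]
  have h4 : jumpPairing Γ L h φ u ε = 0 := by
    simp [jumpPairing, fun ξ => (hφ.eq_zero (hε' ξ)).2.1, fun ξ => (hφ.eq_zero (hΓ ξ)).2.1,
      plusTranspose]
  rw [h2, h3, h4] at h1
  simp only [fun ξ => (hφ.eq_zero (hΓ ξ)).1, inner_zero_right, mul_zero,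
    intervalIntegral.integral_zero] at h1
  linarith

namespace Expansion

variable {μ μ₂ : ℝ} {D D₁ Ω₃ : Set Plane} {Γ : ℝ → Plane} {L : ℝ} {h : ℝ → ℝ}
  {U : Plane → Plane} {u : ℝ → Plane → Plane} {p : ℝ → Plane → ℝ} {u₀ u₁ : Plane → Plane}
  {p₀ p₁ : Plane → ℝ} {a : ℝ} {S : Plane → ℝ}

/-- The leading order velocity has the same boundary values as the solutions. -/
lemma frontier_eq (X : Expansion μ μ₂ D D₁ Ω₃ Γ L h U u p u₀ u₁ p₀ p₁) :
    ∀ x ∈ frontier D, u₀ x = U x := by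
  intro x hx
  have hxc := frontier_subset_closure hx
  obtain ⟨C, hC⟩ := X.bound_u
  have h0 : Tendsto (fun ε : ℝ => ε) (𝓝[>] 0) (𝓝 0) := tendsto_id.mono_left nhdsWithin_le_nhds
  have h1 : ∀ᶠ ε : ℝ in 𝓝[>] 0, ‖U x - u₀ x‖ ≤ ε * C := by
    filter_upwards [hC, X.sol, self_mem_nhdsWithin] with ε hCε hs hε
    have hε : 0 < ε := hε
    rw [← hs.boundary_u x hx]
    have hcont : ContinuousOn (fun y => ‖u ε y - u₀ y‖) (closure D) :=
      (hs.continuous_u.sub X.continuous_u₀).norm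
    have : (𝓝[D] x).NeBot := mem_closure_iff_nhdsWithin_neBot.1 hxc
    refine le_of_tendsto ((hcont x hxc).mono_left (nhdsWithin_mono x subset_closure)) ?_
    filter_upwards [self_mem_nhdsWithin] with y hy
    have := hCε y hy
    rwa [norm_smul, norm_inv, Real.norm_of_nonneg hε.le, inv_mul_le_iff₀ hε] at this
  have h2 : ‖U x - u₀ x‖ ≤ 0 * C := ge_of_tendsto (h0.mul_const C) h1
  rw [zero_mul] at h2
  exact (sub_eq_zero.1 (norm_le_zero_iff.1 h2)).symm

lemma weak_form_u₀ (X : Expansion μ μ₂ D D₁ Ω₃ Γ L h U u p u₀ u₁ p₀ p₁)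
    (T : Tube D D₁ Ω₃ Γ L h a S) {φ : Plane → Plane} (hφ : IsTest2 D φ)
    (hd : ∀ ξ, Γ ξ ∉ tsupport φ) :
    (∫ x in D, p₀ x * divergence φ x) + μ * (∫ x in D, inner ℝ (u₀ x) (divSym φ x)) = 0 := by
  rw [(X.first_order T hφ).1]
  simp [fun ξ => (hφ.eq_zero (hd ξ)).1]

lemma weak_form_u₁ (X : Expansion μ μ₂ D D₁ Ω₃ Γ L h U u p u₀ u₁ p₀ p₁)
    (T : Tube D D₁ Ω₃ Γ L h a S) {φ : Plane → Plane} (hφ : IsTest2 D φ)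
    (hd : ∀ ξ, Γ ξ ∉ tsupport φ) :
    (∫ x in D, p₁ x * divergence φ x) + μ * (∫ x in D, inner ℝ (u₁ x) (divSym φ x)) = 0 := by
  have := (X.first_order T hφ).2
  simpa [fun ξ => (hφ.eq_zero (hd ξ)).1, fun ξ => (hφ.eq_zero (hd ξ)).2.1,
    fun ξ => (hφ.eq_zero (hd ξ)).2.2.1, plusTranspose, frob] using this

/-- The limit of the first-order velocity at a boundary point is zero, if it is known that near
this point `D` lies on one side of the interface. -/
lemma tendsto_frontier_of_subset (X : Expansion μ μ₂ D D₁ Ω₃ Γ L h U u p u₀ u₁ p₀ p₁)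
    (T : Tube D D₁ Ω₃ Γ L h a S) (hμ : 0 < μ) {x₀ : Plane} (hx₀ : x₀ ∈ frontier D)
    {ρ : Plane → ℝ} {e : Plane} {r : ℝ} (c : BoundaryChart D x₀ ρ e r)
    (hball : ∀ s ∈ Icc 0 (a / 2), ∀ ξ, gammaEps Γ h s ξ ∉ Metric.ball x₀ r) {O : Set Plane}
    (hOD : O ⊆ D₁ ∪ Ω₃) (hu₁ : IsX0 O u₁) (hp₁ : IsX0 O p₁) (hp₀ : IsX0 O p₀)
    (hWO : D ∩ Metric.ball x₀ r ⊆ O)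
    (hp : ∀ᶠ ε in 𝓝[>] 0, ContinuousOn (p ε) (D ∩ Metric.ball x₀ r) ∧
      D ∩ Metric.ball x₀ r ⊆ omega1 D₁ Γ h ε ∪ Ω₃) :
    Tendsto u₁ (𝓝[D₁ ∪ Ω₃] x₀) (𝓝 0) := by
  have hg := X.geometry
  have hsubD : D₁ ∪ Ω₃ ⊆ D := union_subset (D₁_subset hg) (Ω₃_subset hg)
  have hmemO : O ∈ 𝓝[D] x₀ := mem_of_superset
    (inter_mem self_mem_nhdsWithin (mem_nhdsWithin_of_mem_nhds (Metric.ball_mem_nhds x₀ c.pos))) hWO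
  have : (𝓝[D] x₀).NeBot := mem_closure_iff_nhdsWithin_neBot.1 (frontier_subset_closure hx₀)
  have hle : 𝓝[D] x₀ ≤ 𝓝[O] x₀ := nhdsWithin_le_iff.2 hmemO
  have hxO : x₀ ∈ closure O := mem_closure_iff_nhdsWithin_neBot.2 (this.mono hle)
  set η := extendFrom O u₁ x₀ with hη
  have hlim : Tendsto u₁ (𝓝[D] x₀) (𝓝 η) := (hu₁.tendsto_extendFrom hxO).mono_left hle
  suffices h0 : η = 0 by
    rw [← h0]; exact hlim.mono_left (nhdsWithin_mono x₀ hsubD)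
  by_contra hne
  have hη4 : 0 < ‖η‖ / 4 := by positivity
  obtain ⟨r₁, hr₁, hclose⟩ := Metric.mem_nhdsWithin_iff.1
    (hlim.eventually (Metric.closedBall_mem_nhds η hη4))
  -- the chart on a ball where `u₁` is close to its boundary value
  set r' := min r₁ r with hr'
  have hr'0 : 0 < r' := lt_min hr₁ c.pos
  have c' : BoundaryChart D x₀ ρ e r' := c.mono hr'0 (min_le_right _ _)
  set W := D ∩ Metric.ball x₀ r' with hW
  have hWr : W ⊆ D ∩ Metric.ball x₀ r :=
    inter_subset_inter_right _ (Metric.ball_subset_ball (min_le_right _ _))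
  have hWo : IsOpen W := hg.isOpen_D.inter Metric.isOpen_ball
  have hWm : MeasurableSet W := hWo.measurableSet
  have hWb : Bornology.IsBounded W := hg.bounded_D.subset inter_subset_left
  have hWOO : W ⊆ O := hWr.trans hWO
  have hX0 : ∀ {F : Type} [NormedAddCommGroup F] [SecondCountableTopology F] {f : Plane → F},
      IsX0 O f → IntegrableOn f W := by
    intro F _ _ f hf
    have hf' := hf.mono hWOO
    obtain ⟨C, -, hC⟩ := hf'.exists_bound hWb
    refine IntegrableOn.of_bound hWb.measure_lt_top
      (hf'.continuousOn.aestronglyMeasurable hWm) C ?_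
    exact (ae_restrict_iff' hWm).2 (Filter.Eventually.of_forall hC)
  have htest : ∀ {φ}, IsTest2 W φ → IsTest2 D φ ∧
      (∀ s ∈ Icc 0 (a / 2), ∀ ξ, gammaEps Γ h s ξ ∉ tsupport φ) ∧ ∀ ξ, Γ ξ ∉ tsupport φ := by
    intro φ hφ
    have h1 : ∀ s ∈ Icc 0 (a / 2), ∀ ξ, gammaEps Γ h s ξ ∉ tsupport φ := fun s hs ξ hm =>
      hball s hs ξ (hWr (hφ.subset hm)).2
    refine ⟨⟨hφ.contDiff, hφ.compact, hφ.subset.trans inter_subset_left⟩, h1, fun ξ => ?_⟩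
    have := h1 0 ⟨le_rfl, by linarith [T.pos]⟩ ξ
    simpa [gammaEps] using this
  -- integrals against test fields in `W`
  have hint : ∀ {φ}, IsTest2 W φ → ∀ f : Plane → ℝ, (∀ x ∉ tsupport φ, f x = 0) →
      ∫ x in W, f x = ∫ x in D, f x := fun hφ f hf =>
    (setIntegral_eq_of_subset_of_forall_sdiff_eq_zero hg.isOpen_D.measurableSet inter_subset_left
      fun x hx => hf x fun h => hx.2 (hφ.subset h)).symm
  have weak₁ : ∀ φ, IsTest2 W φ → (∫ x in W, p₁ x * divergence φ x)
      + μ * (∫ x in W, inner ℝ (u₁ x) (divSym φ x)) = 0 := by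
    intro φ hφ
    rw [hint hφ _ fun x hx => by rw [(hφ.eq_zero hx).2.2.1, mul_zero],
      hint hφ _ fun x hx => by rw [(hφ.eq_zero hx).2.2.2, inner_zero_right]]
    exact X.weak_form_u₁ T (htest hφ).1 (htest hφ).2.2
  obtain ⟨g, hgi, hgb⟩ := X.dom_p
  obtain ⟨C, hC⟩ := X.bound_u
  have hgW : IntegrableOn g W := hgi.mono_set inter_subset_left
  have hδ : 0 < r' / 4 := by linarith
  have hδr : 3 * (r' / 4) < r' := by linarith
  set φ₀ : Plane → Plane := fun y => (ρ y * ballBump (x₀ + (r' / 4) • e) (2 * (r' / 4)) y) • η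
    with hφ₀
  have hφ₀s : ContDiff ℝ 2 φ₀ := (c.smooth.mul contDiff_ballBump).smul contDiff_const
  have cd : Continuous (divergence φ₀) := continuous_divergence (hφ₀s.of_le (by norm_num))
  have cE : Continuous (divSym φ₀) := continuous_divSym hφ₀s
  obtain ⟨M₁, hM₁⟩ := hg.bounded_D.isCompact_closure.exists_bound_of_continuousOn cd.continuousOn
  obtain ⟨M₂, hM₂⟩ := hg.bounded_D.isCompact_closure.exists_bound_of_continuousOn cE.continuousOn
  have hWc : ∀ x ∈ W, x ∈ closure D := fun x hx => subset_closure hx.1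
  -- the rescaled differences of the solutions
  have hq : ∀ᶠ ε in 𝓝[>] 0, IntegrableOn (fun x => ε⁻¹ * (p ε x - p₀ x)) W ∧
      ∀ x ∈ W, |ε⁻¹ * (p ε x - p₀ x)| ≤ g x := by
    filter_upwards [hp, hgb] with ε hpε hgε
    have hb : ∀ x ∈ W, |ε⁻¹ * (p ε x - p₀ x)| ≤ g x := fun x hx => hgε x (hpε.2 (hWr hx))
    refine ⟨hgW.mono' ?_ ((ae_restrict_iff' hWm).2 (Filter.Eventually.of_forall hb)), hb⟩
    have hc : ContinuousOn (fun x => ε⁻¹ * (p ε x - p₀ x)) W :=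
      continuousOn_const.mul ((hpε.1.mono hWr).sub (hp₀.mono hWOO).continuousOn)
    exact hc.aestronglyMeasurable hWm
  have hwc : ∀ᶠ ε in 𝓝[>] 0, ContinuousOn (fun x => ε⁻¹ • (u ε x - u₀ x)) (closure D) ∧
      ∀ x ∈ frontier D, ε⁻¹ • (u ε x - u₀ x) = 0 := by
    filter_upwards [X.sol] with ε hs
    refine ⟨(hs.continuous_u.sub X.continuous_u₀).const_smul ε⁻¹, fun x hx => ?_⟩
    rw [hs.boundary_u x hx, X.frontier_eq x hx, sub_self, smul_zero]
  have hzero : ∀ᶠ ε in 𝓝[>] 0, (∫ x in W, ε⁻¹ * (p ε x - p₀ x) * divergence φ₀ x)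
      + μ * ∫ x in W, inner ℝ (ε⁻¹ • (u ε x - u₀ x)) (divSym φ₀ x) = 0 := by
    filter_upwards [hq, hwc, X.eventually_sol T, Ioo_mem_nhdsGT (half_pos T.pos)]
      with ε hqε hwε hs hεa
    refine c'.weak_form_boundary hg.isOpen_D hg.bounded_D hδ hδr hwε.1 hwε.2 hqε.1 ?_ η
    intro φ hφ
    obtain ⟨hφD, hφ1, hφ2⟩ := htest hφ
    have e1 := hs.2.2.weak_form_away X.geometry T hs.1 hs.2.1 hφD fun s hs' ξ =>
      hφ1 s ⟨hs'.1, hs'.2.trans hεa.2.le⟩ ξ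
    have e2 := X.weak_form_u₀ T hφD hφ2
    have cdφ := continuous_divergence (hφ.contDiff.of_le (by norm_num))
    have cEφ := continuous_divSym hφ.contDiff
    have i1 := (hs.2.2.weak_form X.geometry T hs.1 hs.2.1 hφD).1
    have i2 := X.integrableOn_p₀ T cdφ
    have i3 : IntegrableOn (fun x => inner ℝ (u ε x) (divSym φ x)) D :=
      integrableOn_of_continuousOn_closure hg (hs.2.2.continuous_u.inner cEφ.continuousOn)
    have i4 : IntegrableOn (fun x => inner ℝ (u₀ x) (divSym φ x)) D :=
      integrableOn_of_continuousOn_closure hg (X.continuous_u₀.inner cEφ.continuousOn)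
    rw [hint hφ _ fun x hx => by rw [(hφ.eq_zero hx).2.2.1, mul_zero],
      hint hφ _ fun x hx => by rw [(hφ.eq_zero hx).2.2.2, inner_zero_right]]
    have s1 : ∀ x, ε⁻¹ * (p ε x - p₀ x) * divergence φ x
        = ε⁻¹ * (p ε x * divergence φ x - p₀ x * divergence φ x) := fun x => by ring
    have s2 : ∀ x, inner ℝ (ε⁻¹ • (u ε x - u₀ x)) (divSym φ x)
        = ε⁻¹ * (inner ℝ (u ε x) (divSym φ x) - inner ℝ (u₀ x) (divSym φ x)) := fun x => by
      rw [real_inner_smul_left, inner_sub_left]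
    simp only [s1, s2]
    rw [integral_const_mul, integral_const_mul, integral_sub i1 i2, integral_sub i3 i4]
    linear_combination ε⁻¹ * e1 - ε⁻¹ * e2
  have t1 : Tendsto (fun ε => ∫ x in W, ε⁻¹ * (p ε x - p₀ x) * divergence φ₀ x) (𝓝[>] 0)
      (𝓝 (∫ x in W, p₁ x * divergence φ₀ x)) := by
    refine tendsto_integral_filter_of_dominated_convergence (fun x => g x * M₁) ?_ ?_
      (hgW.mul_const M₁) ?_
    · filter_upwards [hq] with ε hqε using hqε.1.1.mul cd.aestronglyMeasurable
    · filter_upwards [hq] with ε hqε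
      refine (ae_restrict_iff' hWm).2 (Filter.Eventually.of_forall fun x hx => ?_)
      rw [norm_mul]
      exact mul_le_mul (hqε.2 x hx) (hM₁ x (hWc x hx)) (norm_nonneg _)
        ((abs_nonneg _).trans (hqε.2 x hx))
    · exact (ae_restrict_iff' hWm).2 (Filter.Eventually.of_forall fun x hx =>
        (X.lim_p x (hOD (hWOO hx))).mul_const _)
  have t2 : Tendsto (fun ε => ∫ x in W, inner ℝ (ε⁻¹ • (u ε x - u₀ x)) (divSym φ₀ x)) (𝓝[>] 0)
      (𝓝 (∫ x in W, inner ℝ (u₁ x) (divSym φ₀ x))) := by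
    refine tendsto_integral_filter_of_dominated_convergence (fun _ => C * M₂) ?_ ?_
      (integrableOn_const hWb.measure_lt_top.ne) ?_
    · filter_upwards [hwc] with ε hwε
      have hc : ContinuousOn (fun x => inner ℝ (ε⁻¹ • (u ε x - u₀ x)) (divSym φ₀ x)) W :=
        (hwε.1.mono hWc).inner cE.continuousOn
      exact hc.aestronglyMeasurable hWm
    · filter_upwards [hC] with ε hCε
      refine (ae_restrict_iff' hWm).2 (Filter.Eventually.of_forall fun x hx => ?_)
      exact (norm_inner_le_norm _ _).trans (mul_le_mul (hCε x hx.1) (hM₂ x (hWc x hx))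
        (norm_nonneg _) ((norm_nonneg _).trans (hCε x hx.1)))
    · refine (ae_restrict_iff' hWm).2 (Filter.Eventually.of_forall fun x hx => ?_)
      exact Tendsto.inner (X.lim_u x (hOD (hWOO hx))) tendsto_const_nhds
  -- the weak form for the field `φ₀`, which vanishes on the boundary only, in the limit `ε → 0`
  have hI := tendsto_nhds_unique (t1.add (t2.const_mul μ))
    (tendsto_const_nhds.congr' (hzero.mono fun ε h => h.symm))
  refine hne (c'.eq_zero_of_weak_form hg.isOpen_D hδ hδr hμ (hX0 hu₁) (hX0 hp₁) weak₁
    (fun x hx => ?_) hI)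
  have := hclose ⟨Metric.ball_subset_ball (min_le_left _ _) hx.2, hx.1⟩
  simpa [dist_eq_norm] using this

/-- The first-order velocity vanishes on the outer boundary. -/
theorem tendsto_frontier (X : Expansion μ μ₂ D D₁ Ω₃ Γ L h U u p u₀ u₁ p₀ p₁)
    (T : Tube D D₁ Ω₃ Γ L h a S) (hμ : 0 < μ) {x₀ : Plane} (hx₀ : x₀ ∈ frontier D) :
    Tendsto u₁ (𝓝[D₁ ∪ Ω₃] x₀) (𝓝 0) := by
  have hg := X.geometry
  have hxD : x₀ ∉ D := by
    have := hx₀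
    rw [hg.isOpen_D.frontier_eq] at this; exact this.2
  obtain ⟨r₀, hr₀, hb₀⟩ := exists_ball_disjoint hg T hxD
  obtain ⟨ρ, e, r, hr, c⟩ := exists_boundaryChart hg.isOpen_D hg.boundary_D hx₀ hr₀
  have hb : ∀ s ∈ Icc 0 (a / 2), ∀ ξ, gammaEps Γ h s ξ ∉ Metric.ball x₀ r := fun s hs ξ hm =>
    hb₀ s hs ξ (Metric.ball_subset_ball hr hm)
  have hsub : D ∩ Metric.ball x₀ r ⊆ D₁ ∪ Ω₃ := by
    intro x hx
    rw [← hg.decomposition]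
    refine ⟨hx.1, ?_⟩
    rintro ⟨ξ, rfl⟩
    refine hb 0 ⟨le_rfl, by linarith [T.pos]⟩ ξ ?_
    simpa [gammaEps] using hx.2
  have hlayer : ∀ ε ∈ Ioo 0 (a / 2), Disjoint (Metric.ball x₀ r) (closure (layer Γ h ε)) := by
    intro ε hε
    refine Disjoint.closure_right ?_ Metric.isOpen_ball
    rw [Set.disjoint_left]
    rintro _ hx ⟨ξ, s, hs0, hs, rfl⟩
    have hh := hg.pos_h ξ
    refine hb (s / h ξ) ⟨by positivity, ?_⟩ ξ ?_
    · rw [div_le_iff₀ hh]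
      exact hs.le.trans (mul_le_mul_of_nonneg_right hε.2.le hh.le)
    · rwa [gammaEps, div_mul_cancel₀ _ hh.ne']
  -- `D` is locally connected at `x₀`, so it lies on one side of the interface in a smaller ball
  have hr3 : 0 < r / 3 := by linarith [c.pos]
  have c3 := c.mono hr3 (by linarith)
  have hb3 : ∀ s ∈ Icc 0 (a / 2), ∀ ξ, gammaEps Γ h s ξ ∉ Metric.ball x₀ (r / 3) :=
    fun s hs ξ hm => hb s hs ξ (Metric.ball_subset_ball (by linarith) hm)
  rcases c.subset_or_subset hg.isOpen_D₁ hg.isOpen_Ω₃ hg.disjoint_D₁_Ω₃ hsub hr3 (by linarith)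
    with hO | hO
  · refine X.tendsto_frontier_of_subset T hμ hx₀ c3 hb3 subset_union_left X.isX0_u₁.1 X.isX0_p₁.1
      X.regular₁.2.2.2 hO ?_
    filter_upwards [X.sol, Ioo_mem_nhdsGT (half_pos T.pos)] with ε hs hε
    have h1 : D ∩ Metric.ball x₀ (r / 3) ⊆ omega1 D₁ Γ h ε := fun x hx =>
      ⟨hO hx, Set.disjoint_left.1 (hlayer ε hε)
        (Metric.ball_subset_ball (by linarith) hx.2)⟩
    exact ⟨hs.regular₁.2.2.2.continuousOn.mono h1, h1.trans subset_union_left⟩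
  · refine X.tendsto_frontier_of_subset T hμ hx₀ c3 hb3 subset_union_right X.isX0_u₁.2 X.isX0_p₁.2
      X.regular₃.2.2.2 hO ?_
    filter_upwards [X.sol] with ε hs
    exact ⟨hs.regular₃.2.2.2.continuousOn.mono hO, hO.trans subset_union_right⟩

end Expansion

end

end ThinFilm

theorem mainTheorem4 (μ μ₂ : ℝ) (hμ : 0 < μ) (hμ₂ : 0 < μ₂)
    (D D₁ Ω₃ : Set ThinFilm.Plane) (Γ : ℝ → ThinFilm.Plane) (L : ℝ) (h : ℝ → ℝ)
    (hgeo : ThinFilm.Geometry D D₁ Ω₃ Γ L h)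
    (U : ThinFilm.Plane → ThinFilm.Plane)
    -- the solutions for small `ε`
    (u : ℝ → ThinFilm.Plane → ThinFilm.Plane) (p : ℝ → ThinFilm.Plane → ℝ)
    (hsol : ∀ᶠ ε : ℝ in 𝓝[>] 0,
      ThinFilm.IsTwoFluidSolution μ μ₂ D D₁ Ω₃ Γ h U ε (u ε) (p ε))
    -- the leading order and the first order of the outer expansion
    (u₀ u₁ : ThinFilm.Plane → ThinFilm.Plane) (p₀ p₁ : ThinFilm.Plane → ℝ)
    (hu₀ : ContinuousOn u₀ (closure D))
    (hreg₁ : ThinFilm.RegularIn D₁ u₀ p₀) (hreg₃ : ThinFilm.RegularIn Ω₃ u₀ p₀)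
    (hu₁ : ThinFilm.IsX0 D₁ u₁ ∧ ThinFilm.IsX0 Ω₃ u₁)
    (hp₁ : ThinFilm.IsX0 D₁ p₁ ∧ ThinFilm.IsX0 Ω₃ p₁)
    (hubound : ∃ C : ℝ, ∀ᶠ ε : ℝ in 𝓝[>] 0, ∀ x ∈ D, ‖ε⁻¹ • (u ε x - u₀ x)‖ ≤ C)
    (hulim : ∀ x ∈ D₁ ∪ Ω₃,
      Tendsto (fun ε : ℝ => ε⁻¹ • (u ε x - u₀ x)) (𝓝[>] 0) (𝓝 (u₁ x)))
    (hplim : ∀ x ∈ D₁ ∪ Ω₃,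
      Tendsto (fun ε : ℝ => ε⁻¹ * (p ε x - p₀ x)) (𝓝[>] 0) (𝓝 (p₁ x)))
    -- the pressures are dominated in fluid 1 and bounded in the layer
    (hpdom : ∃ g : ThinFilm.Plane → ℝ, IntegrableOn g D ∧ ∀ᶠ ε : ℝ in 𝓝[>] 0,
      ∀ x ∈ ThinFilm.omega1 D₁ Γ h ε ∪ Ω₃, |ε⁻¹ * (p ε x - p₀ x)| ≤ g x)
    (hpbound : ∃ C : ℝ, ∀ᶠ ε : ℝ in 𝓝[>] 0, ∀ x ∈ ThinFilm.layer Γ h ε, |p ε x| ≤ C)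
    -- the inner expansion
    (hinner : ∀ ξ : ℝ, ThinFilm.InnerConvergence μ μ₂ D₁ Ω₃ Γ h u₀ p₀ u p ξ) :
    (∀ φ : ThinFilm.Plane → ThinFilm.Plane, ThinFilm.IsTest D φ →
      ThinFilm.stokesPairing μ D u₁ p₁ φ =
        (μ₂ - μ) * (∫ ξ in (0 : ℝ)..L, h ξ *
          ThinFilm.frob (ThinFilm.matB2 μ μ₂ D₁ u₀ Γ ξ)
            (ThinFilm.plusTranspose (fderiv ℝ φ (Γ ξ))))
        + 2 * (μ - μ₂) * (∫ ξ in (0 : ℝ)..L, h ξ *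
          inner ℝ (ThinFilm.normal Γ ξ)
            (ThinFilm.matB2 μ μ₂ D₁ u₀ Γ ξ (ThinFilm.normal Γ ξ)) *
          ThinFilm.divergence φ (Γ ξ))
        + (∫ ξ in (0 : ℝ)..L, deriv (deriv h) ξ *
          inner ℝ (ThinFilm.normal Γ ξ) (φ (Γ ξ)))
        + (∫ ξ in (0 : ℝ)..L, deriv (ThinFilm.curv Γ) ξ * h ξ *
          inner ℝ (ThinFilm.tangent Γ ξ) (φ (Γ ξ)))) ∧
    (∀ ψ : ThinFilm.Plane → ℝ, ThinFilm.IsTest D ψ →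
      ∫ x in D, inner ℝ (u₁ x) (gradient ψ x) = 0) ∧
    (∀ x ∈ frontier D, Tendsto u₁ (𝓝[D₁ ∪ Ω₃] x) (𝓝 0)) := by
  have X : ThinFilm.Expansion μ μ₂ D D₁ Ω₃ Γ L h U u p u₀ u₁ p₀ p₁ :=
    ⟨hgeo, hsol, hu₀, hreg₁, hreg₃, hu₁, hp₁, hubound, hulim, hplim, hpdom, hpbound, hinner⟩
  obtain ⟨a, S, T⟩ := ThinFilm.exists_tube hgeo
  refine ⟨fun φ hφ => X.stokesPairing_eq T ⟨?_, hφ.2.1, hφ.2.2⟩, fun ψ hψ => ?_,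
    fun x hx => X.tendsto_frontier T hμ hx⟩
  · exact_mod_cast contDiff_infty.1 hφ.1 2
  · exact (X.integral_inner_gradient_u₁ T (by exact_mod_cast contDiff_infty.1 hψ.1 1) hψ.2.1
      hψ.2.2).2
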